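/- \textbf{Setting.} Let $\Omega\subset\mathbb R^2$ be a bounded (Lipschitz) polygonal domain and let $g:\Omega\to\mathbb R^{2\times2}$ be in $L^\infty$, with $g(x)$ symmetric positive definite for a.e. $x$. Fix $k\ge2$, $l_1,l_2\ge0$, $\varrho\in\mathbb R$, $0<c_1$ and $c_2$. Consider conforming partitions $\mathcal T_h$ of $\Omega$, all made of triangles or all made of convex quadrilaterals $T$ (diameter $h_T$, $h_{\min}=\min_T h_T$), that are shape regular: $h_K\le\varrho\rho_K$ ($\rho_K$ the diameter of the largest inscribed disc) for every triangle $K\in\mathcal T_h$, respectively for the four triangles cut from each quadrilateral by its two diagonals. Let $\Gamma_h^0$ be the union of the interior edges $e$ (length $h_e$), each with a fixed unit normal $\mathbf n_e$, let $[v]=v^--v^+$, $\{v\}=\frac12(v^++v^-)$ be jump and average, where $v^\pm(x)=\lim_{s\to0^+}v(x\pm s\mathbf n_e)$, and let $\mathrm h$ be a measurable mesh function with $c_1h_T\le \mathrm h\le c_2h_T$ inside each $T$ and $c_1h_e\le\mathrm h\le c_2h_e$ on each interior edge. Let $\mathbb V_h^k$ be the space of $v$ with $v|_T\circ F_T\in\mathbb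 P_k$ (triangles) or $\mathbb Q_k$ (quadrilaterals) for all $T$, where $F_T$ is the affine/bi-affine map from the reference triangle/square onto $T$; $\nabla_h,D_h^2$ are the elementwise gradient and Hessian. On $[\mathbb V_h^k]^3$ let $$(v,w)_{H^2_h}=(D_h^2v,D_h^2w)_{L^2(\Omega)}+(\mathrm h^{-1}[\nabla_hv],[\nabla_hw])_{L^2(\Gamma_h^0)}+(\mathrm h^{-3}[v],[w])_{L^2(\Gamma_h^0)}+(v,w)_{L^2(\Omega)},$$ $\|v\|_{H^2_h}^2=(v,v)_{H^2_h}$. The discrete Hessian is $H_h(v)=D_h^2v-R_h([\nabla_hv])+B_h([v])$ (componentwise), $R_h=\sum_er_e$, $B_h=\sum_eb_e$, where $r_e(\phi)\in[\mathbb V_h^{l_1}]^{2\times2}$, $b_e(\phi)\in[\mathbb V_h^{l_2}]^{2\times2}$ are given by $\int_\Omega r_e(\phi):\tau=\int_e\{\tau\}\mathbf n_e\cdot\phi$ and $\int_\Omega b_e(\phi):\tau=\int_e\{\mathrm{div}\,\tau\}\cdot\mathbf n_e\,\phi$ for all $\tau$ in the respective space. Put $$E_h^s(y)=\tfrac12\int_\Omega|\nabla_hy^T\nabla_hy-g|^2,\qquad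 a_h^s(z;y,v)=\int_\Omega(\nabla_hv^T\nabla_hy+\nabla_hy^T\nabla_hv):(\nabla_hz^T\nabla_hz-g),$$ $$a_h^b(y,v)=\int_\Omega(g^{-\frac12}H_h(y)g^{-\frac12}):(g^{-\frac12}H_h(v)g^{-\frac12})+(\mathrm h^{-1}[\nabla_hy],[\nabla_hv])_{L^2(\Gamma_h^0)}+(\mathrm h^{-3}[y],[v])_{L^2(\Gamma_h^0)},$$ $E_h^b(y)=\frac12a_h^b(y,y)$ and $E_h^p=E_h^s+\sigma_hE_h^b$ with $\sigma_h\ge0$; if $\sigma_h>0$, assume in addition that $g$ is uniformly positive definite (i.e. $g^{-1}\in L^\infty(\Omega)$). Given constants $C_p,\widetilde C_p>0$, let $$d_h(y)=\tfrac{C_p}{2}E_h^p(y)^{\frac12}+\tfrac{\widetilde C_p}{2}\Big(h_{\min}^{-1}(E_h^p(y)+1)\big(E_h^p(y)^{\frac12}+\|g\|_{L^1(\Omega)}\big)+\sigma_hE_h^p(y)\Big),$$ $$c_h(y)=\min\big\{(1+C_pE_h^p(y)^{\frac12})^{-1},\,d_h(y)^{-1}\big\}.$$ \textbf{Corollary (uniform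 energy decay).} In this setting, with the kind of cell (triangles or quadrilaterals) fixed, there is a constant $C_p>0$ such that, for all such partitions and mesh functions, $$|a_h^s(z;v,w)|\le C_pE_h^s(z)^{\frac12}\|v\|_{H^2_h}\|w\|_{H^2_h}\qquad\forall z,v,w\in[\mathbb V_h^k]^3 ,\qquad(*)$$ and for every $C_p>0$ with $(*)$ there is a constant $\widetilde C_p>0$, independent of the partition, the mesh function, $\sigma_h$, $\tau$, the initial guess and the iteration number, such that the following holds for all such partitions, mesh functions and $\sigma_h$. Let $y_h^0\in[\mathbb V_h^k]^3$ and $0<\tau\le\frac12c_h(y_h^0)$. Then the iteration $y_h^{n+1}=y_h^n+\delta y_h^{n+1}$, $n\ge0$, where $\delta y_h^{n+1}\in[\mathbb V_h^k]^3$ satisfies $$\tau^{-1}(\delta y_h^{n+1},v)_{H_h^2}+a_h^s(y_h^n;\delta y_h^{n+1},v)+\sigma_ha_h^b(\delta y_h^{n+1},v)=-a_h^s(y_h^n;y_h^n,v)-\sigma_ha_h^b(y_h^n,v)\quad\forall v\in[\mathbb V_h^k]^3,$$ is well defined (each step has exactly one solution), the sequence $\{c_h(y_h^n)\}_{n\ge0}$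 is nondecreasing, and $$E_h^p(y_h^{N+1})+\frac1{2\tau}\sum_{n=0}^N\|\delta y_h^{n+1}\|_{H^2_h}^2\le E_h^p(y_h^0)\qquad\forall N\ge0 .$$ -/

import Mathlib

open MeasureTheory

noncomputable section

namespace PrestrainedPlate

/-! ### The domain -/

abbrev Plane := EuclideanSpace ℝ (Fin 2)

/-- Bounded (Lipschitz) polygonal domain: a bounded, connected, nonempty open set which, near each
of its boundary points `x`, is an open circular sector with vertex `x` and opening angle
`β - α ∈ (0, 2π)` (a half disc at the points of the sides, another sector at the corners). -/
def IsPolygonalDomain (Ω : Set Plane) : Prop :=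
  IsOpen Ω ∧ Bornology.IsBounded Ω ∧ IsConnected Ω ∧
    ∀ x ∈ frontier Ω, ∃ r : ℝ, 0 < r ∧ ∃ α β : ℝ, α < β ∧ β < α + 2 * Real.pi ∧
      Ω ∩ Metric.ball x r =
        {z | ∃ t θ : ℝ, 0 < t ∧ t < r ∧ α < θ ∧ θ < β ∧
          z = x + t • (!₂[Real.cos θ, Real.sin θ] : Plane)}

/-! ### Cells -/

inductive CellShape
  | triangle
  | quadrilateral

namespace CellShape

/-- Number of vertices. -/
@[reducible] def n : CellShape → ℕ
  | triangle => 3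
  | quadrilateral => 4

/-- The reference cell: the unit triangle or the unit square. -/
def refCell : CellShape → Set Plane
  | triangle => {x | 0 ≤ x 0 ∧ 0 ≤ x 1 ∧ x 0 + x 1 ≤ 1}
  | quadrilateral => {x | ∀ i, 0 ≤ x i ∧ x i ≤ 1}

/-- Vertex shape functions on the reference cell; the vertices of the unit square are numbered
cyclically `(0,0), (1,0), (1,1), (0,1)`. -/
def shapeFn : (s : CellShape) → Plane → Fin s.n → ℝ
  | triangle => fun x => ![1 - x 0 - x 1, x 0, x 1]
  | quadrilateral => fun x =>
      ![(1 - x 0) * (1 - x 1), x 0 * (1 - x 1), x 0 * x 1, (1 - x 0) * x 1]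

/-- The affine (bi-affine) map `F_T` of the reference cell onto the cell `T` with vertices `v`. -/
def refMap (s : CellShape) (v : Fin s.n → Plane) (x : Plane) : Plane :=
  ∑ a, s.shapeFn x a • v a

/-- `ℙ_k` for triangles, `ℚ_k` for quadrilaterals. -/
def polySpace (s : CellShape) (k : ℕ) : Submodule ℝ (MvPolynomial (Fin 2) ℝ) :=
  match s with
  | triangle => MvPolynomial.restrictTotalDegree (Fin 2) ℝ k
  | quadrilateral => MvPolynomial.restrictDegree (Fin 2) ℝ k

/-- The points `v` are the vertices of a non-degenerate triangle, respectively, in cyclic order, of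
a non-degenerate convex quadrilateral (no three vertices are collinear and the diagonals meet). -/
def IsCell : (s : CellShape) → (Fin s.n → Plane) → Prop
  | triangle => fun v => AffineIndependent ℝ v
  | quadrilateral => fun v =>
      (∀ a : Fin 4, AffineIndependent ℝ (fun b : Fin 3 => v (a.succAbove b))) ∧
        (segment ℝ (v 0) (v 2) ∩ segment ℝ (v 1) (v 3)).Nonempty

end CellShape

/-- Diameter of the largest disc inscribed in `K`. -/
def inscribedDiam (K : Set Plane) : ℝ :=
  sSup {d : ℝ | ∃ c : Plane, Metric.closedBall c (d / 2) ⊆ K}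

/-- The triangle with vertices `v` satisfies `h_K ≤ ϱ ρ_K`. -/
def TriangleRegular (ϱ : ℝ) (v : Fin 3 → Plane) : Prop :=
  Metric.diam (convexHull ℝ (Set.range v)) ≤ ϱ * inscribedDiam (convexHull ℝ (Set.range v))

/-- Shape regularity of a cell; for a quadrilateral it is required of the four triangles obtained
by cutting along either diagonal, that is, by leaving out one vertex. -/
def CellShape.Regular (ϱ : ℝ) : (s : CellShape) → (Fin s.n → Plane) → Prop
  | triangle => fun v => TriangleRegular ϱ v
  | quadrilateral => fun v => ∀ a : Fin 4, TriangleRegular ϱ (fun b : Fin 3 => v (a.succAbove b))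

/-! ### Meshes -/

/-- The `a`-th edge of the cell with vertices `v` (from vertex `a` to the cyclically next one)
coincides with the `b`-th edge of the cell with vertices `w`. -/
def SharedEdge {n : ℕ} (v w : Fin n → Plane) (a b : Fin n) : Prop :=
  s(v a, v (finRotate n a)) = s(w b, w (finRotate n b))

/-- A conforming partition of `Ω` into (closed) triangles or into (closed) convex quadrilaterals,
together with an orientation of its interior edges. -/
structure Mesh (s : CellShape) (Ω : Set Plane) where
  N : ℕ
  vert : Fin N → Fin s.n → Plane
  isCell : ∀ i, s.IsCell (vert i)
  cover : ⋃ i, convexHull ℝ (Set.range (vert i)) = closure Ω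
  disjoint : ∀ i j, i ≠ j →
    Disjoint (interior (convexHull ℝ (Set.range (vert i))))
      (interior (convexHull ℝ (Set.range (vert j))))
  /-- Two distinct cells meet in the convex hull of their common vertices: the empty set, a common
  vertex or a common edge. -/
  conforming : ∀ i j, i ≠ j →
    convexHull ℝ (Set.range (vert i)) ∩ convexHull ℝ (Set.range (vert j)) =
      convexHull ℝ (Set.range (vert i) ∩ Set.range (vert j))
  /-- The interior edges: `(i, a, j)` stands for the `a`-th edge of the cell `i`, shared with the
  cell `j`; the chosen unit normal points from the cell `i` into the cell `j`. -/
  edges : Finset (Fin N × Fin s.n × Fin N)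
  edges_shared : ∀ i a j, (i, a, j) ∈ edges → i ≠ j ∧ ∃ b, SharedEdge (vert i) (vert j) a b
  /-- Each interior edge is listed once, with one of its two orientations. -/
  edges_orient : ∀ i a j b, i ≠ j → SharedEdge (vert i) (vert j) a b →
    Xor ((i, a, j) ∈ edges) ((j, b, i) ∈ edges)

namespace Mesh

variable {s : CellShape} {Ω : Set Plane} (M : Mesh s Ω)

/-- The closed cell `T_i`. -/
def cell (i : Fin M.N) : Set Plane := convexHull ℝ (Set.range (M.vert i))

def ShapeRegular (ϱ : ℝ) : Prop := ∀ i, s.Regular ϱ (M.vert i)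

/-- `h_min`, the smallest cell diameter. -/
def hMin : ℝ := ⨅ i, Metric.diam (M.cell i)

abbrev Edge := Fin M.N × Fin s.n × Fin M.N

def edgeStart (e : M.Edge) : Plane := M.vert e.1 e.2.1

def edgeEnd (e : M.Edge) : Plane := M.vert e.1 (finRotate s.n e.2.1)

/-- The unit normal of `e`, pointing out of the cell `e.1`: the normalized component orthogonal to
`e` of the vector from a third vertex of that cell to `e`. -/
def normal (e : M.Edge) : Plane :=
  let t : Plane := M.edgeEnd e - M.edgeStart e
  let u : Plane := M.edgeStart e - M.vert e.1 (finRotate s.n (finRotate s.n e.2.1))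
  let w : Plane := u - (inner ℝ u t / inner ℝ t t) • t
  ‖w‖⁻¹ • w

/-- Mesh functions: `c₁ h_T ≤ hf ≤ c₂ h_T` inside each cell and `c₁ h_e ≤ hf ≤ c₂ h_e` on each
(relatively open) interior edge. -/
def IsMeshFunction (c₁ c₂ : ℝ) (hf : Plane → ℝ) : Prop :=
  Measurable hf ∧
    (∀ i, ∀ x ∈ interior (M.cell i),
      c₁ * Metric.diam (M.cell i) ≤ hf x ∧ hf x ≤ c₂ * Metric.diam (M.cell i)) ∧
    (∀ e ∈ M.edges, ∀ x ∈ openSegment ℝ (M.edgeStart e) (M.edgeEnd e),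
      c₁ * dist (M.edgeStart e) (M.edgeEnd e) ≤ hf x ∧
        hf x ≤ c₂ * dist (M.edgeStart e) (M.edgeEnd e))

/-! ### Broken spaces and operators

Piecewise functions are families `f i : Plane → ℝ`, where only the values of `f i` on the closed
cell `T_i` matter. -/

/-- The broken finite element space `𝕍_h^k`. A function `v` in this space is given by the
polynomials `v|_T ∘ F_T` on the reference cell, which can be prescribed independently on each
cell. -/
abbrev V (k : ℕ) := Fin M.N → s.polySpace k

/-- `[𝕍_h^k]³`. -/
abbrev V3 (k : ℕ) := Fin 3 → M.V k

/-- The values of `v ∈ 𝕍_h^k` on the cell `T_i`, namely `v_i ∘ F_{T_i}⁻¹`. -/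
def val {k : ℕ} (v : M.V k) (i : Fin M.N) (x : Plane) : ℝ :=
  MvPolynomial.eval (fun j => Function.invFunOn (s.refMap (M.vert i)) s.refCell x j)
    (v i : MvPolynomial (Fin 2) ℝ)

/-- Broken partial derivative `∂_a`, up to the boundary of each cell. -/
def pd (a : Fin 2) (f : Fin M.N → Plane → ℝ) (i : Fin M.N) (x : Plane) : ℝ :=
  fderivWithin ℝ (f i) (M.cell i) x (EuclideanSpace.single a 1)

/-- The integral over `Ω` of a piecewise function. -/
def integral (f : Fin M.N → Plane → ℝ) : ℝ := ∑ i, ∫ x in M.cell i, f i x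

/-- The integral over the edge `e` with respect to arc length. -/
def edgeIntegral (e : M.Edge) (f : Plane → ℝ) : ℝ :=
  dist (M.edgeStart e) (M.edgeEnd e) *
    ∫ t in (0 : ℝ)..1, f (AffineMap.lineMap (M.edgeStart e) (M.edgeEnd e) t)

/-- The jump `f⁻ - f⁺` across `e`; the normal points from the `-` side `e.1` to the `+` side. -/
def jump (f : Fin M.N → Plane → ℝ) (e : M.Edge) (x : Plane) : ℝ := f e.1 x - f e.2.2 x

def avg (f : Fin M.N → Plane → ℝ) (e : M.Edge) (x : Plane) : ℝ := (f e.1 x + f e.2.2 x) / 2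

/-- `(hf⁻¹ [∇_h v], [∇_h w])_{L²(Γ_h⁰)}`. -/
def gradJumpForm (hf : Plane → ℝ) {k : ℕ} (v w : M.V k) : ℝ :=
  ∑ e ∈ M.edges, M.edgeIntegral e fun x =>
    (hf x)⁻¹ * ∑ a, M.jump (M.pd a (M.val v)) e x * M.jump (M.pd a (M.val w)) e x

/-- `(hf⁻³ [v], [w])_{L²(Γ_h⁰)}`. -/
def jumpForm (hf : Plane → ℝ) {k : ℕ} (v w : M.V k) : ℝ :=
  ∑ e ∈ M.edges, M.edgeIntegral e fun x =>
    ((hf x) ^ 3)⁻¹ * (M.jump (M.val v) e x * M.jump (M.val w) e x)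

/-- The form `⟨v, w⟩_{H²_h(Ω)}` (the square of the semi-norm is `⟨v, v⟩`). -/
def semiForm (hf : Plane → ℝ) {k : ℕ} (v w : M.V k) : ℝ :=
  M.integral (fun i x => ∑ a, ∑ b,
      M.pd a (M.pd b (M.val v)) i x * M.pd a (M.pd b (M.val w)) i x) +
    M.gradJumpForm hf v w + M.jumpForm hf v w

/-- The scalar product `(v, w)_{H²_h(Ω)}` on `[𝕍_h^k]³`. -/
def innerH2 (hf : Plane → ℝ) {k : ℕ} (v w : M.V3 k) : ℝ :=
  ∑ m, (M.semiForm hf (v m) (w m) + M.integral fun i x => M.val (v m) i x * M.val (w m) i x)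

/-- The norm `‖v‖_{H²_h(Ω)}` on `[𝕍_h^k]³`. -/
def normH2 (hf : Plane → ℝ) {k : ℕ} (v : M.V3 k) : ℝ := √(M.innerH2 hf v v)

/-! ### Lifting operators and discrete Hessian -/

/-- The local lifting `r_e(φ) ∈ [𝕍_h^l]^{2×2}`: the unique element with
`∫_Ω r_e(φ) : τ = ∫_e {τ} n_e · φ` for all `τ ∈ [𝕍_h^l]^{2×2}`. -/
def liftGrad (l : ℕ) (e : M.Edge) (φ : Fin 2 → Plane → ℝ) : Fin 2 → Fin 2 → M.V l :=
  Classical.epsilon fun r => ∀ τ : Fin 2 → Fin 2 → M.V l,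
    M.integral (fun i x => ∑ a, ∑ b, M.val (r a b) i x * M.val (τ a b) i x) =
      M.edgeIntegral e fun x =>
        ∑ a, (∑ b, M.avg (M.val (τ a b)) e x * M.normal e b) * φ a x

/-- The local lifting `b_e(φ) ∈ [𝕍_h^l]^{2×2}`: the unique element with
`∫_Ω b_e(φ) : τ = ∫_e {div τ} · n_e φ` for all `τ ∈ [𝕍_h^l]^{2×2}`, with the row-wise
divergence. -/
def liftVal (l : ℕ) (e : M.Edge) (φ : Plane → ℝ) : Fin 2 → Fin 2 → M.V l :=
  Classical.epsilon fun r => ∀ τ : Fin 2 → Fin 2 → M.V l,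
    M.integral (fun i x => ∑ a, ∑ b, M.val (r a b) i x * M.val (τ a b) i x) =
      M.edgeIntegral e fun x =>
        (∑ a, M.avg (fun i y => ∑ b, M.pd b (M.val (τ a b)) i y) e x * M.normal e a) * φ x

/-- The discrete Hessian `H_h(v) = D²_h v - R_h([∇_h v]) + B_h([v])`. -/
def discreteHessian (l₁ l₂ : ℕ) {k : ℕ} (v : M.V k) (i : Fin M.N) (x : Plane) :
    Matrix (Fin 2) (Fin 2) ℝ :=
  Matrix.of fun a b =>
    M.pd a (M.pd b (M.val v)) i x
      - M.val ((∑ e ∈ M.edges, M.liftGrad l₁ e fun c => M.jump (M.pd c (M.val v)) e) a b) i x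
      + M.val ((∑ e ∈ M.edges, M.liftVal l₂ e (M.jump (M.val v) e)) a b) i x

end Mesh

/-! ### Metric, energies and forms -/

/-- `A : B`. -/
def frob (A B : Matrix (Fin 2) (Fin 2) ℝ) : ℝ := ∑ a, ∑ b, A a b * B a b

/-- `A^{-1/2}` for a symmetric positive definite matrix `A`. -/
def invSqrt (A : Matrix (Fin 2) (Fin 2) ℝ) : Matrix (Fin 2) (Fin 2) ℝ :=
  cfc (fun t : ℝ => (√t)⁻¹) A

/-- `‖g‖_{L¹(Ω)}`, with the Frobenius norm. -/
def normL1 (Ω : Set Plane) (g : Plane → Matrix (Fin 2) (Fin 2) ℝ) : ℝ :=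
  ∫ x in Ω, √(frob (g x) (g x))

/-- `g` is uniformly positive definite on `Ω`, equivalently `g⁻¹` is essentially bounded. -/
def UniformlyPosDef (Ω : Set Plane) (g : Plane → Matrix (Fin 2) (Fin 2) ℝ) : Prop :=
  ∃ κ : ℝ, 0 < κ ∧ ∀ᵐ x ∂(volume.restrict Ω), ∀ ξ : Fin 2 → ℝ,
    κ * ∑ a, ξ a ^ 2 ≤ ∑ a, ∑ b, ξ a * g x a b * ξ b

namespace Mesh

variable {s : CellShape} {Ω : Set Plane} (M : Mesh s Ω)

/-- `(∇_h y)ᵀ ∇_h w`, where `∇_h y` is the `3 × 2` broken Jacobian matrix. -/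
def gradProd {k : ℕ} (y w : M.V3 k) (i : Fin M.N) (x : Plane) : Matrix (Fin 2) (Fin 2) ℝ :=
  Matrix.of fun a b => ∑ m, M.pd a (M.val (y m)) i x * M.pd b (M.val (w m)) i x

/-- Stretching energy `E_h^s`. -/
def stretchEnergy (g : Plane → Matrix (Fin 2) (Fin 2) ℝ) {k : ℕ} (y : M.V3 k) : ℝ :=
  (1 / 2) * M.integral fun i x => frob (M.gradProd y y i x - g x) (M.gradProd y y i x - g x)

/-- The form `a_h^s(z; y, v)`. -/
def stretchForm (g : Plane → Matrix (Fin 2) (Fin 2) ℝ) {k : ℕ} (z y v : M.V3 k) : ℝ :=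
  M.integral fun i x =>
    frob (M.gradProd v y i x + M.gradProd y v i x) (M.gradProd z z i x - g x)

/-- The form `a_h^b(y, v)`. -/
def bendForm (hf : Plane → ℝ) (g : Plane → Matrix (Fin 2) (Fin 2) ℝ) (l₁ l₂ : ℕ) {k : ℕ}
    (y v : M.V3 k) : ℝ :=
  ∑ m, (M.integral (fun i x =>
      frob (invSqrt (g x) * M.discreteHessian l₁ l₂ (y m) i x * invSqrt (g x))
        (invSqrt (g x) * M.discreteHessian l₁ l₂ (v m) i x * invSqrt (g x)))
    + M.gradJumpForm hf (y m) (v m) + M.jumpForm hf (y m) (v m))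

/-- Bending energy `E_h^b`. -/
def bendEnergy (hf : Plane → ℝ) (g : Plane → Matrix (Fin 2) (Fin 2) ℝ) (l₁ l₂ : ℕ) {k : ℕ}
    (y : M.V3 k) : ℝ :=
  (1 / 2) * M.bendForm hf g l₁ l₂ y y

/-- Preprocessing energy `E_h^p = E_h^s + σ E_h^b`. -/
def preEnergy (hf : Plane → ℝ) (g : Plane → Matrix (Fin 2) (Fin 2) ℝ) (l₁ l₂ : ℕ) (σ : ℝ) {k : ℕ}
    (y : M.V3 k) : ℝ :=
  M.stretchEnergy g y + σ * M.bendEnergy hf g l₁ l₂ y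

/-- `δ ∈ [𝕍_h^k]³` solves the linearized gradient flow equation at the iterate `y`. -/
def IsIncrement (hf : Plane → ℝ) (g : Plane → Matrix (Fin 2) (Fin 2) ℝ) (l₁ l₂ : ℕ) (σ τ : ℝ)
    {k : ℕ} (y δ : M.V3 k) : Prop :=
  ∀ v : M.V3 k,
    τ⁻¹ * M.innerH2 hf δ v + M.stretchForm g y δ v + σ * M.bendForm hf g l₁ l₂ δ v =
      - M.stretchForm g y y v - σ * M.bendForm hf g l₁ l₂ y v

/-- The quantity `d_h(y)`, with constants `Cp` and `Cp'`. -/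
def dStep (hf : Plane → ℝ) (g : Plane → Matrix (Fin 2) (Fin 2) ℝ) (l₁ l₂ : ℕ) (σ Cp Cp' : ℝ)
    {k : ℕ} (y : M.V3 k) : ℝ :=
  let E := M.preEnergy hf g l₁ l₂ σ y
  Cp / 2 * √E + Cp' / 2 * (M.hMin⁻¹ * (E + 1) * (√E + normL1 Ω g) + σ * E)

/-- The step threshold `c_h(y)`, with constants `Cp` and `Cp'`. -/
def cStep (hf : Plane → ℝ) (g : Plane → Matrix (Fin 2) (Fin 2) ℝ) (l₁ l₂ : ℕ) (σ Cp Cp' : ℝ)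
    {k : ℕ} (y : M.V3 k) : ℝ :=
  min (1 + Cp * √(M.preEnergy hf g l₁ l₂ σ y))⁻¹ (M.dStep hf g l₁ l₂ σ Cp Cp' y)⁻¹

end Mesh

/-- `Cp` is a continuity constant of `a_h^s`, uniformly over all meshes and mesh functions of the
class determined by `ϱ, c₁, c₂`. -/
def IsContinuityConstant (Ω : Set Plane) (g : Plane → Matrix (Fin 2) (Fin 2) ℝ) (s : CellShape)
    (k : ℕ) (ϱ c₁ c₂ Cp : ℝ) : Prop :=
  ∀ (M : Mesh s Ω) (hf : Plane → ℝ), M.ShapeRegular ϱ → M.IsMeshFunction c₁ c₂ hf →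
    ∀ z v w : M.V3 k,
      |M.stretchForm g z v w| ≤ Cp * √(M.stretchEnergy g z) * M.normH2 hf v * M.normH2 hf w

end PrestrainedPlate

end

/-! The stretching energy is a quartic polynomial of the deformation, so its change in one step can
be written exactly. With `S = ∇yᵀ∇y - g`, `L = ∇δᵀ∇y + ∇yᵀ∇δ` and `Q = ∇δᵀ∇δ`, the strain of `y + δ`
is `S + L + Q`. Hence the new energy is the old one plus `a^s(y; y, δ)`, plus half of `a^s(y; δ,
δ)`, plus half of `‖L + Q‖²`, plus the exact quadratic expansion of the bending part
(`stretchEnergy_add`). Testing the flow equation with `δ` eliminates the first-order terms and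
produces `-τ⁻¹ ‖δ‖²`. What remains is to absorb `a^s(y; δ, δ)`, `‖L‖²` and `‖Q‖²` into half of `τ⁻¹
‖δ‖²`, all norms of `δ` being `H²_h` norms. The first is bounded by the continuity constant. The
second is of order `h_min⁻¹ (√E + ‖g‖_{L¹}) ‖δ‖²`. The third is of order `‖δ‖⁴`, and becomes
quadratic by an a priori bound of `‖δ‖²` that follows from the flow equation itself and the first
restriction on `τ`. `energy_decay_of_bounds` contains this real algebra.

The analytic input is a pair of gradient bounds with constants independent of the mesh: `‖∇_h
v‖_{L⁴} ≤ C ‖v‖_{H²_h}`, which gives the continuity of `a^s` and the estimate of `Q`, and `‖∇_h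
v‖²_{L^∞} ≤ C h_min⁻¹ ‖v‖²_{H²_h}`, which gives the estimate of `L`
(`exists_integral_vgradSq_sq_le`, `exists_vgradSq_le`). Both are proved by integrating along lines.
A polygonal domain has finitely many pairs of independent directions such that from every point the
segments in both directions of one pair stay inside (`exists_cones`). Along such a segment a
piecewise smooth function varies by at most the integral of its derivative plus the jumps at the
edges crossed. The Gagliardo–Nirenberg argument in the two directions gives the broken embedding of
BV into `L²` (`exists_sobolev`). A second-order version of the line argument controls `∇_h v` in
`L¹` by `v`, its Hessian and the jumps (`exists_interpolation`). Together they bound `∇_h v` in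
`L²`. Applying the Sobolev inequality to the squares of the derivatives gives `L⁴`; the jumps of
these squares factor as `[w²] = (w⁻ + w⁺)[w]`, and an inverse inequality bounds the traces. Hölder's
inequality on one cell and the inverse inequality then give the `L^∞` bound.

The inverse inequality needs the geometry of the cells: the reference map is a diffeomorphism onto
the cell, smooth up to the boundary, with Jacobian at least a constant times the squared diameter
(`exists_jac_lower`). The line argument needs the combinatorics of the mesh: two cells meet in a
vertex or in a common edge, and an edge belongs to at most two cells.

Once a single step decreases the energy, the threshold `c_h` does not decrease, so the condition on
`τ` is inherited by the next iterate and induction finishes the proof. Each step is uniquely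
solvable because its form is positive definite under the first restriction on `τ`. -/

namespace PrestrainedPlate

/-! ### Planar determinants -/

/-- The determinant of two plane vectors. -/
def cross (u w : Plane) : ℝ := u 0 * w 1 - u 1 * w 0

theorem plane_ext {u w : Plane} (h0 : u 0 = w 0) (h1 : u 1 = w 1) : u = w := by
  ext i; fin_cases i <;> assumption

theorem eq_zero_of_combo {p q : Plane} (h : cross p q ≠ 0) {x y : ℝ} (hxy : x • p + y • q = 0) :
    x = 0 ∧ y = 0 := by
  have h0 : x * p 0 + y * q 0 = 0 := by simpa using congrArg (fun z : Plane => z 0) hxy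
  have h1 : x * p 1 + y * q 1 = 0 := by simpa using congrArg (fun z : Plane => z 1) hxy
  unfold cross at h
  constructor
  · have : x * (p 0 * q 1 - p 1 * q 0) = 0 := by linear_combination q 1 * h0 - q 0 * h1
    exact (mul_eq_zero.1 this).resolve_right h
  · have : y * (p 0 * q 1 - p 1 * q 0) = 0 := by linear_combination p 0 * h1 - p 1 * h0
    exact (mul_eq_zero.1 this).resolve_right h

/-- Cramer's rule. It also supplies the oblique coordinates used for integration along two
directions. -/
theorem combo_of_cross_ne_zero {p q : Plane} (h : cross p q ≠ 0) (z : Plane) :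
    z = (cross z q / cross p q) • p + (cross p z / cross p q) • q := by
  unfold cross at *
  apply plane_ext <;>
    simp only [PiLp.add_apply, PiLp.smul_apply, smul_eq_mul, div_mul_eq_mul_div, ← add_div] <;>
    rw [eq_div_iff h] <;> ring

/-- Twice the signed area of a triangle. -/
def triDet (w : Fin 3 → Plane) : ℝ := cross (w 1 - w 0) (w 2 - w 0)

theorem triDet_ne_zero {w : Fin 3 → Plane} (h : AffineIndependent ℝ w) : triDet w ≠ 0 := by
  intro h0
  rw [affineIndependent_iff] at h
  have key : ∀ p q : ℝ, p • (w 1 - w 0) + q • (w 2 - w 0) = 0 → p = 0 ∧ q = 0 := by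
    intro p q hpq
    have := h Finset.univ ![-p - q, p, q] (by simp [Fin.sum_univ_three]; ring)
      (by
        simp only [Fin.sum_univ_three, Matrix.cons_val]
        rw [← hpq]; module)
    exact ⟨by simpa using this 1 (Finset.mem_univ _), by simpa using this 2 (Finset.mem_univ _)⟩
  unfold triDet cross at h0
  set u := w 1 - w 0
  set z := w 2 - w 0
  -- A vanishing determinant makes `-z i • u + u i • z` vanish for both coordinates `i`;
  -- independence then forces both coordinates of `u` to be zero.
  obtain ⟨h1, h2⟩ := key (- z 0) (u 0) (by
    apply plane_ext <;> simp <;> linarith)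
  obtain ⟨h3, h4⟩ := key (- z 1) (u 1) (by
    apply plane_ext <;> simp <;> linarith)
  have hu : u = 0 := plane_ext (by simpa using h2) (by simpa using h4)
  exact one_ne_zero (key 1 0 (by simp [hu])).1

/-! ### Cells as images of the reference cell: Jacobian, orientation, injectivity. -/

namespace CellShape

/-! ### The reference map -/

/-- First edge vector at the vertex `0`. -/
def vecA : (s : CellShape) → (Fin s.n → Plane) → Plane
  | triangle => fun v => v 1 - v 0
  | quadrilateral => fun v => v 1 - v 0

/-- Second edge vector at the vertex `0`. -/
def vecB : (s : CellShape) → (Fin s.n → Plane) → Plane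
  | triangle => fun v => v 2 - v 0
  | quadrilateral => fun v => v 3 - v 0

/-- Coefficient of the bilinear term of the reference map. -/
def vecC : (s : CellShape) → (Fin s.n → Plane) → Plane
  | triangle => fun _ => 0
  | quadrilateral => fun v => v 0 - v 1 + v 2 - v 3

/-- The vertex numbered `0`. -/
def vert0 : (s : CellShape) → (Fin s.n → Plane) → Plane
  | triangle => fun v => v 0
  | quadrilateral => fun v => v 0

theorem refMap_eq (s : CellShape) (v : Fin s.n → Plane) (x : Plane) :
    s.refMap v x = s.vert0 v + x 0 • s.vecA v + x 1 • s.vecB v + (x 0 * x 1) • s.vecC v := by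
  cases s
  · simp only [refMap, shapeFn, vert0, vecA, vecB, vecC]
    rw [Fin.sum_univ_three]
    simp only [Matrix.cons_val]
    module
  · simp only [refMap, shapeFn, vert0, vecA, vecB, vecC]
    rw [Fin.sum_univ_four]
    simp only [Matrix.cons_val]
    module

/-- Derivative of the reference map in the first variable. -/
def d0 (s : CellShape) (v : Fin s.n → Plane) (x : Plane) : Plane := s.vecA v + x 1 • s.vecC v

/-- Derivative of the reference map in the second variable. -/
def d1 (s : CellShape) (v : Fin s.n → Plane) (x : Plane) : Plane := s.vecB v + x 0 • s.vecC v

/-- Jacobian determinant of the reference map. -/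
def jac (s : CellShape) (v : Fin s.n → Plane) (x : Plane) : ℝ := cross (s.d0 v x) (s.d1 v x)

/-- An exact mean value formula: the only nonlinear term is `x 0 * x 1`, for which the difference is
the derivative at the midpoint. On the convex reference cell it reduces injectivity to a
nonvanishing Jacobian. -/
theorem refMap_sub (s : CellShape) (v : Fin s.n → Plane) (x y : Plane) :
    s.refMap v x - s.refMap v y =
      (x 0 - y 0) • s.d0 v (midpoint ℝ x y) + (x 1 - y 1) • s.d1 v (midpoint ℝ x y) := by
  have h : ∀ i, (midpoint ℝ x y) i = (x i + y i) / 2 := by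
    intro i; simp [midpoint_eq_smul_add]; ring
  rw [refMap_eq, refMap_eq, d0, d1, h, h]
  module

theorem mem_refCell_bounds {s : CellShape} {x : Plane} (hx : x ∈ s.refCell) (i : Fin 2) :
    0 ≤ x i ∧ x i ≤ 1 := by
  cases s
  · obtain ⟨h0, h1, h2⟩ := hx
    fin_cases i
    · exact ⟨h0, by show x 0 ≤ 1; linarith⟩
    · exact ⟨h1, by show x 1 ≤ 1; linarith⟩
  · exact hx i

theorem convex_refCell (s : CellShape) : Convex ℝ s.refCell := by
  cases s
  · intro x ⟨h0, h1, h2⟩ y ⟨h3, h4, h5⟩ a b ha hb hab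
    refine ⟨?_, ?_, ?_⟩ <;> simp
    · positivity
    · positivity
    · nlinarith
  · intro x hx y hy a b ha hb hab i
    have := hx i; have := hy i
    constructor <;> simp <;> nlinarith

theorem isCompact_refCell (s : CellShape) : IsCompact s.refCell := by
  refine Metric.isCompact_of_isClosed_isBounded ?_ ?_
  · cases s
    · have h : refCell triangle = {x : Plane | 0 ≤ x 0} ∩ ({x | 0 ≤ x 1} ∩ {x | x 0 + x 1 ≤ 1}) := rfl
      rw [h]
      exact (isClosed_le (by fun_prop) (by fun_prop)).inter
        ((isClosed_le (by fun_prop) (by fun_prop)).inter (isClosed_le (by fun_prop) (by fun_prop)))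
    · have h : refCell quadrilateral = ⋂ i, ({x : Plane | 0 ≤ x i} ∩ {x | x i ≤ 1}) := by
        ext x; simp [refCell]
      rw [h]
      exact isClosed_iInter fun i =>
        (isClosed_le (by fun_prop) (by fun_prop)).inter (isClosed_le (by fun_prop) (by fun_prop))
  · refine (Metric.isBounded_iff_subset_closedBall 0).2 ⟨2, fun x hx => ?_⟩
    have h0 := mem_refCell_bounds hx 0
    have h1 := mem_refCell_bounds hx 1
    rw [mem_closedBall_zero_iff, EuclideanSpace.norm_eq, Real.sqrt_le_left (by norm_num)]
    simp only [Fin.sum_univ_two, Real.norm_eq_abs, sq_abs]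
    nlinarith

theorem measurableSet_refCell (s : CellShape) : MeasurableSet s.refCell :=
  s.isCompact_refCell.isClosed.measurableSet

/-- An open box contained in the reference cell. -/
theorem box_subset_refCell (s : CellShape) :
    {x : Plane | ∀ i, 0 < x i ∧ x i < 1 / 2} ⊆ s.refCell := by
  intro x hx
  cases s
  · have h0 := hx 0; have h1 := hx 1
    exact ⟨h0.1.le, h1.1.le, by linarith⟩
  · exact fun i => ⟨(hx i).1.le, by linarith [(hx i).2]⟩

theorem isOpen_box : IsOpen {x : Plane | ∀ i, 0 < x i ∧ x i < 1 / 2} := by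
  have h : {x : Plane | ∀ i, 0 < x i ∧ x i < 1 / 2} =
      ⋂ i, ({x : Plane | 0 < x i} ∩ {x | x i < 1 / 2}) := by
    ext x; simp
  rw [h]
  exact isOpen_iInter_of_finite fun i =>
    (isOpen_lt (by fun_prop) (by fun_prop)).inter (isOpen_lt (by fun_prop) (by fun_prop))

theorem interior_refCell_nonempty (s : CellShape) : (interior s.refCell).Nonempty := by
  refine ⟨!₂[1 / 4, 1 / 4], interior_maximal s.box_subset_refCell isOpen_box ?_⟩
  intro i; fin_cases i <;> norm_num

/-- The determinants of the sub-triangles which control the Jacobian. -/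
def cornerDet : (s : CellShape) → (Fin s.n → Plane) → Fin s.n → ℝ
  | triangle => fun v _ => triDet v
  | quadrilateral => fun v a => triDet fun b : Fin 3 => v (a.succAbove b)

theorem jac_triangle (v : Fin 3 → Plane) (x : Plane) : jac triangle v x = triDet v := by
  simp [jac, d0, d1, vecA, vecB, vecC, triDet]

theorem succAbove_vals : 
    ((0 : Fin 4).succAbove (0 : Fin 3) = 1 ∧ (0 : Fin 4).succAbove (1 : Fin 3) = 2 ∧
      (0 : Fin 4).succAbove (2 : Fin 3) = 3) ∧
    ((1 : Fin 4).succAbove (0 : Fin 3) = 0 ∧ (1 : Fin 4).succAbove (1 : Fin 3) = 2 ∧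
      (1 : Fin 4).succAbove (2 : Fin 3) = 3) ∧
    ((2 : Fin 4).succAbove (0 : Fin 3) = 0 ∧ (2 : Fin 4).succAbove (1 : Fin 3) = 1 ∧
      (2 : Fin 4).succAbove (2 : Fin 3) = 3) ∧
    ((3 : Fin 4).succAbove (0 : Fin 3) = 0 ∧ (3 : Fin 4).succAbove (1 : Fin 3) = 1 ∧
      (3 : Fin 4).succAbove (2 : Fin 3) = 2) := by decide

/-- The quadratic terms of the Jacobian cancel, so it interpolates its four corner values
bilinearly. The value at a vertex is the determinant of the triangle at that corner, which omits the
opposite vertex; hence the shift of indices by two. -/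
theorem jac_quadrilateral (v : Fin 4 → Plane) (x : Plane) :
    jac quadrilateral v x =
      (1 - x 0) * (1 - x 1) * cornerDet quadrilateral v 2 +
        x 0 * (1 - x 1) * cornerDet quadrilateral v 3 + x 0 * x 1 * cornerDet quadrilateral v 0 +
        (1 - x 0) * x 1 * cornerDet quadrilateral v 1 := by
  obtain ⟨⟨a0, a1, a2⟩, ⟨b0, b1, b2⟩, ⟨c0, c1, c2⟩, d0', d1', d2'⟩ := succAbove_vals
  simp only [jac, d0, d1, vecA, vecB, vecC, cornerDet, triDet, cross, a0, a1, a2, b0, b1, b2, c0,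
    c1, c2, d0', d1', d2', PiLp.add_apply, PiLp.sub_apply, PiLp.smul_apply, smul_eq_mul]
  ring

/-- All the sub-triangles of a cell have the same orientation. -/
theorem IsCell.exists_orientation {s : CellShape} {v : Fin s.n → Plane} (h : s.IsCell v) :
    ∃ ε : ℝ, (ε = 1 ∨ ε = -1) ∧ ∀ a, 0 < ε * s.cornerDet v a := by
  cases s
  · have h0 := triDet_ne_zero h
    rcases lt_or_gt_of_ne h0 with h1 | h1
    · exact ⟨-1, Or.inr rfl, fun a => by simp only [cornerDet]; linarith⟩
    · exact ⟨1, Or.inl rfl, fun a => by simp only [cornerDet]; linarith⟩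
  · obtain ⟨h0, z, hz1, hz2⟩ := h
    have hne : ∀ a, cornerDet quadrilateral v a ≠ 0 := fun a => triDet_ne_zero (h0 a)
    rw [segment_eq_image'] at hz1 hz2
    obtain ⟨p, ⟨hp0, hp1⟩, hp⟩ := hz1
    obtain ⟨q, ⟨hq0, hq1⟩, hq⟩ := hz2
    have e0 := congrArg (fun z : Plane => z 0) (hp.trans hq.symm)
    have e1 := congrArg (fun z : Plane => z 1) (hp.trans hq.symm)
    simp only [PiLp.add_apply, PiLp.sub_apply, PiLp.smul_apply, smul_eq_mul] at e0 e1
    -- With the diagonals meeting at parameters `p` and `q`, the four determinants are `p`, `q`, `1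
    -- - p`, `1 - q` times `K`. These factors are nonnegative and the products nonzero, so all have
    -- the sign of `K`.
    set K := cross (v 2 - v 0) (v 3 - v 1) with hK
    obtain ⟨⟨a0, a1, a2⟩, ⟨b0, b1, b2⟩, ⟨c0, c1, c2⟩, d0', d1', d2'⟩ := succAbove_vals
    have k2 : cornerDet quadrilateral v 2 = p * K := by
      simp only [hK, cornerDet, triDet, cross, c0, c1, c2, PiLp.sub_apply]
      linear_combination (v 1 1 - v 3 1) * e0 - (v 1 0 - v 3 0) * e1
    have k3 : cornerDet quadrilateral v 3 = q * K := by
      simp only [hK, cornerDet, triDet, cross, d0', d1', d2', PiLp.sub_apply]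
      linear_combination (v 0 1 - v 2 1) * e0 - (v 0 0 - v 2 0) * e1
    have k0 : cornerDet quadrilateral v 0 = (1 - p) * K := by
      simp only [hK, cornerDet, triDet, cross, a0, a1, a2, PiLp.sub_apply]
      linear_combination (v 3 1 - v 1 1) * e0 - (v 3 0 - v 1 0) * e1
    have k1 : cornerDet quadrilateral v 1 = (1 - q) * K := by
      simp only [hK, cornerDet, triDet, cross, b0, b1, b2, PiLp.sub_apply]
      linear_combination (v 2 1 - v 0 1) * e0 - (v 2 0 - v 0 0) * e1
    have hKne : K ≠ 0 := fun hh => hne 2 (by rw [k2, hh, mul_zero])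
    have pos : ∀ c : ℝ, 0 ≤ c → c * K ≠ 0 → ∀ ε, 0 < ε * K → 0 < ε * (c * K) := by
      intro c hc hcK ε hε
      have : 0 < c := lt_of_le_of_ne hc fun hh => hcK (by rw [← hh, zero_mul])
      calc 0 < c * (ε * K) := mul_pos this hε
        _ = _ := by ring
    have fin : ∀ ε, 0 < ε * K → ∀ a, 0 < ε * cornerDet quadrilateral v a := by
      intro ε hε a
      fin_cases a
      · show 0 < ε * cornerDet quadrilateral v 0
        rw [k0]; exact pos _ (by linarith) (k0 ▸ hne 0) ε hε
      · show 0 < ε * cornerDet quadrilateral v 1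
        rw [k1]; exact pos _ (by linarith) (k1 ▸ hne 1) ε hε
      · show 0 < ε * cornerDet quadrilateral v 2
        rw [k2]; exact pos _ (by linarith) (k2 ▸ hne 2) ε hε
      · show 0 < ε * cornerDet quadrilateral v 3
        rw [k3]; exact pos _ (by linarith) (k3 ▸ hne 3) ε hε
    rcases lt_or_gt_of_ne hKne with h1 | h1
    · exact ⟨-1, Or.inr rfl, fin _ (by linarith)⟩
    · exact ⟨1, Or.inl rfl, fin _ (by linarith)⟩

/-- On the reference cell the Jacobian is a convex combination of the corner determinants, so a
lower bound at the corners persists. -/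
theorem le_jac {s : CellShape} {v : Fin s.n → Plane} {ε m : ℝ}
    (h : ∀ a, m ≤ ε * s.cornerDet v a) {x : Plane} (hx : x ∈ s.refCell) : m ≤ ε * s.jac v x := by
  cases s
  · rw [jac_triangle]; exact h 0
  · rw [jac_quadrilateral]
    have h0 := hx 0; have h1 := hx 1
    have e : ε * ((1 - x 0) * (1 - x 1) * cornerDet quadrilateral v 2 +
        x 0 * (1 - x 1) * cornerDet quadrilateral v 3 + x 0 * x 1 * cornerDet quadrilateral v 0 +
        (1 - x 0) * x 1 * cornerDet quadrilateral v 1) - m =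
        (1 - x 0) * (1 - x 1) * (ε * cornerDet quadrilateral v 2 - m) +
        x 0 * (1 - x 1) * (ε * cornerDet quadrilateral v 3 - m) +
        x 0 * x 1 * (ε * cornerDet quadrilateral v 0 - m) +
        (1 - x 0) * x 1 * (ε * cornerDet quadrilateral v 1 - m) := by ring
    have f0 : 0 ≤ 1 - x 0 := by linarith
    have f1 : 0 ≤ 1 - x 1 := by linarith
    have g0 := sub_nonneg.2 (h 0); have g1 := sub_nonneg.2 (h 1)
    have g2 := sub_nonneg.2 (h 2); have g3 := sub_nonneg.2 (h 3)
    rw [← sub_nonneg, e]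
    have := h0.1; have := h1.1
    positivity

theorem IsCell.exists_jac_pos {s : CellShape} {v : Fin s.n → Plane} (h : s.IsCell v) :
    ∃ ε : ℝ, (ε = 1 ∨ ε = -1) ∧ ∀ x ∈ s.refCell, 0 < ε * s.jac v x := by
  obtain ⟨ε, hε, hpos⟩ := h.exists_orientation
  have : Nonempty (Fin s.n) := by cases s <;> exact ⟨0⟩
  obtain ⟨a, ha⟩ := Finite.exists_min fun a => ε * s.cornerDet v a
  exact ⟨ε, hε, fun x hx => (hpos a).trans_le (le_jac ha hx)⟩

theorem IsCell.jac_ne_zero {s : CellShape} {v : Fin s.n → Plane} (h : s.IsCell v) {x : Plane}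
    (hx : x ∈ s.refCell) : s.jac v x ≠ 0 := by
  obtain ⟨ε, -, hpos⟩ := h.exists_jac_pos
  intro h0
  have := hpos x hx
  rw [h0, mul_zero] at this
  exact this.false

theorem IsCell.injOn_refMap {s : CellShape} {v : Fin s.n → Plane} (h : s.IsCell v) :
    Set.InjOn (s.refMap v) s.refCell := by
  intro x hx y hy hxy
  have hm : midpoint ℝ x y ∈ s.refCell := s.convex_refCell.midpoint_mem hx hy
  have := refMap_sub s v x y
  rw [hxy, sub_self] at this
  obtain ⟨h0, h1⟩ := eq_zero_of_combo (h.jac_ne_zero hm) this.symm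
  exact plane_ext (by linarith) (by linarith)

end CellShape
end PrestrainedPlate

/-! ### Surjectivity and smooth inversion of the reference map. -/

namespace PrestrainedPlate

theorem cross_swap (u w : Plane) : cross u w = - cross w u := by unfold cross; ring

theorem abs_coord_le_norm (u : Plane) (i : Fin 2) : |u i| ≤ ‖u‖ := by
  simpa using PiLp.norm_apply_le u i

theorem abs_cross_le (u w : Plane) : |cross u w| ≤ 2 * ‖u‖ * ‖w‖ := by
  unfold cross
  have h : ∀ i j, |u i * w j| ≤ ‖u‖ * ‖w‖ := fun i j => by
    rw [abs_mul]
    exact mul_le_mul (abs_coord_le_norm u i) (abs_coord_le_norm w j) (abs_nonneg _) (norm_nonneg _)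
  have := abs_sub (u 0 * w 1) (u 1 * w 0)
  linarith [h 0 1, h 1 0]

theorem convex_cross_nonneg (ε : ℝ) (e p : Plane) : Convex ℝ {z : Plane | 0 ≤ ε * cross e (z - p)} := by
  intro x hx y hy a b ha hb hab
  simp only [Set.mem_ofPred_eq] at *
  have : ε * cross e (a • x + b • y - p) = a * (ε * cross e (x - p)) + b * (ε * cross e (y - p)) := by
    have hb' : b = 1 - a := by linarith
    subst hb'
    simp [cross]; ring
  rw [this]; positivity

namespace CellShape

theorem shapeFn_nonneg {s : CellShape} {x : Plane} (hx : x ∈ s.refCell) (a : Fin s.n) :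
    0 ≤ s.shapeFn x a := by
  have h0 := mem_refCell_bounds hx 0
  have h1 := mem_refCell_bounds hx 1
  have e0 : 0 ≤ 1 - x 0 := by linarith
  have e1 : 0 ≤ 1 - x 1 := by linarith
  cases s
  · have h2 := hx.2.2
    fin_cases a
    · show 0 ≤ 1 - x 0 - x 1
      linarith
    · exact h0.1
    · exact h1.1
  · fin_cases a
    · exact mul_nonneg e0 e1
    · exact mul_nonneg h0.1 e1
    · exact mul_nonneg h0.1 h1.1
    · exact mul_nonneg e0 h1.1

theorem sum_shapeFn (s : CellShape) (x : Plane) : ∑ a, s.shapeFn x a = 1 := by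
  cases s
  · simp only [shapeFn]
    rw [Fin.sum_univ_three]; simp; ring
  · simp only [shapeFn]
    rw [Fin.sum_univ_four]; simp; ring

theorem refMap_mem_convexHull {s : CellShape} (v : Fin s.n → Plane) {x : Plane}
    (hx : x ∈ s.refCell) : s.refMap v x ∈ convexHull ℝ (Set.range v) :=
  (convex_convexHull ℝ _).sum_mem (fun a _ => shapeFn_nonneg hx a) (s.sum_shapeFn x)
    fun a _ => subset_convexHull ℝ _ (Set.mem_range_self a)

theorem convexHull_subset_triangle (v : Fin 3 → Plane) :
    convexHull ℝ (Set.range v) ⊆ triangle.refMap v '' triangle.refCell := by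
  refine convexHull_min ?_ ?_
  · rintro _ ⟨a, rfl⟩
    fin_cases a
    · refine ⟨!₂[0, 0], ⟨?_, ?_, ?_⟩, ?_⟩ <;> simp [refMap_eq, vert0, vecA, vecB, vecC]
    · refine ⟨!₂[1, 0], ⟨?_, ?_, ?_⟩, ?_⟩ <;> simp [refMap_eq, vert0, vecA, vecB, vecC]
    · refine ⟨!₂[0, 1], ⟨?_, ?_, ?_⟩, ?_⟩ <;> simp [refMap_eq, vert0, vecA, vecB, vecC]
  · rintro _ ⟨x, hx, rfl⟩ _ ⟨y, hy, rfl⟩ a b ha hb hab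
    refine ⟨a • x + b • y, triangle.convex_refCell hx hy ha hb hab, ?_⟩
    have hb' : b = 1 - a := by linarith
    subst hb'
    simp only [refMap_eq, vert0, vecA, vecB, vecC, PiLp.add_apply, PiLp.smul_apply, smul_eq_mul]
    module

/-- Half-planes are convex, so only the vertices matter; there the determinants are zero or corner
determinants. -/
theorem edge_cross_nonneg {v : Fin 4 → Plane} {ε : ℝ}
    (h : ∀ a, 0 < ε * cornerDet quadrilateral v a) {z : Plane}
    (hz : z ∈ convexHull ℝ (Set.range v)) :
    0 ≤ ε * cross (v 1 - v 0) (z - v 0) ∧ 0 ≤ ε * cross (v 2 - v 1) (z - v 1) ∧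
      0 ≤ ε * cross (v 3 - v 2) (z - v 2) ∧ 0 ≤ ε * cross (v 0 - v 3) (z - v 3) := by
  obtain ⟨⟨a0, a1, a2⟩, ⟨b0, b1, b2⟩, ⟨c0, c1, c2⟩, d0', d1', d2'⟩ := succAbove_vals
  have h0 := h 0; have h1 := h 1; have h2 := h 2; have h3 := h 3
  simp only [cornerDet, triDet, cross, a0, a1, a2, b0, b1, b2, c0,
    c1, c2, d0', d1', d2', PiLp.sub_apply] at h0 h1 h2 h3
  refine ⟨?_, ?_, ?_, ?_⟩
  all_goals
    refine convexHull_min (s := Set.range v) ?_ (convex_cross_nonneg ε _ _) hz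
    rintro _ ⟨a, rfl⟩
    fin_cases a <;> simp only [Set.mem_ofPred_eq, cross, PiLp.sub_apply, Fin.zero_eta, Fin.mk_one,
      Fin.reduceFinMk] <;> linarith

/-- The quadrilateral is swept by the segments `ξ ↦ F(ξ, η)`. The signed position `c η` of the point
relative to the line of such a segment is nonnegative for `η = 0` and nonpositive for `η = 1`, so
some line passes through the point. The two remaining edges then confine `ξ` to `[0, 1]`. -/
theorem convexHull_subset_quadrilateral {v : Fin 4 → Plane} (hv : quadrilateral.IsCell v) :
    convexHull ℝ (Set.range v) ⊆ quadrilateral.refMap v '' quadrilateral.refCell := by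
  intro x hx
  obtain ⟨ε, hε, hc⟩ := hv.exists_orientation
  have hjac : ∀ y ∈ quadrilateral.refCell, 0 < ε * quadrilateral.jac v y := by
    obtain ⟨a, ha⟩ := Finite.exists_min fun a => ε * quadrilateral.cornerDet v a
    exact fun y hy => (hc a).trans_le (le_jac ha hy)
  obtain ⟨e0, e1, e2, e3⟩ := edge_cross_nonneg hc hx
  let c : ℝ → ℝ := fun η => ε * cross (v 1 - v 0 + η • (v 0 - v 1 + v 2 - v 3))
    (x - (v 0 + η • (v 3 - v 0)))
  have hcc : ContinuousOn c (Set.Icc 0 1) := by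
    simp only [c, cross, PiLp.add_apply, PiLp.sub_apply, PiLp.smul_apply, smul_eq_mul]
    fun_prop
  have hc0 : 0 ≤ c 0 := by simpa [c] using e0
  have hc1 : c 1 ≤ 0 := by
    have : c 1 = -(ε * cross (v 3 - v 2) (x - v 2)) := by
      simp [c, cross]; ring
    rw [this]; linarith
  obtain ⟨η, hη, hη0⟩ := intermediate_value_Icc' zero_le_one hcc ⟨hc1, hc0⟩
  have hε0 : ε ≠ 0 := by rcases hε with h | h <;> rw [h] <;> norm_num
  have hcr : cross (v 1 - v 0 + η • (v 0 - v 1 + v 2 - v 3)) (x - (v 0 + η • (v 3 - v 0))) = 0 :=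
    (mul_eq_zero.1 hη0).resolve_left hε0
  have hl : (!₂[0, η] : Plane) ∈ quadrilateral.refCell := by
    intro i; fin_cases i
    · simp
    · simpa using hη
  have hr : (!₂[1, η] : Plane) ∈ quadrilateral.refCell := by
    intro i; fin_cases i
    · simp
    · simpa using hη
  have jl := hjac _ hl
  have jr := hjac _ hr
  simp only [jac, d0, d1, vecA, vecB, vecC] at jl jr
  simp only [Matrix.cons_val, zero_smul, add_zero, one_smul] at jl jr
  set p := v 1 - v 0 + η • (v 0 - v 1 + v 2 - v 3) with hp
  set L := v 0 + η • (v 3 - v 0) with hL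
  set q := v 3 - v 0 with hq
  have jl0 : cross p q ≠ 0 := fun h => by rw [h, mul_zero] at jl; exact jl.false
  have hx1 := combo_of_cross_ne_zero jl0 (x - L)
  rw [hcr, zero_div, zero_smul, add_zero] at hx1
  set ξ := cross (x - L) q / cross p q with hξ
  have hξ0 : 0 ≤ ξ := by
    have h1 : ξ = (ε * cross (x - L) q) / (ε * cross p q) := by
      rw [hξ, mul_div_mul_left _ _ hε0]
    rw [h1]
    refine div_nonneg ?_ jl.le
    have : ε * cross (x - L) q = ε * cross (v 0 - v 3) (x - v 3) := by
      simp only [hL, hq, cross, PiLp.add_apply, PiLp.sub_apply, PiLp.smul_apply, smul_eq_mul]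
      ring
    rw [this]; exact e3
  -- On the line found, the position relative to the edge from `v 1` to `v 2` is `1 - ξ` times the
  -- oriented Jacobian at `(1, η)`, which is positive.
  have hξ1 : ξ ≤ 1 := by
    have h1 : ε * cross (v 2 - v 1) (x - v 1) =
        (1 - ξ) * (ε * cross p (q + (v 0 - v 1 + v 2 - v 3))) := by
      have h2 : x = L + ξ • p := by rw [← hx1]; abel
      rw [h2]
      simp only [hL, hp, hq, cross, PiLp.add_apply, PiLp.sub_apply, PiLp.smul_apply, smul_eq_mul]
      ring
    rw [h1] at e1
    by_contra hlt
    have : (1 - ξ) * (ε * cross p (q + (v 0 - v 1 + v 2 - v 3))) < 0 :=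
      mul_neg_of_neg_of_pos (by linarith) jr
    linarith
  refine ⟨!₂[ξ, η], ?_, ?_⟩
  · intro i; fin_cases i
    · exact ⟨by simpa using hξ0, by simpa using hξ1⟩
    · simpa using hη
  · have h2 : x = L + ξ • p := by rw [← hx1]; abel
    rw [h2, refMap_eq]
    simp only [vert0, vecA, vecB, vecC, Matrix.cons_val, hL, hp, hq]
    module

theorem IsCell.image_refMap {s : CellShape} {v : Fin s.n → Plane} (h : s.IsCell v) :
    s.refMap v '' s.refCell = convexHull ℝ (Set.range v) := by
  refine Set.Subset.antisymm ?_ ?_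
  · rintro _ ⟨x, hx, rfl⟩
    exact refMap_mem_convexHull v hx
  · cases s
    · exact convexHull_subset_triangle v
    · exact convexHull_subset_quadrilateral h

/-! ### Derivative of the reference map -/

/-- Fréchet derivative of the reference map. -/
noncomputable def refDeriv (s : CellShape) (v : Fin s.n → Plane) (x : Plane) : Plane →L[ℝ] Plane :=
  (EuclideanSpace.proj (0 : Fin 2) : Plane →L[ℝ] ℝ).smulRight (s.d0 v x) +
    (EuclideanSpace.proj (1 : Fin 2) : Plane →L[ℝ] ℝ).smulRight (s.d1 v x)

theorem refDeriv_apply (s : CellShape) (v : Fin s.n → Plane) (x u : Plane) :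
    s.refDeriv v x u = u 0 • s.d0 v x + u 1 • s.d1 v x := by
  simp [refDeriv]

theorem contDiff_refMap (s : CellShape) (v : Fin s.n → Plane) {n : WithTop ℕ∞} :
    ContDiff ℝ n (s.refMap v) := by
  have : s.refMap v = fun x : Plane => s.vert0 v + x 0 • s.vecA v + x 1 • s.vecB v + (x 0 * x 1) • s.vecC v :=
    funext (refMap_eq s v)
  rw [this]
  fun_prop

theorem hasFDerivAt_refMap (s : CellShape) (v : Fin s.n → Plane) (x : Plane) :
    HasFDerivAt (s.refMap v) (s.refDeriv v x) x := by
  have e : s.refMap v = fun x : Plane => s.vert0 v + x 0 • s.vecA v + x 1 • s.vecB v + (x 0 * x 1) • s.vecC v :=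
    funext (refMap_eq s v)
  rw [e]
  have hp : ∀ i : Fin 2, HasFDerivAt (fun y : Plane => y i)
      (EuclideanSpace.proj i : Plane →L[ℝ] ℝ) x := fun i =>
    (EuclideanSpace.proj i : Plane →L[ℝ] ℝ).hasFDerivAt
  have := ((((hp 0).smul_const (s.vecA v)).const_add (s.vert0 v)).add
    ((hp 1).smul_const (s.vecB v))).add (((hp 0).mul (hp 1)).smul_const (s.vecC v))
  refine this.congr_fderiv ?_
  ext1 u
  simp only [refDeriv, d0, d1, add_apply, ContinuousLinearMap.smulRight_apply,
    smul_apply, smul_eq_mul]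
  module

theorem det_refDeriv (s : CellShape) (v : Fin s.n → Plane) (x : Plane) :
    (s.refDeriv v x).det = s.jac v x := by
  rw [ContinuousLinearMap.det,
    ← LinearMap.det_toMatrix (EuclideanSpace.basisFun (Fin 2) ℝ).toBasis, Matrix.det_fin_two]
  simp [LinearMap.toMatrix_apply, refDeriv_apply, jac, cross]
  ring

/-! ### The inverse of the reference map -/

/-- The inverse of the reference map on the cell. -/
noncomputable def refInv (s : CellShape) (v : Fin s.n → Plane) : Plane → Plane :=
  Function.invFunOn (s.refMap v) s.refCell

theorem IsCell.refInv_mem {s : CellShape} {v : Fin s.n → Plane} (h : s.IsCell v) {x : Plane}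
    (hx : x ∈ convexHull ℝ (Set.range v)) : s.refInv v x ∈ s.refCell :=
  Function.invFunOn_mem (by rwa [← h.image_refMap] at hx)

theorem IsCell.refMap_refInv {s : CellShape} {v : Fin s.n → Plane} (h : s.IsCell v) {x : Plane}
    (hx : x ∈ convexHull ℝ (Set.range v)) : s.refMap v (s.refInv v x) = x :=
  Function.invFunOn_eq (by rwa [← h.image_refMap] at hx)

theorem IsCell.refInv_refMap {s : CellShape} {v : Fin s.n → Plane} (h : s.IsCell v) {x : Plane}
    (hx : x ∈ s.refCell) : s.refInv v (s.refMap v x) = x :=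
  h.injOn_refMap.leftInvOn_invFunOn hx

/-- The reference cell is compact, so images of its closed subsets are closed. -/
theorem IsCell.continuousOn_refInv {s : CellShape} {v : Fin s.n → Plane} (h : s.IsCell v) :
    ContinuousOn (s.refInv v) (convexHull ℝ (Set.range v)) := by
  rw [continuousOn_iff_isClosed]
  intro t ht
  refine ⟨s.refMap v '' (s.refCell ∩ t), ?_, ?_⟩
  · exact ((s.isCompact_refCell.inter_right ht).image
      (s.contDiff_refMap v (n := 0)).continuous).isClosed
  · ext x
    constructor
    · rintro ⟨hx1, hx2⟩
      exact ⟨⟨_, ⟨h.refInv_mem hx2, hx1⟩, h.refMap_refInv hx2⟩, hx2⟩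
    · rintro ⟨⟨y, ⟨hy1, hy2⟩, rfl⟩, hx2⟩
      refine ⟨?_, hx2⟩
      rw [Set.mem_preimage, h.refInv_refMap hy1]
      exact hy2

/-- Smoothness up to the boundary of the cell. By continuity the inverse on the cell agrees near
each point with the local inverse of the inverse function theorem, and the latter is smooth on a
full neighbourhood, also at boundary points. -/
theorem IsCell.contDiffOn_refInv {s : CellShape} {v : Fin s.n → Plane} (h : s.IsCell v)
    {n : ℕ∞} : ContDiffOn ℝ n (s.refInv v) (convexHull ℝ (Set.range v)) := by
  refine ContDiffOn.of_le (n := ((⊤ : ℕ∞) : WithTop ℕ∞)) ?_ (by exact_mod_cast le_top)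
  intro x hx
  have hξ := h.refInv_mem hx
  have hdet : (s.refDeriv v (s.refInv v x)).det ≠ 0 := by
    rw [det_refDeriv]; exact h.jac_ne_zero hξ
  set f' := (s.refDeriv v (s.refInv v x)).toContinuousLinearEquivOfDetNeZero hdet with hf'
  have hd : HasFDerivAt (s.refMap v) (f' : Plane →L[ℝ] Plane) (s.refInv v x) :=
    hasFDerivAt_refMap s v _
  have hcd : ContDiffAt ℝ ((⊤ : ℕ∞) : WithTop ℕ∞) (s.refMap v) (s.refInv v x) :=
    (s.contDiff_refMap v).contDiffAt
  have hn : ((⊤ : ℕ∞) : WithTop ℕ∞) ≠ 0 := by simp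
  have hinv := hcd.to_localInverse hd hn
  rw [h.refMap_refInv hx] at hinv
  refine hinv.contDiffWithinAt.congr_of_eventuallyEq_of_mem ?_ hx
  have hst : HasStrictFDerivAt (s.refMap v) (f' : Plane →L[ℝ] Plane) (s.refInv v x) :=
    hcd.hasStrictFDerivAt' hd hn
  have hl := (h.continuousOn_refInv x hx).eventually hst.eventually_left_inverse
  filter_upwards [hl, self_mem_nhdsWithin] with y hy hyc
  rw [h.refMap_refInv hyc] at hy
  exact hy.symm

end CellShape
end PrestrainedPlate

/-! ### Shape regularity as a lower bound of the Jacobian. -/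

namespace PrestrainedPlate
namespace CellShape

/-! ### Quantitative shape regularity -/

theorem IsCell.volume_convexHull {s : CellShape} {v : Fin s.n → Plane} (h : s.IsCell v) :
    volume (convexHull ℝ (Set.range v)) = ∫⁻ x in s.refCell, ENNReal.ofReal |s.jac v x| := by
  rw [← h.image_refMap, ← lintegral_abs_det_fderiv_eq_addHaar_image volume s.measurableSet_refCell
    (fun x _ => (hasFDerivAt_refMap s v x).hasFDerivWithinAt) h.injOn_refMap]
  simp_rw [det_refDeriv]

theorem volume_ball_plane (c : Plane) {r : ℝ} (hr : 0 ≤ r) :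
    volume (Metric.closedBall c r) = ENNReal.ofReal (Real.pi * r ^ 2) := by
  rw [EuclideanSpace.volume_closedBall_fin_two, ENNReal.ofReal_mul Real.pi_pos.le,
    ENNReal.ofReal_pow hr, mul_comm]

theorem refCell_subset_closedBall (s : CellShape) : s.refCell ⊆ Metric.closedBall 0 2 := by
  intro x hx
  have h0 := mem_refCell_bounds hx 0
  have h1 := mem_refCell_bounds hx 1
  rw [mem_closedBall_zero_iff, EuclideanSpace.norm_eq, Real.sqrt_le_left (by norm_num)]
  simp only [Fin.sum_univ_two, Real.norm_eq_abs, sq_abs]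
  nlinarith

end CellShape

open CellShape

theorem diam_convexHull_pos {n : ℕ} {w : Fin n → Plane} {i j : Fin n} (h : w i ≠ w j) :
    0 < Metric.diam (convexHull ℝ (Set.range w)) := by
  rw [convexHull_diam]
  exact (dist_pos.2 h).trans_le
    (Metric.dist_le_diam_of_mem (Set.finite_range w).isBounded ⟨i, rfl⟩ ⟨j, rfl⟩)

theorem dist_le_diam_convexHull {n : ℕ} (w : Fin n → Plane) (i j : Fin n) :
    dist (w i) (w j) ≤ Metric.diam (convexHull ℝ (Set.range w)) := by
  rw [convexHull_diam]
  exact Metric.dist_le_diam_of_mem (Set.finite_range w).isBounded ⟨i, rfl⟩ ⟨j, rfl⟩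

theorem exists_dist_eq_diam {n : ℕ} [NeZero n] (w : Fin n → Plane) :
    ∃ i j, dist (w i) (w j) = Metric.diam (convexHull ℝ (Set.range w)) := by
  obtain ⟨⟨i, j⟩, hij⟩ := Finite.exists_max fun p : Fin n × Fin n => dist (w p.1) (w p.2)
  refine ⟨i, j, le_antisymm (dist_le_diam_convexHull w i j) ?_⟩
  rw [convexHull_diam]
  refine Metric.diam_le_of_forall_dist_le dist_nonneg ?_
  rintro _ ⟨a, rfl⟩ _ ⟨b, rfl⟩
  exact hij (a, b)

/-- A diameter above half of the supremum is enough and spares the question whether the supremum is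
attained; this costs the factor `2`. Since a nondegenerate triangle has positive diameter,
regularity forces `ϱ > 0`. -/
theorem TriangleRegular.exists_disc {ϱ : ℝ} {w : Fin 3 → Plane} (h : TriangleRegular ϱ w)
    (hw : AffineIndependent ℝ w) :
    0 < ϱ ∧ ∃ (c : Plane) (d : ℝ), 0 < d ∧ Metric.closedBall c (d / 2) ⊆ convexHull ℝ (Set.range w) ∧
      Metric.diam (convexHull ℝ (Set.range w)) ≤ 2 * ϱ * d := by
  set K := convexHull ℝ (Set.range w) with hK
  have hKb : Bornology.IsBounded K := isBounded_convexHull.2 (Set.finite_range w).isBounded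
  have hd : 0 < Metric.diam K := diam_convexHull_pos (i := 0) (j := 1) (hw.injective.ne (by decide))
  unfold TriangleRegular inscribedDiam at h
  set D : Set ℝ := {d : ℝ | ∃ c : Plane, Metric.closedBall c (d / 2) ⊆ K} with hD
  have h0D : (0 : ℝ) ∈ D := by
    refine ⟨w 0, ?_⟩
    simpa using subset_convexHull ℝ _ (Set.mem_range_self 0)
  have hbdd : BddAbove D := by
    refine ⟨2 * Metric.diam K, ?_⟩
    rintro d ⟨c, hc⟩
    by_contra! hlt
    have hd0 : 0 < d := by linarith
    have hc0 : c ∈ K := hc (Metric.mem_closedBall_self (by positivity))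
    have hu : ‖(EuclideanSpace.single 0 1 : Plane)‖ = 1 := by simp
    have hc1 : c + (d / 2) • (EuclideanSpace.single 0 1 : Plane) ∈ K := by
      refine hc ?_
      rw [Metric.mem_closedBall, dist_eq_norm, add_sub_cancel_left, norm_smul, hu, mul_one,
        Real.norm_of_nonneg (by positivity)]
    have := Metric.dist_le_diam_of_mem hKb hc1 hc0
    rw [dist_eq_norm, add_sub_cancel_left, norm_smul, hu, mul_one,
        Real.norm_of_nonneg (by positivity)] at this
    linarith
  have hs0 : 0 ≤ sSup D := le_csSup hbdd h0D
  have hpos : 0 < ϱ * sSup D := hd.trans_le h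
  have hs : 0 < sSup D := by
    rcases hs0.lt_or_eq with h1 | h1
    · exact h1
    · rw [← h1, mul_zero] at hpos; exact absurd hpos (lt_irrefl _)
  have hϱ : 0 < ϱ := pos_of_mul_pos_left hpos hs0
  refine ⟨hϱ, ?_⟩
  obtain ⟨d, ⟨c, hc⟩, hd2⟩ := exists_lt_of_lt_csSup ⟨0, h0D⟩ (half_lt_self hs)
  refine ⟨c, d, by linarith, hc, ?_⟩
  nlinarith

/-- Comparison of areas: the disc has area `π (d / 2)²`, while the triangle has area at most
`|triDet w|` times that of the disc of radius `2` containing the reference cell. Together with `diam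
≤ 2 ϱ d` this gives `64 ϱ²`. -/
theorem TriangleRegular.sq_diam_le {ϱ : ℝ} {w : Fin 3 → Plane} (h : TriangleRegular ϱ w)
    (hw : AffineIndependent ℝ w) :
    0 < ϱ ∧ 1 / (64 * ϱ ^ 2) * Metric.diam (convexHull ℝ (Set.range w)) ^ 2 ≤ |triDet w| := by
  obtain ⟨hϱ, c, d, hd, hc, hle⟩ := h.exists_disc hw
  refine ⟨hϱ, ?_⟩
  have hcell : CellShape.IsCell .triangle w := hw
  have h1 := measure_mono (μ := volume) hc
  rw [hcell.volume_convexHull, volume_ball_plane _ (by positivity)] at h1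
  have h2 : ∫⁻ x in triangle.refCell, ENNReal.ofReal |triangle.jac w x| ≤
      ENNReal.ofReal |triDet w| * ENNReal.ofReal (Real.pi * 2 ^ 2) := by
    simp_rw [jac_triangle]
    rw [setLIntegral_const, ← volume_ball_plane (0 : Plane) (by norm_num : (0 : ℝ) ≤ 2)]
    gcongr
    exact triangle.refCell_subset_closedBall
  have h3 := h1.trans h2
  rw [← ENNReal.ofReal_mul (abs_nonneg _), ENNReal.ofReal_le_ofReal_iff (by positivity)] at h3
  have h4 : d ^ 2 / 16 ≤ |triDet w| := by nlinarith [Real.pi_pos]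
  have hdn := Metric.diam_nonneg (s := convexHull ℝ (Set.range w))
  rw [one_div, inv_mul_le_iff₀ (by positivity)]
  nlinarith [mul_le_mul hle hle hdn (by positivity), sq_nonneg ϱ]

/-- The determinant can be based at any vertex, so any edge can play the part of the first factor.
-/
theorem abs_triDet_le (w : Fin 3 → Plane) {i j : Fin 3} (hij : i ≠ j) :
    |triDet w| ≤ 2 * dist (w i) (w j) * Metric.diam (convexHull ℝ (Set.range w)) := by
  have key : ∀ a b c : Fin 3, |triDet w| = |cross (w b - w a) (w c - w a)| →
      |triDet w| ≤ 2 * dist (w a) (w b) * Metric.diam (convexHull ℝ (Set.range w)) := by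
    intro a b c h
    rw [h]
    refine (abs_cross_le _ _).trans ?_
    rw [← dist_eq_norm, ← dist_eq_norm, dist_comm (w b)]
    gcongr
    exact dist_le_diam_convexHull w c a
  have e1 : triDet w = cross (w 2 - w 1) (w 0 - w 1) := by simp [triDet, cross]; ring
  have e2 : triDet w = cross (w 0 - w 2) (w 1 - w 2) := by simp [triDet, cross]; ring
  fin_cases i <;> fin_cases j
  · exact absurd rfl hij
  · exact key 0 1 2 rfl
  · exact key 0 2 1 (by rw [cross_swap, abs_neg]; rfl)
  · exact key 1 0 2 (by rw [cross_swap, abs_neg, e1])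
  · exact absurd rfl hij
  · exact key 1 2 0 (by rw [e1])
  · exact key 2 0 1 (by rw [e2])
  · exact key 2 1 0 (by rw [cross_swap, abs_neg, e2])
  · exact absurd rfl hij

theorem exists_succAbove_eq_of_ne {a i : Fin 4} (h : i ≠ a) : ∃ b : Fin 3, a.succAbove b = i :=
  Fin.exists_succAbove_eq h

/-- The diameter `H` is the distance of two vertices, hence some sub-triangle `c` has diameter `H`;
its determinant is at least `κ H²`, so all its edges are at least `κ H / 2` long. Every other
sub-triangle shares an edge with it, and its own regularity turns this length into the bound `κ (κ H
/ 2)²`. -/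
theorem cornerDet_quadrilateral_lower {ϱ : ℝ} {v : Fin 4 → Plane}
    (hv : quadrilateral.IsCell v) (h : quadrilateral.Regular ϱ v) (a : Fin 4) :
    1 / 4 * (1 / (64 * ϱ ^ 2)) ^ 3 * Metric.diam (convexHull ℝ (Set.range v)) ^ 2 ≤
      |quadrilateral.cornerDet v a| := by
  set κ := 1 / (64 * ϱ ^ 2)
  set H := Metric.diam (convexHull ℝ (Set.range v))
  have hreg : ∀ a : Fin 4, κ * Metric.diam (convexHull ℝ (Set.range fun b : Fin 3 => v (a.succAbove b))) ^ 2
      ≤ |quadrilateral.cornerDet v a| := fun a => ((h a).sq_diam_le (hv.1 a)).2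
  have hϱ : 0 < ϱ := ((h 0).sq_diam_le (hv.1 0)).1
  have hκ : 0 < κ := by positivity
  have hinj : Function.Injective v := by
    intro p q hpq
    by_contra hne
    obtain ⟨c, hcp, hcq⟩ : ∃ c : Fin 4, p ≠ c ∧ q ≠ c := by
      clear hpq; revert p q; decide
    obtain ⟨b, hb⟩ := exists_succAbove_eq_of_ne hcp
    obtain ⟨b', hb'⟩ := exists_succAbove_eq_of_ne hcq
    have := (hv.1 c).injective (a₁ := b) (a₂ := b') (by simp only [hb, hb', hpq])
    exact hne (by rw [← hb, ← hb', this])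
  have hdist : ∀ (c : Fin 4) (p q : Fin 4), p ≠ c → q ≠ c →
      dist (v p) (v q) ≤ Metric.diam (convexHull ℝ (Set.range fun b : Fin 3 => v (c.succAbove b))) := by
    intro c p q hp hq
    obtain ⟨b, rfl⟩ := exists_succAbove_eq_of_ne hp
    obtain ⟨b', rfl⟩ := exists_succAbove_eq_of_ne hq
    exact dist_le_diam_convexHull (fun b : Fin 3 => v (c.succAbove b)) b b'
  have hsub : ∀ c : Fin 4, Metric.diam (convexHull ℝ (Set.range fun b : Fin 3 => v (c.succAbove b))) ≤ H := by
    intro c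
    refine Metric.diam_mono (convexHull_mono ?_) (isBounded_convexHull.2 (Set.finite_range v).isBounded)
    rintro _ ⟨b, rfl⟩; exact ⟨_, rfl⟩
  obtain ⟨p, q, hpq⟩ := exists_dist_eq_diam v
  have hH : 0 < H := diam_convexHull_pos (i := (0 : Fin 4)) (j := 1) (hinj.ne (by decide))
  have hpq' : p ≠ q := by
    rintro rfl
    rw [dist_self] at hpq
    exact hH.ne hpq
  obtain ⟨c, hcp, hcq⟩ : ∃ c : Fin 4, p ≠ c ∧ q ≠ c := by
    clear hpq hpq'; revert p q; decide
  have hDc := hdist c p q hcp hcq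
  rw [hpq] at hDc
  have hDc' : Metric.diam (convexHull ℝ (Set.range fun b : Fin 3 => v (c.succAbove b))) = H :=
    le_antisymm (hsub c) hDc
  have hTc := hreg c
  rw [hDc'] at hTc
  -- every edge of the sub-triangle `c` is long
  have hedge : ∀ i j : Fin 4, i ≠ c → j ≠ c → i ≠ j → κ * H / 2 ≤ dist (v i) (v j) := by
    intro i j hi hj hij
    obtain ⟨b, rfl⟩ := exists_succAbove_eq_of_ne hi
    obtain ⟨b', rfl⟩ := exists_succAbove_eq_of_ne hj
    have h1 := abs_triDet_le (fun b : Fin 3 => v (c.succAbove b)) (i := b) (j := b')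
      (fun e => hij (by rw [e]))
    rw [hDc'] at h1
    have h2 : κ * H * H ≤ 2 * dist (v (c.succAbove b)) (v (c.succAbove b')) * H := by
      calc κ * H * H = κ * H ^ 2 := by ring
        _ ≤ _ := hTc.trans h1
    have := le_of_mul_le_mul_right h2 hH
    linarith
  obtain ⟨i, j, hic, hia, hjc, hja, hij⟩ :
      ∃ i j : Fin 4, i ≠ c ∧ i ≠ a ∧ j ≠ c ∧ j ≠ a ∧ i ≠ j := by
    clear hTc hDc hDc' hedge hcp hcq; revert a c; decide
  have h1 := hedge i j hic hjc hij
  have h2 := hdist a i j hia hja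
  refine le_trans ?_ (hreg a)
  have h3 : (κ * H / 2) ^ 2 ≤
      Metric.diam (convexHull ℝ (Set.range fun b : Fin 3 => v (a.succAbove b))) ^ 2 :=
    pow_le_pow_left₀ (by positivity) (h1.trans h2) 2
  calc 1 / 4 * κ ^ 3 * H ^ 2 = κ * (κ * H / 2) ^ 2 := by ring
    _ ≤ _ := by gcongr

/-- On shape regular cells the Jacobian is bounded below by the square of the diameter. -/
theorem exists_jac_lower (s : CellShape) (ϱ : ℝ) :
    ∃ c : ℝ, 0 < c ∧ ∀ v : Fin s.n → Plane, s.IsCell v → s.Regular ϱ v → ∀ x ∈ s.refCell,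
      c * Metric.diam (convexHull ℝ (Set.range v)) ^ 2 ≤ |s.jac v x| := by
  have main : ∀ (κ : ℝ) (v : Fin s.n → Plane), s.IsCell v →
      (∀ a, κ * Metric.diam (convexHull ℝ (Set.range v)) ^ 2 ≤ |s.cornerDet v a|) →
      ∀ x ∈ s.refCell, κ * Metric.diam (convexHull ℝ (Set.range v)) ^ 2 ≤ |s.jac v x| := by
    intro κ v hv hκ x hx
    obtain ⟨ε, hε, hpos⟩ := hv.exists_orientation
    have habs : |ε| = 1 := by rcases hε with h | h <;> simp [h]
    have h1 : ∀ a, κ * Metric.diam (convexHull ℝ (Set.range v)) ^ 2 ≤ ε * s.cornerDet v a := by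
      intro a
      rw [← abs_of_pos (hpos a), abs_mul, habs, one_mul]
      exact hκ a
    refine (le_jac h1 hx).trans ((le_abs_self _).trans ?_)
    rw [abs_mul, habs, one_mul]
  by_cases hϱ : 0 < ϱ
  · cases s
    · exact ⟨1 / (64 * ϱ ^ 2), by positivity, fun v hv hr =>
        main _ v hv fun a => (TriangleRegular.sq_diam_le hr hv).2⟩
    · exact ⟨1 / 4 * (1 / (64 * ϱ ^ 2)) ^ 3, by positivity, fun v hv hr =>
        main _ v hv fun a => cornerDet_quadrilateral_lower hv hr a⟩
  · refine ⟨1, one_pos, fun v hv hr => absurd ?_ hϱ⟩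
    cases s
    · exact (TriangleRegular.sq_diam_le hr hv).1
    · exact ((hr 0).sq_diam_le (hv.1 0)).1

end PrestrainedPlate

/-! ### Combinatorics of conforming meshes. -/

namespace PrestrainedPlate

open Filter Topology

/-! ### Overlapping triangles -/

@[fun_prop]
theorem continuous_cross {X : Type*} [TopologicalSpace X] {f g : X → Plane} (hf : Continuous f)
    (hg : Continuous g) : Continuous fun x => cross (f x) (g x) := by
  unfold cross; fun_prop

/-- The midpoint of `p q` has barycentric coordinates `1/2, 1/2, 0` in the triangle `p q r`. A small
displacement towards the side of `r` makes the last coordinate positive and keeps the other two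
positive. -/
theorem eventually_mem_interior {K : Set Plane} (hK : Convex ℝ K) {p q r w : Plane} (hp : p ∈ K)
    (hq : q ∈ K) (hr : r ∈ K) (h : 0 < cross (q - p) w * cross (q - p) (r - p)) :
    ∀ᶠ ε in 𝓝[>] (0 : ℝ), midpoint ℝ p q + ε • w ∈ interior K := by
  set D := cross (q - p) (r - p) with hD
  have hD0 : D ≠ 0 := fun h0 => by rw [h0, mul_zero] at h; exact h.false
  have hint : ∀ z : Plane, 0 < cross (z - p) (r - p) / D → 0 < cross (q - p) (z - p) / D →
      cross (z - p) (r - p) / D + cross (q - p) (z - p) / D < 1 → z ∈ interior K := by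
    intro z h1 h2 h3
    refine mem_interior.2 ⟨{z | 0 < cross (z - p) (r - p) / D ∧ 0 < cross (q - p) (z - p) / D ∧
      cross (z - p) (r - p) / D + cross (q - p) (z - p) / D < 1}, ?_, ?_, ⟨h1, h2, h3⟩⟩
    · rintro z ⟨h1, h2, h3⟩
      have e := combo_of_cross_ne_zero hD0 (z - p)
      rw [← hD] at e
      set β := cross (z - p) (r - p) / D
      set γ := cross (q - p) (z - p) / D
      have e2 : z = (1 - β - γ) • p + β • q + γ • r := by
        have : z = p + (z - p) := by abel
        rw [this, e]; module
      rw [e2]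
      have := hK.sum_mem (t := Finset.univ) (w := ![1 - β - γ, β, γ]) (z := ![p, q, r])
        (by intro i _; fin_cases i <;> simp <;> linarith)
        (by rw [Fin.sum_univ_three]; simp; ring)
        (by intro i _; fin_cases i <;> simpa)
      rw [Fin.sum_univ_three] at this
      simpa using this
    · exact (isOpen_lt continuous_const (by fun_prop)).and
        ((isOpen_lt continuous_const (by fun_prop)).and (isOpen_lt (by fun_prop) continuous_const))
  have hm : ∀ i, (midpoint ℝ p q) i = (p i + q i) / 2 := by
    intro i; simp [midpoint_eq_smul_add]; ring
  have e1 : ∀ ε : ℝ, cross (midpoint ℝ p q + ε • w - p) (r - p) / D =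
      1 / 2 + ε * (cross w (r - p) / D) := by
    intro ε
    field_simp
    simp only [hD, cross, PiLp.add_apply, PiLp.sub_apply, PiLp.smul_apply, smul_eq_mul, hm]
    ring
  have e2 : ∀ ε : ℝ, cross (q - p) (midpoint ℝ p q + ε • w - p) / D =
      ε * (cross (q - p) w / D) := by
    intro ε
    field_simp
    simp only [cross, PiLp.add_apply, PiLp.sub_apply, PiLp.smul_apply, smul_eq_mul, hm]
    ring
  have hc : 0 < cross (q - p) w / D := by
    have : cross (q - p) w / D = cross (q - p) w * D / D ^ 2 := by field_simp
    rw [this]; positivity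
  set b := cross w (r - p) / D
  set c := cross (q - p) w / D
  have t1 : Tendsto (fun ε : ℝ => 1 / 2 + ε * b) (𝓝[>] 0) (𝓝 (1 / 2)) := by
    have : Tendsto (fun ε : ℝ => 1 / 2 + ε * b) (𝓝 0) (𝓝 (1 / 2 + 0 * b)) :=
      (by fun_prop : Continuous fun ε : ℝ => 1 / 2 + ε * b).tendsto 0
    simpa using this.mono_left nhdsWithin_le_nhds
  have t2 : Tendsto (fun ε : ℝ => 1 / 2 + ε * b + ε * c) (𝓝[>] 0) (𝓝 (1 / 2)) := by
    have : Tendsto (fun ε : ℝ => 1 / 2 + ε * b + ε * c) (𝓝 0) (𝓝 (1 / 2 + 0 * b + 0 * c)) :=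
      (by fun_prop : Continuous fun ε : ℝ => 1 / 2 + ε * b + ε * c).tendsto 0
    simpa using this.mono_left nhdsWithin_le_nhds
  filter_upwards [t1.eventually (lt_mem_nhds (show (0 : ℝ) < 1 / 2 by norm_num)),
    t2.eventually (gt_mem_nhds (show (1 : ℝ) / 2 < 1 by norm_num)), self_mem_nhdsWithin]
    with ε h1 h2 h3
  refine hint _ ?_ ?_ ?_
  · rw [e1]; exact h1
  · rw [e2]; exact mul_pos h3 hc
  · rw [e1, e2]; exact h2

/-- Two convex sets with a common segment and points strictly on the same side of it are entered
simultaneously by leaving the midpoint in one direction. -/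
theorem interior_inter_nonempty {K K' : Set Plane} (hK : Convex ℝ K) (hK' : Convex ℝ K')
    {p q r r' : Plane} (hp : p ∈ K) (hq : q ∈ K) (hr : r ∈ K) (hp' : p ∈ K') (hq' : q ∈ K')
    (hr' : r' ∈ K') (h : 0 < cross (q - p) (r - p) * cross (q - p) (r' - p)) :
    (interior K ∩ interior K').Nonempty := by
  have hne : cross (q - p) (r' - p) ≠ 0 := fun h0 => by rw [h0, mul_zero] at h; exact h.false
  obtain ⟨ε, h1, h2⟩ := ((eventually_mem_interior hK hp hq hr (w := r' - p)
    (by rwa [mul_comm])).and (eventually_mem_interior hK' hp' hq' hr' (w := r' - p)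
    (mul_self_pos.2 hne))).exists
  exact ⟨_, h1, h2⟩

/-- Pigeonhole principle: a line has only two sides, so two of the three points `r₁`, `r₂`, `r₃` lie
on the same one. -/
theorem not_three_disjoint {K₁ K₂ K₃ : Set Plane} (h₁ : Convex ℝ K₁) (h₂ : Convex ℝ K₂)
    (h₃ : Convex ℝ K₃) {p q r₁ r₂ r₃ : Plane} (hp₁ : p ∈ K₁) (hq₁ : q ∈ K₁) (hr₁ : r₁ ∈ K₁)
    (hp₂ : p ∈ K₂) (hq₂ : q ∈ K₂) (hr₂ : r₂ ∈ K₂) (hp₃ : p ∈ K₃) (hq₃ : q ∈ K₃) (hr₃ : r₃ ∈ K₃)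
    (c₁ : cross (q - p) (r₁ - p) ≠ 0) (c₂ : cross (q - p) (r₂ - p) ≠ 0)
    (c₃ : cross (q - p) (r₃ - p) ≠ 0)
    (d₁₂ : Disjoint (interior K₁) (interior K₂)) (d₁₃ : Disjoint (interior K₁) (interior K₃))
    (d₂₃ : Disjoint (interior K₂) (interior K₃)) : False := by
  have n₁₂ := fun h => Set.not_disjoint_iff_nonempty_inter.2
    (interior_inter_nonempty h₁ h₂ hp₁ hq₁ hr₁ hp₂ hq₂ hr₂ h) d₁₂
  have n₁₃ := fun h => Set.not_disjoint_iff_nonempty_inter.2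
    (interior_inter_nonempty h₁ h₃ hp₁ hq₁ hr₁ hp₃ hq₃ hr₃ h) d₁₃
  have n₂₃ := fun h => Set.not_disjoint_iff_nonempty_inter.2
    (interior_inter_nonempty h₂ h₃ hp₂ hq₂ hr₂ hp₃ hq₃ hr₃ h) d₂₃
  rcases lt_or_gt_of_ne c₁ with a | a <;> rcases lt_or_gt_of_ne c₂ with b | b <;>
    rcases lt_or_gt_of_ne c₃ with c | c
  · exact n₁₂ (mul_pos_of_neg_of_neg a b)
  · exact n₁₂ (mul_pos_of_neg_of_neg a b)
  · exact n₁₃ (mul_pos_of_neg_of_neg a c)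
  · exact n₂₃ (mul_pos b c)
  · exact n₂₃ (mul_pos_of_neg_of_neg b c)
  · exact n₁₃ (mul_pos a c)
  · exact n₁₂ (mul_pos a b)
  · exact n₁₂ (mul_pos a b)

namespace CellShape

theorem IsCell.injective {s : CellShape} {v : Fin s.n → Plane} (h : s.IsCell v) :
    Function.Injective v := by
  cases s
  · exact AffineIndependent.injective h
  · intro p q hpq
    by_contra hne
    obtain ⟨c, hcp, hcq⟩ : ∃ c : Fin 4, p ≠ c ∧ q ≠ c := by
      clear hpq; revert p q; decide
    obtain ⟨b, hb⟩ := exists_succAbove_eq_of_ne hcp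
    obtain ⟨b', hb'⟩ := exists_succAbove_eq_of_ne hcq
    have := (h.1 c).injective (a₁ := b) (a₂ := b') (by simp only [hb, hb', hpq])
    exact hne (by rw [← hb, ← hb', this])

theorem cross_ne_zero_of_triDet {w : Fin 3 → Plane} (h : triDet w ≠ 0) {a b c : Fin 3} (hab : a ≠ b)
    (hac : a ≠ c) (hbc : b ≠ c) : cross (w b - w a) (w c - w a) ≠ 0 := by
  have e : cross (w b - w a) (w c - w a) = triDet w ∨ cross (w b - w a) (w c - w a) = - triDet w := by
    fin_cases a <;> fin_cases b <;> fin_cases c <;>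
      first
      | exact absurd rfl hab
      | exact absurd rfl hac
      | exact absurd rfl hbc
      | (left; simp only [triDet, cross, PiLp.sub_apply, Fin.zero_eta, Fin.mk_one, Fin.reduceFinMk] <;>
         ring1)
      | (right; simp only [triDet, cross, PiLp.sub_apply, Fin.zero_eta, Fin.mk_one, Fin.reduceFinMk]
         ring1)
  rcases e with e | e <;> rw [e]
  · exact h
  · exact neg_ne_zero.2 h

/-- No three vertices of a cell are collinear. -/
theorem IsCell.cross_ne_zero {s : CellShape} {v : Fin s.n → Plane} (h : s.IsCell v) {a b c : Fin s.n}
    (hab : a ≠ b) (hac : a ≠ c) (hbc : b ≠ c) : cross (v b - v a) (v c - v a) ≠ 0 := by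
  cases s
  · exact cross_ne_zero_of_triDet (triDet_ne_zero h) hab hac hbc
  · obtain ⟨d, had, hbd, hcd⟩ : ∃ d : Fin 4, a ≠ d ∧ b ≠ d ∧ c ≠ d := by
      clear hab hac hbc; revert a b c; decide
    obtain ⟨a', rfl⟩ := exists_succAbove_eq_of_ne had
    obtain ⟨b', rfl⟩ := exists_succAbove_eq_of_ne hbd
    obtain ⟨c', rfl⟩ := exists_succAbove_eq_of_ne hcd
    exact cross_ne_zero_of_triDet (triDet_ne_zero (h.1 d)) (fun e => hab (by rw [e]))
      (fun e => hac (by rw [e])) (fun e => hbc (by rw [e]))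

theorem exists_third {s : CellShape} {a b : Fin s.n} (_ : a ≠ b) : ∃ c : Fin s.n, a ≠ c ∧ b ≠ c := by
  cases s
  · change ∃ c : Fin 3, _
    change Fin 3 at a b
    revert a b; decide
  · change ∃ c : Fin 4, _
    change Fin 4 at a b
    revert a b; decide

theorem finRotate_ne {s : CellShape} (a : Fin s.n) : a ≠ finRotate s.n a := by
  cases s
  · change Fin 3 at a
    change a ≠ finRotate 3 a
    revert a; decide
  · change Fin 4 at a
    change a ≠ finRotate 4 a
    revert a; decide

theorem eq_of_edge_eq {s : CellShape} {a b : Fin s.n}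
    (h : s(a, finRotate s.n a) = s(b, finRotate s.n b)) : a = b := by
  cases s
  · change Fin 3 at a b
    change s(a, finRotate 3 a) = s(b, finRotate 3 b) at h
    revert a b; decide
  · change Fin 4 at a b
    change s(a, finRotate 4 a) = s(b, finRotate 4 b) at h
    revert a b; decide

/-- Two vertices of a cell span an edge, or a diagonal that separates two other vertices. -/
theorem IsCell.edge_or_diagonal {s : CellShape} {v : Fin s.n → Plane} (h : s.IsCell v)
    {a b : Fin s.n} (hab : a ≠ b) :
    (∃ c, s(v a, v b) = s(v c, v (finRotate s.n c))) ∨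
      ∃ c d, cross (v b - v a) (v c - v a) * cross (v b - v a) (v d - v a) < 0 := by
  cases s
  · left
    change Fin 3 at a b
    obtain ⟨c, hc⟩ : ∃ c : Fin 3, s(a, b) = s(c, finRotate 3 c) := by
      clear h; revert a b; decide
    exact ⟨c, by simpa using congrArg (Sym2.map v) hc⟩
  · change Fin 4 at a b
    have hcase : (∃ c : Fin 4, s(a, b) = s(c, finRotate 4 c)) ∨
        (a = 0 ∧ b = 2) ∨ (a = 2 ∧ b = 0) ∨ (a = 1 ∧ b = 3) ∨ (a = 3 ∧ b = 1) := by
      clear h; revert a b; decide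
    obtain ⟨⟨a0, a1, a2⟩, ⟨b0, b1, b2⟩, ⟨c0, c1, c2⟩, d0', d1', d2'⟩ := succAbove_vals
    obtain ⟨ε, hε, hpos⟩ := h.exists_orientation
    have hε2 : ε * ε = 1 := by rcases hε with rfl | rfl <;> norm_num
    have prod : ∀ i j, 0 < cornerDet quadrilateral v i * cornerDet quadrilateral v j := by
      intro i j
      have := mul_pos (hpos i) (hpos j)
      calc 0 < _ := this
        _ = (ε * ε) * (cornerDet quadrilateral v i * cornerDet quadrilateral v j) := by ring
        _ = _ := by rw [hε2, one_mul]
    have k13 := prod 1 3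
    have k02 := prod 0 2
    simp only [cornerDet, triDet, a0, a1, a2, b0, b1, b2, c0, c1, c2, d0', d1', d2'] at k13 k02
    rcases hcase with ⟨c, hc⟩ | ⟨rfl, rfl⟩ | ⟨rfl, rfl⟩ | ⟨rfl, rfl⟩ | ⟨rfl, rfl⟩
    · exact Or.inl ⟨c, by simpa using congrArg (Sym2.map v) hc⟩
    · refine Or.inr ⟨(1 : Fin 4), (3 : Fin 4), ?_⟩
      have e : cross (v 2 - v 0) (v 1 - v 0) * cross (v 2 - v 0) (v 3 - v 0) =
        - (cross (v 2 - v 0) (v 3 - v 0) * cross (v 1 - v 0) (v 2 - v 0)) := by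
        simp [cross]; ring
      rw [e]; linarith
    · refine Or.inr ⟨(1 : Fin 4), (3 : Fin 4), ?_⟩
      have e : cross (v 0 - v 2) (v 1 - v 2) * cross (v 0 - v 2) (v 3 - v 2) =
        - (cross (v 2 - v 0) (v 3 - v 0) * cross (v 1 - v 0) (v 2 - v 0)) := by
        simp [cross]; ring
      rw [e]; linarith
    · refine Or.inr ⟨(0 : Fin 4), (2 : Fin 4), ?_⟩
      have e : cross (v 3 - v 1) (v 0 - v 1) * cross (v 3 - v 1) (v 2 - v 1) =
        - (cross (v 2 - v 1) (v 3 - v 1) * cross (v 1 - v 0) (v 3 - v 0)) := by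
        simp [cross]; ring
      rw [e]; linarith
    · refine Or.inr ⟨(0 : Fin 4), (2 : Fin 4), ?_⟩
      have e : cross (v 1 - v 3) (v 0 - v 3) * cross (v 1 - v 3) (v 2 - v 3) =
        - (cross (v 2 - v 1) (v 3 - v 1) * cross (v 1 - v 0) (v 3 - v 0)) := by
        simp [cross]; ring
      rw [e]; linarith

theorem two_vertices (s : CellShape) : ∃ a b : Fin s.n, a ≠ b := by
  cases s
  · exact ⟨(0 : Fin 3), (1 : Fin 3), by decide⟩
  · exact ⟨(0 : Fin 4), (1 : Fin 4), by decide⟩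

theorem n_le_four (s : CellShape) : s.n ≤ 4 := by cases s <;> decide

theorem IsCell.interior_nonempty {s : CellShape} {v : Fin s.n → Plane} (h : s.IsCell v) :
    (interior (convexHull ℝ (Set.range v))).Nonempty := by
  obtain ⟨a, b, hab⟩ := s.two_vertices
  obtain ⟨c, hac, hbc⟩ := exists_third hab
  have hm : ∀ i, v i ∈ convexHull ℝ (Set.range v) := fun i =>
    subset_convexHull ℝ _ (Set.mem_range_self i)
  have hne := h.cross_ne_zero hab hac hbc
  exact (interior_inter_nonempty (convex_convexHull ℝ _) (convex_convexHull ℝ _) (hm a) (hm b) (hm c)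
    (hm a) (hm b) (hm c) (mul_self_pos.2 hne)).mono Set.inter_subset_left

end CellShape

namespace Mesh

open CellShape

variable {s : CellShape} {Ω : Set Plane} (M : Mesh s Ω)

theorem convex_cell (i : Fin M.N) : Convex ℝ (M.cell i) := convex_convexHull ℝ _

theorem isCompact_cell (i : Fin M.N) : IsCompact (M.cell i) :=
  (Set.finite_range _).isCompact_convexHull (𝕜 := ℝ)

theorem isClosed_cell (i : Fin M.N) : IsClosed (M.cell i) := (M.isCompact_cell i).isClosed

theorem measurableSet_cell (i : Fin M.N) : MeasurableSet (M.cell i) :=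
  (M.isClosed_cell i).measurableSet

theorem interior_cell_nonempty (i : Fin M.N) : (interior (M.cell i)).Nonempty :=
  (M.isCell i).interior_nonempty

theorem uniqueDiffOn_cell (i : Fin M.N) : UniqueDiffOn ℝ (M.cell i) :=
  uniqueDiffOn_convex (M.convex_cell i) (M.interior_cell_nonempty i)

theorem vert_mem_cell (i : Fin M.N) (a : Fin s.n) : M.vert i a ∈ M.cell i :=
  subset_convexHull ℝ _ (Set.mem_range_self a)

theorem disjoint_interior {i j : Fin M.N} (h : i ≠ j) :
    Disjoint (interior (M.cell i)) (interior (M.cell j)) := M.disjoint i j h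

theorem diam_cell_pos (i : Fin M.N) : 0 < Metric.diam (M.cell i) := by
  obtain ⟨a, b, hab⟩ := s.two_vertices
  exact diam_convexHull_pos ((M.isCell i).injective.ne hab)

/-- A point common to two cells is a vertex or lies on a common edge. -/
theorem vertex_or_sharedEdge {i j : Fin M.N} (hij : i ≠ j) {x : Plane} (hi : x ∈ M.cell i)
    (hj : x ∈ M.cell j) :
    (∃ a, x = M.vert i a) ∨ ∃ a b, SharedEdge (M.vert i) (M.vert j) a b ∧
      x ∈ segment ℝ (M.vert i a) (M.vert i (finRotate s.n a)) := by
  have hx : x ∈ convexHull ℝ (Set.range (M.vert i) ∩ Set.range (M.vert j)) := by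
    rw [← M.conforming i j hij]; exact ⟨hi, hj⟩
  set W := Set.range (M.vert i) ∩ Set.range (M.vert j) with hW
  have hdisj := M.disjoint_interior hij
  have Wi : ∀ p ∈ W, p ∈ M.cell i := fun p hp => subset_convexHull ℝ _ hp.1
  have Wj : ∀ p ∈ W, p ∈ M.cell j := fun p hp => subset_convexHull ℝ _ hp.2
  by_cases hsub : W.Subsingleton
  · left
    have : x ∈ W := by rwa [hsub.convex.convexHull_eq] at hx
    obtain ⟨a, ha⟩ := this.1
    exact ⟨a, ha.symm⟩
  right
  rw [Set.not_subsingleton_iff] at hsub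
  obtain ⟨p, hp, q, hq, hpq⟩ := hsub
  obtain ⟨a, ha⟩ := hp.1; obtain ⟨a', ha'⟩ := hq.1
  obtain ⟨b, hb⟩ := hp.2; obtain ⟨b', hb'⟩ := hq.2
  have haa : a ≠ a' := by rintro rfl; exact hpq (ha.symm.trans ha')
  have hbb : b ≠ b' := by rintro rfl; exact hpq (hb.symm.trans hb')
  -- A third common vertex would place a nondegenerate triangle in both cells, against the
  -- disjointness of the interiors.
  have hWpq : W ⊆ {p, q} := by
    intro r hr
    by_contra hr'
    simp only [Set.mem_insert_iff, Set.mem_singleton_iff, not_or] at hr'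
    obtain ⟨c, hc⟩ := hr.1
    have hac : a ≠ c := by rintro rfl; exact hr'.1 (hc.symm.trans ha)
    have hac' : a' ≠ c := by rintro rfl; exact hr'.2 (hc.symm.trans ha')
    have hne := (M.isCell i).cross_ne_zero haa hac hac'
    rw [ha, ha', hc] at hne
    exact Set.not_disjoint_iff_nonempty_inter.2 (interior_inter_nonempty (M.convex_cell i)
      (M.convex_cell j) (Wi p hp) (Wi q hq) (Wi r hr) (Wj p hp) (Wj q hq) (Wj r hr)
      (mul_self_pos.2 hne)) hdisj
  -- If `p q` separated two vertices of the cell `i`, one of them would lie on the side of a third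
  -- vertex of `j`, and the interiors would overlap. Hence `p q` is an edge of both cells.
  have nodiag : ∀ (i j : Fin M.N), i ≠ j → p ∈ M.cell i → q ∈ M.cell i → ∀ b b', b ≠ b' →
      M.vert j b = p → M.vert j b' = q →
      ¬ ∃ c d, cross (q - p) (M.vert i c - p) * cross (q - p) (M.vert i d - p) < 0 := by
    rintro i j hij hpi hqi b b' hbb hb hb' ⟨c, d, hcd⟩
    obtain ⟨e, hbe, hbe'⟩ := exists_third hbb
    have hne := (M.isCell j).cross_ne_zero hbb hbe hbe'
    rw [hb, hb'] at hne
    have hpj : p ∈ M.cell j := hb ▸ M.vert_mem_cell j b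
    have hqj : q ∈ M.cell j := hb' ▸ M.vert_mem_cell j b'
    have hcon : ∀ c, ¬ 0 < cross (q - p) (M.vert i c - p) * cross (q - p) (M.vert j e - p) :=
      fun c h => Set.not_disjoint_iff_nonempty_inter.2 (interior_inter_nonempty (M.convex_cell i)
        (M.convex_cell j) hpi hqi (M.vert_mem_cell i c) hpj hqj (M.vert_mem_cell j e) h)
        (M.disjoint_interior hij)
    have h1 := hcon c; have h2 := hcon d
    set X := cross (q - p) (M.vert i c - p)
    set Y := cross (q - p) (M.vert i d - p)
    set Z := cross (q - p) (M.vert j e - p)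
    push Not at h1 h2
    have : 0 ≤ (X * Z) * (Y * Z) := mul_nonneg_of_nonpos_of_nonpos h1 h2
    have h3 : (X * Z) * (Y * Z) = (X * Y) * (Z * Z) := by ring
    have h4 : (X * Y) * (Z * Z) < 0 := mul_neg_of_neg_of_pos hcd (mul_self_pos.2 hne)
    linarith
  rcases (M.isCell i).edge_or_diagonal haa with ⟨c, hc⟩ | hdiag
  swap
  · rw [ha, ha'] at hdiag
    exact absurd hdiag (nodiag i j hij (Wi p hp) (Wi q hq) b b' hbb hb hb')
  rcases (M.isCell j).edge_or_diagonal hbb with ⟨d, hd⟩ | hdiag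
  swap
  · rw [hb, hb'] at hdiag
    exact absurd hdiag (nodiag j i hij.symm (Wj p hp) (Wj q hq) a a' haa ha ha')
  refine ⟨c, d, ?_, ?_⟩
  · unfold SharedEdge
    rw [← hc, ← hd, ha, ha', hb, hb']
  · have hx2 : x ∈ segment ℝ p q := by
      rw [← convexHull_pair]; exact convexHull_mono hWpq hx
    rw [ha, ha'] at hc
    rcases Sym2.eq_iff.1 hc with ⟨h1, h2⟩ | ⟨h1, h2⟩
    · rw [← h1, ← h2]; exact hx2
    · rw [← h1, ← h2, segment_symm]; exact hx2

/-- An edge is shared with at most one other cell. -/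
theorem eq_of_sharedEdge {i j j' : Fin M.N} {a b b' : Fin s.n} (hij : i ≠ j) (hij' : i ≠ j')
    (h : SharedEdge (M.vert i) (M.vert j) a b) (h' : SharedEdge (M.vert i) (M.vert j') a b') :
    j = j' := by
  by_contra hjj
  set p := M.vert i a
  set q := M.vert i (finRotate s.n a)
  -- Each of the three cells contains the segment and has a vertex off its line, which is the
  -- situation excluded by `not_three_disjoint`.
  have key : ∀ (j : Fin M.N) (b : Fin s.n), s(p, q) = s(M.vert j b, M.vert j (finRotate s.n b)) →
      p ∈ M.cell j ∧ q ∈ M.cell j ∧ ∃ r ∈ M.cell j, cross (q - p) (r - p) ≠ 0 := by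
    intro j b hb
    obtain ⟨c, hc1, hc2⟩ := exists_third (finRotate_ne b)
    rcases Sym2.eq_iff.1 hb with ⟨h1, h2⟩ | ⟨h1, h2⟩
    · rw [h1, h2]
      exact ⟨M.vert_mem_cell _ _, M.vert_mem_cell _ _, _, M.vert_mem_cell j c,
        (M.isCell j).cross_ne_zero (finRotate_ne b) hc1 hc2⟩
    · rw [h1, h2]
      exact ⟨M.vert_mem_cell _ _, M.vert_mem_cell _ _, _, M.vert_mem_cell j c,
        (M.isCell j).cross_ne_zero (finRotate_ne b).symm hc2 hc1⟩
  obtain ⟨hp1, hq1, r1, hr1, c1⟩ := key i a rfl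
  obtain ⟨hp2, hq2, r2, hr2, c2⟩ := key j b h
  obtain ⟨hp3, hq3, r3, hr3, c3⟩ := key j' b' h'
  exact not_three_disjoint (M.convex_cell i) (M.convex_cell j) (M.convex_cell j') hp1 hq1 hr1 hp2 hq2
    hr2 hp3 hq3 hr3 c1 c2 c3 (M.disjoint_interior hij) (M.disjoint_interior hij')
    (M.disjoint_interior hjj)

/-- A cell comes first in at most four listed edges, because the local index of the edge determines
the neighbour. -/
theorem sum_edges_fst_le {f : Fin M.N → ℝ} (hf : ∀ i, 0 ≤ f i) :
    ∑ e ∈ M.edges, f e.1 ≤ 4 * ∑ i, f i := by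
  rw [← Finset.sum_fiberwise_of_maps_to (g := fun e => e.1) (t := Finset.univ)
    (fun e _ => Finset.mem_univ _), Finset.mul_sum]
  refine Finset.sum_le_sum fun i _ => ?_
  have hcard : (M.edges.filter fun e => e.1 = i).card ≤ 4 := by
    refine le_trans ?_ s.n_le_four
    calc _ ≤ (Finset.univ : Finset (Fin s.n)).card := by
          refine Finset.card_le_card_of_injOn (fun e => e.2.1) (fun _ _ => Finset.mem_coe.2 (Finset.mem_univ _)) ?_
          rintro ⟨i₁, a, j⟩ h ⟨i₂, a', j'⟩ h' haa
          simp only [Finset.coe_filter, Set.mem_ofPred_eq] at h h'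
          obtain ⟨h1, rfl⟩ := h
          obtain ⟨h2, rfl⟩ := h'
          simp only at haa
          subst haa
          obtain ⟨hne, b, hb⟩ := M.edges_shared _ _ _ h1
          obtain ⟨hne', b', hb'⟩ := M.edges_shared _ _ _ h2
          rw [M.eq_of_sharedEdge hne hne' hb hb']
      _ = s.n := by simp
  calc ∑ e ∈ M.edges with e.1 = i, f e.1 = ∑ e ∈ M.edges with e.1 = i, f i :=
        Finset.sum_congr rfl fun e he => by rw [(Finset.mem_filter.1 he).2]
    _ = (M.edges.filter fun e => e.1 = i).card * f i := by rw [Finset.sum_const, nsmul_eq_mul]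
    _ ≤ 4 * f i := by
        gcongr
        · exact hf i
        · exact_mod_cast hcard

/-- The counting now uses the local index `b` of the edge in the second cell. Equal `b` means the
same geometric edge, hence the same first cell and, since vertices are distinct, the same local
index there. -/
theorem sum_edges_snd_le {f : Fin M.N → ℝ} (hf : ∀ i, 0 ≤ f i) :
    ∑ e ∈ M.edges, f e.2.2 ≤ 4 * ∑ i, f i := by
  rw [← Finset.sum_fiberwise_of_maps_to (g := fun e => e.2.2) (t := Finset.univ)
    (fun e _ => Finset.mem_univ _), Finset.mul_sum]
  refine Finset.sum_le_sum fun j _ => ?_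
  have : Nonempty (Fin s.n) := ⟨s.two_vertices.choose⟩
  choose! b hb using fun (e : M.Edge) (he : e ∈ M.edges) => (M.edges_shared e.1 e.2.1 e.2.2 he).2
  have hcard : (M.edges.filter fun e => e.2.2 = j).card ≤ 4 := by
    refine le_trans ?_ s.n_le_four
    calc _ ≤ (Finset.univ : Finset (Fin s.n)).card := by
          refine Finset.card_le_card_of_injOn b (fun _ _ => Finset.mem_coe.2 (Finset.mem_univ _)) ?_
          rintro ⟨i, a, j₁⟩ h ⟨i', a', j₂⟩ h' hbb
          simp only [Finset.coe_filter, Set.mem_ofPred_eq] at h h'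
          obtain ⟨h1, rfl⟩ := h
          obtain ⟨h2, rfl⟩ := h'
          have hs := hb _ h1
          have hs' := hb _ h2
          simp only at hs hs'
          rw [hbb] at hs
          have hii : i = i' := M.eq_of_sharedEdge (M.edges_shared _ _ _ h1).1.symm
            (M.edges_shared _ _ _ h2).1.symm hs.symm hs'.symm
          subst hii
          have : s(M.vert i a, M.vert i (finRotate s.n a)) =
            s(M.vert i a', M.vert i (finRotate s.n a')) := Eq.trans hs (Eq.symm hs')
          have h3 := Sym2.map.injective (M.isCell i).injective (a₁ := s(a, finRotate s.n a))
            (a₂ := s(a', finRotate s.n a')) (by simpa using this)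
          rw [eq_of_edge_eq h3]
      _ = s.n := by simp
  calc ∑ e ∈ M.edges with e.2.2 = j, f e.2.2 = ∑ e ∈ M.edges with e.2.2 = j, f j :=
        Finset.sum_congr rfl fun e he => by rw [(Finset.mem_filter.1 he).2]
    _ = (M.edges.filter fun e => e.2.2 = j).card * f j := by rw [Finset.sum_const, nsmul_eq_mul]
    _ ≤ 4 * f j := by
        gcongr
        · exact hf j
        · exact_mod_cast hcard

/-! ### Edges -/

theorem edgeStart_ne_edgeEnd (e : M.Edge) : M.edgeStart e ≠ M.edgeEnd e :=
  (M.isCell e.1).injective.ne (finRotate_ne e.2.1)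

theorem edge_length_pos (e : M.Edge) : 0 < dist (M.edgeStart e) (M.edgeEnd e) :=
  dist_pos.2 (M.edgeStart_ne_edgeEnd e)

theorem lineMap_mem_fst (e : M.Edge) {t : ℝ} (ht : t ∈ Set.Icc (0 : ℝ) 1) :
    AffineMap.lineMap (M.edgeStart e) (M.edgeEnd e) t ∈ M.cell e.1 :=
  (M.convex_cell e.1).lineMap_mem (M.vert_mem_cell _ _) (M.vert_mem_cell _ _) ht

theorem edge_mem_snd {e : M.Edge} (he : e ∈ M.edges) :
    M.edgeStart e ∈ M.cell e.2.2 ∧ M.edgeEnd e ∈ M.cell e.2.2 := by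
  obtain ⟨-, b, hb⟩ := M.edges_shared e.1 e.2.1 e.2.2 he
  unfold edgeStart edgeEnd
  rcases Sym2.eq_iff.1 hb with ⟨h1, h2⟩ | ⟨h1, h2⟩ <;> rw [h1, h2] <;>
    exact ⟨M.vert_mem_cell _ _, M.vert_mem_cell _ _⟩

theorem lineMap_mem_snd {e : M.Edge} (he : e ∈ M.edges) {t : ℝ} (ht : t ∈ Set.Icc (0 : ℝ) 1) :
    AffineMap.lineMap (M.edgeStart e) (M.edgeEnd e) t ∈ M.cell e.2.2 :=
  (M.convex_cell e.2.2).lineMap_mem (M.edge_mem_snd he).1 (M.edge_mem_snd he).2 ht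

theorem edge_length_le_fst (e : M.Edge) :
    dist (M.edgeStart e) (M.edgeEnd e) ≤ Metric.diam (M.cell e.1) :=
  Metric.dist_le_diam_of_mem (M.isCompact_cell _).isBounded (M.vert_mem_cell _ _)
    (M.vert_mem_cell _ _)

theorem edge_length_le_snd {e : M.Edge} (he : e ∈ M.edges) :
    dist (M.edgeStart e) (M.edgeEnd e) ≤ Metric.diam (M.cell e.2.2) :=
  Metric.dist_le_diam_of_mem (M.isCompact_cell _).isBounded (M.edge_mem_snd he).1
    (M.edge_mem_snd he).2

/-! ### Measure of the cells -/

theorem volume_frontier_cell (i : Fin M.N) : volume (frontier (M.cell i)) = 0 :=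
  (M.convex_cell i).addHaar_frontier volume

theorem cell_ae_eq_interior (i : Fin M.N) : M.cell i =ᵐ[volume] (interior (M.cell i) : Set Plane) :=
  (interior_ae_eq_of_null_frontier (M.volume_frontier_cell i)).symm

theorem aedisjoint_cell {i j : Fin M.N} (h : i ≠ j) : AEDisjoint volume (M.cell i) (M.cell j) :=
  (M.disjoint_interior h).aedisjoint.congr (M.cell_ae_eq_interior i) (M.cell_ae_eq_interior j)

theorem sum_volume_cell_le : ∑ i, volume (M.cell i) ≤ volume (closure Ω) := by
  rw [← M.cover, ← tsum_fintype (L := .unconditional _)]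
  exact (measure_iUnion₀ (fun i j h => M.aedisjoint_cell h)
    fun i => (M.measurableSet_cell i).nullMeasurableSet).ge

theorem cell_subset_closure (i : Fin M.N) : M.cell i ⊆ closure Ω := by
  rw [← M.cover]; exact Set.subset_iUnion (fun i => M.cell i) i

end Mesh
end PrestrainedPlate

/-! ### Cone property and regular openness of polygonal domains. -/

namespace PrestrainedPlate

open Filter Topology

/-! ### Sectors -/

/-- The unit vector with polar angle `θ`. -/
noncomputable def dir (θ : ℝ) : Plane := !₂[Real.cos θ, Real.sin θ]

theorem norm_dir (θ : ℝ) : ‖dir θ‖ = 1 := by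
  rw [EuclideanSpace.norm_eq]
  simp [dir, Fin.sum_univ_two]

theorem cross_dir (α β : ℝ) : cross (dir α) (dir β) = Real.sin (β - α) := by
  simp [cross, dir, Real.sin_sub]; ring

theorem norm_smul_dir {t : ℝ} (ht : 0 < t) (θ : ℝ) : ‖t • dir θ‖ = t := by
  rw [norm_smul, norm_dir, mul_one, Real.norm_of_nonneg ht.le]

theorem smul_dir_eq {α β : ℝ} (h1 : α < β) (h2 : β < α + Real.pi) {t θ : ℝ} (ht : 0 < t)
    (hα : α < θ) (hβ : θ < β) :
    ∃ p q : ℝ, 0 < p ∧ 0 < q ∧ t • dir θ = p • dir α + q • dir β := by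
  have hs : 0 < Real.sin (β - α) := Real.sin_pos_of_pos_of_lt_pi (by linarith) (by linarith)
  have hs1 : 0 < Real.sin (β - θ) := Real.sin_pos_of_pos_of_lt_pi (by linarith) (by linarith)
  have hs2 : 0 < Real.sin (θ - α) := Real.sin_pos_of_pos_of_lt_pi (by linarith) (by linarith)
  have hc := combo_of_cross_ne_zero (p := dir α) (q := dir β) (by rw [cross_dir]; exact hs.ne')
    (t • dir θ)
  refine ⟨_, _, ?_, ?_, hc⟩
  · rw [cross_dir]
    have : cross (t • dir θ) (dir β) = t * cross (dir θ) (dir β) := by simp [cross]; ring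
    rw [this, cross_dir]; positivity
  · rw [cross_dir]
    have : cross (dir α) (t • dir θ) = t * cross (dir α) (dir θ) := by simp [cross]; ring
    rw [this, cross_dir]; positivity

/-- The angle solves `p sin (θ - α) = q sin (β - θ)`. The two sides compare oppositely at `α` and
`β`, so the intermediate value theorem yields `θ` already inside the interval. -/
theorem combo_dir_eq {α β : ℝ} (h1 : α < β) (h2 : β < α + Real.pi) {p q : ℝ} (hp : 0 < p)
    (hq : 0 < q) : ∃ t θ : ℝ, 0 < t ∧ α < θ ∧ θ < β ∧ p • dir α + q • dir β = t • dir θ := by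
  have hs : 0 < Real.sin (β - α) := Real.sin_pos_of_pos_of_lt_pi (by linarith) (by linarith)
  set f : ℝ → ℝ := fun θ => p * Real.sin (θ - α) - q * Real.sin (β - θ)
  have hf : ContinuousOn f (Set.Icc α β) := by fun_prop
  have hfα : f α < 0 := by simp [f]; positivity
  have hfβ : 0 < f β := by simp [f]; positivity
  obtain ⟨θ, ⟨hθ1, hθ2⟩, hθ⟩ := intermediate_value_Ioo h1.le hf ⟨hfα, hfβ⟩
  have hs1 : 0 < Real.sin (β - θ) := Real.sin_pos_of_pos_of_lt_pi (by linarith) (by linarith)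
  refine ⟨p * Real.sin (β - α) / Real.sin (β - θ), θ, by positivity, hθ1, hθ2, ?_⟩
  have e := combo_of_cross_ne_zero (p := dir α) (q := dir β) (by rw [cross_dir]; exact hs.ne')
    (dir θ)
  rw [cross_dir, cross_dir, cross_dir] at e
  have hθ' : p * Real.sin (θ - α) = q * Real.sin (β - θ) := sub_eq_zero.1 hθ
  rw [e, smul_add, smul_smul, smul_smul]
  congr 2
  · field_simp
  · field_simp
    linarith

theorem norm_combo_dir_le {p q : ℝ} {α β : ℝ} (v : Plane) {δ s : ℝ} (hδ : 0 ≤ δ)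
    (hs : s ∈ Set.Icc (0 : ℝ) 1) (hv : v = p • dir α + q • dir β) :
    ‖(p + s * δ) • dir α + q • dir β‖ ≤ ‖v‖ + δ := by
  have : (p + s * δ) • dir α + q • dir β = v + (s * δ) • dir α := by rw [hv]; module
  rw [this]
  refine (norm_add_le _ _).trans ?_
  rw [norm_smul, norm_dir, mul_one, Real.norm_of_nonneg (mul_nonneg hs.1 hδ)]
  nlinarith [hs.2]

/-- From a point of a sector of opening less than `π` one can move in both boundary directions. -/
theorem sector_cone {Ω : Set Plane} {x : Plane} {r α β : ℝ} (h1 : α < β) (h2 : β < α + Real.pi)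
    (hΩ : ∀ t θ : ℝ, 0 < t → t < r → α < θ → θ < β → x + t • dir θ ∈ Ω) {t θ : ℝ} (ht : 0 < t)
    (htr : t < r / 2) (hα : α < θ) (hβ : θ < β) {s : ℝ} (hs : s ∈ Set.Icc (0 : ℝ) 1) :
    x + t • dir θ + s • ((r / 2) • dir α) ∈ Ω ∧ x + t • dir θ + s • ((r / 2) • dir β) ∈ Ω := by
  obtain ⟨p, q, hp, hq, he⟩ := smul_dir_eq h1 h2 ht hα hβ
  have hr : 0 < r / 2 := ht.trans htr
  constructor
  · have hp' : 0 < p + s * (r / 2) := by have := mul_nonneg hs.1 hr.le; linarith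
    obtain ⟨t', θ', ht', h3, h4, h5⟩ := combo_dir_eq h1 h2 hp' hq
    have hn := norm_combo_dir_le (p := p) (q := q) (t • dir θ) hr.le hs he
    rw [h5, norm_smul_dir ht', norm_smul_dir ht] at hn
    have : x + t • dir θ + s • ((r / 2) • dir α) = x + t' • dir θ' := by
      rw [← h5, he]; module
    rw [this]
    exact hΩ _ _ ht' (by linarith) h3 h4
  · have hq' : 0 < q + s * (r / 2) := by have := mul_nonneg hs.1 hr.le; linarith
    obtain ⟨t', θ', ht', h3, h4, h5⟩ := combo_dir_eq h1 h2 hp hq'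
    have hn := norm_combo_dir_le (p := q) (q := p) (t • dir θ) hr.le hs (by rw [he, add_comm])
    rw [add_comm, h5, norm_smul_dir ht', norm_smul_dir ht] at hn
    have : x + t • dir θ + s • ((r / 2) • dir β) = x + t' • dir θ' := by
      rw [← h5, he]; module
    rw [this]
    exact hΩ _ _ ht' (by linarith) h3 h4

/-- The segments issuing from `x` in the directions `p.1` and `p.2` stay in `Ω`. -/
def ConeAt (Ω : Set Plane) (p : Plane × Plane) (x : Plane) : Prop :=
  ∀ t ∈ Set.Icc (0 : ℝ) 1, x + t • p.1 ∈ Ω ∧ x + t • p.2 ∈ Ω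

/-- At a reentrant corner the opening exceeds `π`, and no single pair of directions serves all
nearby points. The sector is therefore covered by three overlapping subsectors, each taking at most
`9/20` of an opening below `2π`, hence less than `π`; inside such a subsector one can move in both
of its boundary directions. Overlaps are needed because the subsectors are open. -/
theorem IsPolygonalDomain.local_cone {Ω : Set Plane} (hΩ : IsPolygonalDomain Ω) {x : Plane}
    (hx : x ∈ closure Ω) : ∃ S : Finset (Plane × Plane), (∀ p ∈ S, cross p.1 p.2 ≠ 0) ∧
      ∃ δ > 0, ∀ y ∈ Metric.ball x δ ∩ Ω, ∃ p ∈ S, ConeAt Ω p y := by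
  classical
  obtain ⟨hopen, -, -, hfr⟩ := hΩ
  by_cases hxΩ : x ∈ Ω
  · obtain ⟨r, hr, hball⟩ := Metric.isOpen_iff.1 hopen x hxΩ
    refine ⟨{((r / 2) • dir 0, (r / 2) • dir (Real.pi / 2))}, ?_, r / 2, by positivity, ?_⟩
    · intro p hp
      rw [Finset.mem_singleton] at hp
      subst hp
      have : cross ((r / 2) • dir 0) ((r / 2) • dir (Real.pi / 2)) = (r / 2) * (r / 2) := by
        simp [cross, dir]
      simp only [this]
      positivity
    · rintro y ⟨hy, -⟩
      refine ⟨_, Finset.mem_singleton_self _, fun t ht => ?_⟩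
      rw [Metric.mem_ball, dist_eq_norm] at hy
      have : ∀ θ, y + t • ((r / 2) • dir θ) ∈ Ω := by
        intro θ
        apply hball
        rw [Metric.mem_ball, dist_eq_norm, add_sub_right_comm]
        refine (norm_add_le _ _).trans_lt ?_
        rw [norm_smul, norm_smul, norm_dir, mul_one, Real.norm_of_nonneg ht.1,
          Real.norm_of_nonneg (by positivity)]
        nlinarith [ht.2]
      exact ⟨this _, this _⟩
  · have hxf : x ∈ frontier Ω := ⟨hx, by rwa [hopen.interior_eq]⟩
    obtain ⟨r, hr, α, β, h1, h2, hset⟩ := hfr x hxf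
    have hin : ∀ t θ : ℝ, 0 < t → t < r → α < θ → θ < β → x + t • dir θ ∈ Ω := by
      intro t θ ht htr hα hβ
      have : x + t • dir θ ∈ Ω ∩ Metric.ball x r := by
        rw [hset]; exact ⟨t, θ, ht, htr, hα, hβ, rfl⟩
      exact this.1
    set ω := β - α with hω
    have hω0 : 0 < ω := by linarith
    let P : ℝ → ℝ → Plane × Plane := fun a b =>
      ((r / 2) • dir (α + a * ω), (r / 2) • dir (α + b * ω))
    have hP : ∀ a b, 0 ≤ a → a < b → b ≤ 1 → b - a ≤ 9 / 20 →
        cross (P a b).1 (P a b).2 ≠ 0 ∧ ∀ t θ : ℝ, 0 < t → t < r / 2 → α + a * ω < θ →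
          θ < α + b * ω → ConeAt Ω (P a b) (x + t • dir θ) := by
      intro a b ha hab hb hba
      have hlt : α + a * ω < α + b * ω := by nlinarith
      have hpi : α + b * ω < α + a * ω + Real.pi := by nlinarith [Real.pi_pos]
      constructor
      · have : cross (P a b).1 (P a b).2 =
            (r / 2) * (r / 2) * cross (dir (α + a * ω)) (dir (α + b * ω)) := by
          simp [P, cross]; ring
        rw [this, cross_dir]
        have : 0 < Real.sin (α + b * ω - (α + a * ω)) :=
          Real.sin_pos_of_pos_of_lt_pi (by linarith) (by linarith)
        positivity
      · intro t θ ht htr hα hβ s hs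
        refine sector_cone hlt hpi (fun t θ h3 h4 h5 h6 => hin t θ h3 h4 ?_ ?_) ht htr hα hβ hs
        · nlinarith
        · nlinarith
    obtain ⟨c1, k1⟩ := hP 0 (9 / 20) (by norm_num) (by norm_num) (by norm_num) (by norm_num)
    obtain ⟨c2, k2⟩ := hP (3 / 10) (7 / 10) (by norm_num) (by norm_num) (by norm_num) (by norm_num)
    obtain ⟨c3, k3⟩ := hP (11 / 20) 1 (by norm_num) (by norm_num) (by norm_num) (by norm_num)
    refine ⟨{P 0 (9 / 20), P (3 / 10) (7 / 10), P (11 / 20) 1}, ?_, r / 2, by positivity, ?_⟩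
    · intro p hp
      simp only [Finset.mem_insert, Finset.mem_singleton] at hp
      rcases hp with rfl | rfl | rfl <;> assumption
    · rintro y ⟨hy, hyΩ⟩
      have : y ∈ Ω ∩ Metric.ball x r := ⟨hyΩ, Metric.ball_subset_ball (by linarith) hy⟩
      rw [hset] at this
      obtain ⟨t, θ, ht, htr, hα, hβ, rfl⟩ := this
      change x + t • dir θ ∈ _ at hy
      rw [Metric.mem_ball, dist_eq_norm, add_sub_cancel_left, norm_smul_dir ht] at hy
      by_cases hc1 : θ < α + 9 / 20 * ω
      · exact ⟨P 0 (9 / 20), by simp, k1 t θ ht hy (by linarith) hc1⟩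
      by_cases hc2 : θ < α + 7 / 10 * ω
      · exact ⟨P (3 / 10) (7 / 10), by simp, k2 t θ ht hy (by linarith) hc2⟩
      · exact ⟨P (11 / 20) 1, by simp, k3 t θ ht hy (by linarith) (by linarith)⟩

/-- Uniform cone property of polygonal domains. -/
theorem IsPolygonalDomain.exists_cones {Ω : Set Plane} (hΩ : IsPolygonalDomain Ω) :
    ∃ S : Finset (Plane × Plane), (∀ p ∈ S, cross p.1 p.2 ≠ 0) ∧
      ∀ x ∈ Ω, ∃ p ∈ S, ConeAt Ω p x := by
  classical
  have hK : IsCompact (closure Ω) := hΩ.2.1.isCompact_closure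
  have main : ∃ S : Finset (Plane × Plane), (∀ p ∈ S, cross p.1 p.2 ≠ 0) ∧
      ∀ y ∈ closure Ω ∩ Ω, ∃ p ∈ S, ConeAt Ω p y := by
    -- Compactness of the closure: the property passes to subsets and to unions of two sets, and it
    -- holds locally.
    refine hK.induction_on (p := fun K => ∃ S : Finset (Plane × Plane),
      (∀ p ∈ S, cross p.1 p.2 ≠ 0) ∧ ∀ y ∈ K ∩ Ω, ∃ p ∈ S, ConeAt Ω p y) ?_ ?_ ?_ ?_
    · exact ⟨∅, by simp, by simp⟩
    · rintro s t hst ⟨S, h1, h2⟩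
      exact ⟨S, h1, fun y hy => h2 y ⟨hst hy.1, hy.2⟩⟩
    · rintro s t ⟨S, h1, h2⟩ ⟨T, h3, h4⟩
      refine ⟨S ∪ T, ?_, ?_⟩
      · intro p hp
        rcases Finset.mem_union.1 hp with h | h
        · exact h1 p h
        · exact h3 p h
      · rintro y ⟨hy | hy, hyΩ⟩
        · obtain ⟨p, hp, hc⟩ := h2 y ⟨hy, hyΩ⟩
          exact ⟨p, Finset.mem_union_left _ hp, hc⟩
        · obtain ⟨p, hp, hc⟩ := h4 y ⟨hy, hyΩ⟩
          exact ⟨p, Finset.mem_union_right _ hp, hc⟩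
    · intro x hx
      obtain ⟨S, h1, δ, hδ, h2⟩ := hΩ.local_cone hx
      exact ⟨Metric.ball x δ, mem_nhdsWithin_of_mem_nhds (Metric.ball_mem_nhds x hδ), S, h1, h2⟩
  obtain ⟨S, h1, h2⟩ := main
  exact ⟨S, h1, fun x hx => h2 x ⟨subset_closure hx, hx⟩⟩

/-- A polygonal domain is regular open. -/
theorem IsPolygonalDomain.interior_closure_subset {Ω : Set Plane} (hΩ : IsPolygonalDomain Ω) :
    interior (closure Ω) ⊆ Ω := by
  intro x hx
  obtain ⟨hopen, -, -, hfr⟩ := hΩ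
  by_contra hxΩ
  have hxf : x ∈ frontier Ω := ⟨interior_subset hx, by rwa [hopen.interior_eq]⟩
  obtain ⟨r, hr, α, β, h1, h2, hset⟩ := hfr x hxf
  have hpi := Real.pi_pos
  -- Bisector of the complementary sector between `β` and `α + 2π`. A thin sector about it misses
  -- the domain but has vertex `x`, so `x` cannot be interior to the closure. The bound `π / 4`
  -- keeps its opening below `π`, so that two determinant conditions describe it.
  set γ := (β + α + 2 * Real.pi) / 2 with hγ
  set η := min ((α + 2 * Real.pi - β) / 2) (Real.pi / 4) with hη
  have hη0 : 0 < η := lt_min (by linarith) (by positivity)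
  have hη1 : η ≤ (α + 2 * Real.pi - β) / 2 := min_le_left _ _
  have hη2 : η ≤ Real.pi / 4 := min_le_right _ _
  have hs : 0 < Real.sin (γ + η - (γ - η)) :=
    Real.sin_pos_of_pos_of_lt_pi (by linarith) (by linarith)
  have hsη : 0 < Real.sin η := Real.sin_pos_of_pos_of_lt_pi (by linarith) (by linarith)
  set O : Set Plane := {z | 0 < cross (dir (γ - η)) (z - x) ∧ 0 < cross (z - x) (dir (γ + η))} ∩
    Metric.ball x r with hO
  have hOo : IsOpen O := ((isOpen_lt continuous_const (by fun_prop)).and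
    (isOpen_lt continuous_const (by fun_prop))).inter Metric.isOpen_ball
  have hdisj : ∀ z ∈ O, z ∉ Ω := by
    rintro z ⟨⟨hz1, hz2⟩, hzb⟩ hzΩ
    have hz : z ∈ Ω ∩ Metric.ball x r := ⟨hzΩ, hzb⟩
    rw [hset] at hz
    obtain ⟨t, θ, ht, htr, hα, hβ, rfl⟩ := hz
    change 0 < cross (dir (γ - η)) (x + t • dir θ - x) at hz1
    change 0 < cross (x + t • dir θ - x) (dir (γ + η)) at hz2
    rw [add_sub_cancel_left] at hz1 hz2
    have e := combo_of_cross_ne_zero (p := dir (γ - η)) (q := dir (γ + η))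
      (by rw [cross_dir]; exact hs.ne') (t • dir θ)
    rw [cross_dir] at e
    obtain ⟨t', θ', ht', h3, h4, h5⟩ := combo_dir_eq (α := γ - η) (β := γ + η) (by linarith)
      (by linarith) (div_pos hz2 hs) (div_pos hz1 hs)
    rw [← e] at h5
    have htt : t = t' := by rw [← norm_smul_dir ht θ, h5, norm_smul_dir ht']
    subst htt
    have hdir : dir θ = dir θ' := smul_right_injective Plane ht.ne' h5
    have hc : Real.cos θ = Real.cos θ' := by
      simpa [dir] using congrArg (fun z : Plane => z 0) hdir
    have hsn : Real.sin θ = Real.sin θ' := by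
      simpa [dir] using congrArg (fun z : Plane => z 1) hdir
    -- Equal directions have angles differing by a multiple of `2π`; here `θ' - θ` lies strictly
    -- between `0` and `2π`.
    have hcos : Real.cos (θ' - θ) = 1 := by
      rw [Real.cos_sub, hc, hsn, ← sq, ← sq, Real.cos_sq_add_sin_sq]
    have := (Real.cos_eq_one_iff_of_lt_of_lt (by linarith) (by linarith)).1 hcos
    linarith
  have htend : Tendsto (fun t : ℝ => x + t • dir γ) (𝓝[>] 0) (𝓝 x) := by
    have : Tendsto (fun t : ℝ => x + t • dir γ) (𝓝 0) (𝓝 (x + (0 : ℝ) • dir γ)) :=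
      (by fun_prop : Continuous fun t : ℝ => x + t • dir γ).tendsto 0
    rw [zero_smul, add_zero] at this
    exact this.mono_left nhdsWithin_le_nhds
  obtain ⟨t, ⟨ht1, ht2⟩, ht3⟩ := ((htend.eventually (isOpen_interior.mem_nhds hx)).and
    (htend.eventually (Metric.ball_mem_nhds x hr))|>.and self_mem_nhdsWithin).exists
  have ht0 : 0 < t := ht3
  have hzO : x + t • dir γ ∈ O := by
    refine ⟨⟨?_, ?_⟩, ht2⟩
    · have : cross (dir (γ - η)) (x + t • dir γ - x) = t * cross (dir (γ - η)) (dir γ) := by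
        simp [cross]; ring
      rw [this, cross_dir]
      have e : γ - (γ - η) = η := by ring
      rw [e]; positivity
    · have : cross (x + t • dir γ - x) (dir (γ + η)) = t * cross (dir γ) (dir (γ + η)) := by
        simp [cross]; ring
      rw [this, cross_dir]
      have e : γ + η - γ = η := by ring
      rw [e]; positivity
  obtain ⟨z, hz1, hz2⟩ := mem_closure_iff.1 (interior_subset ht1) O hOo hzO
  exact hdisj z hz1 hz2

/-- The mesh covers only the closure of the domain. Regular openness brings the interiors of the
cells back into `Ω`, where the cone property holds and `g` is controlled. -/
theorem Mesh.interior_cell_subset {s : CellShape} {Ω : Set Plane} (hΩ : IsPolygonalDomain Ω)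
    (M : Mesh s Ω) (i : Fin M.N) : interior (M.cell i) ⊆ Ω :=
  (interior_mono (M.cell_subset_closure i)).trans hΩ.interior_closure_subset

end PrestrainedPlate

/-! ### Variation of piecewise smooth functions along a segment. -/

namespace PrestrainedPlate

/-! ### Chains of intervals -/

/-- The graph of overlaps of a family of sets. -/
def overlapGraph {ι : Type*} (I : ι → Set ℝ) : SimpleGraph ι where
  Adj i j := i ≠ j ∧ (I i ∩ I j).Nonempty
  symm := ⟨fun i j h => ⟨h.1.symm, by rw [Set.inter_comm]; exact h.2⟩⟩
  loopless := ⟨fun _ h => h.1 rfl⟩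

/-- Otherwise the union of the pieces reachable from `i` and the union of the others would be closed
sets covering a connected set. They would share a point, and this point would provide an edge of the
graph between the two classes. -/
theorem overlapGraph_reachable {ι : Type*} [Finite ι] {A : Set ℝ} (hA : IsPreconnected A)
    {I : ι → Set ℝ} (hI : ∀ i, IsClosed (I i)) (hcover : A ⊆ ⋃ i, I i) (hsub : ∀ i, I i ⊆ A)
    {i j : ι} (hi : (I i).Nonempty) (hj : (I j).Nonempty) : (overlapGraph I).Reachable i j := by
  by_contra hnot
  set B : Set ℝ := ⋃ k ∈ {k | (overlapGraph I).Reachable i k}, I k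
  set C : Set ℝ := ⋃ k ∈ {k | ¬ (overlapGraph I).Reachable i k}, I k
  have hB : IsClosed B := (Set.toFinite _).isClosed_biUnion fun k _ => hI k
  have hC : IsClosed C := (Set.toFinite _).isClosed_biUnion fun k _ => hI k
  have hABC : A ⊆ B ∪ C := by
    intro x hx
    obtain ⟨k, hk⟩ := Set.mem_iUnion.1 (hcover hx)
    by_cases h : (overlapGraph I).Reachable i k
    · exact Or.inl (Set.mem_biUnion (show k ∈ {k | (overlapGraph I).Reachable i k} from h) hk)
    · exact Or.inr (Set.mem_biUnion (show k ∈ {k | ¬ (overlapGraph I).Reachable i k} from h) hk)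
  obtain ⟨s, hs⟩ := hi
  obtain ⟨t, ht⟩ := hj
  obtain ⟨x, -, hxB, hxC⟩ := isPreconnected_closed_iff.1 hA B C hB hC hABC
    ⟨s, hsub i hs, Set.mem_biUnion (show i ∈ {k | (overlapGraph I).Reachable i k} from
      SimpleGraph.Reachable.refl i) hs⟩
    ⟨t, hsub j ht, Set.mem_biUnion (show j ∈ {k | ¬ (overlapGraph I).Reachable i k} from hnot) ht⟩
  obtain ⟨k, hk, hxk⟩ := Set.mem_iUnion₂.1 hxB
  obtain ⟨l, hl, hxl⟩ := Set.mem_iUnion₂.1 hxC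
  have hkl : k ≠ l := by rintro rfl; exact hl hk
  exact hl (SimpleGraph.Reachable.trans hk
    (SimpleGraph.Adj.reachable (show (overlapGraph I).Adj k l from ⟨hkl, x, hxk, hxl⟩)))

/-- Telescoping: inside a piece the function varies by `V`, and at a common point of consecutive
pieces the branch is changed at the cost `J`. -/
theorem walk_variation {ι : Type*} {I : ι → Set ℝ} {f : ι → ℝ → ℝ} {V : ι → ℝ} {J : Sym2 ι → ℝ}
    (hV : ∀ i, ∀ s ∈ I i, ∀ t ∈ I i, |f i s - f i t| ≤ V i)
    (hJ : ∀ i j, i ≠ j → ∀ s ∈ I i ∩ I j, |f i s - f j s| ≤ J s(i, j)) {i j : ι}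
    (p : (overlapGraph I).Walk i j) : ∀ s ∈ I i, ∀ t ∈ I j,
      |f i s - f j t| ≤ (p.support.map V).sum + (p.edges.map J).sum := by
  induction p with
  | nil => intro s hs t ht; simpa using hV _ s hs t ht
  | @cons i k j h p ih =>
    intro s hs t ht
    obtain ⟨hik, u, hui, huk⟩ := id h
    have h1 := hV i s hs u hui
    have h2 := hJ i k hik u ⟨hui, huk⟩
    have h3 := ih u huk t ht
    simp only [SimpleGraph.Walk.support_cons, SimpleGraph.Walk.edges_cons, List.map_cons,
      List.sum_cons]
    have h4 : f i s - f j t = (f i s - f i u) + (f i u - f k u) + (f k u - f j t) := by ring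
    rw [h4]
    have := abs_add_three (f i s - f i u) (f i u - f k u) (f k u - f j t)
    linarith

theorem list_sum_le_sum {ι : Type*} [Fintype ι] {l : List ι} (hl : l.Nodup) {V : ι → ℝ}
    (hV : ∀ i, 0 ≤ V i) : (l.map V).sum ≤ ∑ i, V i := by
  classical
  rw [← List.sum_toFinset V hl]
  exact Finset.sum_le_sum_of_subset_of_nonneg (Finset.subset_univ _) fun i _ _ => hV i

/-- A piecewise function on an interval varies at most by the sum of the variations on the pieces
and of the jumps. -/
theorem chain_variation {ι : Type*} [Fintype ι] [DecidableEq ι] {A : Set ℝ} (hA : IsPreconnected A)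
    {I : ι → Set ℝ} (hI : ∀ i, IsClosed (I i)) (hcover : A ⊆ ⋃ i, I i) (hsub : ∀ i, I i ⊆ A)
    {f : ι → ℝ → ℝ} {V : ι → ℝ} {J : Sym2 ι → ℝ} (hV0 : ∀ i, 0 ≤ V i) (hJ0 : ∀ z, 0 ≤ J z)
    (hV : ∀ i, ∀ s ∈ I i, ∀ t ∈ I i, |f i s - f i t| ≤ V i)
    (hJ : ∀ i j, i ≠ j → ∀ s ∈ I i ∩ I j, |f i s - f j s| ≤ J s(i, j)) {i j : ι} {s t : ℝ}
    (hs : s ∈ I i) (ht : t ∈ I j) : |f i s - f j t| ≤ ∑ i, V i + ∑ z, J z := by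
  obtain ⟨p⟩ := overlapGraph_reachable hA hI hcover hsub ⟨s, hs⟩ ⟨t, ht⟩
  have hp := (p.toPath).2
  -- A path visits each piece and uses each pair at most once, so its cost is bounded by the full
  -- sums without multiplicities.
  refine (walk_variation hV hJ (p.toPath : (overlapGraph I).Walk i j) s hs t ht).trans ?_
  exact add_le_add (list_sum_le_sum hp.support_nodup hV0)
    (list_sum_le_sum hp.isTrail.edges_nodup hJ0)

/-! ### Lines through a mesh -/

namespace Mesh

variable {s : CellShape} {Ω : Set Plane} (M : Mesh s Ω)

/-- Parameter of the point of the edge `e` on the line `{x | cross a x = κ}`. -/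
noncomputable def crossParam (a : Plane) (e : M.Edge) (κ : ℝ) : ℝ :=
  (κ - cross a (M.edgeStart e)) / (cross a (M.edgeEnd e) - cross a (M.edgeStart e))

open Classical in
/-- Jump of `u` where the line `{x | cross a x = κ}` crosses the edge `e`. -/
noncomputable def lineJump (a : Plane) (u : Fin M.N → Plane → ℝ) (e : M.Edge) (κ : ℝ) : ℝ :=
  if cross a (M.edgeStart e) ≠ cross a (M.edgeEnd e) ∧ M.crossParam a e κ ∈ Set.Icc (0 : ℝ) 1 then
    |M.jump u e (AffineMap.lineMap (M.edgeStart e) (M.edgeEnd e) (M.crossParam a e κ))|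
  else 0

theorem lineJump_nonneg (a : Plane) (u : Fin M.N → Plane → ℝ) (e : M.Edge) (κ : ℝ) :
    0 ≤ M.lineJump a u e κ := by
  unfold lineJump; split_ifs <;> positivity

/-- The line through `x` in direction `a` does not meet any vertex. -/
def GoodLine (a x : Plane) : Prop := ∀ i c, cross a (M.vert i c) ≠ cross a x

theorem cross_add_smul_self (a x : Plane) (t : ℝ) : cross a (x + t • a) = cross a x := by
  simp [cross]; ring

theorem cross_lineMap (a P Q : Plane) (t : ℝ) :
    cross a (AffineMap.lineMap P Q t) = cross a P + t * (cross a Q - cross a P) := by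
  simp [cross, AffineMap.lineMap_apply]; ring

theorem exists_edge_of_sharedEdge {a y : Plane} (hy : M.GoodLine a y) {i j : Fin M.N} {c d : Fin s.n}
    (hij : i ≠ j) (hcd : SharedEdge (M.vert i) (M.vert j) c d)
    (hseg : y ∈ segment ℝ (M.vert i c) (M.vert i (finRotate s.n c))) :
    ∃ e ∈ M.edges, s(e.1, e.2.2) = s(i, j) ∧ cross a (M.edgeStart e) ≠ cross a (M.edgeEnd e) ∧
      M.crossParam a e (cross a y) ∈ Set.Icc (0 : ℝ) 1 ∧
      y = AffineMap.lineMap (M.edgeStart e) (M.edgeEnd e) (M.crossParam a e (cross a y)) := by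
  have key : ∀ e : M.Edge, y ∈ segment ℝ (M.edgeStart e) (M.edgeEnd e) →
      cross a (M.edgeStart e) ≠ cross a (M.edgeEnd e) ∧
      M.crossParam a e (cross a y) ∈ Set.Icc (0 : ℝ) 1 ∧
      y = AffineMap.lineMap (M.edgeStart e) (M.edgeEnd e) (M.crossParam a e (cross a y)) := by
    intro e he
    rw [segment_eq_image_lineMap] at he
    obtain ⟨t, ht, hty⟩ := he
    have hc := cross_lineMap a (M.edgeStart e) (M.edgeEnd e) t
    rw [hty] at hc
    -- An edge through `y` parallel to `a` would lie on the line together with its end points, which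
    -- are vertices.
    have hne : cross a (M.edgeStart e) ≠ cross a (M.edgeEnd e) := by
      intro h
      rw [← h, sub_self, mul_zero, add_zero] at hc
      exact hy e.1 e.2.1 hc.symm
    have hne' : cross a (M.edgeEnd e) - cross a (M.edgeStart e) ≠ 0 := sub_ne_zero.2 hne.symm
    have ht' : M.crossParam a e (cross a y) = t := by
      rw [crossParam, hc, add_sub_cancel_left, mul_div_assoc, div_self hne', mul_one]
    rw [ht']
    exact ⟨hne, ht, hty.symm⟩
  rcases M.edges_orient i c j d hij hcd with ⟨h, -⟩ | ⟨h, -⟩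
  · exact ⟨_, h, rfl, key (i, c, j) hseg⟩
  · refine ⟨_, h, Sym2.eq_swap, key (j, d, i) ?_⟩
    unfold edgeStart edgeEnd
    rcases Sym2.eq_iff.1 hcd with ⟨h1, h2⟩ | ⟨h1, h2⟩
    · rw [h1, h2] at hseg; exact hseg
    · rw [h1, h2, segment_symm] at hseg; exact hseg

theorem exists_crossing {a y : Plane} (hy : M.GoodLine a y) {i j : Fin M.N} (hij : i ≠ j)
    (hi : y ∈ M.cell i) (hj : y ∈ M.cell j) :
    ∃ e ∈ M.edges, s(e.1, e.2.2) = s(i, j) ∧ cross a (M.edgeStart e) ≠ cross a (M.edgeEnd e) ∧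
      M.crossParam a e (cross a y) ∈ Set.Icc (0 : ℝ) 1 ∧
      y = AffineMap.lineMap (M.edgeStart e) (M.edgeEnd e) (M.crossParam a e (cross a y)) := by
  rcases M.vertex_or_sharedEdge hij hi hj with ⟨c, hc⟩ | ⟨c, d, hcd, hseg⟩
  · exact absurd (by rw [hc]) (hy i c)
  · exact M.exists_edge_of_sharedEdge hy hij hcd hseg

/-- Part of the unit segment from `x` in direction `a` inside the cell `i`. -/
def trace (a x : Plane) (i : Fin M.N) : Set ℝ :=
  Set.Icc 0 1 ∩ (fun t : ℝ => x + t • a) ⁻¹' M.cell i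

theorem isClosed_trace (a x : Plane) (i : Fin M.N) : IsClosed (M.trace a x i) :=
  isClosed_Icc.inter ((M.isClosed_cell i).preimage (by fun_prop))

theorem isCompact_trace (a x : Plane) (i : Fin M.N) : IsCompact (M.trace a x i) :=
  isCompact_Icc.inter_right ((M.isClosed_cell i).preimage (by fun_prop))

theorem convex_trace (a x : Plane) (i : Fin M.N) : Convex ℝ (M.trace a x i) := by
  refine (convex_Icc 0 1).inter ?_
  intro t ht r hr p q hp hq hpq
  have := M.convex_cell i ht hr hp hq hpq
  have e : p • (x + t • a) + q • (x + r • a) = x + (p • t + q • r) • a := by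
    have : q = 1 - p := by linarith
    subst this
    simp only [smul_eq_mul]; module
  rw [e] at this
  exact this

/-- Chain estimate along a segment. -/
theorem segment_variation {a x : Plane} (hx : M.GoodLine a x)
    (hin : ∀ t ∈ Set.Icc (0 : ℝ) 1, x + t • a ∈ Ω) {u f : Fin M.N → ℝ → ℝ}
    {v : Fin M.N → Plane → ℝ} {V : Fin M.N → ℝ}
    (hu : ∀ i t, u i t = v i (x + t • a)) (hf : ∀ i j t, f i t - f j t = u i t - u j t)
    (hV0 : ∀ i, 0 ≤ V i)
    (hV : ∀ i, ∀ r ∈ M.trace a x i, ∀ t ∈ M.trace a x i, |f i r - f i t| ≤ V i) {i j : Fin M.N}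
    {r t : ℝ} (hr : r ∈ M.trace a x i) (ht : t ∈ M.trace a x j) :
    |f i r - f j t| ≤ ∑ i, V i + ∑ e ∈ M.edges, M.lineJump a v e (cross a x) := by
  -- The jumps are grouped by the unordered pair of cells, so that summing over pairs restores the
  -- sum over all edges.
  set J : Sym2 (Fin M.N) → ℝ := fun z =>
    ∑ e ∈ M.edges with s(e.1, e.2.2) = z, M.lineJump a v e (cross a x) with hJdef
  have hJ0 : ∀ z, 0 ≤ J z := fun z => Finset.sum_nonneg fun e _ => M.lineJump_nonneg _ _ _ _
  have hsum : ∑ z, J z = ∑ e ∈ M.edges, M.lineJump a v e (cross a x) :=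
    Finset.sum_fiberwise_of_maps_to (fun e _ => Finset.mem_univ _) _
  rw [← hsum]
  refine chain_variation isPreconnected_Icc (M.isClosed_trace a x) ?_
    (fun i => Set.inter_subset_left) hV0 hJ0 hV ?_ hr ht
  · intro t ht
    have : x + t • a ∈ ⋃ i, M.cell i := M.cover.symm ▸ subset_closure (hin t ht)
    obtain ⟨i, hi⟩ := Set.mem_iUnion.1 this
    exact Set.mem_iUnion.2 ⟨i, ht, hi⟩
  · rintro i j hij t ⟨⟨-, hti⟩, -, htj⟩
    have hgood : M.GoodLine a (x + t • a) := by
      intro i c; rw [cross_add_smul_self]; exact hx i c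
    obtain ⟨e, he, hez, hne, hpar, hy⟩ := M.exists_crossing hgood hij hti htj
    rw [cross_add_smul_self] at hpar hy
    -- `f` and `u` have the same jumps: they differ by a function of the parameter common to all
    -- cells. This freedom is used later to subtract an affine function.
    rw [hf, hu, hu]
    refine le_trans ?_ (Finset.single_le_sum (fun e _ => M.lineJump_nonneg a v e (cross a x))
      (Finset.mem_filter.2 ⟨he, hez⟩))
    rw [lineJump, if_pos ⟨hne, hpar⟩, ← hy, jump]
    rcases Sym2.eq_iff.1 hez with ⟨h1, h2⟩ | ⟨h1, h2⟩
    · rw [h1, h2]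
    · rw [h1, h2, abs_sub_comm]

/-- On a line without vertices two traces meet only where the line crosses an edge transversally,
that is, in finitely many points. Up to null sets the traces are disjoint parts of `[0, 1]`. -/
theorem sum_volume_trace_le {a x : Plane} (ha : a ≠ 0) (hx : M.GoodLine a x) :
    ∑ i, volume.real (M.trace a x i) ≤ 1 := by
  have hdis : ∀ i j, i ≠ j → AEDisjoint volume (M.trace a x i) (M.trace a x j) := by
    intro i j hij
    refine Set.Finite.measure_zero ?_ volume
    have hinj : Function.Injective fun t : ℝ => x + t • a := fun t t' h =>
      smul_left_injective ℝ ha (add_left_cancel h)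
    refine Set.Finite.subset (Set.Finite.preimage hinj.injOn
      (Set.Finite.image (fun e : M.Edge => (AffineMap.lineMap (M.edgeStart e) (M.edgeEnd e)
        (M.crossParam a e (cross a x)) : Plane)) M.edges.finite_toSet)) ?_
    rintro t ⟨⟨-, hti⟩, -, htj⟩
    have hgood : M.GoodLine a (x + t • a) := by
      intro i c; rw [cross_add_smul_self]; exact hx i c
    obtain ⟨e, he, -, -, -, hy⟩ := M.exists_crossing hgood hij hti htj
    rw [cross_add_smul_self] at hy
    exact ⟨e, he, hy.symm⟩
  have h1 : ∑ i, volume (M.trace a x i) ≤ volume (Set.Icc (0 : ℝ) 1) := by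
    rw [← tsum_fintype (L := .unconditional _), ← measure_iUnion₀ (fun i j h => hdis i j h)
      fun i => (M.isClosed_trace a x i).measurableSet.nullMeasurableSet]
    exact measure_mono (Set.iUnion_subset fun i => Set.inter_subset_left)
  have hfin : ∀ i, volume (M.trace a x i) ≠ ⊤ := fun i => (M.isCompact_trace a x i).measure_lt_top.ne
  have h2 := ENNReal.toReal_mono (by simp) h1
  rw [ENNReal.toReal_sum fun i _ => hfin i] at h2
  simpa [Measure.real] using h2

/-- Broken directional derivative. -/
noncomputable def dd (a : Plane) (u : Fin M.N → Plane → ℝ) (i : Fin M.N) (x : Plane) : ℝ :=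
  fderivWithin ℝ (u i) (M.cell i) x a

theorem hasDerivWithinAt_trace {u : Fin M.N → Plane → ℝ} {i : Fin M.N}
    (hu : DifferentiableOn ℝ (u i) (M.cell i)) (a x : Plane) {t : ℝ} (ht : t ∈ M.trace a x i) :
    HasDerivWithinAt (fun t : ℝ => u i (x + t • a)) (M.dd a u i (x + t • a)) (M.trace a x i) t := by
  have h1 := (hu _ ht.2).hasFDerivWithinAt
  have h2 : HasDerivWithinAt (fun t : ℝ => x + t • a) a (M.trace a x i) t := by
    have := ((hasDerivAt_id t).smul_const a).const_add x
    simpa using this.hasDerivWithinAt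
  exact h1.comp_hasDerivWithinAt t h2 fun r hr => hr.2

theorem abs_sub_le_integral_trace {u : Fin M.N → Plane → ℝ} {i : Fin M.N}
    (hu : DifferentiableOn ℝ (u i) (M.cell i)) {a x : Plane}
    (hc : ContinuousOn (M.dd a u i) (M.cell i)) {r t : ℝ} (hr : r ∈ M.trace a x i)
    (ht : t ∈ M.trace a x i) :
    |u i (x + r • a) - u i (x + t • a)| ≤ ∫ q in M.trace a x i, |M.dd a u i (x + q • a)| := by
  wlog hrt : r ≤ t generalizing r t
  · rw [abs_sub_comm]; exact this ht hr (le_of_not_ge hrt)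
  have hsub : Set.Icc r t ⊆ M.trace a x i := (M.convex_trace a x i).ordConnected.out hr ht
  have hcont : ContinuousOn (fun q : ℝ => M.dd a u i (x + q • a)) (M.trace a x i) :=
    hc.comp (by fun_prop) fun q hq => hq.2
  have hint : IntegrableOn (fun q : ℝ => |M.dd a u i (x + q • a)|) (M.trace a x i) :=
    hcont.abs.integrableOn_compact (M.isCompact_trace a x i)
  have hii : IntervalIntegrable (fun q : ℝ => M.dd a u i (x + q • a)) volume r t :=
    (hcont.mono (by rwa [Set.uIcc_of_le hrt])).intervalIntegrable
  have hftc := intervalIntegral.integral_eq_sub_of_hasDerivAt_of_le hrt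
    (f := fun q : ℝ => u i (x + q • a)) (f' := fun q => M.dd a u i (x + q • a))
    (fun q hq => ((M.hasDerivWithinAt_trace hu a x (hsub hq)).mono hsub).continuousWithinAt)
    (fun q hq => ((M.hasDerivWithinAt_trace hu a x (hsub (Set.Ioo_subset_Icc_self hq))).mono
      hsub).hasDerivAt (Icc_mem_nhds hq.1 hq.2)) hii
  rw [abs_sub_comm, ← hftc]
  refine (intervalIntegral.abs_integral_le_integral_abs hrt).trans ?_
  rw [intervalIntegral.integral_of_le hrt]
  exact setIntegral_mono_set hint (Filter.Eventually.of_forall fun q => abs_nonneg _)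
    (Set.Ioc_subset_Icc_self.trans hsub).eventuallyLE

theorem abs_sub_mul_le_trace {u : Fin M.N → Plane → ℝ} {i : Fin M.N}
    (hu : DifferentiableOn ℝ (u i) (M.cell i)) {a x : Plane} {c W : ℝ}
    (hW : ∀ q ∈ M.trace a x i, |M.dd a u i (x + q • a) - c| ≤ W) {r t : ℝ}
    (hr : r ∈ M.trace a x i) (ht : t ∈ M.trace a x i) :
    |(u i (x + r • a) - r * c) - (u i (x + t • a) - t * c)| ≤ W * volume.real (M.trace a x i) := by
  have hW0 : 0 ≤ W := (abs_nonneg _).trans (hW r hr)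
  have hd : ∀ q ∈ M.trace a x i, HasDerivWithinAt (fun q : ℝ => u i (x + q • a) - q * c)
      (M.dd a u i (x + q • a) - c) (M.trace a x i) q := fun q hq => by
    exact ((M.hasDerivWithinAt_trace hu a x hq).fun_sub
      ((hasDerivWithinAt_id q _).mul_const c)).congr_deriv (by rw [one_mul])
  have h1 := (M.convex_trace a x i).norm_image_sub_le_of_norm_hasDerivWithin_le hd
    (fun q hq => hW q hq) ht hr
  rw [Real.norm_eq_abs] at h1
  refine h1.trans (mul_le_mul_of_nonneg_left ?_ hW0)
  have hsub : Set.uIcc t r ⊆ M.trace a x i := (M.convex_trace a x i).ordConnected.uIcc_subset ht hr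
  have := measureReal_mono (μ := volume) hsub (M.isCompact_trace a x i).measure_lt_top.ne
  rw [Real.norm_eq_abs]
  refine le_trans (le_of_eq ?_) this
  rw [Measure.real, Set.uIcc, Real.volume_Icc, max_sub_min_eq_abs,
    ENNReal.toReal_ofReal (abs_nonneg _)]

end Mesh
end PrestrainedPlate

/-! ### Oblique coordinates and integration of the line estimates. -/

namespace PrestrainedPlate

open scoped ENNReal

/-! ### Oblique coordinates -/

theorem lintegral_plane_eq {F : Plane → ℝ≥0∞} (hF : Measurable F) :
    ∫⁻ x, F x = ∫⁻ β : ℝ, ∫⁻ α : ℝ, F !₂[α, β] := by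
  have h1 := (PiLp.volume_preserving_toLp (Fin 2)).lintegral_comp hF
  have h2 := (volume_preserving_finTwoArrow ℝ).lintegral_comp
    (f := fun p : ℝ × ℝ => F !₂[p.1, p.2]) (hF.comp (by fun_prop))
  have h3 : ∀ y : Fin 2 → ℝ, F !₂[(MeasurableEquiv.finTwoArrow y).1, (MeasurableEquiv.finTwoArrow y).2]
      = F (WithLp.toLp 2 y) := by
    intro y
    congr 1
    apply plane_ext <;> simp [MeasurableEquiv.finTwoArrow]
  rw [← h1]
  simp_rw [h3] at h2
  rw [h2, Measure.volume_eq_prod, lintegral_prod_symm]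
  exact (hF.comp (by fun_prop)).aemeasurable

/-- Tonelli's theorem in the oblique coordinates `x = α a + β b`. -/
theorem lintegral_oblique {a b : Plane} (hab : cross a b ≠ 0) {F : Plane → ℝ≥0∞}
    (hF : Measurable F) :
    ∫⁻ x, F x = ENNReal.ofReal |cross a b| * ∫⁻ β : ℝ, ∫⁻ α : ℝ, F (α • a + β • b) := by
  -- The linear map sending the basis to `a`, `b` is the derivative of the reference map of the
  -- triangle `0, a, b`, whose determinant is known.
  set T : Plane →L[ℝ] Plane := CellShape.triangle.refDeriv ![0, a, b] 0 with hT
  have hTa : ∀ x : Plane, T x = x 0 • a + x 1 • b := by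
    intro x
    rw [hT, CellShape.refDeriv_apply]
    simp [CellShape.d0, CellShape.d1, CellShape.vecA, CellShape.vecB, CellShape.vecC]
  have hdet : LinearMap.det (T : Plane →ₗ[ℝ] Plane) = cross a b := by
    have := CellShape.det_refDeriv .triangle ![0, a, b] 0
    rw [← hT, ContinuousLinearMap.det, CellShape.jac_triangle] at this
    rw [this]; simp [triDet]
  have h1 := Measure.map_linearMap_addHaar_eq_smul_addHaar (volume : Measure Plane)
    (f := (T : Plane →ₗ[ℝ] Plane)) (by rw [hdet]; exact hab)
  have h2 : ∫⁻ x, F (T x) = ENNReal.ofReal |(cross a b)⁻¹| * ∫⁻ x, F x := by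
    have h3 : ∫⁻ x, F (T x) = ∫⁻ x, F x ∂(Measure.map (T : Plane →ₗ[ℝ] Plane) volume) :=
      (lintegral_map hF T.continuous.measurable).symm
    rw [h3, h1, lintegral_smul_measure, hdet, smul_eq_mul]
  have h4 := lintegral_plane_eq (hF.comp T.continuous.measurable)
  simp only [Function.comp_apply] at h4
  rw [h2] at h4
  have h5 : ∀ α β : ℝ, T !₂[α, β] = α • a + β • b := by intro α β; rw [hTa]; simp
  simp_rw [h5] at h4
  rw [← h4, ← mul_assoc, ← ENNReal.ofReal_mul (abs_nonneg _), ← abs_mul, mul_inv_cancel₀ hab, abs_one,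
    ENNReal.ofReal_one, one_mul]

theorem exists_cross_ne_zero {a : Plane} (ha : a ≠ 0) : ∃ b, cross a b ≠ 0 := by
  by_contra! h
  apply ha
  have h0 := h (EuclideanSpace.single 0 1)
  have h1 := h (EuclideanSpace.single 1 1)
  simp [cross] at h0 h1
  exact plane_ext (by simpa using h1) (by simpa using h0)

theorem ae_cross_ne {a : Plane} (ha : a ≠ 0) (κ : ℝ) : ∀ᵐ x : Plane, κ ≠ cross a x := by
  obtain ⟨b, hab⟩ := exists_cross_ne_zero ha
  have hm : MeasurableSet {x : Plane | κ = cross a x} :=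
    (isClosed_eq continuous_const (by fun_prop)).measurableSet
  rw [ae_iff]
  have e : {x : Plane | ¬ κ ≠ cross a x} = {x : Plane | κ = cross a x} := by ext; simp
  rw [e, ← lintegral_indicator_one hm, lintegral_oblique hab (measurable_one.indicator hm)]
  have hz : ∫⁻ β : ℝ, ∫⁻ α : ℝ, Set.indicator {x : Plane | κ = cross a x} (1 : Plane → ℝ≥0∞)
      (α • a + β • b) = ∫⁻ β : ℝ, (0 : ℝ≥0∞) := by
    refine lintegral_congr_ae ?_
    filter_upwards [Measure.ae_ne (volume : Measure ℝ) (κ / cross a b)] with β hβ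
    have : ∀ α : ℝ, (α • a + β • b) ∉ {x : Plane | κ = cross a x} := by
      intro α hα
      apply hβ
      have h1 : κ = β * cross a b := by
        have := Set.mem_ofPred_eq ▸ hα
        rw [show κ = _ from hα]; simp [cross]; ring
      rw [h1]; field_simp
    simp [Set.indicator_of_notMem (this _)]
  rw [hz]; simp

namespace Mesh

variable {s : CellShape} {Ω : Set Plane} (M : Mesh s Ω)

theorem ae_goodLine {a : Plane} (ha : a ≠ 0) : ∀ᵐ x : Plane, M.GoodLine a x :=
  ae_all_iff.2 fun _ => ae_all_iff.2 fun _ => ae_cross_ne ha _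

/-! ### Piecewise functions as functions on the plane -/

/-- The sum over the cells of the absolute values of a piecewise function, extended by zero. -/
noncomputable def cellSum (f : Fin M.N → Plane → ℝ) (x : Plane) : ℝ≥0∞ :=
  ∑ i, (M.cell i).indicator (fun y => ENNReal.ofReal |f i y|) x

theorem measurable_indicator_cell {f : Plane → ℝ} {i : Fin M.N} (hf : ContinuousOn f (M.cell i)) :
    Measurable ((M.cell i).indicator fun y => ENNReal.ofReal |f y|) := by
  classical
  rw [← Set.piecewise_eq_indicator]
  exact ContinuousOn.measurable_piecewise
    (ENNReal.continuous_ofReal.comp_continuousOn hf.abs) continuousOn_const (M.measurableSet_cell i)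

theorem measurable_cellSum {f : Fin M.N → Plane → ℝ} (hf : ∀ i, ContinuousOn (f i) (M.cell i)) :
    Measurable (M.cellSum f) :=
  Finset.measurable_sum _ fun i _ => M.measurable_indicator_cell (hf i)

theorem lintegral_cellSum {f : Fin M.N → Plane → ℝ} (hf : ∀ i, ContinuousOn (f i) (M.cell i)) :
    ∫⁻ x, M.cellSum f x = ∑ i, ∫⁻ x in M.cell i, ENNReal.ofReal |f i x| := by
  unfold cellSum
  rw [lintegral_finsetSum _ fun i _ => M.measurable_indicator_cell (hf i)]
  exact Finset.sum_congr rfl fun i _ => lintegral_indicator (M.measurableSet_cell i) _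

theorem le_cellSum (f : Fin M.N → Plane → ℝ) {i : Fin M.N} {x : Plane} (hx : x ∈ M.cell i) :
    ENNReal.ofReal |f i x| ≤ M.cellSum f x := by
  have h := Finset.single_le_sum (f := fun i => (M.cell i).indicator
    (fun y => ENNReal.ofReal |f i y|) x) (fun _ _ => zero_le) (Finset.mem_univ i)
  exact (Set.indicator_of_mem hx _).symm.le.trans h

theorem cellSum_of_mem_interior (f : Fin M.N → Plane → ℝ) {i : Fin M.N} {x : Plane}
    (hx : x ∈ interior (M.cell i)) (hfr : ∀ j, x ∉ frontier (M.cell j)) :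
    M.cellSum f x = ENNReal.ofReal |f i x| := by
  unfold cellSum
  rw [Finset.sum_eq_single i]
  · exact Set.indicator_of_mem (interior_subset hx) _
  · intro j _ hj
    refine Set.indicator_of_notMem (fun hxj => ?_) _
    have : x ∈ interior (M.cell j) := by
      by_contra h
      exact hfr j ⟨subset_closure hxj, h⟩
    exact Set.disjoint_left.1 (M.disjoint_interior hj) this hx
  · simp

theorem ae_notMem_frontier : ∀ᵐ x : Plane, ∀ j, x ∉ frontier (M.cell j) :=
  ae_all_iff.2 fun j => measure_eq_zero_iff_ae_notMem.1 (M.volume_frontier_cell j)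

/-- Boundaries of cells are null and interiors disjoint, so almost everywhere the sum over the cells
has at most one term. -/
theorem lintegral_cellSum_le (f : Fin M.N → Plane → ℝ) {H : Plane → ℝ≥0∞}
    (h : ∀ᵐ x, ∀ i, x ∈ interior (M.cell i) → ENNReal.ofReal |f i x| ≤ H x) :
    ∫⁻ x, M.cellSum f x ≤ ∫⁻ x, H x := by
  refine lintegral_mono_ae ?_
  filter_upwards [h, M.ae_notMem_frontier] with x hx hfr
  by_cases hex : ∃ i, x ∈ interior (M.cell i)
  · obtain ⟨i, hi⟩ := hex
    rw [M.cellSum_of_mem_interior f hi hfr]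
    exact hx i hi
  · push Not at hex
    have : M.cellSum f x = 0 := by
      refine Finset.sum_eq_zero fun i _ => Set.indicator_of_notMem (fun hxi => ?_) _
      exact hfr i ⟨subset_closure hxi, hex i⟩
    rw [this]; exact zero_le

/-! ### Jumps along lines -/

/-- The integral of the absolute jump over an edge. -/
noncomputable def jumpL (u : Fin M.N → Plane → ℝ) (e : M.Edge) : ℝ≥0∞ :=
  ENNReal.ofReal (dist (M.edgeStart e) (M.edgeEnd e)) *
    ∫⁻ t in Set.Icc (0 : ℝ) 1,
      ENNReal.ofReal |M.jump u e (AffineMap.lineMap (M.edgeStart e) (M.edgeEnd e) t)|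

theorem continuousOn_jump_lineMap {u : Fin M.N → Plane → ℝ}
    (hu : ∀ i, ContinuousOn (u i) (M.cell i)) {e : M.Edge} (he : e ∈ M.edges) :
    ContinuousOn (fun t : ℝ => M.jump u e (AffineMap.lineMap (M.edgeStart e) (M.edgeEnd e) t))
      (Set.Icc 0 1) :=
  ((hu e.1).comp (AffineMap.lineMap_continuous.continuousOn) fun _ ht => M.lineMap_mem_fst e ht).sub
    ((hu e.2.2).comp (AffineMap.lineMap_continuous.continuousOn) fun _ ht => M.lineMap_mem_snd he ht)

theorem ofReal_lineJump {a : Plane} (u : Fin M.N → Plane → ℝ) {e : M.Edge}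
    (hne : cross a (M.edgeStart e) ≠ cross a (M.edgeEnd e)) (κ : ℝ) :
    ENNReal.ofReal (M.lineJump a u e κ) = (Set.Icc (0 : ℝ) 1).indicator (fun t => ENNReal.ofReal
      |M.jump u e (AffineMap.lineMap (M.edgeStart e) (M.edgeEnd e) t)|) (M.crossParam a e κ) := by
  unfold lineJump
  by_cases h : M.crossParam a e κ ∈ Set.Icc (0 : ℝ) 1
  · rw [if_pos ⟨hne, h⟩, Set.indicator_of_mem h]
  · rw [if_neg fun h' => h h'.2, Set.indicator_of_notMem h, ENNReal.ofReal_zero]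

theorem measurable_jump_indicator {u : Fin M.N → Plane → ℝ}
    (hu : ∀ i, ContinuousOn (u i) (M.cell i)) {e : M.Edge} (he : e ∈ M.edges) :
    Measurable ((Set.Icc (0 : ℝ) 1).indicator (fun t => ENNReal.ofReal
      |M.jump u e (AffineMap.lineMap (M.edgeStart e) (M.edgeEnd e) t)|)) := by
  classical
  rw [← Set.piecewise_eq_indicator]
  exact ContinuousOn.measurable_piecewise
    (ENNReal.continuous_ofReal.comp_continuousOn (M.continuousOn_jump_lineMap hu he).abs)
    continuousOn_const measurableSet_Icc

theorem measurable_lineJump {u : Fin M.N → Plane → ℝ} (hu : ∀ i, ContinuousOn (u i) (M.cell i))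
    {e : M.Edge} (he : e ∈ M.edges) (a : Plane) :
    Measurable fun κ => ENNReal.ofReal (M.lineJump a u e κ) := by
  by_cases hne : cross a (M.edgeStart e) = cross a (M.edgeEnd e)
  · have : (fun κ => ENNReal.ofReal (M.lineJump a u e κ)) = fun _ => 0 := by
      funext κ
      rw [lineJump, if_neg fun h => h.1 hne, ENNReal.ofReal_zero]
    rw [this]; exact measurable_const
  · simp_rw [M.ofReal_lineJump u hne]
    exact (M.measurable_jump_indicator hu he).comp (by unfold crossParam; fun_prop)

theorem lintegral_comp_affine {p : ℝ} (hp : p ≠ 0) (q : ℝ) (G : ℝ → ℝ≥0∞) :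
    ∫⁻ x, G (p * x + q) = ENNReal.ofReal |p⁻¹| * ∫⁻ x, G x := by
  have h1 : ∫⁻ x, G (p * x + q) = ∫⁻ y, G (y + q) ∂(Measure.map (p * ·) volume) :=
    ((Homeomorph.mulLeft₀ p hp).measurableEmbedding.lintegral_map (fun y => G (y + q))).symm
  rw [h1, Real.map_volume_mul_left hp, lintegral_smul_measure, lintegral_add_right_eq_self G,
    smul_eq_mul]

/-- The parameter of the crossing point on the edge is an affine function of the transversal
coordinate `β`, with slope `cross a b / D`. Substitution turns the integral over lines into an
integral over the edge, and `|D|` is at most `2 ‖a‖` times its length. -/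
theorem lintegral_lineJump_le {u : Fin M.N → Plane → ℝ} (e : M.Edge) {a b : Plane}
    (hab : cross a b ≠ 0) :
    ∫⁻ β : ℝ, ENNReal.ofReal (M.lineJump a u e (β * cross a b)) ≤
      ENNReal.ofReal (2 * ‖a‖ / |cross a b|) * M.jumpL u e := by
  by_cases hne : cross a (M.edgeStart e) = cross a (M.edgeEnd e)
  · have : ∀ κ, ENNReal.ofReal (M.lineJump a u e κ) = 0 := by
      intro κ
      rw [lineJump, if_neg fun h => h.1 hne, ENNReal.ofReal_zero]
    simp [this]
  · simp_rw [M.ofReal_lineJump u hne]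
    set D := cross a (M.edgeEnd e) - cross a (M.edgeStart e) with hD
    have hD0 : D ≠ 0 := sub_ne_zero.2 fun h => hne h.symm
    have hpar : ∀ β : ℝ, M.crossParam a e (β * cross a b) =
        (cross a b / D) * β + (- cross a (M.edgeStart e) / D) := by
      intro β; unfold crossParam; rw [← hD]; field_simp; ring
    simp_rw [hpar]
    rw [lintegral_comp_affine (div_ne_zero hab hD0), lintegral_indicator measurableSet_Icc, jumpL,
      ← mul_assoc, ← ENNReal.ofReal_mul (by positivity)]
    gcongr
    rw [inv_div, abs_div, div_mul_eq_mul_div]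
    gcongr
    have : D = cross a (M.edgeEnd e - M.edgeStart e) := by rw [hD]; simp [cross]; ring
    rw [this, dist_comm, dist_eq_norm]
    exact abs_cross_le _ _

/-- Bound for the variation of `u` along the line `{α a + β b | α}`, where `w` is the derivative. -/
noncomputable def lineBound (a b : Plane) (u w : Fin M.N → Plane → ℝ) (β : ℝ) : ℝ≥0∞ :=
  (∫⁻ α : ℝ, M.cellSum w (α • a + β • b)) +
    ∑ e ∈ M.edges, ENNReal.ofReal (M.lineJump a u e (β * cross a b))

theorem measurable_lintegral_cellSum {f : Fin M.N → Plane → ℝ}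
    (hf : ∀ i, ContinuousOn (f i) (M.cell i)) (a b : Plane) :
    Measurable fun β : ℝ => ∫⁻ α : ℝ, M.cellSum f (α • a + β • b) := by
  have : Measurable fun p : ℝ × ℝ => M.cellSum f (p.2 • a + p.1 • b) :=
    (M.measurable_cellSum hf).comp (by fun_prop)
  exact this.lintegral_prod_right'

theorem measurable_sum_lineJump {u : Fin M.N → Plane → ℝ} (hu : ∀ i, ContinuousOn (u i) (M.cell i))
    (a : Plane) (c : ℝ) :
    Measurable fun β : ℝ => ∑ e ∈ M.edges, ENNReal.ofReal (M.lineJump a u e (β * c)) :=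
  Finset.measurable_fun_sum _ fun _ he => (M.measurable_lineJump hu he a).comp (by fun_prop)

theorem measurable_lineBound {u w : Fin M.N → Plane → ℝ} (hu : ∀ i, ContinuousOn (u i) (M.cell i))
    (hw : ∀ i, ContinuousOn (w i) (M.cell i)) (a b : Plane) : Measurable (M.lineBound a b u w) :=
  (M.measurable_lintegral_cellSum hw a b).add (M.measurable_sum_lineJump hu a _)

theorem lintegral_lintegral_cellSum {f : Fin M.N → Plane → ℝ}
    (hf : ∀ i, ContinuousOn (f i) (M.cell i)) {a b : Plane} (hab : cross a b ≠ 0) :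
    ∫⁻ β : ℝ, ∫⁻ α : ℝ, M.cellSum f (α • a + β • b) =
      ENNReal.ofReal (1 / |cross a b|) * ∫⁻ x, M.cellSum f x := by
  have h := lintegral_oblique hab (M.measurable_cellSum hf)
  have h0 : 0 < |cross a b| := abs_pos.2 hab
  rw [h, ← mul_assoc, ← ENNReal.ofReal_mul (by positivity), one_div, inv_mul_cancel₀ h0.ne',
    ENNReal.ofReal_one, one_mul]

theorem lintegral_sum_lineJump_le {u : Fin M.N → Plane → ℝ}
    (hu : ∀ i, ContinuousOn (u i) (M.cell i)) {a b : Plane} (hab : cross a b ≠ 0) :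
    ∫⁻ β : ℝ, ∑ e ∈ M.edges, ENNReal.ofReal (M.lineJump a u e (β * cross a b)) ≤
      ENNReal.ofReal (2 * ‖a‖ / |cross a b|) * ∑ e ∈ M.edges, M.jumpL u e := by
  have hm : ∀ e ∈ M.edges, Measurable fun β : ℝ =>
      ENNReal.ofReal (M.lineJump a u e (β * cross a b)) := fun e he =>
    (M.measurable_lineJump hu he a).comp (by fun_prop)
  rw [lintegral_finsetSum _ hm, Finset.mul_sum]
  exact Finset.sum_le_sum fun e _ => M.lintegral_lineJump_le e hab

theorem lintegral_lineBound_le {u w : Fin M.N → Plane → ℝ}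
    (hu : ∀ i, ContinuousOn (u i) (M.cell i)) (hw : ∀ i, ContinuousOn (w i) (M.cell i))
    {a b : Plane} (hab : cross a b ≠ 0) :
    ∫⁻ β : ℝ, M.lineBound a b u w β ≤ ENNReal.ofReal ((1 + 2 * ‖a‖) / |cross a b|) *
      ((∫⁻ x, M.cellSum w x) + ∑ e ∈ M.edges, M.jumpL u e) := by
  unfold lineBound
  rw [lintegral_add_left (M.measurable_lintegral_cellSum hw a b), mul_add,
    M.lintegral_lintegral_cellSum hw hab]
  have h0 : 0 < |cross a b| := abs_pos.2 hab
  refine add_le_add ?_ ((M.lintegral_sum_lineJump_le hu hab).trans ?_)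
  · gcongr
    linarith [norm_nonneg a]
  · gcongr
    linarith [norm_nonneg a]

theorem cross_oblique (a b : Plane) (α β : ℝ) : cross a (α • a + β • b) = β * cross a b := by
  simp [cross]; ring

/-- Variation along a segment in direction `a`. -/
theorem ofReal_variation_le {u : Fin M.N → Plane → ℝ}
    (hu : ∀ i, DifferentiableOn ℝ (u i) (M.cell i)) {a b : Plane}
    (hw : ∀ i, ContinuousOn (M.dd a u i) (M.cell i)) {α β t : ℝ}
    (hx : M.GoodLine a (α • a + β • b))
    (hin : ∀ t ∈ Set.Icc (0 : ℝ) 1, α • a + β • b + t • a ∈ Ω) (ht : t ∈ Set.Icc (0 : ℝ) 1)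
    {i j : Fin M.N} (hi : α • a + β • b ∈ M.cell i) (hj : α • a + β • b + t • a ∈ M.cell j) :
    ENNReal.ofReal |u i (α • a + β • b) - u j (α • a + β • b + t • a)| ≤
      M.lineBound a b u (M.dd a u) β := by
  set x := α • a + β • b with hxdef
  have h0 : (0 : ℝ) ∈ M.trace a x i := ⟨by simp, by simpa using hi⟩
  have hmain := M.segment_variation hx hin (f := fun i t => u i (x + t • a))
    (u := fun i t => u i (x + t • a)) (v := u)
    (V := fun i => ∫ q in M.trace a x i, |M.dd a u i (x + q • a)|) (fun _ _ => rfl)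
    (fun _ _ _ => rfl) (fun i => integral_nonneg fun _ => abs_nonneg _)
    (fun i r hr t ht => M.abs_sub_le_integral_trace (hu i) (hw i) hr ht) h0
    (show t ∈ M.trace a x j from ⟨ht, hj⟩)
  simp only [zero_smul, add_zero] at hmain
  refine (ENNReal.ofReal_le_ofReal hmain).trans ?_
  rw [ENNReal.ofReal_add (Finset.sum_nonneg fun i _ => integral_nonneg fun _ => abs_nonneg _)
    (Finset.sum_nonneg fun e _ => M.lineJump_nonneg _ _ _ _),
    ENNReal.ofReal_sum_of_nonneg fun i _ => integral_nonneg fun _ => abs_nonneg _,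
    ENNReal.ofReal_sum_of_nonneg fun e _ => M.lineJump_nonneg _ _ _ _, lineBound,
    hxdef, cross_oblique, ← hxdef]
  refine add_le_add_left ?_ _
  have h1 : ∀ i, ENNReal.ofReal (∫ q in M.trace a x i, |M.dd a u i (x + q • a)|) ≤
      ∫⁻ q : ℝ, (M.cell i).indicator (fun y => ENNReal.ofReal |M.dd a u i y|) (x + q • a) := by
    intro i
    have hcont : ContinuousOn (fun q : ℝ => M.dd a u i (x + q • a)) (M.trace a x i) :=
      (hw i).comp (by fun_prop) fun q hq => hq.2
    rw [ofReal_integral_eq_lintegral_ofReal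
      (hcont.abs.integrableOn_compact (M.isCompact_trace a x i))
      (Filter.Eventually.of_forall fun q => abs_nonneg _),
      ← lintegral_indicator (M.isClosed_trace a x i).measurableSet]
    refine lintegral_mono fun q => ?_
    by_cases hq : q ∈ M.trace a x i
    · rw [Set.indicator_of_mem hq,
        Set.indicator_of_mem (show x + q • a ∈ M.cell i from hq.2)]
    · rw [Set.indicator_of_notMem hq]; exact zero_le
  refine (Finset.sum_le_sum fun i _ => h1 i).trans ?_
  have hm : ∀ i ∈ Finset.univ, Measurable fun q : ℝ =>
      (M.cell i).indicator (fun y => ENNReal.ofReal |M.dd a u i y|) (x + q • a) := fun i _ =>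
    (M.measurable_indicator_cell (hw i)).comp (by fun_prop)
  rw [← lintegral_finsetSum _ hm]
  have h2 : ∀ q : ℝ, x + q • a = (α + q) • a + β • b := by intro q; rw [hxdef]; module
  simp_rw [h2]
  exact (lintegral_add_left_eq_self (fun q : ℝ => M.cellSum (M.dd a u) (q • a + β • b)) α).le

end Mesh
end PrestrainedPlate

/-! ### The broken Sobolev inequality from BV to `L²`. -/

namespace PrestrainedPlate

open scoped ENNReal

namespace Mesh

variable {s : CellShape} {Ω : Set Plane} (M : Mesh s Ω)

/-! ### Comparison of piecewise functions -/

theorem lintegral_cellSum_le_sum {κ : Type*} (T : Finset κ) {f : Fin M.N → Plane → ℝ}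
    {g : κ → Fin M.N → Plane → ℝ} (hg : ∀ k ∈ T, ∀ i, ContinuousOn (g k i) (M.cell i)) {K : ℝ}
    (hK : 0 ≤ K) (h : ∀ i, ∀ x ∈ M.cell i, |f i x| ≤ K * ∑ k ∈ T, |g k i x|) :
    ∫⁻ x, M.cellSum f x ≤ ENNReal.ofReal K * ∑ k ∈ T, ∫⁻ x, M.cellSum (g k) x := by
  rw [← lintegral_finsetSum _ fun k hk => M.measurable_cellSum (hg k hk),
    ← lintegral_const_mul _ (Finset.measurable_fun_sum _ fun k hk => M.measurable_cellSum (hg k hk))]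
  refine lintegral_mono fun x => ?_
  simp only [cellSum]
  rw [Finset.sum_comm, Finset.mul_sum]
  refine Finset.sum_le_sum fun i _ => ?_
  by_cases hx : x ∈ M.cell i
  · simp only [Set.indicator_of_mem hx]
    rw [← ENNReal.ofReal_sum_of_nonneg fun _ _ => abs_nonneg _, ← ENNReal.ofReal_mul hK]
    exact ENNReal.ofReal_le_ofReal (h i x hx)
  · simp [Set.indicator_of_notMem hx]

theorem jumpL_le_sum {κ : Type*} (T : Finset κ) {f : Fin M.N → Plane → ℝ}
    {g : κ → Fin M.N → Plane → ℝ} (hg : ∀ k ∈ T, ∀ i, ContinuousOn (g k i) (M.cell i)) {K : ℝ}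
    (hK : 0 ≤ K) {e : M.Edge} (he : e ∈ M.edges)
    (h : ∀ x ∈ M.cell e.1, x ∈ M.cell e.2.2 → |M.jump f e x| ≤ K * ∑ k ∈ T, |M.jump (g k) e x|) :
    M.jumpL f e ≤ ENNReal.ofReal K * ∑ k ∈ T, M.jumpL (g k) e := by
  unfold jumpL
  have hm : ∀ k ∈ T, AEMeasurable (fun t : ℝ => ENNReal.ofReal
      |M.jump (g k) e (AffineMap.lineMap (M.edgeStart e) (M.edgeEnd e) t)|)
      (volume.restrict (Set.Icc (0 : ℝ) 1)) := fun k hk =>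
    (ENNReal.continuous_ofReal.comp_continuousOn
      (M.continuousOn_jump_lineMap (hg k hk) he).abs).aemeasurable measurableSet_Icc
  rw [← Finset.mul_sum, mul_left_comm, ← lintegral_finsetSum' _ hm,
    ← lintegral_const_mul'' _ (Finset.aemeasurable_fun_sum _ hm)]
  refine mul_le_mul_right (setLIntegral_mono' measurableSet_Icc fun t ht => ?_) _
  rw [← ENNReal.ofReal_sum_of_nonneg fun _ _ => abs_nonneg _, ← ENNReal.ofReal_mul hK]
  exact ENNReal.ofReal_le_ofReal (h _ (M.lineMap_mem_fst e ht) (M.lineMap_mem_snd he ht))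

theorem dd_eq_sum (a : Plane) (u : Fin M.N → Plane → ℝ) (i : Fin M.N) (x : Plane) :
    M.dd a u i x = ∑ c, a c * M.pd c u i x := by
  unfold dd pd
  have : a = ∑ c, a c • (EuclideanSpace.single c 1 : Plane) := by
    rw [Fin.sum_univ_two]; apply plane_ext <;> simp
  conv_lhs => rw [this]
  simp

theorem abs_dd_le (a : Plane) (u : Fin M.N → Plane → ℝ) (i : Fin M.N) (x : Plane) :
    |M.dd a u i x| ≤ ‖a‖ * ∑ c, |M.pd c u i x| := by
  rw [dd_eq_sum, Finset.mul_sum]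
  refine (Finset.abs_sum_le_sum_abs _ _).trans (Finset.sum_le_sum fun c _ => ?_)
  rw [abs_mul]
  gcongr
  exact abs_coord_le_norm a c

theorem contDiffOn_dd {m n : WithTop ℕ∞} {u : Fin M.N → Plane → ℝ} {i : Fin M.N}
    (hu : ContDiffOn ℝ n (u i) (M.cell i)) (hmn : m + 1 ≤ n) (a : Plane) :
    ContDiffOn ℝ m (M.dd a u i) (M.cell i) :=
  (hu.fderivWithin (M.uniqueDiffOn_cell i) hmn).clm_apply contDiffOn_const

theorem contDiffOn_pd {m n : WithTop ℕ∞} {u : Fin M.N → Plane → ℝ} {i : Fin M.N}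
    (hu : ContDiffOn ℝ n (u i) (M.cell i)) (hmn : m + 1 ≤ n) (c : Fin 2) :
    ContDiffOn ℝ m (M.pd c u i) (M.cell i) := M.contDiffOn_dd hu hmn _

/-! ### The broken Sobolev inequality -/

/-- The broken `BV` norm. -/
noncomputable def bvNorm (u : Fin M.N → Plane → ℝ) : ℝ≥0∞ :=
  (∫⁻ x, M.cellSum u x) + (∑ c, ∫⁻ x, M.cellSum (M.pd c u) x) + ∑ e ∈ M.edges, M.jumpL u e

/-- Pointwise bound on the line `{α a + β b | α}`. -/
noncomputable def pointBound (a b : Plane) (u w : Fin M.N → Plane → ℝ) (β : ℝ) : ℝ≥0∞ :=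
  (∫⁻ α : ℝ, M.cellSum u (α • a + β • b)) + M.lineBound a b u w β

/-- For each `t ∈ [0, 1]` the value at `x` is bounded by the value at `x + t a` plus the variation
along the line. Averaging over `t` replaces the unknown value by an integral along the line, so the
bound depends only on `β`. -/
theorem ofReal_le_pointBound {u : Fin M.N → Plane → ℝ}
    (hu : ∀ i, DifferentiableOn ℝ (u i) (M.cell i)) {a b : Plane}
    (hw : ∀ i, ContinuousOn (M.dd a u i) (M.cell i)) {α β : ℝ}
    (hx : M.GoodLine a (α • a + β • b))
    (hin : ∀ t ∈ Set.Icc (0 : ℝ) 1, α • a + β • b + t • a ∈ Ω) {i : Fin M.N}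
    (hi : α • a + β • b ∈ M.cell i) :
    ENNReal.ofReal |u i (α • a + β • b)| ≤ M.pointBound a b u (M.dd a u) β := by
  set x := α • a + β • b with hxdef
  have h1 : ∀ t ∈ Set.Icc (0 : ℝ) 1, ENNReal.ofReal |u i x| ≤
      M.cellSum u (x + t • a) + M.lineBound a b u (M.dd a u) β := by
    intro t ht
    have : x + t • a ∈ ⋃ i, M.cell i := M.cover.symm ▸ subset_closure (hin t ht)
    obtain ⟨j, hj⟩ := Set.mem_iUnion.1 this
    have h2 := M.ofReal_variation_le hu hw hx hin ht hi hj
    have h3 : |u i x| ≤ |u j (x + t • a)| + |u i x - u j (x + t • a)| := by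
      have := abs_add_le (u j (x + t • a)) (u i x - u j (x + t • a))
      rwa [add_sub_cancel] at this
    refine (ENNReal.ofReal_le_ofReal h3).trans (ENNReal.ofReal_add_le.trans ?_)
    exact add_le_add (M.le_cellSum u hj) h2
  have h4 : ∫⁻ _t in Set.Icc (0 : ℝ) 1, ENNReal.ofReal |u i x| ≤
      ∫⁻ t in Set.Icc (0 : ℝ) 1, (M.cellSum u (x + t • a) + M.lineBound a b u (M.dd a u) β) :=
    setLIntegral_mono' measurableSet_Icc h1
  rw [lintegral_add_right _ measurable_const, setLIntegral_const, setLIntegral_const,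
    Real.volume_Icc] at h4
  simp only [sub_zero, ENNReal.ofReal_one, mul_one] at h4
  refine h4.trans (add_le_add_left ((setLIntegral_le_lintegral _ _).trans ?_) _)
  have h2 : ∀ q : ℝ, x + q • a = (α + q) • a + β • b := by intro q; rw [hxdef]; module
  simp_rw [h2]
  exact (lintegral_add_left_eq_self (fun q : ℝ => M.cellSum u (q • a + β • b)) α).le

theorem lintegral_pointBound_le {u : Fin M.N → Plane → ℝ}
    (hu : ∀ i, ContDiffOn ℝ 1 (u i) (M.cell i)) {a b : Plane} (hab : cross a b ≠ 0) :
    ∫⁻ β : ℝ, M.pointBound a b u (M.dd a u) β ≤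
      ENNReal.ofReal ((1 + 2 * ‖a‖) / |cross a b| * (1 + ‖a‖)) * M.bvNorm u := by
  have hc : ∀ i, ContinuousOn (u i) (M.cell i) := fun i => (hu i).continuousOn
  have hw : ∀ i, ContinuousOn (M.dd a u i) (M.cell i) := fun i =>
    (M.contDiffOn_dd (m := 0) (hu i) (by norm_num) a).continuousOn
  have hp : ∀ c ∈ Finset.univ, ∀ i, ContinuousOn (M.pd c u i) (M.cell i) := fun c _ i =>
    (M.contDiffOn_pd (m := 0) (hu i) (by norm_num) c).continuousOn
  have h0 : 0 < |cross a b| := abs_pos.2 hab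
  unfold pointBound
  rw [lintegral_add_left (M.measurable_lintegral_cellSum hc a b),
    M.lintegral_lintegral_cellSum hc hab]
  have h1 := M.lintegral_lineBound_le hc hw hab
  have h2 := M.lintegral_cellSum_le_sum (f := M.dd a u) (g := fun c => M.pd c u) Finset.univ hp
    (norm_nonneg a) fun i x _ => M.abs_dd_le a u i x
  have hK : ENNReal.ofReal (1 / |cross a b|) ≤ ENNReal.ofReal ((1 + 2 * ‖a‖) / |cross a b|) := by
    gcongr; linarith [norm_nonneg a]
  rw [ENNReal.ofReal_mul (by positivity), mul_assoc]
  refine (add_le_add (mul_le_mul_left hK _) h1).trans ?_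
  rw [← mul_add]
  refine mul_le_mul_right ?_ _
  have h1a : (1 : ℝ≥0∞) ≤ ENNReal.ofReal (1 + ‖a‖) := by
    rw [← ENNReal.ofReal_one]; exact ENNReal.ofReal_le_ofReal (by linarith [norm_nonneg a])
  have h2a : ENNReal.ofReal ‖a‖ ≤ ENNReal.ofReal (1 + ‖a‖) :=
    ENNReal.ofReal_le_ofReal (by linarith)
  unfold bvNorm
  rw [mul_add, mul_add, ← add_assoc]
  refine add_le_add (add_le_add ?_ (h2.trans ?_)) ?_
  · exact le_mul_of_one_le_left zero_le h1a
  · exact mul_le_mul_left h2a _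
  · exact le_mul_of_one_le_left zero_le h1a

theorem oblique_eq {a b : Plane} (hab : cross a b ≠ 0) (x : Plane) :
    (cross x b / cross a b) • a + (cross a x / cross a b) • b = x :=
  (combo_of_cross_ne_zero hab x).symm

theorem oblique_fst {a b : Plane} (hab : cross a b ≠ 0) (α β : ℝ) :
    cross (α • a + β • b) b / cross a b = α := by
  rw [div_eq_iff hab]; simp [cross]; ring

theorem oblique_snd {a b : Plane} (hab : cross a b ≠ 0) (α β : ℝ) :
    cross a (α • a + β • b) / cross a b = β := by
  rw [div_eq_iff hab]; simp [cross]; ring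

theorem lintegral_oblique_mul {a b : Plane} (hab : cross a b ≠ 0) {G F : ℝ → ℝ≥0∞}
    (hG : Measurable G) (hF : Measurable F) :
    ∫⁻ x : Plane, G (cross a x / cross a b) * F (cross x b / cross a b) =
      ENNReal.ofReal |cross a b| * ((∫⁻ β, G β) * ∫⁻ α, F α) := by
  have h1 : Measurable fun x : Plane => cross a x / cross a b :=
    (by fun_prop : Continuous fun x : Plane => cross a x / cross a b).measurable
  have h2 : Measurable fun x : Plane => cross x b / cross a b :=
    (by fun_prop : Continuous fun x : Plane => cross x b / cross a b).measurable
  rw [lintegral_oblique hab (F := fun x => G (cross a x / cross a b) * F (cross x b / cross a b))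
    ((hG.comp h1).mul (hF.comp h2))]
  simp_rw [oblique_fst hab, oblique_snd hab, lintegral_const_mul _ hF, lintegral_mul_const _ hG]

end Mesh

open Mesh

theorem ne_zero_of_cross {a b : Plane} (h : cross a b ≠ 0) : a ≠ 0 ∧ b ≠ 0 := by
  constructor
  · rintro rfl; simp [cross] at h
  · rintro rfl; simp [cross] at h

/-- Broken Sobolev inequality `‖u‖_{L²} ≤ C ‖u‖_{BV}`, with a constant depending on the domain. -/
theorem IsPolygonalDomain.exists_sobolev {Ω : Set Plane} (hΩ : IsPolygonalDomain Ω) :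
    ∃ C : ℝ, 0 ≤ C ∧ ∀ (s : CellShape) (M : Mesh s Ω) (u : Fin M.N → Plane → ℝ),
      (∀ i, ContDiffOn ℝ 1 (u i) (M.cell i)) →
      ∫⁻ x, M.cellSum (fun i x => u i x ^ 2) x ≤ ENNReal.ofReal C * M.bvNorm u ^ 2 := by
  obtain ⟨S, hS, hcone⟩ := hΩ.exists_cones
  let K : Plane → Plane → ℝ := fun a b => (1 + 2 * ‖a‖) / |cross a b| * (1 + ‖a‖)
  have hK0 : ∀ a b, 0 ≤ K a b := fun a b => by positivity
  refine ⟨∑ p ∈ S, |cross p.1 p.2| * (K p.1 p.2 * K p.2 p.1),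
    Finset.sum_nonneg fun p _ => mul_nonneg (abs_nonneg _) (mul_nonneg (hK0 _ _) (hK0 _ _)), ?_⟩
  intro s M u hu
  have hd : ∀ i, DifferentiableOn ℝ (u i) (M.cell i) := fun i => (hu i).differentiableOn (by norm_num)
  have hc : ∀ i, ContinuousOn (u i) (M.cell i) := fun i => (hu i).continuousOn
  have hw : ∀ a i, ContinuousOn (M.dd a u i) (M.cell i) := fun a i =>
    (M.contDiffOn_dd (m := 0) (hu i) (by norm_num) a).continuousOn
  have hmeas : ∀ a b, Measurable (M.pointBound a b u (M.dd a u)) := fun a b =>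
    (M.measurable_lintegral_cellSum hc a b).add (M.measurable_lineBound hc (hw a) a b)
  -- Gagliardo–Nirenberg: at a point with cone `p`, the square is bounded by the product of the two
  -- line bounds. The bound along `p.1` depends only on the coordinate transversal to `p.1`, the
  -- other one only on the coordinate transversal to `p.2`, so the integral of the product
  -- factorizes. Summation over all pairs makes the majorant independent of the cone valid at the
  -- point.
  set H : Plane → ℝ≥0∞ := fun x => ∑ p ∈ S,
    M.pointBound p.1 p.2 u (M.dd p.1 u) (cross p.1 x / cross p.1 p.2) *
      M.pointBound p.2 p.1 u (M.dd p.2 u) (cross x p.2 / cross p.1 p.2) with hH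
  have hgood : ∀ᵐ x : Plane, ∀ p ∈ S, M.GoodLine p.1 x ∧ M.GoodLine p.2 x := by
    rw [Filter.eventually_all_finset]
    intro p hp
    exact (M.ae_goodLine (ne_zero_of_cross (hS p hp)).1).and
      (M.ae_goodLine (ne_zero_of_cross (hS p hp)).2)
  have hle : ∫⁻ x, M.cellSum (fun i x => u i x ^ 2) x ≤ ∫⁻ x, H x := by
    refine M.lintegral_cellSum_le _ ?_
    filter_upwards [hgood] with x hx i hi
    obtain ⟨p, hp, hpc⟩ := hcone x (M.interior_cell_subset hΩ i hi)
    obtain ⟨hg1, hg2⟩ := hx p hp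
    have hab := hS p hp
    have hba : cross p.2 p.1 ≠ 0 := by rw [cross_swap]; exact neg_ne_zero.2 hab
    have e := oblique_eq hab x
    have e' : (cross p.1 x / cross p.1 p.2) • p.2 + (cross x p.2 / cross p.1 p.2) • p.1 = x := by
      rw [add_comm]; exact e
    have h1 := M.ofReal_le_pointBound (b := p.2) (α := cross x p.2 / cross p.1 p.2)
      (β := cross p.1 x / cross p.1 p.2) hd (hw p.1) (by rw [e]; exact hg1)
      (by rw [e]; exact fun t ht => (hpc t ht).1) (by rw [e]; exact interior_subset hi)
    have h2 := M.ofReal_le_pointBound (b := p.1) (α := cross p.1 x / cross p.1 p.2)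
      (β := cross x p.2 / cross p.1 p.2) hd (hw p.2) (by rw [e']; exact hg2)
      (by rw [e']; exact fun t ht => (hpc t ht).2) (by rw [e']; exact interior_subset hi)
    rw [e] at h1
    rw [e'] at h2
    have h3 : ENNReal.ofReal |u i x ^ 2| = ENNReal.ofReal |u i x| * ENNReal.ofReal |u i x| := by
      rw [← ENNReal.ofReal_mul (abs_nonneg _), abs_pow, sq]
    rw [h3]
    exact (mul_le_mul' h1 h2).trans (Finset.single_le_sum (f := fun p : Plane × Plane =>
      M.pointBound p.1 p.2 u (M.dd p.1 u) (cross p.1 x / cross p.1 p.2) *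
      M.pointBound p.2 p.1 u (M.dd p.2 u) (cross x p.2 / cross p.1 p.2)) (fun _ _ => zero_le) hp)
  refine hle.trans ?_
  have hHm : ∀ p ∈ S, Measurable fun x : Plane =>
      M.pointBound p.1 p.2 u (M.dd p.1 u) (cross p.1 x / cross p.1 p.2) *
      M.pointBound p.2 p.1 u (M.dd p.2 u) (cross x p.2 / cross p.1 p.2) := fun p _ =>
    ((hmeas _ _).comp (by fun_prop : Continuous fun x : Plane => cross p.1 x / cross p.1 p.2).measurable).mul
      ((hmeas _ _).comp (by fun_prop : Continuous fun x : Plane => cross x p.2 / cross p.1 p.2).measurable)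
  rw [hH, lintegral_finsetSum _ hHm, ENNReal.ofReal_sum_of_nonneg fun p _ =>
    mul_nonneg (abs_nonneg _) (mul_nonneg (hK0 _ _) (hK0 _ _)), Finset.sum_mul]
  refine Finset.sum_le_sum fun p hp => ?_
  have hab := hS p hp
  have hba : cross p.2 p.1 ≠ 0 := by rw [cross_swap]; exact neg_ne_zero.2 hab
  rw [lintegral_oblique_mul hab (hmeas _ _) (hmeas _ _), ENNReal.ofReal_mul (abs_nonneg _),
    ENNReal.ofReal_mul (hK0 _ _), mul_assoc]
  refine mul_le_mul_right ?_ _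
  calc _ ≤ (ENNReal.ofReal (K p.1 p.2) * M.bvNorm u) * (ENNReal.ofReal (K p.2 p.1) * M.bvNorm u) :=
        mul_le_mul' (M.lintegral_pointBound_le hu hab) (M.lintegral_pointBound_le hu hba)
    _ = _ := by ring

end PrestrainedPlate

/-! ### The broken interpolation inequality for the gradient. -/

namespace PrestrainedPlate

open scoped ENNReal

namespace Mesh

variable {s : CellShape} {Ω : Set Plane} (M : Mesh s Ω)

/-! ### Interpolation: the broken gradient is controlled by the function and its Hessian -/

/-- Bound, on the line `{α a + β b | α}`, for the deviation of `v` from an affine function. -/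
noncomputable def hessBound (a b : Plane) (v : Fin M.N → Plane → ℝ) (β : ℝ) : ℝ≥0∞ :=
  M.lineBound a b (M.dd a v) (M.dd a (M.dd a v)) β +
    ∑ e ∈ M.edges, ENNReal.ofReal (M.lineJump a v e (β * cross a b))

/-- Let `c` be the derivative at `x` in direction `a`. Along the segment the derivative stays within
`W` of `c`, so `v (x + t a) - t c` varies by at most `W` plus the jumps of `v`, the traces having
total length at most one. Comparison of `t = 0` with `t = 1` bounds `c` by the two values of `v` and
these quantities. -/
theorem ofReal_dd_le {v : Fin M.N → Plane → ℝ} (hv : ∀ i, ContDiffOn ℝ 2 (v i) (M.cell i))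
    {a b : Plane} (ha : a ≠ 0) {α β : ℝ} (hx : M.GoodLine a (α • a + β • b))
    (hin : ∀ t ∈ Set.Icc (0 : ℝ) 1, α • a + β • b + t • a ∈ Ω) {i : Fin M.N}
    (hi : α • a + β • b ∈ M.cell i) :
    ENNReal.ofReal |M.dd a v i (α • a + β • b)| ≤
      M.cellSum v (α • a + β • b + a) + M.cellSum v (α • a + β • b) + M.hessBound a b v β := by
  set x := α • a + β • b with hxdef
  have hdv : ∀ i, DifferentiableOn ℝ (v i) (M.cell i) := fun i => (hv i).differentiableOn (by norm_num)
  have hw1 : ∀ i, ContDiffOn ℝ 1 (M.dd a v i) (M.cell i) := fun i =>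
    M.contDiffOn_dd (hv i) (by norm_num) a
  have hdw : ∀ i, DifferentiableOn ℝ (M.dd a v i) (M.cell i) := fun i =>
    (hw1 i).differentiableOn (by norm_num)
  have hcw : ∀ i, ContinuousOn (M.dd a (M.dd a v) i) (M.cell i) := fun i =>
    (M.contDiffOn_dd (m := 0) (hw1 i) (by norm_num) a).continuousOn
  -- An infinite bound makes the claim trivial; otherwise it is a real number `W` usable in the mean
  -- value theorem.
  by_cases htop : M.lineBound a b (M.dd a v) (M.dd a (M.dd a v)) β = ⊤
  · unfold hessBound; rw [htop]; simp
  set W := (M.lineBound a b (M.dd a v) (M.dd a (M.dd a v)) β).toReal with hW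
  set c := M.dd a v i x with hc
  have hbound : ∀ k, ∀ q ∈ M.trace a x k, |M.dd a v k (x + q • a) - c| ≤ W := by
    intro k q hq
    have := M.ofReal_variation_le hdw hcw hx hin hq.1 hi hq.2
    rw [abs_sub_comm, hW]
    exact (ENNReal.ofReal_le_iff_le_toReal htop).1 this
  have h1mem : x + (1 : ℝ) • a ∈ ⋃ i, M.cell i :=
    M.cover.symm ▸ subset_closure (hin 1 (by simp))
  obtain ⟨j, hj⟩ := Set.mem_iUnion.1 h1mem
  have h0 : (0 : ℝ) ∈ M.trace a x i := ⟨by simp, by simpa using hi⟩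
  have h1 : (1 : ℝ) ∈ M.trace a x j := ⟨by simp, hj⟩
  have hW0 : 0 ≤ W := ENNReal.toReal_nonneg
  have hmain := M.segment_variation hx hin (f := fun i t => v i (x + t • a) - t * c)
    (u := fun i t => v i (x + t • a)) (v := v)
    (V := fun k => W * volume.real (M.trace a x k)) (fun _ _ => rfl)
    (fun _ _ _ => by ring) (fun k => mul_nonneg hW0 measureReal_nonneg)
    (fun k r hr t ht => M.abs_sub_mul_le_trace (hdv k) (hbound k) hr ht) h0 h1
  rw [← Finset.mul_sum] at hmain
  have hsum := M.sum_volume_trace_le ha hx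
  simp only [zero_smul, add_zero, one_smul, zero_mul, sub_zero, one_mul] at hmain
  rw [one_smul] at hj
  set L := ∑ e ∈ M.edges, M.lineJump a v e (cross a x) with hL
  have hL0 : 0 ≤ L := Finset.sum_nonneg fun e _ => M.lineJump_nonneg _ _ _ _
  have hcle : |c| ≤ |v j (x + a)| + |v i x| + (W + L) := by
    have e1 : c = v j (x + a) - v i x + (v i x - (v j (x + a) - c)) := by ring
    have e2 : W * ∑ k, volume.real (M.trace a x k) ≤ W := by nlinarith
    calc |c| = |v j (x + a) - v i x + (v i x - (v j (x + a) - c))| := by rw [← e1]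
      _ ≤ |v j (x + a) - v i x| + |v i x - (v j (x + a) - c)| := abs_add_le _ _
      _ ≤ |v j (x + a)| + |v i x| + (W + L) := by
        have := abs_sub (v j (x + a)) (v i x)
        linarith
  refine (ENNReal.ofReal_le_ofReal hcle).trans ?_
  rw [ENNReal.ofReal_add (by positivity) (by positivity),
    ENNReal.ofReal_add (by positivity) (by positivity), ENNReal.ofReal_add hW0 hL0, hW,
    ENNReal.ofReal_toReal htop, hL, ENNReal.ofReal_sum_of_nonneg fun e _ => M.lineJump_nonneg _ _ _ _,
    hessBound, hxdef, cross_oblique, ← hxdef]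
  exact add_le_add (add_le_add (M.le_cellSum v hj) (M.le_cellSum v hi)) le_rfl

/-- The right hand side of the interpolation inequality. -/
noncomputable def hessNorm (v : Fin M.N → Plane → ℝ) : ℝ≥0∞ :=
  (∫⁻ x, M.cellSum v x) + (∑ c, ∑ d, ∫⁻ x, M.cellSum (M.pd d (M.pd c v)) x) +
    (∑ e ∈ M.edges, M.jumpL v e) + ∑ c, ∑ e ∈ M.edges, M.jumpL (M.pd c v) e

theorem pd_dd {v : Fin M.N → Plane → ℝ} (hv : ∀ i, ContDiffOn ℝ 2 (v i) (M.cell i)) (a : Plane)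
    (d : Fin 2) {i : Fin M.N} {x : Plane} (hx : x ∈ M.cell i) :
    M.pd d (M.dd a v) i x = ∑ c, a c * M.pd d (M.pd c v) i x := by
  have hd : ∀ c, DifferentiableWithinAt ℝ (M.pd c v i) (M.cell i) x := fun c =>
    ((M.contDiffOn_pd (m := 1) (hv i) (by norm_num) c).differentiableOn (by norm_num)) x hx
  have e : M.dd a v i = fun y => a 0 * M.pd 0 v i y + a 1 * M.pd 1 v i y := by
    funext y; rw [dd_eq_sum, Fin.sum_univ_two]
  have hu := M.uniqueDiffOn_cell i x hx
  rw [Fin.sum_univ_two]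
  conv_lhs => unfold pd
  rw [e, fderivWithin_fun_add hu ((hd 0).const_mul _) ((hd 1).const_mul _),
    fderivWithin_const_mul hu, fderivWithin_const_mul hu]
  · rfl
  · exact hd 1
  · exact hd 0

theorem lintegral_hessBound_le {v : Fin M.N → Plane → ℝ}
    (hv : ∀ i, ContDiffOn ℝ 2 (v i) (M.cell i)) {a b : Plane} (hab : cross a b ≠ 0) :
    ∫⁻ β : ℝ, M.hessBound a b v β ≤
      ENNReal.ofReal ((1 + 2 * ‖a‖) / |cross a b| * (1 + ‖a‖) ^ 2) * M.hessNorm v := by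
  have hcv : ∀ i, ContinuousOn (v i) (M.cell i) := fun i => (hv i).continuousOn
  have hw1 : ∀ i, ContDiffOn ℝ 1 (M.dd a v i) (M.cell i) := fun i =>
    M.contDiffOn_dd (hv i) (by norm_num) a
  have hcw : ∀ i, ContinuousOn (M.dd a v i) (M.cell i) := fun i => (hw1 i).continuousOn
  have hcw' : ∀ i, ContinuousOn (M.dd a (M.dd a v) i) (M.cell i) := fun i =>
    (M.contDiffOn_dd (m := 0) (hw1 i) (by norm_num) a).continuousOn
  have hp1 : ∀ c i, ContDiffOn ℝ 1 (M.pd c v i) (M.cell i) := fun c i =>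
    M.contDiffOn_pd (hv i) (by norm_num) c
  have hp2 : ∀ c d i, ContinuousOn (M.pd d (M.pd c v) i) (M.cell i) := fun c d i =>
    (M.contDiffOn_pd (m := 0) (hp1 c i) (by norm_num) d).continuousOn
  have h0 : 0 < |cross a b| := abs_pos.2 hab
  have hna := norm_nonneg a
  unfold hessBound
  rw [lintegral_add_left (M.measurable_lineBound hcw hcw' a b)]
  have h1 := M.lintegral_lineBound_le hcw hcw' hab
  have h2 := M.lintegral_sum_lineJump_le hcv hab
  have h3 : ∫⁻ x, M.cellSum (M.dd a (M.dd a v)) x ≤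
      ENNReal.ofReal ((1 + ‖a‖) ^ 2) * ∑ c, ∑ d, ∫⁻ x, M.cellSum (M.pd d (M.pd c v)) x := by
    rw [← Finset.sum_product']
    refine M.lintegral_cellSum_le_sum (g := fun p : Fin 2 × Fin 2 => M.pd p.2 (M.pd p.1 v))
      (Finset.univ ×ˢ Finset.univ) (fun p _ => hp2 _ _) (by positivity) fun i x hx => ?_
    have e1 := M.abs_dd_le a (M.dd a v) i x
    have e2 : ∀ d, |M.pd d (M.dd a v) i x| ≤ ‖a‖ * ∑ c, |M.pd d (M.pd c v) i x| := by
      intro d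
      rw [M.pd_dd hv a d hx, Finset.mul_sum]
      refine (Finset.abs_sum_le_sum_abs _ _).trans (Finset.sum_le_sum fun c _ => ?_)
      rw [abs_mul]
      gcongr
      exact abs_coord_le_norm a c
    rw [Finset.sum_product, Finset.sum_comm]
    calc |M.dd a (M.dd a v) i x| ≤ ‖a‖ * ∑ d, (‖a‖ * ∑ c, |M.pd d (M.pd c v) i x|) :=
          e1.trans (by gcongr with d; exact e2 d)
      _ = ‖a‖ ^ 2 * ∑ d, ∑ c, |M.pd d (M.pd c v) i x| := by
          rw [← Finset.mul_sum]; ring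
      _ ≤ _ := by
          gcongr
          linarith
  have h4 : ∑ e ∈ M.edges, M.jumpL (M.dd a v) e ≤
      ENNReal.ofReal ((1 + ‖a‖) ^ 2) * ∑ c, ∑ e ∈ M.edges, M.jumpL (M.pd c v) e := by
    rw [Finset.sum_comm, Finset.mul_sum]
    refine Finset.sum_le_sum fun e he => ?_
    refine M.jumpL_le_sum (g := fun c => M.pd c v) Finset.univ (fun c _ i => (hp1 c i).continuousOn)
      (by positivity) he fun x _ _ => ?_
    have e1 : M.jump (M.dd a v) e x = ∑ c, a c * M.jump (M.pd c v) e x := by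
      unfold jump; rw [dd_eq_sum, dd_eq_sum, ← Finset.sum_sub_distrib]
      exact Finset.sum_congr rfl fun c _ => by ring
    rw [e1, Finset.mul_sum]
    refine (Finset.abs_sum_le_sum_abs _ _).trans (Finset.sum_le_sum fun c _ => ?_)
    rw [abs_mul]
    gcongr
    refine (abs_coord_le_norm a c).trans ?_
    nlinarith
  have hK2 : ENNReal.ofReal (2 * ‖a‖ / |cross a b|) ≤ ENNReal.ofReal ((1 + 2 * ‖a‖) / |cross a b|) := by
    gcongr; linarith
  rw [ENNReal.ofReal_mul (by positivity), mul_assoc]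
  refine (add_le_add h1 (h2.trans (mul_le_mul_left hK2 _))).trans ?_
  rw [← mul_add]
  refine mul_le_mul_right ?_ _
  unfold hessNorm
  have h1a : (1 : ℝ≥0∞) ≤ ENNReal.ofReal ((1 + ‖a‖) ^ 2) := by
    rw [← ENNReal.ofReal_one]; exact ENNReal.ofReal_le_ofReal (by nlinarith)
  calc _ ≤ ENNReal.ofReal ((1 + ‖a‖) ^ 2) * (∑ c, ∑ d, ∫⁻ x, M.cellSum (M.pd d (M.pd c v)) x) +
        ENNReal.ofReal ((1 + ‖a‖) ^ 2) * ∑ c, ∑ e ∈ M.edges, M.jumpL (M.pd c v) e +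
        ENNReal.ofReal ((1 + ‖a‖) ^ 2) * ∑ e ∈ M.edges, M.jumpL v e :=
        add_le_add (add_le_add h3 h4) (le_mul_of_one_le_left zero_le h1a)
    _ = ENNReal.ofReal ((1 + ‖a‖) ^ 2) * ((∑ c, ∑ d, ∫⁻ x, M.cellSum (M.pd d (M.pd c v)) x) +
        (∑ e ∈ M.edges, M.jumpL v e) + ∑ c, ∑ e ∈ M.edges, M.jumpL (M.pd c v) e) := by ring
    _ ≤ _ := by
      gcongr
      exact le_add_left le_rfl

theorem measurable_hessBound {v : Fin M.N → Plane → ℝ}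
    (hv : ∀ i, ContDiffOn ℝ 2 (v i) (M.cell i)) (a b : Plane) : Measurable (M.hessBound a b v) := by
  have hw1 : ∀ i, ContDiffOn ℝ 1 (M.dd a v i) (M.cell i) := fun i =>
    M.contDiffOn_dd (hv i) (by norm_num) a
  exact (M.measurable_lineBound (fun i => (hw1 i).continuousOn) (fun i =>
    (M.contDiffOn_dd (m := 0) (hw1 i) (by norm_num) a).continuousOn) a b).add
    (M.measurable_sum_lineJump (fun i => (hv i).continuousOn) a _)

/-- Integrable majorant of the derivative in direction `a` on the part of the domain where the cone
directions are `a` and `b`. -/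
noncomputable def dirBound (a b : Plane) (v : Fin M.N → Plane → ℝ) (x : Plane) : ℝ≥0∞ :=
  M.cellSum v (x + a) + M.cellSum v x +
    Ω.indicator (fun x => M.hessBound a b v (cross a x / cross a b)) x

theorem measurable_dirBound (hΩ : MeasurableSet Ω) {v : Fin M.N → Plane → ℝ}
    (hv : ∀ i, ContDiffOn ℝ 2 (v i) (M.cell i)) (a b : Plane) : Measurable (M.dirBound a b v) := by
  have hm := M.measurable_cellSum fun i => (hv i).continuousOn
  refine ((hm.comp (by fun_prop)).add hm).add ?_
  exact Measurable.indicator ((M.measurable_hessBound hv a b).comp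
    (by fun_prop : Continuous fun x : Plane => cross a x / cross a b).measurable) hΩ

/-- `hessBound` is constant on lines in direction `a`, so its integral is finite only because `Ω` is
bounded: inside `Ω` the coordinate along `a` is confined to `[-R, R]`. -/
theorem lintegral_dirBound_le (hΩm : MeasurableSet Ω) {ρ : ℝ} (hρ : Ω ⊆ Metric.closedBall 0 ρ)
    {v : Fin M.N → Plane → ℝ} (hv : ∀ i, ContDiffOn ℝ 2 (v i) (M.cell i)) {a b : Plane}
    (hab : cross a b ≠ 0) :
    ∫⁻ x, M.dirBound a b v x ≤ ENNReal.ofReal (2 + 4 * |ρ| * ‖b‖ *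
      ((1 + 2 * ‖a‖) / |cross a b| * (1 + ‖a‖) ^ 2)) * M.hessNorm v := by
  have hm := M.measurable_cellSum fun i => (hv i).continuousOn
  have hmh := M.measurable_hessBound hv a b
  have h0 : 0 < |cross a b| := abs_pos.2 hab
  have hind : Measurable (Ω.indicator fun x => M.hessBound a b v (cross a x / cross a b)) :=
    Measurable.indicator (hmh.comp
      (by fun_prop : Continuous fun x : Plane => cross a x / cross a b).measurable) hΩm
  have e1 : ∫⁻ x, M.dirBound a b v x = (∫⁻ x, M.cellSum v (x + a)) + (∫⁻ x, M.cellSum v x) +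
      ∫⁻ x, Ω.indicator (fun x => M.hessBound a b v (cross a x / cross a b)) x := by
    unfold dirBound
    rw [lintegral_add_right _ hind, lintegral_add_right _ hm]
  have e2 : ∫⁻ x, M.cellSum v (x + a) = ∫⁻ x, M.cellSum v x :=
    lintegral_add_right_eq_self (fun x => M.cellSum v x) a
  set R : ℝ := 2 * |ρ| * ‖b‖ / |cross a b| with hR
  have hR0 : 0 ≤ R := by positivity
  have e3 : ∫⁻ x, Ω.indicator (fun x => M.hessBound a b v (cross a x / cross a b)) x ≤
      ENNReal.ofReal (4 * |ρ| * ‖b‖) * ∫⁻ β, M.hessBound a b v β := by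
    rw [lintegral_oblique hab hind]
    have h1 : ∀ β : ℝ, ∫⁻ α : ℝ, Ω.indicator (fun x => M.hessBound a b v (cross a x / cross a b))
        (α • a + β • b) ≤ M.hessBound a b v β * ENNReal.ofReal (2 * R) := by
      intro β
      have h2 : ∀ α : ℝ, Ω.indicator (fun x => M.hessBound a b v (cross a x / cross a b))
          (α • a + β • b) ≤ (Set.Icc (-R) R).indicator (fun _ => M.hessBound a b v β) α := by
        intro α
        by_cases hx : α • a + β • b ∈ Ω
        · have hα : α ∈ Set.Icc (-R) R := by
            refine abs_le.1 ?_
            rw [← oblique_fst hab α β, abs_div, hR]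
            gcongr
            refine (abs_cross_le _ _).trans ?_
            gcongr
            exact (mem_closedBall_zero_iff.1 (hρ hx)).trans (le_abs_self ρ)
          rw [Set.indicator_of_mem hx, Set.indicator_of_mem hα, oblique_snd hab]
        · rw [Set.indicator_of_notMem hx]; exact zero_le
      refine (lintegral_mono h2).trans ?_
      rw [lintegral_indicator measurableSet_Icc, setLIntegral_const, Real.volume_Icc]
      refine le_of_eq ?_
      congr 2; ring
    refine (mul_le_mul_right (lintegral_mono h1) _).trans ?_
    rw [lintegral_mul_const _ hmh, mul_comm (∫⁻ β, _), ← mul_assoc,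
      ← ENNReal.ofReal_mul (abs_nonneg _)]
    refine le_of_eq ?_
    congr 2
    rw [hR]; field_simp; ring
  have e4 := M.lintegral_hessBound_le hv hab
  have e5 : ∫⁻ x, M.cellSum v x ≤ M.hessNorm v := by
    unfold hessNorm; rw [add_assoc, add_assoc]; exact le_add_right le_rfl
  rw [e1, e2, ENNReal.ofReal_add (by norm_num) (by positivity), ENNReal.ofReal_mul (by positivity),
    add_mul]
  refine add_le_add ?_ (e3.trans ?_)
  · have : ENNReal.ofReal 2 = 2 := by norm_num
    rw [this, two_mul]; exact add_le_add e5 e5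
  · rw [mul_assoc (ENNReal.ofReal _)]
    exact mul_le_mul_right e4 _

theorem pd_eq_combo {a b : Plane} (hab : cross a b ≠ 0) (v : Fin M.N → Plane → ℝ) (c : Fin 2)
    (i : Fin M.N) (x : Plane) :
    |M.pd c v i x| ≤ 2 * (‖a‖ + ‖b‖) / |cross a b| * (|M.dd a v i x| + |M.dd b v i x|) := by
  have h0 : 0 < |cross a b| := abs_pos.2 hab
  have h := combo_of_cross_ne_zero hab (EuclideanSpace.single c 1 : Plane)
  have hn : ‖(EuclideanSpace.single c 1 : Plane)‖ = 1 := by simp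
  unfold pd
  conv_lhs => rw [h]
  rw [map_add, map_smul, map_smul, smul_eq_mul, smul_eq_mul]
  refine (abs_add_le _ _).trans ?_
  rw [abs_mul, abs_mul, mul_add]
  refine add_le_add (mul_le_mul_of_nonneg_right ?_ (abs_nonneg _))
    (mul_le_mul_of_nonneg_right ?_ (abs_nonneg _))
  · rw [abs_div]
    gcongr
    refine (abs_cross_le _ _).trans ?_
    rw [hn]; linarith [norm_nonneg a]
  · rw [abs_div]
    gcongr
    refine (abs_cross_le _ _).trans ?_
    rw [hn]; linarith [norm_nonneg b]

end Mesh

open Mesh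

/-- Interpolation inequality: the `L¹` norm of the broken gradient is controlled by the function, its
broken Hessian and the jumps, with a constant depending on the domain. -/
theorem IsPolygonalDomain.exists_interpolation {Ω : Set Plane} (hΩ : IsPolygonalDomain Ω) :
    ∃ C : ℝ, 0 ≤ C ∧ ∀ (s : CellShape) (M : Mesh s Ω) (v : Fin M.N → Plane → ℝ),
      (∀ i, ContDiffOn ℝ 2 (v i) (M.cell i)) → ∀ c,
      ∫⁻ x, M.cellSum (M.pd c v) x ≤ ENNReal.ofReal C * M.hessNorm v := by
  obtain ⟨S, hS, hcone⟩ := hΩ.exists_cones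
  have hΩm : MeasurableSet Ω := hΩ.1.measurableSet
  obtain ⟨ρ, hρ⟩ := hΩ.2.1.subset_closedBall 0
  let Q : Plane → Plane → ℝ := fun a b => 2 * (‖a‖ + ‖b‖) / |cross a b|
  let K : Plane → Plane → ℝ := fun a b => 2 + 4 * |ρ| * ‖b‖ *
      ((1 + 2 * ‖a‖) / |cross a b| * (1 + ‖a‖) ^ 2)
  have hQ0 : ∀ a b, 0 ≤ Q a b := fun a b => by positivity
  have hK0 : ∀ a b, 0 ≤ K a b := fun a b => by positivity
  refine ⟨∑ p ∈ S, Q p.1 p.2 * (K p.1 p.2 + K p.2 p.1),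
    Finset.sum_nonneg fun p _ => mul_nonneg (hQ0 _ _) (add_nonneg (hK0 _ _) (hK0 _ _)), ?_⟩
  intro s M v hv c
  set H : Plane → ℝ≥0∞ := fun x => ∑ p ∈ S, ENNReal.ofReal (Q p.1 p.2) *
    (M.dirBound p.1 p.2 v x + M.dirBound p.2 p.1 v x) with hH
  have hgood : ∀ᵐ x : Plane, ∀ p ∈ S, M.GoodLine p.1 x ∧ M.GoodLine p.2 x := by
    rw [Filter.eventually_all_finset]
    intro p hp
    exact (M.ae_goodLine (ne_zero_of_cross (hS p hp)).1).and
      (M.ae_goodLine (ne_zero_of_cross (hS p hp)).2)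
  have hpoint : ∀ (a b : Plane) (hab : cross a b ≠ 0) (x : Plane) (i : Fin M.N), M.GoodLine a x →
      (∀ t ∈ Set.Icc (0 : ℝ) 1, x + t • a ∈ Ω) → x ∈ M.cell i →
      ENNReal.ofReal |M.dd a v i x| ≤ M.dirBound a b v x := by
    intro a b hab x i hg hin hi
    have e := oblique_eq hab x
    have h1 := M.ofReal_dd_le (b := b) (α := cross x b / cross a b) (β := cross a x / cross a b) hv
      (ne_zero_of_cross hab).1 (by rw [e]; exact hg) (by rw [e]; exact hin) (by rw [e]; exact hi)
    rw [e] at h1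
    have hxΩ : x ∈ Ω := by simpa using hin 0 (by simp)
    rw [dirBound, Set.indicator_of_mem hxΩ]
    exact h1
  have hle : ∫⁻ x, M.cellSum (M.pd c v) x ≤ ∫⁻ x, H x := by
    refine M.lintegral_cellSum_le _ ?_
    filter_upwards [hgood] with x hx i hi
    obtain ⟨p, hp, hpc⟩ := hcone x (M.interior_cell_subset hΩ i hi)
    obtain ⟨hg1, hg2⟩ := hx p hp
    have hab := hS p hp
    have hba : cross p.2 p.1 ≠ 0 := by rw [cross_swap]; exact neg_ne_zero.2 hab
    have h1 := hpoint p.1 p.2 hab x i hg1 (fun t ht => (hpc t ht).1) (interior_subset hi)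
    have h2 := hpoint p.2 p.1 hba x i hg2 (fun t ht => (hpc t ht).2) (interior_subset hi)
    refine le_trans ?_ (Finset.single_le_sum (f := fun p : Plane × Plane => ENNReal.ofReal (Q p.1 p.2) *
      (M.dirBound p.1 p.2 v x + M.dirBound p.2 p.1 v x)) (fun _ _ => zero_le) hp)
    refine (ENNReal.ofReal_le_ofReal (M.pd_eq_combo hab v c i x)).trans ?_
    rw [ENNReal.ofReal_mul (hQ0 _ _), ENNReal.ofReal_add (abs_nonneg _) (abs_nonneg _)]
    exact mul_le_mul_right (add_le_add h1 h2) _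
  refine hle.trans ?_
  have hm : ∀ a b, Measurable (M.dirBound a b v) := M.measurable_dirBound hΩm hv
  have hHm : ∀ p ∈ S, Measurable fun x => ENNReal.ofReal (Q p.1 p.2) *
      (M.dirBound p.1 p.2 v x + M.dirBound p.2 p.1 v x) := fun p _ =>
    ((hm _ _).add (hm _ _)).const_mul _
  rw [hH, lintegral_finsetSum _ hHm,
    ENNReal.ofReal_sum_of_nonneg fun p _ => mul_nonneg (hQ0 _ _) (add_nonneg (hK0 _ _) (hK0 _ _)),
    Finset.sum_mul]
  refine Finset.sum_le_sum fun p hp => ?_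
  have hab := hS p hp
  have hba : cross p.2 p.1 ≠ 0 := by rw [cross_swap]; exact neg_ne_zero.2 hab
  have hadd : Measurable fun x => M.dirBound p.1 p.2 v x + M.dirBound p.2 p.1 v x :=
    (hm _ _).add (hm _ _)
  rw [lintegral_const_mul _ hadd, lintegral_add_left (hm _ _),
    ENNReal.ofReal_mul (hQ0 _ _), ENNReal.ofReal_add (hK0 _ _) (hK0 _ _), mul_assoc, add_mul]
  exact mul_le_mul_right (add_le_add (M.lintegral_dirBound_le hΩm hρ hv hab)
    (M.lintegral_dirBound_le hΩm hρ hv hba)) _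

end PrestrainedPlate

/-! ### Duality in finite dimension; regularity and linearity of finite element functions. -/

namespace PrestrainedPlate

/-! ### Bilinear forms on finite-dimensional spaces -/

/-- A quadratic polynomial without sign change has nonpositive discriminant. All later
Cauchy–Schwarz inequalities for integrals of piecewise functions rest on this. -/
theorem sq_le_mul_of_forall_nonneg {a b c : ℝ} (h : ∀ t : ℝ, 0 ≤ a + 2 * t * b + t ^ 2 * c) :
    b ^ 2 ≤ a * c := by
  have := discrim_le_zero (a := c) (b := 2 * b) (c := a) fun t => by
    have := h t; nlinarith
  unfold discrim at this
  nlinarith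

/-- Definiteness makes `B` injective into the dual space, which has the same dimension. Symmetry
plays no part. -/
theorem exists_representer {E : Type*} [AddCommGroup E] [Module ℝ E] [FiniteDimensional ℝ E]
    (B : LinearMap.BilinForm ℝ E) (hB : ∀ u, B u u = 0 → u = 0) (f : E →ₗ[ℝ] ℝ) :
    ∃ u, ∀ v, B u v = f v := by
  have hinj : Function.Injective (B : E →ₗ[ℝ] Module.Dual ℝ E) := by
    rw [injective_iff_map_eq_zero]
    intro u hu
    exact hB u (by rw [hu]; rfl)
  have hsurj := (LinearMap.injective_iff_surjective_of_finrank_eq_finrank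
    (Subspace.dual_finrank_eq (K := ℝ) (V := E)).symm).1 hinj
  obtain ⟨u, hu⟩ := hsurj f
  exact ⟨u, fun v => by rw [hu]⟩

/-- Cauchy–Schwarz for `B`, applied to the representer of `f`. -/
theorem exists_functional_bound {E : Type*} [AddCommGroup E] [Module ℝ E] [FiniteDimensional ℝ E]
    (B : LinearMap.BilinForm ℝ E) (hsymm : ∀ u v, B u v = B v u) (hpos : ∀ u, 0 ≤ B u u)
    (hB : ∀ u, B u u = 0 → u = 0) (f : E →ₗ[ℝ] ℝ) :
    ∃ C : ℝ, 0 ≤ C ∧ ∀ v, f v ^ 2 ≤ C * B v v := by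
  obtain ⟨u, hu⟩ := exists_representer B hB f
  refine ⟨B u u, hpos u, fun v => ?_⟩
  rw [← hu v]
  refine sq_le_mul_of_forall_nonneg fun t => ?_
  have := hpos (u + t • v)
  simp only [map_add, map_smul, LinearMap.add_apply, LinearMap.smul_apply, smul_eq_mul,
    hsymm v u] at this
  nlinarith

/-! ### Polynomials as functions on the plane -/

theorem eq_zero_of_integral_sq {K : Set Plane} (hK : Convex ℝ K) (hc : IsCompact K)
    (hi : (interior K).Nonempty) {f : Plane → ℝ} (hf : ContinuousOn f K)
    (h : ∫ x in K, f x ^ 2 = 0) {x : Plane} (hx : x ∈ K) : f x = 0 := by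
  have h2 : ContinuousOn (fun x => f x ^ 2) K := hf.pow 2
  rw [setIntegral_eq_zero_iff_of_nonneg_ae (Filter.Eventually.of_forall fun x => sq_nonneg _)
    (h2.integrableOn_compact hc)] at h
  have h3 := Measure.eqOn_of_ae_eq h h2 continuousOn_const (by
    rw [hK.closure_interior_eq_closure_of_nonempty_interior hi]; exact subset_closure)
  exact pow_eq_zero_iff two_ne_zero |>.1 (h3 hx)

noncomputable def polyEval (p : MvPolynomial (Fin 2) ℝ) (ξ : Plane) : ℝ :=
  MvPolynomial.eval (fun j => ξ j) p

theorem contDiff_polyEval {n : WithTop ℕ∞} (p : MvPolynomial (Fin 2) ℝ) :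
    ContDiff ℝ n (polyEval p) := by
  unfold polyEval
  induction p using MvPolynomial.induction_on with
  | C a => simpa using contDiff_const
  | add p q hp hq => simpa using hp.add hq
  | mul_X p j hp =>
    simp only [map_mul, MvPolynomial.eval_X]
    exact hp.mul (by fun_prop)

theorem hasFDerivAt_polyEval (p : MvPolynomial (Fin 2) ℝ) (ξ : Plane) :
    HasFDerivAt (polyEval p) (∑ j, polyEval (MvPolynomial.pderiv j p) ξ •
      (EuclideanSpace.proj j : Plane →L[ℝ] ℝ)) ξ := by
  induction p using MvPolynomial.induction_on with
  | C a =>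
    have : polyEval (MvPolynomial.C a) = fun _ => a := by funext x; simp [polyEval]
    rw [this]
    refine (hasFDerivAt_const a ξ).congr_fderiv ?_
    simp [polyEval]
  | add p q hp hq =>
    have : polyEval (p + q) = fun x => polyEval p x + polyEval q x := by
      funext x; simp [polyEval]
    rw [this]
    refine (hp.add hq).congr_fderiv ?_
    rw [← Finset.sum_add_distrib]
    refine Finset.sum_congr rfl fun j _ => ?_
    rw [← add_smul]; simp [polyEval]
  | mul_X p j hp =>
    have : polyEval (p * MvPolynomial.X j) = fun x => polyEval p x * x j := by
      funext x; simp [polyEval]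
    rw [this]
    have hj : HasFDerivAt (fun x : Plane => x j) (EuclideanSpace.proj j : Plane →L[ℝ] ℝ) ξ :=
      (EuclideanSpace.proj j : Plane →L[ℝ] ℝ).hasFDerivAt
    refine (hp.mul hj).congr_fderiv ?_
    have e : ∀ m, polyEval (MvPolynomial.pderiv m (p * MvPolynomial.X j)) ξ =
        polyEval (MvPolynomial.pderiv m p) ξ * ξ j + if m = j then polyEval p ξ else 0 := by
      intro m
      simp only [polyEval, Derivation.leibniz, smul_eq_mul, map_add, map_mul, MvPolynomial.eval_X,
        MvPolynomial.pderiv_X, Pi.single_apply]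
      split_ifs with h1 h2 h2
      · simp; ring
      · exact absurd h1.symm h2
      · exact absurd h2.symm h1
      · simp; ring
    simp only [e, add_smul, Finset.sum_add_distrib, ite_smul, zero_smul, Finset.sum_ite_eq',
      Finset.mem_univ, if_true]
    rw [add_comm, Finset.smul_sum]
    congr 1
    exact Finset.sum_congr rfl fun m _ => by rw [smul_smul, mul_comm]

theorem eq_zero_of_polyEval {s : CellShape} {p : MvPolynomial (Fin 2) ℝ}
    (h : ∀ ξ ∈ s.refCell, polyEval p ξ = 0) : p = 0 := by
  refine MvPolynomial.funext_set (fun _ => Set.Ioo (0 : ℝ) (1 / 2))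
    (fun _ => Set.Ioo_infinite (by norm_num)) fun x hx => ?_
  have := h (WithLp.toLp 2 x) (s.box_subset_refCell fun i => hx i trivial)
  simpa [polyEval] using this

/-- The `L²` product over the reference cell. -/
noncomputable def refForm (s : CellShape) (W : Submodule ℝ (MvPolynomial (Fin 2) ℝ)) :
    LinearMap.BilinForm ℝ W :=
  have hi : ∀ p q : MvPolynomial (Fin 2) ℝ,
      IntegrableOn (fun ξ => polyEval p ξ * polyEval q ξ) s.refCell := fun p q =>
    ((contDiff_polyEval (n := 0) p).continuous.mul
      (contDiff_polyEval (n := 0) q).continuous).continuousOn.integrableOn_compact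
        s.isCompact_refCell
  LinearMap.mk₂ ℝ (fun p q : W => ∫ ξ in s.refCell, polyEval p ξ * polyEval q ξ)
    (fun p q r => by
      rw [← integral_add (hi _ _) (hi _ _)]
      exact integral_congr_ae (Filter.Eventually.of_forall fun ξ => by
        simp only [polyEval, Submodule.coe_add, map_add]; ring))
    (fun c p q => by
      rw [smul_eq_mul, ← integral_const_mul]
      exact integral_congr_ae (Filter.Eventually.of_forall fun ξ => by
        simp only [polyEval, Submodule.coe_smul, MvPolynomial.smul_eval]; ring))
    (fun p q r => by
      rw [← integral_add (hi _ _) (hi _ _)]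
      exact integral_congr_ae (Filter.Eventually.of_forall fun ξ => by
        simp only [polyEval, Submodule.coe_add, map_add]; ring))
    (fun c p q => by
      rw [smul_eq_mul, ← integral_const_mul]
      exact integral_congr_ae (Filter.Eventually.of_forall fun ξ => by
        simp only [polyEval, Submodule.coe_smul, MvPolynomial.smul_eval]; ring))

theorem refForm_apply (s : CellShape) (W : Submodule ℝ (MvPolynomial (Fin 2) ℝ)) (p q : W) :
    refForm s W p q = ∫ ξ in s.refCell, polyEval p ξ * polyEval q ξ := rfl

/-- Equivalence of norms in finite dimension: the coordinates of `p` in a basis are functionals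
bounded by the `L²` norm, and the basis elements are bounded on the compact reference cell. -/
theorem exists_polyEval_bound (s : CellShape) (W : Submodule ℝ (MvPolynomial (Fin 2) ℝ))
    [FiniteDimensional ℝ W] : ∃ C : ℝ, 0 ≤ C ∧ ∀ p ∈ W, ∀ ξ ∈ s.refCell,
      polyEval p ξ ^ 2 ≤ C * ∫ ζ in s.refCell, polyEval p ζ ^ 2 := by
  let b := Module.finBasis ℝ W
  have hsymm : ∀ p q, refForm s W p q = refForm s W q p := fun p q => by
    simp only [refForm_apply, mul_comm]
  have hsq : ∀ p : W, refForm s W p p = ∫ ζ in s.refCell, polyEval p ζ ^ 2 := fun p => by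
    simp only [refForm_apply, sq]
  have hpos : ∀ p, 0 ≤ refForm s W p p := fun p => by
    rw [hsq]; exact integral_nonneg fun x => sq_nonneg _
  have hB : ∀ p, refForm s W p p = 0 → p = 0 := fun p hp => by
    rw [hsq] at hp
    refine Subtype.ext (eq_zero_of_polyEval (s := s) fun ξ hξ => ?_)
    exact eq_zero_of_integral_sq s.convex_refCell s.isCompact_refCell
      s.interior_refCell_nonempty (contDiff_polyEval (n := 0) _).continuous.continuousOn hp hξ
  choose C hC0 hC using fun i => exists_functional_bound (refForm s W) hsymm hpos hB (b.coord i)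
  have hm : ∀ i, ∃ m : ℝ, ∀ ξ ∈ s.refCell, ‖polyEval (b i) ξ‖ ≤ m := fun i =>
    s.isCompact_refCell.exists_bound_of_continuousOn
      (contDiff_polyEval (n := 0) _).continuous.continuousOn
  choose m hm using hm
  refine ⟨(∑ i, m i ^ 2) * ∑ i, C i, mul_nonneg (Finset.sum_nonneg fun _ _ => sq_nonneg _)
    (Finset.sum_nonneg fun i _ => hC0 i), fun p hp ξ hξ => ?_⟩
  have e : polyEval p ξ = ∑ i, b.coord i ⟨p, hp⟩ * polyEval (b i) ξ := by
    have := congrArg (fun q : W => polyEval (q : MvPolynomial (Fin 2) ℝ) ξ) (b.sum_repr ⟨p, hp⟩)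
    simp only [polyEval, Submodule.coe_sum, map_sum, Submodule.coe_smul,
      MvPolynomial.smul_eval] at this
    rw [polyEval, ← this]; rfl
  rw [e]
  refine (Finset.sum_mul_sq_le_sq_mul_sq _ _ _).trans ?_
  rw [mul_comm, mul_assoc]
  have h1 : ∑ i, polyEval (b i) ξ ^ 2 ≤ ∑ i, m i ^ 2 := Finset.sum_le_sum fun i _ => by
    have := hm i ξ hξ
    rw [Real.norm_eq_abs] at this
    exact sq_le_sq' (by linarith [abs_le.1 this]) (abs_le.1 this).2
  have h2 : ∑ i, b.coord i ⟨p, hp⟩ ^ 2 ≤ (∑ i, C i) * ∫ ζ in s.refCell, polyEval p ζ ^ 2 := by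
    rw [Finset.sum_mul]
    refine Finset.sum_le_sum fun i _ => (hC i _).trans_eq ?_
    rw [hsq]
  exact mul_le_mul h1 h2 (Finset.sum_nonneg fun _ _ => sq_nonneg _)
    (Finset.sum_nonneg fun _ _ => sq_nonneg _)

instance (s : CellShape) (k : ℕ) : FiniteDimensional ℝ (s.polySpace k) := by
  cases s
  · exact inferInstanceAs (Module.Finite ℝ (MvPolynomial.restrictTotalDegree (Fin 2) ℝ k))
  · exact inferInstanceAs (Module.Finite ℝ (MvPolynomial.restrictDegree (Fin 2) ℝ k))

/-! ### Regularity of finite element functions -/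

namespace Mesh

variable {s : CellShape} {Ω : Set Plane} (M : Mesh s Ω) {k : ℕ}

theorem val_eq (v : M.V k) (i : Fin M.N) (x : Plane) :
    M.val v i x = polyEval (v i) (s.refInv (M.vert i) x) := rfl

theorem val_refMap (v : M.V k) (i : Fin M.N) {ξ : Plane} (hξ : ξ ∈ s.refCell) :
    M.val v i (s.refMap (M.vert i) ξ) = polyEval (v i) ξ := by
  rw [val_eq, (M.isCell i).refInv_refMap hξ]

theorem contDiffOn_val {n : ℕ∞} (v : M.V k) (i : Fin M.N) :
    ContDiffOn ℝ n (M.val v i) (M.cell i) :=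
  (contDiff_polyEval (v i : MvPolynomial (Fin 2) ℝ)).comp_contDiffOn (M.isCell i).contDiffOn_refInv

theorem contDiffOn_pd_val {n : ℕ} (v : M.V k) (a : Fin 2) (i : Fin M.N) :
    ContDiffOn ℝ n (M.pd a (M.val v) i) (M.cell i) :=
  M.contDiffOn_pd (n := ((n + 1 : ℕ) : ℕ∞)) (M.contDiffOn_val v i) (by norm_cast) a

theorem contDiffOn_pd_pd_val {n : ℕ} (v : M.V k) (a b : Fin 2) (i : Fin M.N) :
    ContDiffOn ℝ n (M.pd a (M.pd b (M.val v)) i) (M.cell i) :=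
  M.contDiffOn_pd (n := ((n + 1 : ℕ) : WithTop ℕ∞)) (M.contDiffOn_pd_val v b i) (by norm_cast) a

theorem continuousOn_val (v : M.V k) (i : Fin M.N) : ContinuousOn (M.val v i) (M.cell i) :=
  (M.contDiffOn_val (n := 0) v i).continuousOn

theorem continuousOn_pd_val (v : M.V k) (a : Fin 2) (i : Fin M.N) :
    ContinuousOn (M.pd a (M.val v) i) (M.cell i) :=
  (M.contDiffOn_pd_val (n := 0) v a i).continuousOn

theorem continuousOn_pd_pd_val (v : M.V k) (a b : Fin 2) (i : Fin M.N) :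
    ContinuousOn (M.pd a (M.pd b (M.val v)) i) (M.cell i) :=
  (M.contDiffOn_pd_pd_val (n := 0) v a b i).continuousOn

theorem isLinearMap_val (i : Fin M.N) (x : Plane) : IsLinearMap ℝ fun v : M.V k => M.val v i x where
  map_add v w := by simp [val]
  map_smul c v := by simp [val, MvPolynomial.smul_eval]

theorem isLinearMap_pd {E : Type*} [AddCommGroup E] [Module ℝ E] {f : E → Fin M.N → Plane → ℝ}
    {i : Fin M.N} (hf : ∀ x, IsLinearMap ℝ fun v => f v i x)
    (hd : ∀ v, DifferentiableOn ℝ (f v i) (M.cell i)) (a : Fin 2) (x : Plane) :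
    IsLinearMap ℝ fun v => M.pd a (f v) i x := by
  by_cases hx : x ∈ M.cell i
  · have hu := M.uniqueDiffOn_cell i x hx
    constructor
    · intro v w
      have : f (v + w) i = fun y => f v i y + f w i y := funext fun y => (hf y).map_add v w
      simp only [pd]
      rw [this, fderivWithin_fun_add hu (hd v x hx) (hd w x hx)]
      rfl
    · intro c v
      have : f (c • v) i = fun y => c • f v i y := funext fun y => (hf y).map_smul c v
      simp only [pd]
      rw [this, fderivWithin_fun_const_smul hu (hd v x hx)]
      rfl
  -- Off the closed cell `fderivWithin` is zero. Linearity therefore holds at every point of the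
  -- plane, and bilinearity of the forms can be checked pointwise under the integrals.
  · have h0 : ∀ v, M.pd a (f v) i x = 0 := fun v => by
      rw [pd, fderivWithin_zero_of_notMem_closure (by rwa [(M.isClosed_cell i).closure_eq])]
      rfl
    exact ⟨fun v w => by simp [h0], fun c v => by simp [h0]⟩

theorem isLinearMap_pd_val (a : Fin 2) (i : Fin M.N) (x : Plane) :
    IsLinearMap ℝ fun v : M.V k => M.pd a (M.val v) i x :=
  M.isLinearMap_pd (M.isLinearMap_val i)
    (fun v => (M.contDiffOn_val (n := 1) v i).differentiableOn (by norm_num)) a x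

theorem isLinearMap_pd_pd_val (a b : Fin 2) (i : Fin M.N) (x : Plane) :
    IsLinearMap ℝ fun v : M.V k => M.pd a (M.pd b (M.val v)) i x :=
  M.isLinearMap_pd (M.isLinearMap_pd_val b i)
    (fun v => (M.contDiffOn_pd_val (n := 1) v b i).differentiableOn (by norm_num)) a x

theorem eq_zero_of_integral_val_sq {v : M.V k} (h : M.integral (fun i x => M.val v i x ^ 2) = 0) :
    v = 0 := by
  have h1 := (Finset.sum_eq_zero_iff_of_nonneg fun i _ =>
    setIntegral_nonneg (M.measurableSet_cell i) fun x _ => sq_nonneg (M.val v i x)).1 h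
  funext i
  refine Subtype.ext (eq_zero_of_polyEval (s := s) fun ξ hξ => ?_)
  rw [← M.val_refMap v i hξ]
  exact eq_zero_of_integral_sq (M.convex_cell i) (M.isCompact_cell i)
    (M.interior_cell_nonempty i) (M.continuousOn_val v i) (h1 i (Finset.mem_univ i))
    (CellShape.refMap_mem_convexHull _ hξ)

end Mesh

end PrestrainedPlate

/-! ### Calculus of piecewise integrals; the inverse inequality. -/

namespace PrestrainedPlate

/-! ### Integrals of piecewise functions -/

theorem integral_mul_sq_le {X : Type*} [MeasurableSpace X] {μ : Measure X} {f g : X → ℝ}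
    (hf : Integrable (fun x => f x ^ 2) μ) (hfg : Integrable (fun x => f x * g x) μ)
    (hg : Integrable (fun x => g x ^ 2) μ) :
    (∫ x, f x * g x ∂μ) ^ 2 ≤ (∫ x, f x ^ 2 ∂μ) * ∫ x, g x ^ 2 ∂μ := by
  refine sq_le_mul_of_forall_nonneg fun t => ?_
  have h : 0 ≤ ∫ x, (f x + t * g x) ^ 2 ∂μ := integral_nonneg fun x => sq_nonneg _
  have e : ∀ x, (f x + t * g x) ^ 2 = f x ^ 2 + 2 * t * (f x * g x) + t ^ 2 * g x ^ 2 :=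
    fun x => by ring
  simp_rw [e] at h
  have h1 : Integrable (fun x => f x ^ 2 + 2 * t * (f x * g x)) μ := hf.add (hfg.const_mul _)
  rwa [integral_add h1 (hg.const_mul _), integral_add hf (hfg.const_mul _), integral_const_mul,
    integral_const_mul] at h

theorem sq_combo_le (a b p q : ℝ) : (a * p + b * q) ^ 2 ≤ (a ^ 2 + b ^ 2) * (p ^ 2 + q ^ 2) := by
  nlinarith [sq_nonneg (a * q - b * p)]

namespace Mesh

variable {s : CellShape} {Ω : Set Plane} (M : Mesh s Ω) {k : ℕ}

def CellIntegrable (f : Fin M.N → Plane → ℝ) : Prop := ∀ i, IntegrableOn (f i) (M.cell i)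

variable {M}

theorem CellIntegrable.add {f g : Fin M.N → Plane → ℝ} (hf : M.CellIntegrable f)
    (hg : M.CellIntegrable g) : M.CellIntegrable fun i x => f i x + g i x :=
  fun i => (hf i).add (hg i)

theorem CellIntegrable.const_mul {f : Fin M.N → Plane → ℝ} (hf : M.CellIntegrable f) (c : ℝ) :
    M.CellIntegrable fun i x => c * f i x :=
  fun i => (hf i).const_mul c

theorem CellIntegrable.abs {f : Fin M.N → Plane → ℝ} (hf : M.CellIntegrable f) :
    M.CellIntegrable fun i x => |f i x| :=
  fun i => (hf i).abs

theorem CellIntegrable.sum {κ : Type*} {T : Finset κ} {f : κ → Fin M.N → Plane → ℝ}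
    (hf : ∀ j ∈ T, M.CellIntegrable (f j)) : M.CellIntegrable fun i x => ∑ j ∈ T, f j i x :=
  fun i => integrable_finsetSum T fun j hj => hf j hj i

theorem cellIntegrable_of_continuousOn {f : Fin M.N → Plane → ℝ}
    (hf : ∀ i, ContinuousOn (f i) (M.cell i)) : M.CellIntegrable f :=
  fun i => (hf i).integrableOn_compact (M.isCompact_cell i)

theorem integral_add {f g : Fin M.N → Plane → ℝ} (hf : M.CellIntegrable f)
    (hg : M.CellIntegrable g) :
    (M.integral fun i x => f i x + g i x) = M.integral f + M.integral g := by
  unfold integral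
  rw [← Finset.sum_add_distrib]
  exact Finset.sum_congr rfl fun i _ => MeasureTheory.integral_add (hf i) (hg i)

theorem integral_const_mul (c : ℝ) (f : Fin M.N → Plane → ℝ) :
    (M.integral fun i x => c * f i x) = c * M.integral f := by
  unfold integral
  rw [Finset.mul_sum]
  exact Finset.sum_congr rfl fun i _ => MeasureTheory.integral_const_mul _ _

theorem integral_sum {κ : Type*} {T : Finset κ} {f : κ → Fin M.N → Plane → ℝ}
    (hf : ∀ j ∈ T, M.CellIntegrable (f j)) :
    (M.integral fun i x => ∑ j ∈ T, f j i x) = ∑ j ∈ T, M.integral (f j) := by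
  unfold integral
  rw [Finset.sum_comm]
  exact Finset.sum_congr rfl fun i _ => MeasureTheory.integral_finsetSum T fun j hj => hf j hj i

theorem integral_mono {f g : Fin M.N → Plane → ℝ} (hf : M.CellIntegrable f)
    (hg : M.CellIntegrable g) (h : ∀ i, ∀ x ∈ M.cell i, f i x ≤ g i x) :
    M.integral f ≤ M.integral g :=
  Finset.sum_le_sum fun i _ => setIntegral_mono_on (hf i) (hg i) (M.measurableSet_cell i) (h i)

theorem integral_nonneg {f : Fin M.N → Plane → ℝ} (h : ∀ i, ∀ x ∈ M.cell i, 0 ≤ f i x) :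
    0 ≤ M.integral f :=
  Finset.sum_nonneg fun i _ => setIntegral_nonneg (M.measurableSet_cell i) (h i)

theorem integral_mul_sq_le {f g : Fin M.N → Plane → ℝ} (hf : M.CellIntegrable fun i x => f i x ^ 2)
    (hfg : M.CellIntegrable fun i x => f i x * g i x)
    (hg : M.CellIntegrable fun i x => g i x ^ 2) :
    (M.integral fun i x => f i x * g i x) ^ 2 ≤
      (M.integral fun i x => f i x ^ 2) * M.integral fun i x => g i x ^ 2 := by
  refine sq_le_mul_of_forall_nonneg fun t => ?_
  have h : 0 ≤ M.integral fun i x => (f i x + t * g i x) ^ 2 :=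
    integral_nonneg fun i x _ => sq_nonneg _
  have e : ∀ i x, (f i x + t * g i x) ^ 2 =
      f i x ^ 2 + 2 * t * (f i x * g i x) + t ^ 2 * g i x ^ 2 := fun i x => by ring
  simp_rw [e] at h
  rwa [integral_add (hf.add (hfg.const_mul _)) (hg.const_mul _),
    integral_add hf (hfg.const_mul _), integral_const_mul, integral_const_mul] at h

/-! ### Inverse inequalities -/

variable (M)

/-- The squared norm of the broken gradient of a scalar function. -/
noncomputable def gradSq (v : M.V k) (i : Fin M.N) (x : Plane) : ℝ :=
  ∑ a, M.pd a (M.val v) i x ^ 2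

theorem gradSq_nonneg (v : M.V k) (i : Fin M.N) (x : Plane) : 0 ≤ M.gradSq v i x :=
  Finset.sum_nonneg fun _ _ => sq_nonneg _

theorem continuousOn_gradSq (v : M.V k) (i : Fin M.N) : ContinuousOn (M.gradSq v i) (M.cell i) :=
  continuousOn_finsetSum _ fun a _ => (M.continuousOn_pd_val v a i).pow 2

/-- The chain rule up to the boundary. The two derivatives of `v ∘ F` coincide because derivatives
within a convex set with interior points are unique. -/
theorem polyEval_pderiv (v : M.V k) (i : Fin M.N) {ξ : Plane} (hξ : ξ ∈ s.refCell) (j : Fin 2) :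
    polyEval (MvPolynomial.pderiv j (v i : MvPolynomial (Fin 2) ℝ)) ξ =
      M.dd (s.refDeriv (M.vert i) ξ (EuclideanSpace.single j 1)) (M.val v) i
        (s.refMap (M.vert i) ξ) := by
  have hx : s.refMap (M.vert i) ξ ∈ M.cell i := CellShape.refMap_mem_convexHull _ hξ
  have h1 := ((M.contDiffOn_val (n := 1) v i).differentiableOn (by norm_num) _ hx).hasFDerivWithinAt
  have h2 := (CellShape.hasFDerivAt_refMap s (M.vert i) ξ).hasFDerivWithinAt (s := s.refCell)
  have h3 := h1.comp ξ h2 fun y hy => CellShape.refMap_mem_convexHull _ hy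
  have h4 := (hasFDerivAt_polyEval (v i : MvPolynomial (Fin 2) ℝ) ξ).hasFDerivWithinAt
    (s := s.refCell)
  have h5 := h4.congr (f₁ := M.val v i ∘ s.refMap (M.vert i)) (fun y hy => M.val_refMap v i hy)
    (M.val_refMap v i hξ)
  have hu := uniqueDiffOn_convex s.convex_refCell s.interior_refCell_nonempty ξ hξ
  have h6 := congrArg (fun L : Plane →L[ℝ] ℝ => L (EuclideanSpace.single j 1)) (hu.eq h5 h3)
  simp only [ContinuousLinearMap.comp_apply] at h6
  rw [dd, ← h6]
  fin_cases j <;> simp [Fin.sum_univ_two]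

theorem norm_refDeriv_single_le (i : Fin M.N) {ξ : Plane} (hξ : ξ ∈ s.refCell) (j : Fin 2) :
    ‖s.refDeriv (M.vert i) ξ (EuclideanSpace.single j 1)‖ ≤ 3 * Metric.diam (M.cell i) := by
  have hd : ∀ a b, ‖M.vert i a - M.vert i b‖ ≤ Metric.diam (M.cell i) := fun a b => by
    rw [← dist_eq_norm]; exact dist_le_diam_convexHull _ _ _
  have hb := CellShape.mem_refCell_bounds hξ
  have hA : ‖s.vecA (M.vert i)‖ ≤ Metric.diam (M.cell i) := by
    cases s <;> exact hd _ _
  have hB : ‖s.vecB (M.vert i)‖ ≤ Metric.diam (M.cell i) := by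
    cases s <;> exact hd _ _
  have hC : ‖s.vecC (M.vert i)‖ ≤ 2 * Metric.diam (M.cell i) := by
    cases s with
    | triangle => simpa [CellShape.vecC] using Metric.diam_nonneg
    | quadrilateral =>
      have e : CellShape.quadrilateral.vecC (M.vert i) =
          (M.vert i 0 - M.vert i 1) + (M.vert i 2 - M.vert i 3) := by
        simp only [CellShape.vecC]; abel
      rw [e]
      refine (norm_add_le _ _).trans ?_
      linarith [hd 0 1, hd 2 3]
  have hC' : ∀ t : ℝ, 0 ≤ t ∧ t ≤ 1 →
      ‖t • s.vecC (M.vert i)‖ ≤ 2 * Metric.diam (M.cell i) := fun t ht => by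
    rw [norm_smul, Real.norm_eq_abs, abs_of_nonneg ht.1]
    nlinarith [norm_nonneg (s.vecC (M.vert i))]
  rw [CellShape.refDeriv_apply]
  fin_cases j
  · simp only [CellShape.d0]
    simpa using (norm_add_le _ _).trans (by linarith [hC' (ξ 1) (hb 1)])
  · simp only [CellShape.d1]
    simpa using (norm_add_le _ _).trans (by linarith [hC' (ξ 0) (hb 0)])

theorem integral_cell_eq (i : Fin M.N) (f : Plane → ℝ) :
    ∫ x in M.cell i, f x =
      ∫ ξ in s.refCell, |s.jac (M.vert i) ξ| * f (s.refMap (M.vert i) ξ) := by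
  have h := integral_image_eq_integral_abs_det_fderiv_smul volume s.measurableSet_refCell
    (fun x _ => (CellShape.hasFDerivAt_refMap s (M.vert i) x).hasFDerivWithinAt)
    (M.isCell i).injOn_refMap f
  rw [(M.isCell i).image_refMap] at h
  simp only [CellShape.det_refDeriv, smul_eq_mul] at h
  exact h

end Mesh

/-- On a quadrilateral the gradient is not polynomial, so norm equivalence is applied to the
reference derivatives `P j = ∂ⱼ(v ∘ F)`, which lie in a fixed finite-dimensional space. They are
related to the gradient by the transpose of `DF`, with entries of `DF` at most `3 h` and Jacobian at
least `c h²`. The powers of `h` on the way to the reference cell and back combine to `h²`. -/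
theorem exists_inverse_inequality (s : CellShape) (k : ℕ) (ϱ : ℝ) :
    ∃ C : ℝ, 0 ≤ C ∧ ∀ (Ω : Set Plane) (M : Mesh s Ω), M.ShapeRegular ϱ → ∀ (v : M.V k) i,
      ∀ x ∈ M.cell i, Metric.diam (M.cell i) ^ 2 * M.gradSq v i x ≤
        C * ∫ y in M.cell i, M.gradSq v i y := by
  obtain ⟨c, hc0, hc⟩ := exists_jac_lower s ϱ
  let D : Fin 2 → (MvPolynomial (Fin 2) ℝ →ₗ[ℝ] MvPolynomial (Fin 2) ℝ) := fun j =>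
    (MvPolynomial.pderiv j).toLinearMap
  choose C hC0 hC using fun j => exists_polyEval_bound s ((s.polySpace k).map (D j))
  set K : ℝ := C 0 + C 1 with hK
  have hK0 : 0 ≤ K := add_nonneg (hC0 0) (hC0 1)
  refine ⟨36 / c ^ 2 * (K * (18 / c)), by positivity, fun Ω M hreg v i x hx => ?_⟩
  set h := Metric.diam (M.cell i) with hh
  have hpos : 0 < h := M.diam_cell_pos i
  have hjac : ∀ ξ ∈ s.refCell, c * h ^ 2 ≤ |s.jac (M.vert i) ξ| := hc _ (M.isCell i) (hreg i)
  let P : Fin 2 → Plane → ℝ := fun j =>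
    polyEval (MvPolynomial.pderiv j (v i : MvPolynomial (Fin 2) ℝ))
  have hPmem : ∀ j, MvPolynomial.pderiv j (v i : MvPolynomial (Fin 2) ℝ) ∈
      (s.polySpace k).map (D j) := fun j => ⟨_, (v i).2, rfl⟩
  have hPc : ∀ j, Continuous (P j) := fun j => (contDiff_polyEval (n := 0) _).continuous
  have hP : ∀ ξ ∈ s.refCell, ∀ j, P j ξ =
      s.refDeriv (M.vert i) ξ (EuclideanSpace.single j 1) 0 *
          M.pd 0 (M.val v) i (s.refMap (M.vert i) ξ) +
        s.refDeriv (M.vert i) ξ (EuclideanSpace.single j 1) 1 *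
          M.pd 1 (M.val v) i (s.refMap (M.vert i) ξ) := fun ξ hξ j => by
    simp only [P]
    rw [M.polyEval_pderiv v i hξ j, M.dd_eq_sum, Fin.sum_univ_two]
  have hd : ∀ ξ ∈ s.refCell, ∀ j m,
      (s.refDeriv (M.vert i) ξ (EuclideanSpace.single j 1) m) ^ 2 ≤ 9 * h ^ 2 :=
    fun ξ hξ j m => by
      have h1 := (abs_coord_le_norm (s.refDeriv (M.vert i) ξ (EuclideanSpace.single j 1)) m).trans
        (M.norm_refDeriv_single_le i hξ j)
      have := pow_le_pow_left₀ (abs_nonneg _) h1 2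
      rw [sq_abs] at this
      linarith
  have hupper : ∀ ξ ∈ s.refCell, ∀ j, P j ξ ^ 2 ≤
      18 / c * (|s.jac (M.vert i) ξ| * M.gradSq v i (s.refMap (M.vert i) ξ)) := by
    intro ξ hξ j
    have hg := M.gradSq_nonneg v i (s.refMap (M.vert i) ξ)
    have h1 : P j ξ ^ 2 ≤ 18 * h ^ 2 * M.gradSq v i (s.refMap (M.vert i) ξ) := by
      rw [hP ξ hξ j, Mesh.gradSq, Fin.sum_univ_two]
      have e0 := hd ξ hξ j 0
      have e1 := hd ξ hξ j 1
      set a := s.refDeriv (M.vert i) ξ (EuclideanSpace.single j 1) 0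
      set b := s.refDeriv (M.vert i) ξ (EuclideanSpace.single j 1) 1
      set p := M.pd 0 (M.val v) i (s.refMap (M.vert i) ξ)
      set q := M.pd 1 (M.val v) i (s.refMap (M.vert i) ξ)
      refine (sq_combo_le a b p q).trans (mul_le_mul_of_nonneg_right (by linarith) (by positivity))
    refine h1.trans ?_
    rw [← mul_assoc]
    refine mul_le_mul_of_nonneg_right ?_ hg
    rw [div_mul_eq_mul_div, le_div_iff₀ hc0]
    nlinarith [hjac ξ hξ]
  have hGi : IntegrableOn (fun ξ => 18 / c * (|s.jac (M.vert i) ξ| *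
      M.gradSq v i (s.refMap (M.vert i) ξ))) s.refCell := by
    refine Integrable.const_mul ?_ _
    have h1 := (integrableOn_image_iff_integrableOn_abs_det_fderiv_smul volume
      s.measurableSet_refCell
      (fun x _ => (CellShape.hasFDerivAt_refMap s (M.vert i) x).hasFDerivWithinAt)
      (M.isCell i).injOn_refMap (M.gradSq v i)).1
    rw [(M.isCell i).image_refMap] at h1
    simp only [CellShape.det_refDeriv, smul_eq_mul] at h1
    exact h1 ((M.continuousOn_gradSq v i).integrableOn_compact (M.isCompact_cell i))
  have hint : ∀ j, ∫ ξ in s.refCell, P j ξ ^ 2 ≤ 18 / c * ∫ y in M.cell i, M.gradSq v i y := by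
    intro j
    rw [M.integral_cell_eq, ← integral_const_mul]
    exact setIntegral_mono_on
      (((hPc j).pow 2).continuousOn.integrableOn_compact s.isCompact_refCell) hGi
      s.measurableSet_refCell fun ξ hξ => hupper ξ hξ j
  set I := ∫ y in M.cell i, M.gradSq v i y with hI
  have hI0 : 0 ≤ I := setIntegral_nonneg (M.measurableSet_cell i) fun x _ => M.gradSq_nonneg v i x
  set ξ := s.refInv (M.vert i) x with hξd
  have hξ : ξ ∈ s.refCell := (M.isCell i).refInv_mem hx
  have hFx : s.refMap (M.vert i) ξ = x := (M.isCell i).refMap_refInv hx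
  have hsum : P 0 ξ ^ 2 + P 1 ξ ^ 2 ≤ K * (18 / c * I) := by
    rw [hK, add_mul]
    exact add_le_add ((hC 0 _ (hPmem 0) ξ hξ).trans (mul_le_mul_of_nonneg_left (hint 0) (hC0 0)))
      ((hC 1 _ (hPmem 1) ξ hξ).trans (mul_le_mul_of_nonneg_left (hint 1) (hC0 1)))
  have e0 := hP ξ hξ 0
  have e1 := hP ξ hξ 1
  have b00 := hd ξ hξ 0 0
  have b01 := hd ξ hξ 0 1
  have b10 := hd ξ hξ 1 0
  have b11 := hd ξ hξ 1 1
  have hJ := hjac ξ hξ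
  have hJe : s.jac (M.vert i) ξ = s.refDeriv (M.vert i) ξ (EuclideanSpace.single 0 1) 0 *
      s.refDeriv (M.vert i) ξ (EuclideanSpace.single 1 1) 1 -
      s.refDeriv (M.vert i) ξ (EuclideanSpace.single 0 1) 1 *
      s.refDeriv (M.vert i) ξ (EuclideanSpace.single 1 1) 0 := by
    simp [CellShape.refDeriv_apply, CellShape.jac, cross]
  rw [hFx] at e0 e1
  simp only [Mesh.gradSq, Fin.sum_univ_two]
  set a0 := s.refDeriv (M.vert i) ξ (EuclideanSpace.single 0 1) 0
  set a1 := s.refDeriv (M.vert i) ξ (EuclideanSpace.single 0 1) 1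
  set b0 := s.refDeriv (M.vert i) ξ (EuclideanSpace.single 1 1) 0
  set b1 := s.refDeriv (M.vert i) ξ (EuclideanSpace.single 1 1) 1
  set p := M.pd 0 (M.val v) i x
  set q := M.pd 1 (M.val v) i x
  set J := s.jac (M.vert i) ξ
  -- Cramer's rule recovers the gradient from the reference derivatives.
  have hp : J * p = b1 * P 0 ξ - a1 * P 1 ξ := by rw [e0, e1, hJe]; ring
  have hq : J * q = a0 * P 1 ξ - b0 * P 0 ξ := by rw [e0, e1, hJe]; ring
  have hS0 : 0 ≤ P 0 ξ ^ 2 + P 1 ξ ^ 2 := by positivity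
  have hJ2 : (c * h ^ 2) ^ 2 ≤ J ^ 2 := by
    rw [← sq_abs J]; exact pow_le_pow_left₀ (by positivity) hJ 2
  have h1 : J ^ 2 * (p ^ 2 + q ^ 2) ≤ 36 * h ^ 2 * (P 0 ξ ^ 2 + P 1 ξ ^ 2) := by
    have : J ^ 2 * (p ^ 2 + q ^ 2) = (J * p) ^ 2 + (J * q) ^ 2 := by ring
    rw [this, hp, hq]
    have u1 := sq_combo_le b1 (-a1) (P 0 ξ) (P 1 ξ)
    have u2 := sq_combo_le a0 (-b0) (P 1 ξ) (P 0 ξ)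
    have u1' := u1.trans (mul_le_mul_of_nonneg_right
      (show b1 ^ 2 + (-a1) ^ 2 ≤ 18 * h ^ 2 by linarith [neg_sq a1]) hS0)
    have u2' := u2.trans (mul_le_mul_of_nonneg_right
      (show a0 ^ 2 + (-b0) ^ 2 ≤ 18 * h ^ 2 by linarith [neg_sq b0]) (by rwa [add_comm]))
    rw [neg_mul, ← sub_eq_add_neg] at u1' u2'
    linarith
  have h2 : (c * h ^ 2) ^ 2 * (p ^ 2 + q ^ 2) ≤ 36 * h ^ 2 * (K * (18 / c * I)) :=
    (mul_le_mul_of_nonneg_right hJ2 (by positivity)).trans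
      (h1.trans (mul_le_mul_of_nonneg_left hsum (by positivity)))
  have h3 : c ^ 2 * h ^ 2 * (h ^ 2 * (p ^ 2 + q ^ 2)) ≤
      c ^ 2 * h ^ 2 * (36 / c ^ 2 * (K * (18 / c)) * I) := by
    have : c ^ 2 * h ^ 2 * (36 / c ^ 2 * (K * (18 / c)) * I) = 36 * h ^ 2 * (K * (18 / c * I)) := by
      field_simp
    rw [this]; linarith
  exact le_of_mul_le_mul_left h3 (by positivity)

end PrestrainedPlate

/-! ### Edge integrals and the real forms of the broken inequalities. -/

namespace PrestrainedPlate

open scoped ENNReal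

namespace Mesh

variable {s : CellShape} {Ω : Set Plane} (M : Mesh s Ω) {k : ℕ}

/-! ### Integrals over edges -/

/-- The parametrization of an edge by `[0, 1]`. -/
noncomputable def edgePt (e : M.Edge) (t : ℝ) : Plane :=
  AffineMap.lineMap (M.edgeStart e) (M.edgeEnd e) t

noncomputable def edgeLen (e : M.Edge) : ℝ := dist (M.edgeStart e) (M.edgeEnd e)

theorem edgeLen_pos (e : M.Edge) : 0 < M.edgeLen e := M.edge_length_pos e

theorem continuous_edgePt (e : M.Edge) : Continuous (M.edgePt e) := AffineMap.lineMap_continuous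

theorem edgePt_mem_openSegment (e : M.Edge) {t : ℝ} (ht : t ∈ Set.Ioo (0 : ℝ) 1) :
    M.edgePt e t ∈ openSegment ℝ (M.edgeStart e) (M.edgeEnd e) := by
  rw [openSegment_eq_image_lineMap]; exact ⟨t, ht, rfl⟩

/-- The open interval is used because the mesh function is controlled only on the relatively open
edge. -/
theorem edgeIntegral_eq (e : M.Edge) (f : Plane → ℝ) :
    M.edgeIntegral e f = M.edgeLen e * ∫ t in Set.Ioo (0 : ℝ) 1, f (M.edgePt e t) := by
  rw [edgeIntegral, intervalIntegral.integral_of_le zero_le_one, integral_Ioc_eq_integral_Ioo]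
  rfl

theorem edgeIntegral_nonneg (e : M.Edge) {f : Plane → ℝ}
    (h : ∀ t ∈ Set.Ioo (0 : ℝ) 1, 0 ≤ f (M.edgePt e t)) : 0 ≤ M.edgeIntegral e f := by
  rw [edgeIntegral_eq]
  exact mul_nonneg (M.edgeLen_pos e).le (setIntegral_nonneg measurableSet_Ioo h)

theorem edgeIntegral_mono (e : M.Edge) {f g : Plane → ℝ}
    (hf : IntegrableOn (fun t => f (M.edgePt e t)) (Set.Ioo 0 1))
    (hg : IntegrableOn (fun t => g (M.edgePt e t)) (Set.Ioo 0 1))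
    (h : ∀ t ∈ Set.Ioo (0 : ℝ) 1, f (M.edgePt e t) ≤ g (M.edgePt e t)) :
    M.edgeIntegral e f ≤ M.edgeIntegral e g := by
  rw [edgeIntegral_eq, edgeIntegral_eq]
  exact mul_le_mul_of_nonneg_left (setIntegral_mono_on hf hg measurableSet_Ioo h)
    (M.edgeLen_pos e).le

theorem edgeIntegral_const_mul (e : M.Edge) (c : ℝ) (f : Plane → ℝ) :
    M.edgeIntegral e (fun x => c * f x) = c * M.edgeIntegral e f := by
  rw [edgeIntegral_eq, edgeIntegral_eq, MeasureTheory.integral_const_mul]; ring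

theorem edgeIntegral_add (e : M.Edge) {f g : Plane → ℝ}
    (hf : IntegrableOn (fun t => f (M.edgePt e t)) (Set.Ioo 0 1))
    (hg : IntegrableOn (fun t => g (M.edgePt e t)) (Set.Ioo 0 1)) :
    M.edgeIntegral e (fun x => f x + g x) = M.edgeIntegral e f + M.edgeIntegral e g := by
  rw [edgeIntegral_eq, edgeIntegral_eq, edgeIntegral_eq, MeasureTheory.integral_add hf hg]; ring

theorem integrableOn_Ioo_of_continuousOn {φ : ℝ → ℝ} (h : ContinuousOn φ (Set.Icc 0 1)) :
    IntegrableOn φ (Set.Ioo 0 1) :=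
  (h.integrableOn_compact isCompact_Icc).mono_set Set.Ioo_subset_Icc_self

theorem continuousOn_comp_edgePt_fst {f : Fin M.N → Plane → ℝ}
    (hf : ∀ i, ContinuousOn (f i) (M.cell i)) (e : M.Edge) :
    ContinuousOn (fun t => f e.1 (M.edgePt e t)) (Set.Icc 0 1) :=
  (hf e.1).comp (M.continuous_edgePt e).continuousOn fun _ ht => M.lineMap_mem_fst e ht

theorem continuousOn_comp_edgePt_snd {f : Fin M.N → Plane → ℝ}
    (hf : ∀ i, ContinuousOn (f i) (M.cell i)) {e : M.Edge} (he : e ∈ M.edges) :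
    ContinuousOn (fun t => f e.2.2 (M.edgePt e t)) (Set.Icc 0 1) :=
  (hf e.2.2).comp (M.continuous_edgePt e).continuousOn fun _ ht => M.lineMap_mem_snd he ht

theorem continuousOn_jump {f : Fin M.N → Plane → ℝ}
    (hf : ∀ i, ContinuousOn (f i) (M.cell i)) {e : M.Edge} (he : e ∈ M.edges) :
    ContinuousOn (fun t => M.jump f e (M.edgePt e t)) (Set.Icc 0 1) :=
  (M.continuousOn_comp_edgePt_fst hf e).sub (M.continuousOn_comp_edgePt_snd hf he)

theorem continuousOn_avg {f : Fin M.N → Plane → ℝ}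
    (hf : ∀ i, ContinuousOn (f i) (M.cell i)) {e : M.Edge} (he : e ∈ M.edges) :
    ContinuousOn (fun t => M.avg f e (M.edgePt e t)) (Set.Icc 0 1) :=
  ((M.continuousOn_comp_edgePt_fst hf e).add (M.continuousOn_comp_edgePt_snd hf he)).div_const 2

/-! ### Real forms of the broken inequalities -/

theorem lintegral_cellSum_eq_ofReal {f : Fin M.N → Plane → ℝ}
    (hf : ∀ i, ContinuousOn (f i) (M.cell i)) :
    ∫⁻ x, M.cellSum f x = ENNReal.ofReal (M.integral fun i x => |f i x|) := by
  rw [M.lintegral_cellSum hf, integral, ENNReal.ofReal_sum_of_nonneg fun i _ =>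
    setIntegral_nonneg (M.measurableSet_cell i) fun x _ => abs_nonneg _]
  refine Finset.sum_congr rfl fun i _ => ?_
  rw [ofReal_integral_eq_lintegral_ofReal
    ((hf i).integrableOn_compact (M.isCompact_cell i)).abs
    (Filter.Eventually.of_forall fun x => abs_nonneg _)]

theorem jumpL_eq_ofReal {u : Fin M.N → Plane → ℝ} (hu : ∀ i, ContinuousOn (u i) (M.cell i))
    {e : M.Edge} (he : e ∈ M.edges) :
    M.jumpL u e = ENNReal.ofReal (M.edgeIntegral e fun x => |M.jump u e x|) := by
  rw [jumpL, edgeIntegral_eq, ENNReal.ofReal_mul (M.edgeLen_pos e).le,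
    ofReal_integral_eq_lintegral_ofReal
      (integrableOn_Ioo_of_continuousOn (M.continuousOn_jump hu he)).abs
      (Filter.Eventually.of_forall fun x => abs_nonneg _)]
  congr 1
  rw [Measure.restrict_congr_set Ioo_ae_eq_Icc.symm]
  rfl

/-- The total variation of the jumps. -/
noncomputable def jumpSum (u : Fin M.N → Plane → ℝ) : ℝ :=
  ∑ e ∈ M.edges, M.edgeIntegral e fun x => |M.jump u e x|

theorem jumpSum_nonneg (u : Fin M.N → Plane → ℝ) : 0 ≤ M.jumpSum u :=
  Finset.sum_nonneg fun e _ => M.edgeIntegral_nonneg e fun _ _ => abs_nonneg _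

theorem sum_jumpL_eq_ofReal {u : Fin M.N → Plane → ℝ} (hu : ∀ i, ContinuousOn (u i) (M.cell i)) :
    ∑ e ∈ M.edges, M.jumpL u e = ENNReal.ofReal (M.jumpSum u) := by
  rw [jumpSum, ENNReal.ofReal_sum_of_nonneg fun e _ => M.edgeIntegral_nonneg e fun _ _ =>
    abs_nonneg _]
  exact Finset.sum_congr rfl fun e he => M.jumpL_eq_ofReal hu he

theorem integral_abs_nonneg (f : Fin M.N → Plane → ℝ) : 0 ≤ M.integral fun i x => |f i x| :=
  integral_nonneg fun _ _ _ => abs_nonneg _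

end Mesh

theorem IsPolygonalDomain.exists_integral_sq_le {Ω : Set Plane} (hΩ : IsPolygonalDomain Ω) :
    ∃ C : ℝ, 0 ≤ C ∧ ∀ (s : CellShape) (M : Mesh s Ω) (u : Fin M.N → Plane → ℝ),
      (∀ i, ContDiffOn ℝ 1 (u i) (M.cell i)) →
      M.integral (fun i x => u i x ^ 2) ≤ C * ((M.integral fun i x => |u i x|) +
        (∑ c, M.integral fun i x => |M.pd c u i x|) + M.jumpSum u) ^ 2 := by
  obtain ⟨C, hC0, hC⟩ := hΩ.exists_sobolev
  refine ⟨C, hC0, fun s M u hu => ?_⟩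
  have h := hC s M u hu
  have hc : ∀ i, ContinuousOn (u i) (M.cell i) := fun i => (hu i).continuousOn
  have hp : ∀ c i, ContinuousOn (M.pd c u i) (M.cell i) := fun c i =>
    (M.contDiffOn_pd (m := 0) (hu i) (by norm_num) c).continuousOn
  have hn := fun c => M.integral_abs_nonneg (M.pd c u)
  have e1 : ∫⁻ x, M.cellSum (fun i x => u i x ^ 2) x =
      ENNReal.ofReal (M.integral fun i x => |u i x ^ 2|) :=
    M.lintegral_cellSum_eq_ofReal fun i => (hc i).pow 2
  rw [e1, Mesh.bvNorm,
    M.lintegral_cellSum_eq_ofReal hc, M.sum_jumpL_eq_ofReal hc,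
    Finset.sum_congr rfl fun c _ => M.lintegral_cellSum_eq_ofReal (hp c),
    ← ENNReal.ofReal_sum_of_nonneg fun c _ => hn c,
    ← ENNReal.ofReal_add (M.integral_abs_nonneg _) (Finset.sum_nonneg fun c _ => hn c),
    ← ENNReal.ofReal_add (add_nonneg (M.integral_abs_nonneg _)
      (Finset.sum_nonneg fun c _ => hn c)) (M.jumpSum_nonneg u),
    ← ENNReal.ofReal_pow (add_nonneg (add_nonneg (M.integral_abs_nonneg _)
      (Finset.sum_nonneg fun c _ => hn c)) (M.jumpSum_nonneg u)), ← ENNReal.ofReal_mul hC0,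
    ENNReal.ofReal_le_ofReal_iff (by positivity)] at h
  simp only [abs_sq] at h
  exact h

theorem IsPolygonalDomain.exists_integral_pd_le {Ω : Set Plane} (hΩ : IsPolygonalDomain Ω) :
    ∃ C : ℝ, 0 ≤ C ∧ ∀ (s : CellShape) (M : Mesh s Ω) (v : Fin M.N → Plane → ℝ),
      (∀ i, ContDiffOn ℝ 2 (v i) (M.cell i)) → ∀ c,
      M.integral (fun i x => |M.pd c v i x|) ≤ C * ((M.integral fun i x => |v i x|) +
        (∑ c, ∑ d, M.integral fun i x => |M.pd d (M.pd c v) i x|) + M.jumpSum v +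
        ∑ c, M.jumpSum (M.pd c v)) := by
  obtain ⟨C, hC0, hC⟩ := hΩ.exists_interpolation
  refine ⟨C, hC0, fun s M v hv c => ?_⟩
  have h := hC s M v hv c
  have hc : ∀ i, ContinuousOn (v i) (M.cell i) := fun i => (hv i).continuousOn
  have hp1 : ∀ c i, ContDiffOn ℝ 1 (M.pd c v i) (M.cell i) := fun c i =>
    M.contDiffOn_pd (hv i) (by norm_num) c
  have hp : ∀ c i, ContinuousOn (M.pd c v i) (M.cell i) := fun c i => (hp1 c i).continuousOn
  have hpp : ∀ c d i, ContinuousOn (M.pd d (M.pd c v) i) (M.cell i) := fun c d i =>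
    (M.contDiffOn_pd (m := 0) (hp1 c i) (by norm_num) d).continuousOn
  have n0 := M.integral_abs_nonneg v
  have n1 : 0 ≤ ∑ c, ∑ d, M.integral fun i x => |M.pd d (M.pd c v) i x| :=
    Finset.sum_nonneg fun _ _ => Finset.sum_nonneg fun _ _ => M.integral_abs_nonneg _
  have n2 := M.jumpSum_nonneg v
  have n3 : 0 ≤ ∑ c, M.jumpSum (M.pd c v) := Finset.sum_nonneg fun _ _ => M.jumpSum_nonneg _
  have e1 : ∑ c, ∑ d, ∫⁻ x, M.cellSum (M.pd d (M.pd c v)) x =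
      ENNReal.ofReal (∑ c, ∑ d, M.integral fun i x => |M.pd d (M.pd c v) i x|) := by
    rw [ENNReal.ofReal_sum_of_nonneg fun _ _ => Finset.sum_nonneg fun _ _ =>
      M.integral_abs_nonneg _]
    refine Finset.sum_congr rfl fun c _ => ?_
    rw [ENNReal.ofReal_sum_of_nonneg fun _ _ => M.integral_abs_nonneg _]
    exact Finset.sum_congr rfl fun d _ => M.lintegral_cellSum_eq_ofReal (hpp c d)
  have e2 : ∑ c, ∑ e ∈ M.edges, M.jumpL (M.pd c v) e =
      ENNReal.ofReal (∑ c, M.jumpSum (M.pd c v)) := by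
    rw [ENNReal.ofReal_sum_of_nonneg fun _ _ => M.jumpSum_nonneg _]
    exact Finset.sum_congr rfl fun c _ => M.sum_jumpL_eq_ofReal (hp c)
  rw [M.lintegral_cellSum_eq_ofReal (hp c), Mesh.hessNorm, M.lintegral_cellSum_eq_ofReal hc, e1, e2,
    M.sum_jumpL_eq_ofReal hc, ← ENNReal.ofReal_add n0 n1, ← ENNReal.ofReal_add (add_nonneg n0 n1) n2,
    ← ENNReal.ofReal_add (add_nonneg (add_nonneg n0 n1) n2) n3, ← ENNReal.ofReal_mul hC0,
    ENNReal.ofReal_le_ofReal_iff (by positivity)] at h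
  exact h

namespace Mesh

variable {s : CellShape} {Ω : Set Plane} (M : Mesh s Ω) {k : ℕ}

/-! ### Weighted integrals over edges -/

theorem integrableOn_weight_mul {ω : Plane → ℝ} (hω : Measurable ω) {B : ℝ} {e : M.Edge}
    (hB : ∀ x ∈ openSegment ℝ (M.edgeStart e) (M.edgeEnd e), |ω x| ≤ B) {φ : ℝ → ℝ}
    (hφ : ContinuousOn φ (Set.Icc 0 1)) :
    IntegrableOn (fun t => ω (M.edgePt e t) * φ t) (Set.Ioo 0 1) := by
  refine Integrable.bdd_mul (c := B) (integrableOn_Ioo_of_continuousOn hφ)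
    (hω.comp (M.continuous_edgePt e).measurable).aestronglyMeasurable ?_
  refine (ae_restrict_mem measurableSet_Ioo).mono fun t ht => ?_
  exact hB _ (M.edgePt_mem_openSegment e ht)

/-- Cauchy–Schwarz against the constant `1`; the weight enters through `1 ≤ b ω`, and its upper
bound `B` serves only for integrability. -/
theorem sq_edgeIntegral_abs_le {ω : Plane → ℝ} (hω : Measurable ω) {b B : ℝ} {e : M.Edge}
    (hB : ∀ x ∈ openSegment ℝ (M.edgeStart e) (M.edgeEnd e), |ω x| ≤ B)
    (hb : ∀ x ∈ openSegment ℝ (M.edgeStart e) (M.edgeEnd e), 1 ≤ b * ω x)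
    {f : Plane → ℝ} (hf : ContinuousOn (fun t => f (M.edgePt e t)) (Set.Icc 0 1)) :
    (M.edgeIntegral e fun x => |f x|) ^ 2 ≤
      M.edgeLen e * b * M.edgeIntegral e fun x => ω x * f x ^ 2 := by
  rw [edgeIntegral_eq, edgeIntegral_eq]
  set φ := fun t => f (M.edgePt e t) with hφ
  have hsq : IntegrableOn (fun t => φ t ^ 2) (Set.Ioo 0 1) :=
    integrableOn_Ioo_of_continuousOn (hf.pow 2)
  have h1 := PrestrainedPlate.integral_mul_sq_le (μ := volume.restrict (Set.Ioo (0 : ℝ) 1))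
    (f := fun t => |φ t|) (g := fun _ => (1 : ℝ)) (by simp only [sq_abs]; exact hsq)
    (by simp only [mul_one]; exact (integrableOn_Ioo_of_continuousOn hf).abs) (by simp)
  simp only [mul_one, one_pow, sq_abs, integral_const, smul_eq_mul, measureReal_restrict_apply_univ,
    Real.volume_real_Ioo, sub_zero, zero_le_one, sup_of_le_left] at h1
  have h2 : ∫ t in Set.Ioo (0 : ℝ) 1, φ t ^ 2 ≤
      b * ∫ t in Set.Ioo (0 : ℝ) 1, ω (M.edgePt e t) * φ t ^ 2 := by
    rw [← MeasureTheory.integral_const_mul]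
    refine setIntegral_mono_on hsq ((M.integrableOn_weight_mul hω hB (hf.pow 2)).const_mul _)
      measurableSet_Ioo fun t ht => ?_
    have := hb _ (M.edgePt_mem_openSegment e ht)
    rw [← mul_assoc]
    exact le_mul_of_one_le_left (sq_nonneg _) this
  have h3 := h1.trans h2
  rw [mul_pow]
  calc M.edgeLen e ^ 2 * (∫ t in Set.Ioo (0 : ℝ) 1, |φ t|) ^ 2
      ≤ M.edgeLen e ^ 2 * (b * ∫ t in Set.Ioo (0 : ℝ) 1, ω (M.edgePt e t) * φ t ^ 2) :=
        mul_le_mul_of_nonneg_left h3 (sq_nonneg _)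
    _ = _ := by ring

variable {M} in
-- Used with `n = 1` for jumps of gradients and `n = 3` for jumps of values. The absolute value of
-- `c₂` dispenses with an assumption on its sign.
theorem IsMeshFunction.weight_bounds {c₁ c₂ : ℝ} (hc₁ : 0 < c₁) {hf : Plane → ℝ}
    (hm : M.IsMeshFunction c₁ c₂ hf) {e : M.Edge} (he : e ∈ M.edges) (n : ℕ) :
    Measurable (fun x => (hf x ^ n)⁻¹) ∧
    (∀ x ∈ openSegment ℝ (M.edgeStart e) (M.edgeEnd e),
      |(hf x ^ n)⁻¹| ≤ ((c₁ * M.edgeLen e) ^ n)⁻¹) ∧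
    (∀ x ∈ openSegment ℝ (M.edgeStart e) (M.edgeEnd e),
      1 ≤ (|c₂| * M.edgeLen e) ^ n * (hf x ^ n)⁻¹) ∧
    ∀ x ∈ openSegment ℝ (M.edgeStart e) (M.edgeEnd e), 0 ≤ (hf x ^ n)⁻¹ := by
  have hl := M.edgeLen_pos e
  have hpos : ∀ x ∈ openSegment ℝ (M.edgeStart e) (M.edgeEnd e), 0 < hf x := fun x hx =>
    (mul_pos hc₁ hl).trans_le (hm.2.2 e he x hx).1
  refine ⟨(hm.1.pow_const n).inv, fun x hx => ?_, fun x hx => ?_, fun x hx => ?_⟩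
  · have := hpos x hx
    rw [abs_of_pos (by positivity)]
    exact inv_anti₀ (by positivity) (pow_le_pow_left₀ (by positivity) (hm.2.2 e he x hx).1 n)
  · have := hpos x hx
    rw [← div_eq_mul_inv, one_le_div (by positivity)]
    refine pow_le_pow_left₀ this.le ((hm.2.2 e he x hx).2.trans ?_) n
    exact mul_le_mul_of_nonneg_right (le_abs_self _) hl.le
  · have := hpos x hx
    positivity

end Mesh

end PrestrainedPlate

/-! ### The discrete norm controls the gradient in `L²`. -/

namespace PrestrainedPlate

theorem le_sqrt_mul_sqrt {x K Q : ℝ} (hK : 0 ≤ K) (h : x ^ 2 ≤ K * Q) : x ≤ √K * √Q := by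
  rw [← Real.sqrt_mul hK]
  exact Real.le_sqrt_of_sq_le h

theorem IsPolygonalDomain.volume_closure_ne_top {Ω : Set Plane} (hΩ : IsPolygonalDomain Ω) :
    volume (closure Ω) ≠ ⊤ := (hΩ.2.1.closure.measure_lt_top).ne

namespace Mesh

variable {s : CellShape} {Ω : Set Plane} (M : Mesh s Ω) {k : ℕ}

/-! ### Measure and length of the mesh -/

theorem sum_volume_real_cell_le (hΩ : IsPolygonalDomain Ω) :
    ∑ i, (volume (M.cell i)).toReal ≤ (volume (closure Ω)).toReal := by
  rw [← ENNReal.toReal_sum fun i _ => (M.isCompact_cell i).measure_ne_top]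
  exact ENNReal.toReal_mono hΩ.volume_closure_ne_top M.sum_volume_cell_le

theorem sq_integral_abs_le (hΩ : IsPolygonalDomain Ω) {f : Fin M.N → Plane → ℝ}
    (hf : M.CellIntegrable f) (hf2 : M.CellIntegrable fun i x => f i x ^ 2) :
    (M.integral fun i x => |f i x|) ^ 2 ≤
      (volume (closure Ω)).toReal * M.integral fun i x => f i x ^ 2 := by
  have h1 : M.CellIntegrable fun _ _ => (1 : ℝ) := cellIntegrable_of_continuousOn fun i =>
    continuousOn_const
  have h := M.integral_mul_sq_le (f := fun i x => |f i x|) (g := fun _ _ => 1)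
    (by simpa only [sq_abs] using hf2) (by simpa only [mul_one] using hf.abs)
    (by simpa only [one_pow] using h1)
  simp only [mul_one, sq_abs, one_pow] at h
  refine h.trans ?_
  rw [mul_comm]
  refine mul_le_mul_of_nonneg_right ?_ (integral_nonneg fun _ _ _ => sq_nonneg _)
  refine le_trans (le_of_eq ?_) (M.sum_volume_real_cell_le hΩ)
  refine Finset.sum_congr rfl fun i _ => ?_
  simp [Measure.real]

theorem diam_cell_le (hΩ : IsPolygonalDomain Ω) (i : Fin M.N) :
    Metric.diam (M.cell i) ≤ Metric.diam (closure Ω) :=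
  Metric.diam_mono (M.cell_subset_closure i) hΩ.2.1.closure

end Mesh

/-- By the lower bound of the Jacobian the area of a cell is at least a constant times its squared
diameter, and the areas sum up to at most that of the closure of the domain. -/
theorem exists_sum_diam_sq_le (s : CellShape) (ϱ : ℝ) {Ω : Set Plane} (hΩ : IsPolygonalDomain Ω) :
    ∃ C : ℝ, 0 ≤ C ∧ ∀ M : Mesh s Ω, M.ShapeRegular ϱ →
      ∑ i, Metric.diam (M.cell i) ^ 2 ≤ C := by
  obtain ⟨c, hc0, hc⟩ := exists_jac_lower s ϱ
  have hr0 : 0 < (volume s.refCell).toReal := by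
    refine ENNReal.toReal_pos ?_ s.isCompact_refCell.measure_ne_top
    exact (Measure.measure_pos_of_nonempty_interior volume s.interior_refCell_nonempty).ne'
  set r := (volume s.refCell).toReal
  refine ⟨(volume (closure Ω)).toReal / (c * r), by positivity, fun M hreg => ?_⟩
  rw [le_div_iff₀ (by positivity), Finset.sum_mul]
  refine le_trans (Finset.sum_le_sum fun i _ => ?_) (M.sum_volume_real_cell_le hΩ)
  have h1 : ENNReal.ofReal (c * Metric.diam (M.cell i) ^ 2) * volume s.refCell ≤
      volume (M.cell i) := by
    rw [Mesh.cell, (M.isCell i).volume_convexHull, ← setLIntegral_const]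
    exact setLIntegral_mono' s.measurableSet_refCell fun ξ hξ =>
      ENNReal.ofReal_le_ofReal (hc _ (M.isCell i) (hreg i) ξ hξ)
  have h2 := ENNReal.toReal_mono (M.isCompact_cell i).measure_ne_top h1
  rw [ENNReal.toReal_mul, ENNReal.toReal_ofReal (by positivity)] at h2
  linarith

theorem exists_sum_edgeLen_sq_le (s : CellShape) (ϱ : ℝ) {Ω : Set Plane}
    (hΩ : IsPolygonalDomain Ω) : ∃ C : ℝ, 0 ≤ C ∧ ∀ M : Mesh s Ω, M.ShapeRegular ϱ →
      ∑ e ∈ M.edges, M.edgeLen e ^ 2 ≤ C := by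
  obtain ⟨C, hC0, hC⟩ := exists_sum_diam_sq_le s ϱ hΩ
  refine ⟨4 * C, by positivity, fun M hreg => ?_⟩
  refine (Finset.sum_le_sum fun e _ => pow_le_pow_left₀ (M.edgeLen_pos e).le
    (M.edge_length_le_fst e) 2).trans ?_
  refine (M.sum_edges_fst_le (f := fun i => Metric.diam (M.cell i) ^ 2)
    fun i => sq_nonneg _).trans ?_
  linarith [hC M hreg]

namespace Mesh

variable {s : CellShape} {Ω : Set Plane} (M : Mesh s Ω) {k : ℕ}

/-! ### The parts of the discrete norm -/

/-- The square of the weighted `L²` norm of the jumps. -/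
noncomputable def jumpSq (hf : Plane → ℝ) (n : ℕ) (u : Fin M.N → Plane → ℝ) : ℝ :=
  ∑ e ∈ M.edges, M.edgeIntegral e fun x => (hf x ^ n)⁻¹ * M.jump u e x ^ 2

/-- The scalar product of `H²_h` on `𝕍_h^k`. -/
noncomputable def scalarForm (hf : Plane → ℝ) (v w : M.V k) : ℝ :=
  M.semiForm hf v w + M.integral fun i x => M.val v i x * M.val w i x

variable {M} {c₁ c₂ : ℝ} {hf : Plane → ℝ}

theorem IsMeshFunction.edgeIntegral_nonneg (hc₁ : 0 < c₁) (hm : M.IsMeshFunction c₁ c₂ hf) (n : ℕ)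
    (u : Fin M.N → Plane → ℝ) {e : M.Edge} (he : e ∈ M.edges) :
    0 ≤ M.edgeIntegral e fun x => (hf x ^ n)⁻¹ * M.jump u e x ^ 2 :=
  M.edgeIntegral_nonneg e fun _ ht => mul_nonneg
    ((hm.weight_bounds hc₁ he n).2.2.2 _ (M.edgePt_mem_openSegment e ht)) (sq_nonneg _)

theorem IsMeshFunction.jumpSq_nonneg (hc₁ : 0 < c₁) (hm : M.IsMeshFunction c₁ c₂ hf) (n : ℕ)
    (u : Fin M.N → Plane → ℝ) : 0 ≤ M.jumpSq hf n u :=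
  Finset.sum_nonneg fun _ he => hm.edgeIntegral_nonneg hc₁ n u he

theorem IsMeshFunction.sq_edgeIntegral_abs_jump_le (hc₁ : 0 < c₁) (hm : M.IsMeshFunction c₁ c₂ hf)
    (n : ℕ) {u : Fin M.N → Plane → ℝ} (hu : ∀ i, ContinuousOn (u i) (M.cell i)) {e : M.Edge}
    (he : e ∈ M.edges) : (M.edgeIntegral e fun x => |M.jump u e x|) ^ 2 ≤
      M.edgeLen e * (|c₂| * M.edgeLen e) ^ n *
        M.edgeIntegral e fun x => (hf x ^ n)⁻¹ * M.jump u e x ^ 2 := by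
  obtain ⟨h1, h2, h3, -⟩ := hm.weight_bounds hc₁ he n
  exact M.sq_edgeIntegral_abs_le h1 h2 h3 (M.continuousOn_jump hu he)

/-- Cauchy–Schwarz on each edge, then over the edges. The sum of powers of the lengths is bounded
uniformly in the mesh for `n = 1` and `n = 3`. -/
theorem IsMeshFunction.sq_jumpSum_le (hc₁ : 0 < c₁) (hm : M.IsMeshFunction c₁ c₂ hf)
    (n : ℕ) {u : Fin M.N → Plane → ℝ} (hu : ∀ i, ContinuousOn (u i) (M.cell i)) :
    M.jumpSum u ^ 2 ≤ (∑ e ∈ M.edges, M.edgeLen e * (|c₂| * M.edgeLen e) ^ n) *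
      M.jumpSq hf n u := by
  refine Finset.sum_sq_le_sum_mul_sum_of_sq_le_mul _ (fun e _ => ?_)
    (fun e he => hm.edgeIntegral_nonneg hc₁ n u he)
    fun e he => hm.sq_edgeIntegral_abs_jump_le hc₁ n hu he
  have := M.edgeLen_pos e
  positivity

theorem jumpForm_self (v : M.V k) : M.jumpForm hf v v = M.jumpSq hf 3 (M.val v) := by
  simp only [jumpForm, jumpSq, sq]

theorem IsMeshFunction.gradJumpForm_self (hc₁ : 0 < c₁) (hm : M.IsMeshFunction c₁ c₂ hf)
    (v : M.V k) : M.gradJumpForm hf v v = ∑ a, M.jumpSq hf 1 (M.pd a (M.val v)) := by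
  simp only [gradJumpForm, jumpSq]
  rw [Finset.sum_comm]
  refine Finset.sum_congr rfl fun e he => ?_
  obtain ⟨h1, h2, -⟩ := hm.weight_bounds hc₁ he 1
  have hi : ∀ a, IntegrableOn (fun t => (hf (M.edgePt e t) ^ 1)⁻¹ *
      M.jump (M.pd a (M.val v)) e (M.edgePt e t) ^ 2) (Set.Ioo 0 1) := fun a =>
    M.integrableOn_weight_mul h1 h2 ((M.continuousOn_jump (M.continuousOn_pd_val v a) he).pow 2)
  rw [Fin.sum_univ_two, ← M.edgeIntegral_add e (hi 0) (hi 1)]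
  simp only [Fin.sum_univ_two, pow_one, mul_add, sq]

theorem integral_hess_self (v : M.V k) :
    (M.integral fun i x => ∑ a, ∑ b,
      M.pd a (M.pd b (M.val v)) i x * M.pd a (M.pd b (M.val v)) i x) =
    ∑ a, ∑ b, M.integral fun i x => M.pd a (M.pd b (M.val v)) i x ^ 2 := by
  have hi : ∀ a b, M.CellIntegrable fun i x =>
      M.pd a (M.pd b (M.val v)) i x * M.pd a (M.pd b (M.val v)) i x := fun a b =>
    cellIntegrable_of_continuousOn fun i =>
      (M.continuousOn_pd_pd_val v a b i).mul (M.continuousOn_pd_pd_val v a b i)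
  rw [integral_sum fun a _ => CellIntegrable.sum fun b _ => hi a b]
  refine Finset.sum_congr rfl fun a _ => ?_
  rw [integral_sum fun b _ => hi a b]
  simp only [sq]

theorem IsMeshFunction.scalarForm_self (hc₁ : 0 < c₁) (hm : M.IsMeshFunction c₁ c₂ hf)
    (v : M.V k) : M.scalarForm hf v v =
      (∑ a, ∑ b, M.integral fun i x => M.pd a (M.pd b (M.val v)) i x ^ 2) +
      (∑ a, M.jumpSq hf 1 (M.pd a (M.val v))) + M.jumpSq hf 3 (M.val v) +
      M.integral fun i x => M.val v i x ^ 2 := by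
  rw [scalarForm, semiForm, integral_hess_self, hm.gradJumpForm_self hc₁, jumpForm_self]
  simp only [sq]

theorem IsMeshFunction.scalarForm_bounds (hc₁ : 0 < c₁) (hm : M.IsMeshFunction c₁ c₂ hf)
    (v : M.V k) :
    (∀ a b, (M.integral fun i x => M.pd a (M.pd b (M.val v)) i x ^ 2) ≤ M.scalarForm hf v v) ∧
    (∀ a, M.jumpSq hf 1 (M.pd a (M.val v)) ≤ M.scalarForm hf v v) ∧
    M.jumpSq hf 3 (M.val v) ≤ M.scalarForm hf v v ∧
    (M.integral fun i x => M.val v i x ^ 2) ≤ M.scalarForm hf v v ∧ 0 ≤ M.scalarForm hf v v := by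
  have n1 : ∀ a b, 0 ≤ M.integral fun i x => M.pd a (M.pd b (M.val v)) i x ^ 2 := fun a b =>
    integral_nonneg fun _ _ _ => sq_nonneg _
  have n2 : ∀ a, 0 ≤ M.jumpSq hf 1 (M.pd a (M.val v)) := fun a => hm.jumpSq_nonneg hc₁ _ _
  have n3 : 0 ≤ M.jumpSq hf 3 (M.val v) := hm.jumpSq_nonneg hc₁ _ _
  have n4 : 0 ≤ M.integral fun i x => M.val v i x ^ 2 := integral_nonneg fun _ _ _ => sq_nonneg _
  have m1 : 0 ≤ ∑ a, ∑ b, M.integral fun i x => M.pd a (M.pd b (M.val v)) i x ^ 2 :=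
    Finset.sum_nonneg fun a _ => Finset.sum_nonneg fun b _ => n1 a b
  have m2 : 0 ≤ ∑ a, M.jumpSq hf 1 (M.pd a (M.val v)) := Finset.sum_nonneg fun a _ => n2 a
  rw [hm.scalarForm_self hc₁]
  refine ⟨fun a b => ?_, fun a => ?_, by linarith, by linarith, by linarith⟩
  · have h1 := Finset.single_le_sum
      (f := fun b => M.integral fun i x => M.pd a (M.pd b (M.val v)) i x ^ 2)
      (fun b _ => n1 a b) (Finset.mem_univ b)
    have h2 := Finset.single_le_sum
      (f := fun a => ∑ b, M.integral fun i x => M.pd a (M.pd b (M.val v)) i x ^ 2)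
      (fun a _ => Finset.sum_nonneg fun b _ => n1 a b) (Finset.mem_univ a)
    linarith
  · have h1 := Finset.single_le_sum (f := fun a => M.jumpSq hf 1 (M.pd a (M.val v)))
      (fun a _ => n2 a) (Finset.mem_univ a)
    linarith

end Mesh

/-- The terms of first order of the broken Sobolev inequalities are controlled by the discrete
norm. -/
theorem exists_first_order_bounds (s : CellShape) (k : ℕ) (ϱ c₁ c₂ : ℝ) (hc₁ : 0 < c₁)
    {Ω : Set Plane} (hΩ : IsPolygonalDomain Ω) :
    ∃ K : ℝ, 0 ≤ K ∧ ∀ (M : Mesh s Ω) (hf : Plane → ℝ), M.ShapeRegular ϱ →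
      M.IsMeshFunction c₁ c₂ hf → ∀ v : M.V k,
      (M.integral fun i x => |M.val v i x|) ≤ K * √(M.scalarForm hf v v) ∧
      (∀ a b, (M.integral fun i x => |M.pd a (M.pd b (M.val v)) i x|) ≤
        K * √(M.scalarForm hf v v)) ∧
      M.jumpSum (M.val v) ≤ K * √(M.scalarForm hf v v) ∧
      ∀ a, M.jumpSum (M.pd a (M.val v)) ≤ K * √(M.scalarForm hf v v) := by
  obtain ⟨E, hE0, hE⟩ := exists_sum_edgeLen_sq_le s ϱ hΩ
  set A := (volume (closure Ω)).toReal with hA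
  have hA0 : 0 ≤ A := ENNReal.toReal_nonneg
  set d := Metric.diam (closure Ω) with hd
  refine ⟨√A + √(|c₂| * E) + √(|c₂| ^ 3 * d ^ 2 * E), by positivity, fun M hf hreg hm v => ?_⟩
  obtain ⟨b1, b2, b3, b4, b5⟩ := hm.scalarForm_bounds hc₁ v
  set Q := M.scalarForm hf v v
  have hQ := Real.sqrt_nonneg Q
  have r1 := mul_nonneg (Real.sqrt_nonneg A) hQ
  have r2 := mul_nonneg (Real.sqrt_nonneg (|c₂| * E)) hQ
  have r3 := mul_nonneg (Real.sqrt_nonneg (|c₂| ^ 3 * d ^ 2 * E)) hQ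
  have t1 : ∀ f : Fin M.N → Plane → ℝ, (∀ i, ContinuousOn (f i) (M.cell i)) →
      (M.integral fun i x => f i x ^ 2) ≤ Q → (M.integral fun i x => |f i x|) ≤ √A * √Q := by
    intro f hfc hfQ
    refine le_sqrt_mul_sqrt hA0 ((M.sq_integral_abs_le hΩ (Mesh.cellIntegrable_of_continuousOn hfc)
      (Mesh.cellIntegrable_of_continuousOn fun i => (hfc i).pow 2)).trans ?_)
    exact mul_le_mul_of_nonneg_left hfQ hA0
  have s1 : ∑ e ∈ M.edges, M.edgeLen e * (|c₂| * M.edgeLen e) ^ 1 ≤ |c₂| * E := by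
    have : ∀ e : M.Edge, M.edgeLen e * (|c₂| * M.edgeLen e) ^ 1 = |c₂| * M.edgeLen e ^ 2 :=
      fun e => by ring
    simp_rw [this, ← Finset.mul_sum]
    exact mul_le_mul_of_nonneg_left (hE M hreg) (abs_nonneg _)
  -- Compared with the gradient jumps there are two additional powers of the edge length, which the
  -- diameter of the domain absorbs.
  have s3 : ∑ e ∈ M.edges, M.edgeLen e * (|c₂| * M.edgeLen e) ^ 3 ≤ |c₂| ^ 3 * d ^ 2 * E := by
    have : ∀ e : M.Edge, M.edgeLen e * (|c₂| * M.edgeLen e) ^ 3 ≤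
        |c₂| ^ 3 * d ^ 2 * M.edgeLen e ^ 2 := fun e => by
      have h1 : M.edgeLen e ^ 2 ≤ d ^ 2 := pow_le_pow_left₀ (M.edgeLen_pos e).le
        ((M.edge_length_le_fst e).trans (M.diam_cell_le hΩ _)) 2
      calc M.edgeLen e * (|c₂| * M.edgeLen e) ^ 3
          = |c₂| ^ 3 * M.edgeLen e ^ 2 * M.edgeLen e ^ 2 := by ring
        _ ≤ _ := by gcongr
    refine (Finset.sum_le_sum fun e _ => this e).trans ?_
    rw [← Finset.mul_sum]
    exact mul_le_mul_of_nonneg_left (hE M hreg) (by positivity)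
  refine ⟨?_, fun a b => ?_, ?_, fun a => ?_⟩
  · linarith [t1 _ (M.continuousOn_val v) b4]
  · linarith [t1 _ (M.continuousOn_pd_pd_val v a b) (b1 a b)]
  · have := le_sqrt_mul_sqrt (by positivity) ((hm.sq_jumpSum_le hc₁ 3 (M.continuousOn_val v)).trans
      (mul_le_mul s3 b3 (hm.jumpSq_nonneg hc₁ _ _) (by positivity)))
    linarith
  · have := le_sqrt_mul_sqrt (by positivity)
      ((hm.sq_jumpSum_le hc₁ 1 (M.continuousOn_pd_val v a)).trans
      (mul_le_mul s1 (b2 a) (hm.jumpSq_nonneg hc₁ _ _) (by positivity)))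
    linarith

/-- Interpolation bounds the gradient in `L¹`, which completes the BV norm of each partial
derivative; its other two parts are the Hessian and the gradient jumps. The Sobolev inequality
raises the exponent to `2`. -/
theorem exists_integral_pd_sq_le (s : CellShape) (k : ℕ) (ϱ c₁ c₂ : ℝ) (hc₁ : 0 < c₁)
    {Ω : Set Plane} (hΩ : IsPolygonalDomain Ω) :
    ∃ C : ℝ, 0 ≤ C ∧ ∀ (M : Mesh s Ω) (hf : Plane → ℝ), M.ShapeRegular ϱ →
      M.IsMeshFunction c₁ c₂ hf → ∀ (v : M.V k) (a : Fin 2),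
      (M.integral fun i x => M.pd a (M.val v) i x ^ 2) ≤ C * M.scalarForm hf v v := by
  obtain ⟨K, hK0, hK⟩ := exists_first_order_bounds s k ϱ c₁ c₂ hc₁ hΩ
  obtain ⟨C₁, hC₁0, hC₁⟩ := hΩ.exists_integral_pd_le
  obtain ⟨C₂, hC₂0, hC₂⟩ := hΩ.exists_integral_sq_le
  refine ⟨C₂ * (C₁ * (8 * K) + 3 * K) ^ 2, by positivity, fun M hf hreg hm v a => ?_⟩
  obtain ⟨b1, b2, b3, b4⟩ := hK M hf hreg hm v
  obtain ⟨-, -, -, -, hQ0⟩ := hm.scalarForm_bounds hc₁ v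
  set Q := M.scalarForm hf v v
  have h1 := hC₁ s M (M.val v) (fun i => M.contDiffOn_val (n := 2) v i) a
  have h2 := hC₂ s M (M.pd a (M.val v)) (fun i => M.contDiffOn_pd_val (n := 1) v a i)
  simp only [Fin.sum_univ_two] at h1 h2
  refine h2.trans ?_
  rw [mul_assoc]
  refine mul_le_mul_of_nonneg_left ?_ hC₂0
  have h3 : C₁ * ((M.integral fun i x => |M.val v i x|) +
      (((M.integral fun i x => |M.pd 0 (M.pd 0 (M.val v)) i x|) +
        M.integral fun i x => |M.pd 1 (M.pd 0 (M.val v)) i x|) +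
        ((M.integral fun i x => |M.pd 0 (M.pd 1 (M.val v)) i x|) +
        M.integral fun i x => |M.pd 1 (M.pd 1 (M.val v)) i x|)) + M.jumpSum (M.val v) +
      (M.jumpSum (M.pd 0 (M.val v)) + M.jumpSum (M.pd 1 (M.val v)))) ≤ C₁ * (8 * K * √Q) :=
    mul_le_mul_of_nonneg_left (by linarith [b2 0 0, b2 0 1, b2 1 0, b2 1 1, b4 0, b4 1]) hC₁0
  have h4 : ((M.integral fun i x => |M.pd a (M.val v) i x|) +
      ((M.integral fun i x => |M.pd 0 (M.pd a (M.val v)) i x|) +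
        M.integral fun i x => |M.pd 1 (M.pd a (M.val v)) i x|) + M.jumpSum (M.pd a (M.val v))) ≤
      (C₁ * (8 * K) + 3 * K) * √Q := by
    linarith [b2 0 a, b2 1 a, b4 a]
  refine (pow_le_pow_left₀ ?_ h4 2).trans_eq ?_
  · have := M.integral_abs_nonneg (M.pd a (M.val v))
    have := M.integral_abs_nonneg (M.pd 0 (M.pd a (M.val v)))
    have := M.integral_abs_nonneg (M.pd 1 (M.pd a (M.val v)))
    have := M.jumpSum_nonneg (M.pd a (M.val v))
    positivity
  · rw [mul_pow, Real.sq_sqrt hQ0]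

end PrestrainedPlate

/-! ### Bounds of the gradient in `L⁴` and in `L^∞`. -/

namespace PrestrainedPlate

namespace Mesh

variable {s : CellShape} {Ω : Set Plane} (M : Mesh s Ω) {k : ℕ}

theorem pd_sq {u : Fin M.N → Plane → ℝ} {i : Fin M.N} (hu : DifferentiableOn ℝ (u i) (M.cell i))
    (c : Fin 2) {x : Plane} (hx : x ∈ M.cell i) :
    M.pd c (fun i x => u i x ^ 2) i x = 2 * u i x * M.pd c u i x := by
  have h := (hu x hx).hasFDerivWithinAt.pow 2
  simp only [pd]
  rw [h.fderivWithin (M.uniqueDiffOn_cell i x hx)]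
  simp

end Mesh

/-- The jumps of the squared derivatives. -/
theorem exists_jumpSum_pd_sq_le (s : CellShape) (k : ℕ) (ϱ c₁ c₂ : ℝ) (hc₁ : 0 < c₁)
    {Ω : Set Plane} (hΩ : IsPolygonalDomain Ω) :
    ∃ C : ℝ, 0 ≤ C ∧ ∀ (M : Mesh s Ω) (hf : Plane → ℝ), M.ShapeRegular ϱ →
      M.IsMeshFunction c₁ c₂ hf → ∀ (v : M.V k) (a : Fin 2),
      M.jumpSum (fun i x => M.pd a (M.val v) i x ^ 2) ≤ C * M.scalarForm hf v v := by
  obtain ⟨I, hI0, hI⟩ := exists_inverse_inequality s k ϱ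
  obtain ⟨C, hC0, hC⟩ := exists_integral_pd_sq_le s k ϱ c₁ c₂ hc₁ hΩ
  refine ⟨√(2 * |c₂| * I * (8 * (2 * C))), by positivity, fun M hf hreg hm v a => ?_⟩
  obtain ⟨-, b2, -, -, hQ0⟩ := hm.scalarForm_bounds hc₁ v
  have hCQ := hC M hf hreg hm v
  set Q := M.scalarForm hf v v
  set G : Fin M.N → ℝ := fun i => ∫ y in M.cell i, M.gradSq v i y with hG
  have hG0 : ∀ i, 0 ≤ G i := fun i =>
    setIntegral_nonneg (M.measurableSet_cell i) fun x _ => M.gradSq_nonneg v i x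
  have hGsum : ∑ i, G i ≤ 2 * C * Q := by
    have e : ∑ i, G i = ∑ a, M.integral fun i x => M.pd a (M.val v) i x ^ 2 := by
      have hci : ∀ a, M.CellIntegrable fun i x => M.pd a (M.val v) i x ^ 2 := fun a =>
        Mesh.cellIntegrable_of_continuousOn fun i => (M.continuousOn_pd_val v a i).pow 2
      exact Mesh.integral_sum (T := Finset.univ) fun a _ => hci a
    rw [e, Fin.sum_univ_two]
    linarith [hCQ 0, hCQ 1]
  set w := M.pd a (M.val v) with hw
  have hwc : ∀ i, ContinuousOn (w i) (M.cell i) := M.continuousOn_pd_val v a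
  have hwG : ∀ i, ∀ x ∈ M.cell i, Metric.diam (M.cell i) ^ 2 * w i x ^ 2 ≤ I * G i :=
    fun i x hx => by
      refine le_trans (mul_le_mul_of_nonneg_left ?_ (sq_nonneg _)) (hI Ω M hreg v i x hx)
      exact Finset.single_le_sum (f := fun a => M.pd a (M.val v) i x ^ 2)
        (fun _ _ => sq_nonneg _) (Finset.mem_univ a)
  have hedge : ∀ e ∈ M.edges, (M.edgeIntegral e fun x => |M.jump (fun i x => w i x ^ 2) e x|) ^ 2 ≤
      2 * |c₂| * I * (G e.1 + G e.2.2) *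
        M.edgeIntegral e fun x => (hf x ^ 1)⁻¹ * M.jump w e x ^ 2 := by
    intro e he
    have hl := M.edgeLen_pos e
    -- The inverse inequality bounds the squared traces of `w` from both cells by `I G / |e|²`, so
    -- `B` bounds `|w⁻ + w⁺|` in `[w²] = (w⁻ + w⁺)[w]`. In the squared edge integral, `B²` meets
    -- exactly the factor `|e|²` coming from Cauchy–Schwarz and the weight, and no power of the mesh
    -- size remains.
    set B := √(2 * I * (G e.1 + G e.2.2)) / M.edgeLen e with hB
    have hGe : 0 ≤ 2 * I * (G e.1 + G e.2.2) := by
      have := hG0 e.1; have := hG0 e.2.2; positivity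
    have hB0 : 0 ≤ B := by positivity
    have hB2 : B ^ 2 * M.edgeLen e ^ 2 = 2 * I * (G e.1 + G e.2.2) := by
      rw [hB, div_pow, Real.sq_sqrt hGe]; field_simp
    have hpt : ∀ t ∈ Set.Ioo (0 : ℝ) 1, |M.jump (fun i x => w i x ^ 2) e (M.edgePt e t)| ≤
        B * |M.jump w e (M.edgePt e t)| := by
      intro t ht
      have ht' := Set.Ioo_subset_Icc_self ht
      have m1 := hwG e.1 _ (M.lineMap_mem_fst e ht')
      have m2 := hwG e.2.2 _ (M.lineMap_mem_snd he ht')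
      change Metric.diam (M.cell e.1) ^ 2 * w e.1 (M.edgePt e t) ^ 2 ≤ _ at m1
      change Metric.diam (M.cell e.2.2) ^ 2 * w e.2.2 (M.edgePt e t) ^ 2 ≤ _ at m2
      have l1 := pow_le_pow_left₀ hl.le (M.edge_length_le_fst e) 2
      have l2 := pow_le_pow_left₀ hl.le (M.edge_length_le_snd he) 2
      simp only [Mesh.jump]
      set p := w e.1 (M.edgePt e t)
      set q := w e.2.2 (M.edgePt e t)
      have e1 : p ^ 2 - q ^ 2 = (p + q) * (p - q) := by ring
      rw [e1, abs_mul]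
      refine mul_le_mul_of_nonneg_right ?_ (abs_nonneg _)
      refine abs_le_of_sq_le_sq ?_ hB0
      have n1 := (mul_le_mul_of_nonneg_right l1 (sq_nonneg p)).trans m1
      have n2 := (mul_le_mul_of_nonneg_right l2 (sq_nonneg q)).trans m2
      refine le_of_mul_le_mul_right ?_ (pow_pos hl 2)
      rw [hB2]
      change Mesh.edgeLen M e ^ 2 * p ^ 2 ≤ _ at n1
      change Mesh.edgeLen M e ^ 2 * q ^ 2 ≤ _ at n2
      nlinarith [sq_nonneg (p - q), mul_nonneg (sq_nonneg (M.edgeLen e)) (sq_nonneg (p - q))]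
    have h1 : (M.edgeIntegral e fun x => |M.jump (fun i x => w i x ^ 2) e x|) ≤
        B * M.edgeIntegral e fun x => |M.jump w e x| := by
      rw [← M.edgeIntegral_const_mul]
      refine M.edgeIntegral_mono e ?_ ?_ hpt
      · exact (Mesh.integrableOn_Ioo_of_continuousOn (M.continuousOn_jump
          (fun i => (hwc i).pow 2) he)).abs
      · exact ((Mesh.integrableOn_Ioo_of_continuousOn (M.continuousOn_jump hwc he)).abs).const_mul _
    have h2 := pow_le_pow_left₀ (M.edgeIntegral_nonneg e fun _ _ => abs_nonneg _) h1 2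
    have h3 := hm.sq_edgeIntegral_abs_jump_le hc₁ 1 hwc he
    refine h2.trans ?_
    rw [mul_pow]
    refine (mul_le_mul_of_nonneg_left h3 (sq_nonneg _)).trans_eq ?_
    calc _ = B ^ 2 * M.edgeLen e ^ 2 * |c₂| *
          M.edgeIntegral e fun x => (hf x ^ 1)⁻¹ * M.jump w e x ^ 2 := by ring
      _ = _ := by rw [hB2]; ring
  have hsum : M.jumpSum (fun i x => w i x ^ 2) ^ 2 ≤
      (∑ e ∈ M.edges, 2 * |c₂| * I * (G e.1 + G e.2.2)) * M.jumpSq hf 1 w := by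
    refine Finset.sum_sq_le_sum_mul_sum_of_sq_le_mul _ (fun e _ => ?_)
      (fun e he => hm.edgeIntegral_nonneg hc₁ 1 w he) hedge
    have := hG0 e.1; have := hG0 e.2.2; positivity
  have hsumG : ∑ e ∈ M.edges, 2 * |c₂| * I * (G e.1 + G e.2.2) ≤
      2 * |c₂| * I * (8 * (2 * C)) * Q := by
    rw [← Finset.mul_sum, Finset.sum_add_distrib, mul_assoc _ _ Q]
    refine mul_le_mul_of_nonneg_left ?_ (by positivity)
    linarith [M.sum_edges_fst_le hG0, M.sum_edges_snd_le hG0]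
  have h := hsum.trans (mul_le_mul hsumG (b2 a) (hm.jumpSq_nonneg hc₁ _ _) (by positivity))
  rw [mul_assoc] at h
  have h4 := le_sqrt_mul_sqrt (by positivity) h
  rwa [Real.sqrt_mul_self hQ0] at h4

/-- The `L⁴` bound: the Sobolev inequality is applied to `w²` for each partial derivative `w`. The
BV norm of `w²` is controlled through `2 |w ∂w| ≤ w² + (∂w)²` and the estimate of the jumps of `w²`.
-/
theorem exists_integral_gradSq_sq_le (s : CellShape) (k : ℕ) (ϱ c₁ c₂ : ℝ) (hc₁ : 0 < c₁)
    {Ω : Set Plane} (hΩ : IsPolygonalDomain Ω) :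
    ∃ C : ℝ, 0 ≤ C ∧ ∀ (M : Mesh s Ω) (hf : Plane → ℝ), M.ShapeRegular ϱ →
      M.IsMeshFunction c₁ c₂ hf → ∀ v : M.V k,
      (M.integral fun i x => M.gradSq v i x ^ 2) ≤ C * M.scalarForm hf v v ^ 2 := by
  obtain ⟨C₁, hC₁0, hC₁⟩ := exists_integral_pd_sq_le s k ϱ c₁ c₂ hc₁ hΩ
  obtain ⟨C₂, hC₂0, hC₂⟩ := exists_jumpSum_pd_sq_le s k ϱ c₁ c₂ hc₁ hΩ
  obtain ⟨C₃, hC₃0, hC₃⟩ := hΩ.exists_integral_sq_le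
  refine ⟨4 * (C₃ * (3 * C₁ + 2 + C₂) ^ 2), by positivity, fun M hf hreg hm v => ?_⟩
  obtain ⟨b1, -, -, -, hQ0⟩ := hm.scalarForm_bounds hc₁ v
  have a1 := hC₁ M hf hreg hm v
  have a2 := hC₂ M hf hreg hm v
  set Q := M.scalarForm hf v v
  have hfour : ∀ a, (M.integral fun i x => (M.pd a (M.val v) i x ^ 2) ^ 2) ≤
      C₃ * (3 * C₁ + 2 + C₂) ^ 2 * Q ^ 2 := by
    intro a
    set w := M.pd a (M.val v) with hw
    have hw1 : ∀ i, ContDiffOn ℝ 1 (w i) (M.cell i) := fun i => M.contDiffOn_pd_val (n := 1) v a i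
    have h := hC₃ s M (fun i x => w i x ^ 2) fun i => (hw1 i).pow 2
    refine h.trans ?_
    rw [mul_assoc, ← mul_pow]
    refine mul_le_mul_of_nonneg_left (pow_le_pow_left₀ ?_ ?_ 2) hC₃0
    · have := M.jumpSum_nonneg (fun i x => w i x ^ 2)
      have := M.integral_abs_nonneg (fun i x => w i x ^ 2)
      have := Finset.sum_nonneg fun (c : Fin 2) (_ : c ∈ Finset.univ) =>
        M.integral_abs_nonneg (M.pd c fun i x => w i x ^ 2)
      positivity
    · have h1 : (M.integral fun i x => |w i x ^ 2|) ≤ C₁ * Q := by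
        simp only [abs_sq]; exact a1 a
      have hpc : ∀ c i, ContinuousOn (M.pd c w i) (M.cell i) := fun c i =>
        M.continuousOn_pd_pd_val v c a i
      have h2 : ∀ c, (M.integral fun i x => |M.pd c (fun i x => w i x ^ 2) i x|) ≤
          C₁ * Q + Q := by
        intro c
        have i1 : M.CellIntegrable fun i x => w i x ^ 2 :=
          Mesh.cellIntegrable_of_continuousOn fun i => (hw1 i).continuousOn.pow 2
        have i2 : M.CellIntegrable fun i x => M.pd c w i x ^ 2 :=
          Mesh.cellIntegrable_of_continuousOn fun i => (hpc c i).pow 2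
        refine le_trans (Mesh.integral_mono ?_ (i1.add i2) ?_) ?_
        · refine Mesh.CellIntegrable.abs (Mesh.cellIntegrable_of_continuousOn fun i => ?_)
          exact (M.contDiffOn_pd (m := 0) ((hw1 i).pow 2) (by norm_num) c).continuousOn
        · intro i x hx
          rw [M.pd_sq ((hw1 i).differentiableOn (by norm_num)) c hx]
          refine abs_le.2 ⟨?_, ?_⟩
          · nlinarith [sq_nonneg (w i x + M.pd c w i x)]
          · nlinarith [sq_nonneg (w i x - M.pd c w i x)]
        · rw [Mesh.integral_add i1 i2]
          exact add_le_add (a1 a) (b1 c a)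
      rw [Fin.sum_univ_two]
      linarith [h2 0, h2 1, a2 a]
  have i4 : ∀ a, M.CellIntegrable fun i x => (M.pd a (M.val v) i x ^ 2) ^ 2 := fun a =>
    Mesh.cellIntegrable_of_continuousOn fun i => ((M.continuousOn_pd_val v a i).pow 2).pow 2
  have h5 : (M.integral fun i x => M.gradSq v i x ^ 2) ≤
      M.integral fun i x => 2 * ((M.pd 0 (M.val v) i x ^ 2) ^ 2 + (M.pd 1 (M.val v) i x ^ 2) ^ 2) := by
    refine Mesh.integral_mono (Mesh.cellIntegrable_of_continuousOn fun i =>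
      (M.continuousOn_gradSq v i).pow 2) (((i4 0).add (i4 1)).const_mul 2) fun i x _ => ?_
    rw [Mesh.gradSq, Fin.sum_univ_two]
    nlinarith [sq_nonneg (M.pd 0 (M.val v) i x ^ 2 - M.pd 1 (M.val v) i x ^ 2)]
  rw [Mesh.integral_const_mul, Mesh.integral_add (i4 0) (i4 1)] at h5
  linarith [hfour 0, hfour 1]

/-! ### Vector-valued functions -/

namespace Mesh

variable {s : CellShape} {Ω : Set Plane} (M : Mesh s Ω) {k : ℕ}

/-- The squared norm of the broken gradient. -/
noncomputable def vgradSq (v : M.V3 k) (i : Fin M.N) (x : Plane) : ℝ := ∑ m, M.gradSq (v m) i x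

theorem vgradSq_nonneg (v : M.V3 k) (i : Fin M.N) (x : Plane) : 0 ≤ M.vgradSq v i x :=
  Finset.sum_nonneg fun _ _ => M.gradSq_nonneg _ _ _

theorem continuousOn_vgradSq (v : M.V3 k) (i : Fin M.N) : ContinuousOn (M.vgradSq v i) (M.cell i) :=
  continuousOn_finsetSum _ fun m _ => M.continuousOn_gradSq (v m) i

theorem innerH2_eq (hf : Plane → ℝ) (v w : M.V3 k) :
    M.innerH2 hf v w = ∑ m, M.scalarForm hf (v m) (w m) := rfl

variable {M} in
theorem IsMeshFunction.innerH2_nonneg {c₁ c₂ : ℝ} {hf : Plane → ℝ} (hc₁ : 0 < c₁)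
    (hm : M.IsMeshFunction c₁ c₂ hf) (v : M.V3 k) : 0 ≤ M.innerH2 hf v v :=
  Finset.sum_nonneg fun m _ => (hm.scalarForm_bounds hc₁ (v m)).2.2.2.2

variable {M} in
theorem IsMeshFunction.normH2_sq {c₁ c₂ : ℝ} {hf : Plane → ℝ} (hc₁ : 0 < c₁)
    (hm : M.IsMeshFunction c₁ c₂ hf) (v : M.V3 k) : M.normH2 hf v ^ 2 = M.innerH2 hf v v :=
  Real.sq_sqrt (hm.innerH2_nonneg hc₁ v)

theorem bddBelow_diam_cell : BddBelow (Set.range fun i => Metric.diam (M.cell i)) :=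
  (Set.finite_range _).bddBelow

theorem hMin_le (i : Fin M.N) : M.hMin ≤ Metric.diam (M.cell i) := ciInf_le M.bddBelow_diam_cell i

theorem hMin_pos (i : Fin M.N) : 0 < M.hMin := by
  have : Nonempty (Fin M.N) := ⟨i⟩
  obtain ⟨j, hj⟩ := exists_eq_ciInf_of_finite (f := fun i => Metric.diam (M.cell i))
  rw [hMin, ← hj]
  exact M.diam_cell_pos j

end Mesh

theorem exists_integral_vgradSq_sq_le (s : CellShape) (k : ℕ) (ϱ c₁ c₂ : ℝ) (hc₁ : 0 < c₁)
    {Ω : Set Plane} (hΩ : IsPolygonalDomain Ω) :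
    ∃ C : ℝ, 0 ≤ C ∧ ∀ (M : Mesh s Ω) (hf : Plane → ℝ), M.ShapeRegular ϱ →
      M.IsMeshFunction c₁ c₂ hf → ∀ v : M.V3 k,
      (M.integral fun i x => M.vgradSq v i x ^ 2) ≤ C * M.innerH2 hf v v ^ 2 := by
  obtain ⟨C, hC0, hC⟩ := exists_integral_gradSq_sq_le s k ϱ c₁ c₂ hc₁ hΩ
  refine ⟨3 * C, by positivity, fun M hf hreg hm v => ?_⟩
  have h := fun m => hC M hf hreg hm (v m)
  have hq := fun m => (hm.scalarForm_bounds hc₁ (v m)).2.2.2.2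
  have hi : ∀ m, M.CellIntegrable fun i x => M.gradSq (v m) i x ^ 2 := fun m =>
    Mesh.cellIntegrable_of_continuousOn fun i => (M.continuousOn_gradSq (v m) i).pow 2
  have h1 : (M.integral fun i x => M.vgradSq v i x ^ 2) ≤
      M.integral fun i x => 3 * ∑ m, M.gradSq (v m) i x ^ 2 := by
    refine Mesh.integral_mono (Mesh.cellIntegrable_of_continuousOn fun i =>
      (M.continuousOn_vgradSq v i).pow 2) ((Mesh.CellIntegrable.sum fun m _ => hi m).const_mul 3)
      fun i x _ => ?_
    have := sq_sum_le_card_mul_sum_sq (s := Finset.univ) (f := fun m => M.gradSq (v m) i x)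
    simpa [Mesh.vgradSq] using this
  rw [Mesh.integral_const_mul, Mesh.integral_sum fun m _ => hi m] at h1
  rw [Mesh.innerH2_eq]
  simp only [Fin.sum_univ_three] at h1 ⊢
  have h0 := h 0
  have h1' := h 1
  have h2 := h 2
  have q0 := hq 0
  have q1 := hq 1
  have q2 := hq 2
  have : C * (M.scalarForm hf (v 0) (v 0) ^ 2 + M.scalarForm hf (v 1) (v 1) ^ 2 +
      M.scalarForm hf (v 2) (v 2) ^ 2) ≤ C * (M.scalarForm hf (v 0) (v 0) +
      M.scalarForm hf (v 1) (v 1) + M.scalarForm hf (v 2) (v 2)) ^ 2 := by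
    refine mul_le_mul_of_nonneg_left ?_ hC0
    nlinarith [mul_nonneg q0 q1, mul_nonneg q0 q2, mul_nonneg q1 q2]
  linarith

/-- Pointwise control of the gradient by the discrete norm. -/
theorem exists_vgradSq_le (s : CellShape) (k : ℕ) (ϱ c₁ c₂ : ℝ) (hc₁ : 0 < c₁)
    {Ω : Set Plane} (hΩ : IsPolygonalDomain Ω) :
    ∃ C : ℝ, 0 ≤ C ∧ ∀ (M : Mesh s Ω) (hf : Plane → ℝ), M.ShapeRegular ϱ →
      M.IsMeshFunction c₁ c₂ hf → ∀ v : M.V3 k, ∀ i, ∀ x ∈ M.cell i,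
      M.vgradSq v i x ≤ C * (M.hMin⁻¹ * M.innerH2 hf v v) := by
  obtain ⟨C, hC0, hC⟩ := exists_integral_vgradSq_sq_le s k ϱ c₁ c₂ hc₁ hΩ
  obtain ⟨I, hI0, hI⟩ := exists_inverse_inequality s k ϱ
  refine ⟨√(I ^ 2 * Real.pi * C), by positivity, fun M hf hreg hm v i x hx => ?_⟩
  have hQ0 := hm.innerH2_nonneg hc₁ v
  have h1 := hC M hf hreg hm v
  set Q := M.innerH2 hf v v
  set h := Metric.diam (M.cell i) with hh
  have hpos : 0 < h := M.diam_cell_pos i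
  set J := ∫ y in M.cell i, M.vgradSq v i y with hJ
  have hinv : h ^ 2 * M.vgradSq v i x ≤ I * J := by
    rw [hJ]
    have e : ∫ y in M.cell i, M.vgradSq v i y = ∑ m, ∫ y in M.cell i, M.gradSq (v m) i y :=
      MeasureTheory.integral_finsetSum _ fun m _ =>
        (M.continuousOn_gradSq (v m) i).integrableOn_compact (M.isCompact_cell i)
    rw [e, Mesh.vgradSq, Finset.mul_sum, Finset.mul_sum]
    exact Finset.sum_le_sum fun m _ => hI Ω M hreg (v m) i x hx
  have hvol : (volume (M.cell i)).toReal ≤ Real.pi * h ^ 2 := by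
    obtain ⟨a, -, -⟩ := s.two_vertices
    have : M.cell i ⊆ Metric.closedBall (M.vert i a) h := fun y hy =>
      Metric.dist_le_diam_of_mem (M.isCompact_cell i).isBounded hy (M.vert_mem_cell i a)
    have h2 := measure_mono (μ := volume) this
    rw [CellShape.volume_ball_plane _ hpos.le] at h2
    have := ENNReal.toReal_mono ENNReal.ofReal_ne_top h2
    rwa [ENNReal.toReal_ofReal (by positivity)] at this
  have hvc := M.continuousOn_vgradSq v i
  -- Hölder on a single cell, whose area is at most `π h²`, gives `J` of order `h ‖v‖²`. Combined
  -- with the inverse inequality this loses one power of `h` for the squared gradient, whereas the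
  -- `L²` bound alone would lose two.
  have hcs : J ^ 2 ≤ Real.pi * h ^ 2 * (C * Q ^ 2) := by
    have h2 := PrestrainedPlate.integral_mul_sq_le (μ := volume.restrict (M.cell i))
      (f := M.vgradSq v i) (g := fun _ => 1)
      ((hvc.pow 2).integrableOn_compact (M.isCompact_cell i))
      (by simp only [mul_one]; exact hvc.integrableOn_compact (M.isCompact_cell i))
      (by simp only [one_pow]; exact continuousOn_const.integrableOn_compact (M.isCompact_cell i))
    simp only [mul_one, one_pow, integral_const, smul_eq_mul, measureReal_restrict_apply_univ] at h2
    refine h2.trans ?_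
    rw [mul_comm]
    refine mul_le_mul hvol (le_trans ?_ h1) (setIntegral_nonneg (M.measurableSet_cell i)
      fun _ _ => sq_nonneg _) (by positivity)
    exact Finset.single_le_sum (f := fun i => ∫ y in M.cell i, M.vgradSq v i y ^ 2)
      (fun i _ => setIntegral_nonneg (M.measurableSet_cell i) fun _ _ => sq_nonneg _)
      (Finset.mem_univ i)
  have hv0 := M.vgradSq_nonneg v i x
  have h3 : (h * M.vgradSq v i x) ^ 2 ≤ I ^ 2 * Real.pi * C * (Q ^ 2) := by
    have h4 := pow_le_pow_left₀ (by positivity) hinv 2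
    have h5 : h ^ 2 * (h * M.vgradSq v i x) ^ 2 ≤ h ^ 2 * (I ^ 2 * Real.pi * C * Q ^ 2) := by
      have := mul_le_mul_of_nonneg_left hcs (sq_nonneg I)
      nlinarith
    exact le_of_mul_le_mul_left h5 (by positivity)
  have h6 := le_sqrt_mul_sqrt (by positivity) h3
  rw [Real.sqrt_sq hQ0] at h6
  have hm0 := M.hMin_pos i
  rw [mul_left_comm, ← div_eq_inv_mul, le_div_iff₀ hm0, mul_comm]
  exact (mul_le_mul_of_nonneg_right (M.hMin_le i) hv0).trans h6

end PrestrainedPlate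

/-! ### Continuity of the stretching form and bounds for an increment. -/

namespace PrestrainedPlate

open scoped ENNReal

/-! ### Pointwise matrix inequalities -/

theorem frob_self_nonneg (A : Matrix (Fin 2) (Fin 2) ℝ) : 0 ≤ frob A A :=
  Finset.sum_nonneg fun _ _ => Finset.sum_nonneg fun _ _ => mul_self_nonneg _

theorem frob_add_le (A B : Matrix (Fin 2) (Fin 2) ℝ) :
    frob (A + B) (A + B) ≤ 2 * frob A A + 2 * frob B B := by
  simp only [frob, Fin.sum_univ_two, Matrix.add_apply]
  nlinarith [sq_nonneg (A 0 0 - B 0 0), sq_nonneg (A 0 1 - B 0 1), sq_nonneg (A 1 0 - B 1 0),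
    sq_nonneg (A 1 1 - B 1 1)]

theorem trace_sq_le (A : Matrix (Fin 2) (Fin 2) ℝ) : (A 0 0 + A 1 1) ^ 2 ≤ 2 * frob A A := by
  simp only [frob, Fin.sum_univ_two]
  nlinarith [sq_nonneg (A 0 0 - A 1 1), sq_nonneg (A 0 1), sq_nonneg (A 1 0)]

namespace Mesh

variable {s : CellShape} {Ω : Set Plane} (M : Mesh s Ω) {k : ℕ}

theorem frob_gradProd_le (v w : M.V3 k) (i : Fin M.N) (x : Plane) :
    frob (M.gradProd v w i x) (M.gradProd v w i x) ≤ M.vgradSq v i x * M.vgradSq w i x := by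
  have h : ∀ a b, M.gradProd v w i x a b * M.gradProd v w i x a b ≤
      (∑ m, M.pd a (M.val (v m)) i x ^ 2) * ∑ m, M.pd b (M.val (w m)) i x ^ 2 := fun a b => by
    rw [← sq]
    exact Finset.sum_mul_sq_le_sq_mul_sq Finset.univ (fun m => M.pd a (M.val (v m)) i x)
      fun m => M.pd b (M.val (w m)) i x
  have e : ∀ u : M.V3 k, M.vgradSq u i x = ∑ a, ∑ m, M.pd a (M.val (u m)) i x ^ 2 := fun u => by
    rw [Finset.sum_comm]; rfl
  rw [e, e, Finset.sum_mul]
  refine Finset.sum_le_sum fun a _ => ?_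
  rw [Finset.mul_sum]
  exact Finset.sum_le_sum fun b _ => h a b

/-! ### Essentially bounded piecewise functions -/

/-- Unlike integrability, essential boundedness is stable under products, so all integrands below
are integrable for formal reasons. -/
def CellBounded (f : Fin M.N → Plane → ℝ) : Prop :=
  ∀ i, MemLp (f i) ∞ (volume.restrict (M.cell i))

variable {M}

theorem cellBounded_of_continuousOn {f : Fin M.N → Plane → ℝ}
    (hf : ∀ i, ContinuousOn (f i) (M.cell i)) : M.CellBounded f := by
  intro i
  obtain ⟨C, hC⟩ := (M.isCompact_cell i).exists_bound_of_continuousOn (hf i)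
  exact memLp_top_of_bound ((hf i).aestronglyMeasurable (M.measurableSet_cell i)) C
    ((ae_restrict_mem (M.measurableSet_cell i)).mono hC)

theorem CellBounded.add {f g : Fin M.N → Plane → ℝ} (hf : M.CellBounded f) (hg : M.CellBounded g) :
    M.CellBounded fun i x => f i x + g i x := fun i => (hf i).add (hg i)

theorem CellBounded.sub {f g : Fin M.N → Plane → ℝ} (hf : M.CellBounded f) (hg : M.CellBounded g) :
    M.CellBounded fun i x => f i x - g i x := fun i => (hf i).sub (hg i)

theorem CellBounded.mul {f g : Fin M.N → Plane → ℝ} (hf : M.CellBounded f) (hg : M.CellBounded g) :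
    M.CellBounded fun i x => f i x * g i x := fun i => (hg i).mul' (hf i)

theorem CellBounded.sum {κ : Type*} {T : Finset κ} {f : κ → Fin M.N → Plane → ℝ}
    (hf : ∀ j ∈ T, M.CellBounded (f j)) : M.CellBounded fun i x => ∑ j ∈ T, f j i x :=
  fun i => memLp_finsetSum T fun j hj => hf j hj i

theorem CellBounded.cellIntegrable {f : Fin M.N → Plane → ℝ} (hf : M.CellBounded f) :
    M.CellIntegrable f := fun i => by
  have : IsFiniteMeasure (volume.restrict (M.cell i)) :=
    ⟨by simpa using (M.isCompact_cell i).measure_lt_top⟩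
  exact (hf i).integrable le_top

theorem cellBounded_val (v : M.V k) : M.CellBounded (M.val v) :=
  cellBounded_of_continuousOn (M.continuousOn_val v)

theorem cellBounded_pd_val (v : M.V k) (a : Fin 2) : M.CellBounded (M.pd a (M.val v)) :=
  cellBounded_of_continuousOn (M.continuousOn_pd_val v a)

theorem cellBounded_pd_pd_val (v : M.V k) (a b : Fin 2) :
    M.CellBounded (M.pd a (M.pd b (M.val v))) :=
  cellBounded_of_continuousOn (M.continuousOn_pd_pd_val v a b)

variable (M)

theorem restrict_cell_le (hΩ : IsPolygonalDomain Ω) (i : Fin M.N) :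
    volume.restrict (M.cell i) ≤ volume.restrict Ω := by
  rw [Measure.restrict_congr_set (M.cell_ae_eq_interior i)]
  exact Measure.restrict_mono (M.interior_cell_subset hΩ i) le_rfl

/-- Piecewise matrix fields with essentially bounded entries. -/
def MatBounded (A : Fin M.N → Plane → Matrix (Fin 2) (Fin 2) ℝ) : Prop :=
  ∀ a b, M.CellBounded fun i x => A i x a b

variable {M}

theorem MatBounded.add {A B : Fin M.N → Plane → Matrix (Fin 2) (Fin 2) ℝ} (hA : M.MatBounded A)
    (hB : M.MatBounded B) : M.MatBounded fun i x => A i x + B i x := fun a b =>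
  (hA a b).add (hB a b)

theorem MatBounded.sub {A B : Fin M.N → Plane → Matrix (Fin 2) (Fin 2) ℝ} (hA : M.MatBounded A)
    (hB : M.MatBounded B) : M.MatBounded fun i x => A i x - B i x := fun a b =>
  (hA a b).sub (hB a b)

theorem MatBounded.mul {A B : Fin M.N → Plane → Matrix (Fin 2) (Fin 2) ℝ} (hA : M.MatBounded A)
    (hB : M.MatBounded B) : M.MatBounded fun i x => A i x * B i x := fun a b => by
  simp only [Matrix.mul_apply]
  exact CellBounded.sum fun j _ => (hA a j).mul (hB j b)

theorem MatBounded.frob {A B : Fin M.N → Plane → Matrix (Fin 2) (Fin 2) ℝ} (hA : M.MatBounded A)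
    (hB : M.MatBounded B) : M.CellBounded fun i x => frob (A i x) (B i x) :=
  CellBounded.sum fun a _ => CellBounded.sum fun b _ => (hA a b).mul (hB a b)

theorem matBounded_gradProd (v w : M.V3 k) : M.MatBounded (M.gradProd v w) := fun a b =>
  CellBounded.sum (T := Finset.univ)
    (f := fun m i x => M.pd a (M.val (v m)) i x * M.pd b (M.val (w m)) i x) fun m _ => (cellBounded_pd_val (v m) a).mul (cellBounded_pd_val (w m) b)

theorem matBounded_of_memLp (hΩ : IsPolygonalDomain Ω) {g : Plane → Matrix (Fin 2) (Fin 2) ℝ}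
    (hg : ∀ a b, MemLp (fun x => g x a b) ⊤ (volume.restrict Ω)) :
    M.MatBounded fun _ x => g x := fun a b i =>
  (hg a b).mono_measure (M.restrict_cell_le hΩ i)

theorem sq_integral_frob_le {A B : Fin M.N → Plane → Matrix (Fin 2) (Fin 2) ℝ}
    (hA : M.MatBounded A) (hB : M.MatBounded B) :
    (M.integral fun i x => PrestrainedPlate.frob (A i x) (B i x)) ^ 2 ≤
      (M.integral fun i x => PrestrainedPlate.frob (A i x) (A i x)) *
        M.integral fun i x => PrestrainedPlate.frob (B i x) (B i x) := by
  refine sq_le_mul_of_forall_nonneg fun t => ?_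
  have h : 0 ≤ M.integral fun i x =>
      PrestrainedPlate.frob (A i x + t • B i x) (A i x + t • B i x) :=
    integral_nonneg fun i x _ => frob_self_nonneg _
  have e : ∀ i x, PrestrainedPlate.frob (A i x + t • B i x) (A i x + t • B i x) =
      PrestrainedPlate.frob (A i x) (A i x) + 2 * t * PrestrainedPlate.frob (A i x) (B i x) +
        t ^ 2 * PrestrainedPlate.frob (B i x) (B i x) := fun i x => by
    simp only [PrestrainedPlate.frob, Fin.sum_univ_two, Matrix.add_apply, Matrix.smul_apply,
      smul_eq_mul]
    ring
  simp_rw [e] at h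
  have hAA := (hA.frob hA).cellIntegrable
  have hAB := (hA.frob hB).cellIntegrable
  have hBB := (hB.frob hB).cellIntegrable
  rwa [integral_add (hAA.add (hAB.const_mul _)) (hBB.const_mul _),
    integral_add hAA (hAB.const_mul _), integral_const_mul, integral_const_mul] at h

/-! ### The stretching form -/

variable (M)

/-- `∇yᵀ∇y - g`. -/
noncomputable def strain (g : Plane → Matrix (Fin 2) (Fin 2) ℝ) (y : M.V3 k) (i : Fin M.N)
    (x : Plane) : Matrix (Fin 2) (Fin 2) ℝ := M.gradProd y y i x - g x

/-- `∇vᵀ∇y + ∇yᵀ∇v`. -/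
noncomputable def symProd (v y : M.V3 k) (i : Fin M.N) (x : Plane) : Matrix (Fin 2) (Fin 2) ℝ :=
  M.gradProd v y i x + M.gradProd y v i x

variable {M}

theorem matBounded_strain (hΩ : IsPolygonalDomain Ω) {g : Plane → Matrix (Fin 2) (Fin 2) ℝ}
    (hg : ∀ a b, MemLp (fun x => g x a b) ⊤ (volume.restrict Ω)) (y : M.V3 k) :
    M.MatBounded (M.strain g y) := (matBounded_gradProd y y).sub (matBounded_of_memLp hΩ hg)

theorem matBounded_symProd (v y : M.V3 k) : M.MatBounded (M.symProd v y) :=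
  (matBounded_gradProd v y).add (matBounded_gradProd y v)

theorem integral_frob_strain (g : Plane → Matrix (Fin 2) (Fin 2) ℝ) (y : M.V3 k) :
    (M.integral fun i x => PrestrainedPlate.frob (M.strain g y i x) (M.strain g y i x)) =
      2 * M.stretchEnergy g y := by
  rw [stretchEnergy]; unfold strain; ring

theorem stretchEnergy_nonneg (g : Plane → Matrix (Fin 2) (Fin 2) ℝ) (y : M.V3 k) :
    0 ≤ M.stretchEnergy g y :=
  mul_nonneg (by norm_num) (integral_nonneg fun _ _ _ => frob_self_nonneg _)

theorem cellIntegrable_vgradSq_mul (v w : M.V3 k) :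
    M.CellIntegrable fun i x => M.vgradSq v i x * M.vgradSq w i x :=
  cellIntegrable_of_continuousOn fun i => (M.continuousOn_vgradSq v i).mul (M.continuousOn_vgradSq w i)

theorem integral_frob_symProd_le (v w : M.V3 k) :
    (M.integral fun i x => PrestrainedPlate.frob (M.symProd v w i x) (M.symProd v w i x)) ≤
      4 * M.integral fun i x => M.vgradSq v i x * M.vgradSq w i x := by
  rw [← integral_const_mul]
  refine integral_mono ((matBounded_symProd v w).frob (matBounded_symProd v w)).cellIntegrable
    ((cellIntegrable_vgradSq_mul v w).const_mul 4) fun i x _ => ?_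
  refine (frob_add_le _ _).trans ?_
  have h1 := M.frob_gradProd_le v w i x
  have h2 := M.frob_gradProd_le w v i x
  linarith

theorem sq_stretchForm_le (hΩ : IsPolygonalDomain Ω) {g : Plane → Matrix (Fin 2) (Fin 2) ℝ}
    (hg : ∀ a b, MemLp (fun x => g x a b) ⊤ (volume.restrict Ω)) (z v w : M.V3 k) :
    M.stretchForm g z v w ^ 2 ≤
      (M.integral fun i x => PrestrainedPlate.frob (M.symProd w v i x) (M.symProd w v i x)) *
        (2 * M.stretchEnergy g z) := by
  rw [← integral_frob_strain]
  exact sq_integral_frob_le (matBounded_symProd w v) (matBounded_strain hΩ hg z)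

end Mesh

/-- The summand `1` keeps the constant positive even when `K` vanishes. -/
theorem abs_le_of_sq_le_prod {x K E p q : ℝ} (hK : 0 ≤ K) (hE : 0 ≤ E) (hp : 0 ≤ p) (hq : 0 ≤ q)
    (h : x ^ 2 ≤ K * E * p ^ 2 * q ^ 2) : |x| ≤ (√K + 1) * √E * p * q := by
  have h3 : x ^ 2 ≤ (√K * √E * p * q) ^ 2 := by
    rwa [mul_pow, mul_pow, mul_pow, Real.sq_sqrt hK, Real.sq_sqrt hE]
  have h4 := abs_le_of_sq_le_sq h3 (by positivity)
  have h5 : 0 ≤ √E * p * q := by positivity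
  linarith

/-- The stretching form is continuous with respect to the discrete norm. -/
theorem exists_continuity_constant (s : CellShape) (k : ℕ) (ϱ c₁ c₂ : ℝ) (hc₁ : 0 < c₁)
    {Ω : Set Plane} (hΩ : IsPolygonalDomain Ω) {g : Plane → Matrix (Fin 2) (Fin 2) ℝ}
    (hg : ∀ a b, MemLp (fun x => g x a b) ⊤ (volume.restrict Ω)) :
    ∃ Cp : ℝ, 0 < Cp ∧ IsContinuityConstant Ω g s k ϱ c₁ c₂ Cp := by
  obtain ⟨C, hC0, hC⟩ := exists_integral_vgradSq_sq_le s k ϱ c₁ c₂ hc₁ hΩ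
  refine ⟨√(8 * C) + 1, by positivity, fun M hf hreg hm z v w => ?_⟩
  have hE := Mesh.stretchEnergy_nonneg g z
  have hv := hC M hf hreg hm v
  have hw := hC M hf hreg hm w
  rw [← hm.normH2_sq hc₁] at hv hw
  have hnv : 0 ≤ M.normH2 hf v := Real.sqrt_nonneg _
  have hnw : 0 ≤ M.normH2 hf w := Real.sqrt_nonneg _
  have hci : ∀ u : M.V3 k, M.CellIntegrable fun i x => M.vgradSq u i x ^ 2 := fun u =>
    Mesh.cellIntegrable_of_continuousOn fun i => (M.continuousOn_vgradSq u i).pow 2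
  -- Two applications of the `L⁴` bound, joined by Cauchy–Schwarz; no negative power of the mesh
  -- size appears.
  have h1 : (M.integral fun i x => M.vgradSq w i x * M.vgradSq v i x) ≤
      C * (M.normH2 hf w ^ 2 * M.normH2 hf v ^ 2) := by
    have h := Mesh.integral_mul_sq_le (hci w) (Mesh.cellIntegrable_vgradSq_mul w v) (hci v)
    have h2 := h.trans (mul_le_mul hw hv (Mesh.integral_nonneg fun _ _ _ => sq_nonneg _)
      (by positivity))
    refine le_of_sq_le_sq (h2.trans_eq (by ring)) (by positivity)
  have h2 := Mesh.sq_stretchForm_le hΩ hg z v w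
  have h4 := (Mesh.integral_frob_symProd_le w v).trans (mul_le_mul_of_nonneg_left h1 (by norm_num))
  refine abs_le_of_sq_le_prod (by positivity) hE hnv hnw (h2.trans ?_)
  exact (mul_le_mul_of_nonneg_right h4 (mul_nonneg zero_le_two hE)).trans_eq (by ring)

namespace Mesh

variable {s : CellShape} {Ω : Set Plane} {M : Mesh s Ω} {k : ℕ}

/-! ### Gradients and energy -/

theorem integral_le_setIntegral (hΩ : IsPolygonalDomain Ω) {f : Plane → ℝ} (hf : IntegrableOn f Ω)
    (h0 : ∀ x, 0 ≤ f x) : (M.integral fun _ x => f x) ≤ ∫ x in Ω, f x := by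
  have hi : ∀ i, IntegrableOn f (interior (M.cell i)) := fun i =>
    hf.mono_set (M.interior_cell_subset hΩ i)
  have e : (M.integral fun _ x => f x) = ∫ x in ⋃ i, interior (M.cell i), f x := by
    rw [integral_iUnion_fintype (fun i => isOpen_interior.measurableSet)
      (fun i j hij => M.disjoint_interior hij) hi]
    exact Finset.sum_congr rfl fun i _ => setIntegral_congr_set (M.cell_ae_eq_interior i)
  rw [e]
  exact setIntegral_mono_set hf (Filter.Eventually.of_forall h0)
    (Set.iUnion_subset fun i => M.interior_cell_subset hΩ i).eventuallyLE

theorem integrableOn_sqrt_frob (hΩ : IsPolygonalDomain Ω) {g : Plane → Matrix (Fin 2) (Fin 2) ℝ}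
    (hg : ∀ a b, MemLp (fun x => g x a b) ⊤ (volume.restrict Ω)) :
    IntegrableOn (fun x => √(PrestrainedPlate.frob (g x) (g x))) Ω := by
  have : IsFiniteMeasure (volume.restrict Ω) := ⟨by simpa using hΩ.2.1.measure_lt_top⟩
  have h1 : MemLp (fun x => PrestrainedPlate.frob (g x) (g x)) ⊤ (volume.restrict Ω) :=
    memLp_finsetSum _ fun a _ => memLp_finsetSum _ fun b _ => (hg a b).mul' (hg a b)
  have h2 : Integrable (fun x => PrestrainedPlate.frob (g x) (g x) + 1) (volume.restrict Ω) :=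
    (h1.integrable le_top).add (integrable_const 1)
  refine h2.mono' (Real.continuous_sqrt.comp_aestronglyMeasurable h1.1) ?_
  refine Filter.Eventually.of_forall fun x => ?_
  have h3 := frob_self_nonneg (g x)
  rw [Real.norm_eq_abs, abs_of_nonneg (Real.sqrt_nonneg _)]
  nlinarith [Real.sq_sqrt h3, Real.sqrt_nonneg (PrestrainedPlate.frob (g x) (g x))]

theorem normL1_nonneg (g : Plane → Matrix (Fin 2) (Fin 2) ℝ) : 0 ≤ normL1 Ω g :=
  MeasureTheory.integral_nonneg fun _ => Real.sqrt_nonneg _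

/-- `|∇y|²` is the trace of `∇yᵀ∇y`, that is, the trace of the strain plus the trace of `g`. The
first is controlled in `L¹` by `√E` through Cauchy–Schwarz, the second by the norm of `g`. -/
theorem integral_vgradSq_le (hΩ : IsPolygonalDomain Ω) {g : Plane → Matrix (Fin 2) (Fin 2) ℝ}
    (hg : ∀ a b, MemLp (fun x => g x a b) ⊤ (volume.restrict Ω)) (y : M.V3 k) :
    M.integral (M.vgradSq y) ≤ (2 * √(volume (closure Ω)).toReal + 2) *
      (√(M.stretchEnergy g y) + normL1 Ω g) := by
  have hS := matBounded_strain hΩ hg y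
  set t : Fin M.N → Plane → ℝ := fun i x => M.strain g y i x 0 0 + M.strain g y i x 1 1 with ht
  have htb : M.CellBounded t := (hS 0 0).add (hS 1 1)
  have htb2 : M.CellIntegrable fun i x => t i x ^ 2 := by
    simp only [sq]; exact (htb.mul htb).cellIntegrable
  have hgi : M.CellIntegrable fun _ x => √(PrestrainedPlate.frob (g x) (g x)) := fun i =>
    Integrable.mono_measure (integrableOn_sqrt_frob hΩ hg) (M.restrict_cell_le hΩ i)
  have hE := stretchEnergy_nonneg g y
  have h1 : M.integral (M.vgradSq y) ≤
      M.integral fun i x => |t i x| + 2 * √(PrestrainedPlate.frob (g x) (g x)) := by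
    refine integral_mono (cellIntegrable_of_continuousOn (M.continuousOn_vgradSq y))
      (htb.cellIntegrable.abs.add (hgi.const_mul 2)) fun i x _ => ?_
    have e : M.vgradSq y i x = t i x + (g x 0 0 + g x 1 1) := by
      simp only [ht, strain, vgradSq, gradSq, gradProd, Matrix.sub_apply, Matrix.of_apply,
        Fin.sum_univ_two, Fin.sum_univ_three]
      ring
    rw [e]
    have h2 : g x 0 0 + g x 1 1 ≤ 2 * √(PrestrainedPlate.frob (g x) (g x)) := by
      refine le_of_sq_le_sq ?_ (by positivity)
      rw [mul_pow, Real.sq_sqrt (frob_self_nonneg _)]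
      linarith [trace_sq_le (g x), frob_self_nonneg (g x)]
    linarith [le_abs_self (t i x)]
  have h2 : (M.integral fun i x => |t i x|) ≤
      2 * √(volume (closure Ω)).toReal * √(M.stretchEnergy g y) := by
    have h3 : (M.integral fun i x => t i x ^ 2) ≤ 4 * M.stretchEnergy g y := by
      have h4 : (M.integral fun i x => t i x ^ 2) ≤ M.integral fun i x =>
          2 * PrestrainedPlate.frob (M.strain g y i x) (M.strain g y i x) :=
        integral_mono htb2 ((hS.frob hS).cellIntegrable.const_mul 2) fun i x _ => trace_sq_le _
      rw [integral_const_mul, integral_frob_strain] at h4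
      linarith
    have h4 := M.sq_integral_abs_le hΩ htb.cellIntegrable htb2
    refine le_of_sq_le_sq ?_ (by positivity)
    rw [mul_pow, mul_pow, Real.sq_sqrt ENNReal.toReal_nonneg, Real.sq_sqrt hE]
    refine (h4.trans (mul_le_mul_of_nonneg_left h3 ENNReal.toReal_nonneg)).trans_eq (by ring)
  have h3 := M.integral_le_setIntegral hΩ (integrableOn_sqrt_frob hΩ hg) fun x => Real.sqrt_nonneg _
  rw [integral_add htb.cellIntegrable.abs (hgi.const_mul 2), integral_const_mul] at h1
  change _ ≤ normL1 Ω g at h3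
  have h4 := normL1_nonneg (Ω := Ω) g
  have h5 := mul_nonneg (Real.sqrt_nonneg (volume (closure Ω)).toReal) h4
  have h6 := Real.sqrt_nonneg (M.stretchEnergy g y)
  linarith

end Mesh

/-- Bounds of the terms of first and second order of the strain of a perturbation. -/
theorem exists_increment_bounds (s : CellShape) (k : ℕ) (ϱ c₁ c₂ : ℝ) (hc₁ : 0 < c₁)
    {Ω : Set Plane} (hΩ : IsPolygonalDomain Ω) {g : Plane → Matrix (Fin 2) (Fin 2) ℝ}
    (hg : ∀ a b, MemLp (fun x => g x a b) ⊤ (volume.restrict Ω)) :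
    ∃ K : ℝ, 0 < K ∧ ∀ (M : Mesh s Ω) (hf : Plane → ℝ), M.ShapeRegular ϱ →
      M.IsMeshFunction c₁ c₂ hf → ∀ y δ : M.V3 k,
      (M.integral fun i x => frob (M.symProd δ y i x) (M.symProd δ y i x)) ≤
        K * (M.hMin⁻¹ * (√(M.stretchEnergy g y) + normL1 Ω g)) * M.innerH2 hf δ δ ∧
      (M.integral fun i x => frob (M.gradProd δ δ i x) (M.gradProd δ δ i x)) ≤
        K * M.innerH2 hf δ δ ^ 2 := by
  obtain ⟨C, hC0, hC⟩ := exists_integral_vgradSq_sq_le s k ϱ c₁ c₂ hc₁ hΩ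
  obtain ⟨I, hI0, hI⟩ := exists_vgradSq_le s k ϱ c₁ c₂ hc₁ hΩ
  set A := 2 * √(volume (closure Ω)).toReal + 2 with hA
  have hA0 : 0 ≤ A := by positivity
  refine ⟨C + 4 * I * A + 1, by positivity, fun M hf hreg hm y δ => ⟨?_, ?_⟩⟩
  · have hQ := hm.innerH2_nonneg hc₁ δ
    have hh : 0 ≤ M.hMin⁻¹ := inv_nonneg.2 (Real.iInf_nonneg fun i => Metric.diam_nonneg)
    -- The increment is measured in `L^∞` and `|∇y|²` in `L¹`, the norm that the energy controls.
    -- This is the only place where `h_min⁻¹` enters the energy estimate.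
    have h1 : (M.integral fun i x => M.vgradSq δ i x * M.vgradSq y i x) ≤
        I * (M.hMin⁻¹ * M.innerH2 hf δ δ) * M.integral (M.vgradSq y) := by
      rw [← Mesh.integral_const_mul]
      refine Mesh.integral_mono (Mesh.cellIntegrable_vgradSq_mul δ y)
        ((Mesh.cellIntegrable_of_continuousOn (M.continuousOn_vgradSq y)).const_mul _)
        fun i x hx => ?_
      exact mul_le_mul_of_nonneg_right (hI M hf hreg hm δ i x hx) (M.vgradSq_nonneg y i x)
    have h2 := Mesh.integral_vgradSq_le hΩ hg y
    have h3 := Mesh.integral_frob_symProd_le δ y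
    have h4 := mul_le_mul_of_nonneg_left h2 (show 0 ≤ I * (M.hMin⁻¹ * M.innerH2 hf δ δ) by positivity)
    have h5 : 0 ≤ M.hMin⁻¹ * (√(M.stretchEnergy g y) + normL1 Ω g) * M.innerH2 hf δ δ :=
      mul_nonneg (mul_nonneg hh (add_nonneg (Real.sqrt_nonneg _) (Mesh.normL1_nonneg g))) hQ
    have h6 : (M.integral fun i x => frob (M.symProd δ y i x) (M.symProd δ y i x)) ≤
        4 * I * A * (M.hMin⁻¹ * (√(M.stretchEnergy g y) + normL1 Ω g) * M.innerH2 hf δ δ) :=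
      (h3.trans (mul_le_mul_of_nonneg_left (h1.trans h4) (by norm_num))).trans_eq (by ring)
    nlinarith [mul_nonneg hC0 h5]
  · have h1 : (M.integral fun i x => frob (M.gradProd δ δ i x) (M.gradProd δ δ i x)) ≤
        M.integral fun i x => M.vgradSq δ i x ^ 2 := by
      refine Mesh.integral_mono
        ((Mesh.matBounded_gradProd δ δ).frob (Mesh.matBounded_gradProd δ δ)).cellIntegrable
        (Mesh.cellIntegrable_of_continuousOn fun i => (M.continuousOn_vgradSq δ i).pow 2)
        fun i x _ => ?_
      rw [sq]; exact M.frob_gradProd_le δ δ i x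
    have h2 := hC M hf hreg hm δ
    have h3 : 0 ≤ (4 * I * A + 1) * M.innerH2 hf δ δ ^ 2 := by positivity
    linarith

end PrestrainedPlate

/-! ### Boundedness of the inverse square root of the metric. -/

namespace PrestrainedPlate

open scoped ENNReal

/-! ### The inverse square root of the metric -/

theorem isSelfAdjoint_of_posDef {A : Matrix (Fin 2) (Fin 2) ℝ} (hA : A.PosDef) : IsSelfAdjoint A :=
  hA.isHermitian

theorem det_pos_and_trace_pos {A : Matrix (Fin 2) (Fin 2) ℝ} (hA : A.PosDef) :
    0 < A.det ∧ 0 < A 0 0 + A 1 1 :=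
  ⟨hA.det_pos, add_pos hA.diag_pos hA.diag_pos⟩

theorem eq_of_mem_spectrum {A : Matrix (Fin 2) (Fin 2) ℝ} {t : ℝ} (ht : t ∈ spectrum ℝ A) :
    t * (A 0 0 + A 1 1 - t) = A.det := by
  rw [spectrum.mem_iff, Matrix.isUnit_iff_isUnit_det, isUnit_iff_ne_zero, not_not,
    Matrix.det_fin_two] at ht
  simp only [Algebra.algebraMap_eq_smul_one, Matrix.sub_apply, Matrix.smul_apply,
    Matrix.one_apply_eq, smul_eq_mul, mul_one, ne_eq, zero_ne_one, not_false_eq_true,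
    Matrix.one_apply_ne, mul_zero, zero_sub, one_ne_zero] at ht
  rw [Matrix.det_fin_two]
  linarith

/-- With `a = √t` and `b = √(T - t)`, the square roots of the two eigenvalues, one has `√det = a b`
and `√(T + 2 √det) = a + b`. Thus `1 / √t` agrees on the spectrum with an affine function whose
coefficients are symmetric in the eigenvalues. -/
theorem inv_sqrt_eq {A : Matrix (Fin 2) (Fin 2) ℝ} (hA : A.PosDef) {t : ℝ}
    (ht : t ∈ spectrum ℝ A) : (√t)⁻¹ =
      (A 0 0 + A 1 1 + √A.det) * (√A.det * √(A 0 0 + A 1 1 + 2 * √A.det))⁻¹ +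
        -(√A.det * √(A 0 0 + A 1 1 + 2 * √A.det))⁻¹ * t := by
  obtain ⟨hd, htr⟩ := det_pos_and_trace_pos hA
  have h := eq_of_mem_spectrum ht
  rw [← h] at hd
  set T := A 0 0 + A 1 1
  have ht0 : 0 < t := by
    by_contra hc
    have : 0 ≤ T - t := by linarith
    nlinarith
  have hs0 : 0 < T - t := pos_of_mul_pos_right hd ht0.le
  set a := √t with ha
  set b := √(T - t) with hb
  have ha0 : 0 < a := Real.sqrt_pos.2 ht0
  have hb0 : 0 < b := Real.sqrt_pos.2 hs0
  have ha2 : a ^ 2 = t := Real.sq_sqrt ht0.le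
  have hb2 : b ^ 2 = T - t := Real.sq_sqrt hs0.le
  have e1 : √A.det = a * b := by rw [← h, Real.sqrt_mul ht0.le]
  have e2 : √(T + 2 * √A.det) = a + b := by
    rw [e1, show T + 2 * (a * b) = (a + b) ^ 2 by nlinarith, Real.sqrt_sq (by positivity)]
  rw [e2, e1, show T = a ^ 2 + b ^ 2 by linarith, ← ha2]
  field_simp
  ring

/-- An explicit formula in the entries of the matrix. It makes the measurability and boundedness of
`g^{-1/2}` visible, which its definition by functional calculus does not. -/
theorem invSqrt_eq {A : Matrix (Fin 2) (Fin 2) ℝ} (hA : A.PosDef) :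
    invSqrt A = (√A.det * √(A 0 0 + A 1 1 + 2 * √A.det))⁻¹ •
      ((A 0 0 + A 1 1 + √A.det) • (1 : Matrix (Fin 2) (Fin 2) ℝ) - A) := by
  have hs := isSelfAdjoint_of_posDef hA
  rw [invSqrt, cfc_congr fun t ht => inv_sqrt_eq hA ht, cfc_const_add _ _ A,
    cfc_const_mul_id _ A, Algebra.algebraMap_eq_smul_one, smul_sub, smul_smul, mul_comm,
    neg_smul, sub_eq_add_neg]

theorem sq_le_det {A : Matrix (Fin 2) (Fin 2) ℝ} (hA : A.PosDef) {κ : ℝ} (hκ : 0 < κ)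
    (h : ∀ ξ : Fin 2 → ℝ, κ * ∑ a, ξ a ^ 2 ≤ ∑ a, ∑ b, ξ a * A a b * ξ b) : κ ^ 2 ≤ A.det := by
  have hsym : A 1 0 = A 0 1 := by simpa using hA.isHermitian.apply 0 1
  have h1 := h ![1, 0]
  -- On this vector the quadratic form equals `A 0 0 * A.det`.
  have h2 := h ![-A 0 1, A 0 0]
  simp only [Fin.sum_univ_two, Matrix.cons_val_zero, Matrix.cons_val_one, hsym] at h1 h2
  have h3 : κ ≤ A 0 0 := by linarith
  have h4 : A 0 0 * (κ * A 0 0) ≤ A 0 0 * A.det := by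
    rw [Matrix.det_fin_two, hsym]
    nlinarith [mul_nonneg hκ.le (sq_nonneg (A 0 1))]
  have h5 := le_of_mul_le_mul_left h4 (by linarith)
  nlinarith

theorem memLp_top_sqrt {X : Type*} [MeasurableSpace X] {μ : Measure X} {f : X → ℝ}
    (hf : MemLp f ∞ μ) : MemLp (fun x => √(f x)) ∞ μ := by
  refine (hf.norm.add (memLp_top_const 1)).of_le (Real.continuous_sqrt.comp_aestronglyMeasurable hf.1)
    (Filter.Eventually.of_forall fun x => ?_)
  have h0 := Real.sqrt_nonneg (f x)
  have h1 := abs_nonneg (f x)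
  simp only [Pi.add_apply, Real.norm_eq_abs]
  rw [abs_of_nonneg h0, abs_of_nonneg (by positivity)]
  refine (Real.sqrt_le_sqrt (le_abs_self _)).trans ?_
  nlinarith [Real.sq_sqrt h1, Real.sqrt_nonneg |f x|]

theorem memLp_top_inv {X : Type*} [MeasurableSpace X] {μ : Measure X} {f : X → ℝ}
    (hf : MemLp f ∞ μ) {c : ℝ} (hc : 0 < c) (h : ∀ᵐ x ∂μ, c ≤ f x) :
    MemLp (fun x => (f x)⁻¹) ∞ μ := by
  refine memLp_top_of_bound hf.1.aemeasurable.inv.aestronglyMeasurable c⁻¹ ?_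
  filter_upwards [h] with x hx
  rw [norm_inv, Real.norm_eq_abs, abs_of_pos (hc.trans_le hx)]
  exact inv_anti₀ hc hx

theorem memLp_invSqrt {Ω : Set Plane} {g : Plane → Matrix (Fin 2) (Fin 2) ℝ}
    (hpos : ∀ᵐ x ∂(volume.restrict Ω), (g x).PosDef)
    (hg : ∀ a b, MemLp (fun x => g x a b) ⊤ (volume.restrict Ω)) (hu : UniformlyPosDef Ω g)
    (a b : Fin 2) : MemLp (fun x => invSqrt (g x) a b) ⊤ (volume.restrict Ω) := by
  obtain ⟨κ, hκ, hu⟩ := hu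
  have hdet : MemLp (fun x => (g x).det) ⊤ (volume.restrict Ω) := by
    simp only [Matrix.det_fin_two]
    exact ((hg 1 1).mul' (hg 0 0)).sub ((hg 1 0).mul' (hg 0 1))
  have hd := memLp_top_sqrt hdet
  have htr : MemLp (fun x => g x 0 0 + g x 1 1) ⊤ (volume.restrict Ω) := (hg 0 0).add (hg 1 1)
  have ht := memLp_top_sqrt (htr.add (hd.const_mul 2))
  have hdt := ht.mul' hd (r := ⊤)
  have hlow : ∀ᵐ x ∂(volume.restrict Ω), κ * √(2 * κ) ≤
      √(g x).det * √(g x 0 0 + g x 1 1 + 2 * √(g x).det) := by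
    filter_upwards [hpos, hu] with x h1 h2
    have h3 : κ ≤ √(g x).det := Real.le_sqrt_of_sq_le (sq_le_det h1 hκ h2)
    have h4 := (det_pos_and_trace_pos h1).2
    exact mul_le_mul h3 (Real.sqrt_le_sqrt (by linarith)) (Real.sqrt_nonneg _) (Real.sqrt_nonneg _)
  have hinv := memLp_top_inv hdt (by positivity) hlow
  have h1 : MemLp (fun x => (g x 0 0 + g x 1 1 + √(g x).det) *
      (1 : Matrix (Fin 2) (Fin 2) ℝ) a b - g x a b) ⊤ (volume.restrict Ω) :=
    ((htr.add hd).mul_const _).sub (hg a b)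
  refine (h1.mul' hinv (r := ⊤)).ae_eq ?_
  filter_upwards [hpos] with x hx
  rw [invSqrt_eq hx]
  simp [Matrix.smul_apply, Matrix.sub_apply]

/-- Ensures that `dStep` is positive, so that its inverse is a genuine decreasing function of the
energy; the inverse of zero would be zero. -/
theorem normL1_pos {Ω : Set Plane} (hΩ : IsPolygonalDomain Ω)
    {g : Plane → Matrix (Fin 2) (Fin 2) ℝ} (hpos : ∀ᵐ x ∂(volume.restrict Ω), (g x).PosDef)
    (hg : ∀ a b, MemLp (fun x => g x a b) ⊤ (volume.restrict Ω)) : 0 < normL1 Ω g := by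
  have h0 : ∀ x, 0 ≤ √(frob (g x) (g x)) := fun x => Real.sqrt_nonneg _
  refine (Mesh.normL1_nonneg g).lt_of_ne' fun h => ?_
  rw [normL1, setIntegral_eq_zero_iff_of_nonneg_ae (Filter.Eventually.of_forall h0)
    (Mesh.integrableOn_sqrt_frob hΩ hg)] at h
  have hfalse : ∀ᵐ _ ∂(volume.restrict Ω), False := by
    filter_upwards [h, hpos] with x h1 h2
    have h3 : frob (g x) (g x) = 0 := by
      rwa [Pi.zero_apply, Real.sqrt_eq_zero (frob_self_nonneg _)] at h1
    have h4 : 0 < g x 0 0 := h2.diag_pos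
    simp only [frob, Fin.sum_univ_two] at h3
    nlinarith [mul_self_nonneg (g x 0 1), mul_self_nonneg (g x 1 0), mul_self_nonneg (g x 1 1)]
  have h5 : volume.restrict Ω = 0 := by simpa using hfalse
  rw [Measure.restrict_eq_zero] at h5
  exact (hΩ.1.measure_pos volume hΩ.2.2.1.nonempty).ne' h5

end PrestrainedPlate

/-! ### Linearity of the discrete Hessian and bilinearity of the forms. -/

namespace PrestrainedPlate

/-! ### Linear and bilinear dependence -/

section Bilinear

variable {E F : Type*} [AddCommGroup E] [Module ℝ E] [AddCommGroup F] [Module ℝ F]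

theorem _root_.IsLinearMap.finsetSum {G : Type*} [AddCommGroup G] [Module ℝ G] {κ : Type*} {T : Finset κ}
    {f : κ → E → G} (hf : ∀ j ∈ T, IsLinearMap ℝ (f j)) : IsLinearMap ℝ fun u => ∑ j ∈ T, f j u where
  map_add u v := by
    rw [← Finset.sum_add_distrib]; exact Finset.sum_congr rfl fun j hj => (hf j hj).map_add u v
  map_smul c u := by
    rw [Finset.smul_sum]; exact Finset.sum_congr rfl fun j hj => (hf j hj).map_smul c u

theorem _root_.IsLinearMap.fun_add {f g : E → ℝ} (hf : IsLinearMap ℝ f) (hg : IsLinearMap ℝ g) :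
    IsLinearMap ℝ fun u => f u + g u where
  map_add u v := by rw [hf.map_add, hg.map_add]; ring
  map_smul c u := by rw [hf.map_smul, hg.map_smul, smul_add]

theorem _root_.IsLinearMap.fun_sub {f g : E → ℝ} (hf : IsLinearMap ℝ f) (hg : IsLinearMap ℝ g) :
    IsLinearMap ℝ fun u => f u - g u where
  map_add u v := by rw [hf.map_add, hg.map_add]; ring
  map_smul c u := by rw [hf.map_smul, hg.map_smul, smul_sub]

theorem _root_.IsLinearMap.fun_const_mul {f : E → ℝ} (hf : IsLinearMap ℝ f) (r : ℝ) :
    IsLinearMap ℝ fun u => r * f u where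
  map_add u v := by rw [hf.map_add]; ring
  map_smul c u := by simp only [hf.map_smul, smul_eq_mul]; ring

theorem _root_.IsLinearMap.fun_mul_const {f : E → ℝ} (hf : IsLinearMap ℝ f) (r : ℝ) :
    IsLinearMap ℝ fun u => f u * r := by
  simpa only [mul_comm] using hf.fun_const_mul r

theorem _root_.IsLinearMap.fun_comp {f : F → ℝ} (hf : IsLinearMap ℝ f) {L : E → F}
    (hL : IsLinearMap ℝ L) : IsLinearMap ℝ fun u => f (L u) where
  map_add u v := by rw [hL.map_add, hf.map_add]
  map_smul c u := by rw [hL.map_smul, hf.map_smul]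

theorem isBilinearMap_mul {f : E → ℝ} {g : F → ℝ} (hf : IsLinearMap ℝ f) (hg : IsLinearMap ℝ g) :
    IsBilinearMap ℝ fun u v => f u * g v where
  add_left u v w := by rw [hf.map_add]; ring
  smul_left c u w := by simp only [hf.map_smul, smul_eq_mul]; ring
  add_right u v w := by rw [hg.map_add]; ring
  smul_right c u w := by simp only [hg.map_smul, smul_eq_mul]; ring

theorem _root_.IsBilinearMap.fun_add {B B' : E → F → ℝ} (h : IsBilinearMap ℝ B) (h' : IsBilinearMap ℝ B') :
    IsBilinearMap ℝ fun u v => B u v + B' u v where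
  add_left u v w := by rw [h.add_left, h'.add_left]; ring
  smul_left c u w := by simp only [h.smul_left, h'.smul_left, smul_eq_mul]; ring
  add_right u v w := by rw [h.add_right, h'.add_right]; ring
  smul_right c u w := by simp only [h.smul_right, h'.smul_right, smul_eq_mul]; ring

theorem _root_.IsBilinearMap.fun_const_mul {B : E → F → ℝ} (h : IsBilinearMap ℝ B) (r : ℝ) :
    IsBilinearMap ℝ fun u v => r * B u v where
  add_left u v w := by rw [h.add_left]; ring
  smul_left c u w := by simp only [h.smul_left, smul_eq_mul]; ring
  add_right u v w := by rw [h.add_right]; ring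
  smul_right c u w := by simp only [h.smul_right, smul_eq_mul]; ring

theorem _root_.IsBilinearMap.finsetSum {κ : Type*} {T : Finset κ} {B : κ → E → F → ℝ}
    (h : ∀ j ∈ T, IsBilinearMap ℝ (B j)) : IsBilinearMap ℝ fun u v => ∑ j ∈ T, B j u v where
  add_left u v w := by
    rw [← Finset.sum_add_distrib]; exact Finset.sum_congr rfl fun j hj => (h j hj).add_left u v w
  smul_left c u w := by
    rw [Finset.smul_sum]; exact Finset.sum_congr rfl fun j hj => (h j hj).smul_left c u w
  add_right u v w := by
    rw [← Finset.sum_add_distrib]; exact Finset.sum_congr rfl fun j hj => (h j hj).add_right u v w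
  smul_right c u w := by
    rw [Finset.smul_sum]; exact Finset.sum_congr rfl fun j hj => (h j hj).smul_right c u w

theorem _root_.IsBilinearMap.fun_comp {E' F' : Type*} [AddCommGroup E'] [Module ℝ E'] [AddCommGroup F']
    [Module ℝ F'] {B : E → F → ℝ} (h : IsBilinearMap ℝ B) {L : E' → E} {L' : F' → F}
    (hL : IsLinearMap ℝ L) (hL' : IsLinearMap ℝ L') : IsBilinearMap ℝ fun u v => B (L u) (L' v) where
  add_left u v w := by rw [hL.map_add, h.add_left]
  smul_left c u w := by rw [hL.map_smul, h.smul_left]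
  add_right u v w := by rw [hL'.map_add, h.add_right]
  smul_right c u w := by rw [hL'.map_smul, h.smul_right]

theorem _root_.IsBilinearMap.integral {X : Type*} [MeasurableSpace X] {μ : Measure X}
    {B : X → E → F → ℝ} (h : ∀ x, IsBilinearMap ℝ (B x))
    (hi : ∀ u v, Integrable (fun x => B x u v) μ) : IsBilinearMap ℝ fun u v => ∫ x, B x u v ∂μ where
  add_left u v w := by
    rw [← MeasureTheory.integral_add (hi _ _) (hi _ _)]
    exact integral_congr_ae (Filter.Eventually.of_forall fun x => (h x).add_left u v w)
  smul_left c u w := by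
    rw [← integral_smul]
    exact integral_congr_ae (Filter.Eventually.of_forall fun x => (h x).smul_left c u w)
  add_right u v w := by
    rw [← MeasureTheory.integral_add (hi _ _) (hi _ _)]
    exact integral_congr_ae (Filter.Eventually.of_forall fun x => (h x).add_right u v w)
  smul_right c u w := by
    rw [← integral_smul]
    exact integral_congr_ae (Filter.Eventually.of_forall fun x => (h x).smul_right c u w)

theorem _root_.IsBilinearMap.isLinearMap_right {B : E → F → ℝ} (h : IsBilinearMap ℝ B) (u : E) :
    IsLinearMap ℝ (B u) := ⟨h.add_right u, fun c v => h.smul_right c u v⟩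

/-- The Riesz representer of a linear functional depending linearly on a parameter. -/
theorem exists_unique_representer [FiniteDimensional ℝ F] {B : F → F → ℝ} (hB : IsBilinearMap ℝ B)
    (hpos : ∀ u, B u u = 0 → u = 0) {f : F → ℝ} (hf : IsLinearMap ℝ f) :
    ∃! u, ∀ v, B u v = f v := by
  obtain ⟨u, hu⟩ := exists_representer hB.toLinearMap hpos (IsLinearMap.mk' f hf)
  refine ⟨u, hu, fun w hw => ?_⟩
  have h1 : B (w + (-1 : ℝ) • u) (w + (-1 : ℝ) • u) = 0 := by
    rw [hB.add_left, hB.smul_left, hw, show B u _ = f _ from hu _]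
    simp
  have := hpos _ h1
  simpa [← sub_eq_add_neg, sub_eq_zero] using this

/-- `Classical.epsilon` has no choice, since the representer is unique; therefore it is linear in
the data. This gives the linearity of the liftings. -/
theorem isLinearMap_epsilon [FiniteDimensional ℝ F] {B : F → F → ℝ} (hB : IsBilinearMap ℝ B)
    (hpos : ∀ u, B u u = 0 → u = 0) {f : E → F → ℝ} (hf : IsBilinearMap ℝ f) :
    IsLinearMap ℝ fun v => Classical.epsilon fun r => ∀ τ, B r τ = f v τ := by
  have hu := fun v => exists_unique_representer hB hpos (hf.isLinearMap_right v)
  have hs : ∀ v τ, B (Classical.epsilon fun r => ∀ τ, B r τ = f v τ) τ = f v τ := fun v =>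
    Classical.epsilon_spec (p := fun r => ∀ τ, B r τ = f v τ) (hu v).exists
  refine ⟨fun v w => (hu (v + w)).unique (hs _) fun τ => ?_,
    fun c v => (hu (c • v)).unique (hs _) fun τ => ?_⟩
  · rw [hB.add_left, hs, hs, hf.add_left]
  · rw [hB.smul_left, hs, hf.smul_left]

end Bilinear

namespace Mesh

variable {s : CellShape} {Ω : Set Plane} {M : Mesh s Ω} {k : ℕ}

theorem isBilinearMap_integral {E F : Type*} [AddCommGroup E] [Module ℝ E] [AddCommGroup F]
    [Module ℝ F] {B : E → F → Fin M.N → Plane → ℝ}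
    (h : ∀ i x, IsBilinearMap ℝ fun u v => B u v i x) (hi : ∀ u v, M.CellIntegrable (B u v)) :
    IsBilinearMap ℝ fun u v => M.integral (B u v) :=
  IsBilinearMap.finsetSum fun i _ => IsBilinearMap.integral (h i) fun u v => hi u v i

theorem isBilinearMap_edgeIntegral {E F : Type*} [AddCommGroup E] [Module ℝ E] [AddCommGroup F]
    [Module ℝ F] {B : E → F → Plane → ℝ} (e : M.Edge)
    (h : ∀ x, IsBilinearMap ℝ fun u v => B u v x)
    (hi : ∀ u v, IntegrableOn (fun t => B u v (M.edgePt e t)) (Set.Ioo 0 1)) :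
    IsBilinearMap ℝ fun u v => M.edgeIntegral e (B u v) := by
  simp only [edgeIntegral_eq]
  exact (IsBilinearMap.integral (fun t => h (M.edgePt e t)) hi).fun_const_mul _

theorem isLinearMap_jump {E : Type*} [AddCommGroup E] [Module ℝ E] {f : E → Fin M.N → Plane → ℝ}
    (hf : ∀ i x, IsLinearMap ℝ fun v => f v i x) (e : M.Edge) (x : Plane) :
    IsLinearMap ℝ fun v => M.jump (f v) e x := (hf _ x).fun_sub (hf _ x)

theorem isLinearMap_avg {E : Type*} [AddCommGroup E] [Module ℝ E] {f : E → Fin M.N → Plane → ℝ}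
    (hf : ∀ i x, IsLinearMap ℝ fun v => f v i x) (e : M.Edge) (x : Plane) :
    IsLinearMap ℝ fun v => M.avg (f v) e x := by
  simp only [avg, div_eq_mul_inv]
  exact ((hf _ x).fun_add (hf _ x)).fun_mul_const _

theorem isLinearMap_apply {ι : Type*} {V : Type*} [AddCommGroup V] [Module ℝ V] (m : ι) :
    IsLinearMap ℝ fun v : ι → V => v m := ⟨fun _ _ => rfl, fun _ _ => rfl⟩

theorem isLinearMap_apply₂ {ι κ : Type*} {V : Type*} [AddCommGroup V] [Module ℝ V] (a : ι) (b : κ) :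
    IsLinearMap ℝ fun v : ι → κ → V => v a b := ⟨fun _ _ => rfl, fun _ _ => rfl⟩

/-! ### The liftings -/

/-- The `L²` product of piecewise polynomial matrix fields. -/
noncomputable def matForm (l : ℕ) (r τ : Fin 2 → Fin 2 → M.V l) : ℝ :=
  M.integral (fun i x => ∑ a, ∑ b, M.val (r a b) i x * M.val (τ a b) i x)

theorem isBilinearMap_matForm (l : ℕ) : IsBilinearMap ℝ (M.matForm l) := by
  refine isBilinearMap_integral (fun i x => ?_) fun u v => ?_
  · exact IsBilinearMap.finsetSum fun a _ => IsBilinearMap.finsetSum fun b _ =>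
      isBilinearMap_mul ((M.isLinearMap_val i x).fun_comp (isLinearMap_apply₂ a b))
        ((M.isLinearMap_val i x).fun_comp (isLinearMap_apply₂ a b))
  · exact (CellBounded.sum fun a _ => CellBounded.sum fun b _ =>
      (cellBounded_val (u a b)).mul (cellBounded_val (v a b))).cellIntegrable

theorem eq_zero_of_matForm {l : ℕ} {r : Fin 2 → Fin 2 → M.V l} (h : M.matForm l r r = 0) :
    r = 0 := by
  have hi : ∀ a b, M.CellIntegrable fun i x => M.val (r a b) i x * M.val (r a b) i x := fun a b =>
    ((cellBounded_val (r a b)).mul (cellBounded_val (r a b))).cellIntegrable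
  have e : M.matForm l r r = ∑ a, ∑ b, M.integral fun i x => M.val (r a b) i x ^ 2 := by
    rw [matForm, integral_sum fun a _ => CellIntegrable.sum fun b _ => hi a b]
    refine Finset.sum_congr rfl fun a _ => ?_
    rw [integral_sum fun b _ => hi a b]
    simp only [sq]
  have n : ∀ a b, 0 ≤ M.integral fun i x => M.val (r a b) i x ^ 2 := fun a b =>
    integral_nonneg fun _ _ _ => sq_nonneg _
  rw [e] at h
  funext a b
  have h1 := (Finset.sum_eq_zero_iff_of_nonneg fun a _ => Finset.sum_nonneg fun b _ => n a b).1 h a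
    (Finset.mem_univ a)
  have h2 := (Finset.sum_eq_zero_iff_of_nonneg fun b _ => n a b).1 h1 b (Finset.mem_univ b)
  exact M.eq_zero_of_integral_val_sq h2

theorem isLinearMap_liftGrad (l : ℕ) {e : M.Edge} (he : e ∈ M.edges) :
    IsLinearMap ℝ fun v : M.V k => M.liftGrad l e fun c => M.jump (M.pd c (M.val v)) e := by
  refine isLinearMap_epsilon (isBilinearMap_matForm l) (fun _ => eq_zero_of_matForm)
    (isBilinearMap_edgeIntegral (M := M) (E := M.V k) (F := Fin 2 → Fin 2 → M.V l) e
      (B := fun v τ x => ∑ a, (∑ b, M.avg (M.val (τ a b)) e x * M.normal e b) *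
        M.jump (M.pd a (M.val v)) e x) (fun x => ?_) fun v τ => ?_)
  · refine IsBilinearMap.finsetSum fun a _ => ?_
    simp only [mul_comm _ (M.jump (M.pd a _) e x)]
    exact isBilinearMap_mul (isLinearMap_jump (fun i x => M.isLinearMap_pd_val a i x) e x)
      (IsLinearMap.finsetSum fun b _ => ((isLinearMap_avg (fun i x => M.isLinearMap_val i x)
        e x).fun_comp (isLinearMap_apply₂ a b)).fun_mul_const _)
  · refine integrableOn_Ioo_of_continuousOn (continuousOn_finsetSum _ fun a _ =>
      (continuousOn_finsetSum _ fun b _ => ?_).mul (M.continuousOn_jump (M.continuousOn_pd_val v a) he))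
    exact (M.continuousOn_avg (M.continuousOn_val (τ a b)) he).mul continuousOn_const

theorem isLinearMap_liftVal (l : ℕ) {e : M.Edge} (he : e ∈ M.edges) :
    IsLinearMap ℝ fun v : M.V k => M.liftVal l e (M.jump (M.val v) e) := by
  refine isLinearMap_epsilon (isBilinearMap_matForm l) (fun _ => eq_zero_of_matForm)
    (isBilinearMap_edgeIntegral (M := M) (E := M.V k) (F := Fin 2 → Fin 2 → M.V l) e
      (B := fun v τ x => (∑ a, M.avg (fun i y => ∑ b, M.pd b (M.val (τ a b)) i y) e x *
        M.normal e a) * M.jump (M.val v) e x) (fun x => ?_) fun v τ => ?_)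
  · simp only [mul_comm _ (M.jump (M.val _) e x)]
    refine isBilinearMap_mul (isLinearMap_jump (fun i x => M.isLinearMap_val i x) e x)
      (IsLinearMap.finsetSum fun a _ => IsLinearMap.fun_mul_const ?_ _)
    exact isLinearMap_avg (f := fun (τ : Fin 2 → Fin 2 → M.V l) i y =>
      ∑ b, M.pd b (M.val (τ a b)) i y) (fun i x => IsLinearMap.finsetSum fun b _ =>
        (M.isLinearMap_pd_val b i x).fun_comp (isLinearMap_apply₂ a b)) e x
  · refine integrableOn_Ioo_of_continuousOn (ContinuousOn.mul (continuousOn_finsetSum _ fun a _ =>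
      ContinuousOn.mul ?_ continuousOn_const) (M.continuousOn_jump (M.continuousOn_val v) he))
    exact M.continuousOn_avg (f := fun i y => ∑ b, M.pd b (M.val (τ a b)) i y)
      (fun i => continuousOn_finsetSum _ fun b _ => M.continuousOn_pd_val (τ a b) b i) he

theorem isLinearMap_discreteHessian (l₁ l₂ : ℕ) (i : Fin M.N) (x : Plane) (a b : Fin 2) :
    IsLinearMap ℝ fun v : M.V k => M.discreteHessian l₁ l₂ v i x a b := by
  simp only [discreteHessian, Matrix.of_apply]
  refine ((M.isLinearMap_pd_pd_val a b i x).fun_sub ?_).fun_add ?_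
  · exact (M.isLinearMap_val i x).fun_comp (L := fun v : M.V k => (∑ e ∈ M.edges,
      M.liftGrad l₁ e fun c => M.jump (M.pd c (M.val v)) e) a b)
      ⟨fun v w => by
        rw [(IsLinearMap.finsetSum fun e he => isLinearMap_liftGrad (M := M) (k := k) l₁ he).map_add]
        rfl,
       fun c w => by
        rw [(IsLinearMap.finsetSum fun e he => isLinearMap_liftGrad (M := M) (k := k) l₁ he).map_smul]
        rfl⟩
  · exact (M.isLinearMap_val i x).fun_comp (L := fun v : M.V k => (∑ e ∈ M.edges,
      M.liftVal l₂ e (M.jump (M.val v) e)) a b)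
      ⟨fun v w => by
        rw [(IsLinearMap.finsetSum fun e he => isLinearMap_liftVal (M := M) (k := k) l₂ he).map_add]
        rfl,
       fun c w => by
        rw [(IsLinearMap.finsetSum fun e he => isLinearMap_liftVal (M := M) (k := k) l₂ he).map_smul]
        rfl⟩

theorem matBounded_discreteHessian (l₁ l₂ : ℕ) (v : M.V k) :
    M.MatBounded (M.discreteHessian l₁ l₂ v) := fun a b =>
  ((cellBounded_pd_pd_val v a b).sub (cellBounded_val _)).add (cellBounded_val _)

/-! ### Bilinearity of the forms -/

variable {c₁ c₂ : ℝ} {hf : Plane → ℝ}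

theorem IsMeshFunction.isBilinearMap_gradJumpForm (hc₁ : 0 < c₁) (hm : M.IsMeshFunction c₁ c₂ hf) :
    IsBilinearMap ℝ (M.gradJumpForm hf (k := k)) := by
  refine IsBilinearMap.finsetSum fun e he => isBilinearMap_edgeIntegral e (fun x => ?_) fun v w => ?_
  · exact (IsBilinearMap.finsetSum fun a _ => isBilinearMap_mul
      (isLinearMap_jump (fun i x => M.isLinearMap_pd_val a i x) e x)
      (isLinearMap_jump (fun i x => M.isLinearMap_pd_val a i x) e x)).fun_const_mul _
  · obtain ⟨h1, h2, -⟩ := hm.weight_bounds hc₁ he 1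
    simp only [pow_one] at h1 h2
    exact M.integrableOn_weight_mul h1 h2 (continuousOn_finsetSum _ fun a _ =>
      (M.continuousOn_jump (M.continuousOn_pd_val v a) he).mul
        (M.continuousOn_jump (M.continuousOn_pd_val w a) he))

theorem IsMeshFunction.isBilinearMap_jumpForm (hc₁ : 0 < c₁) (hm : M.IsMeshFunction c₁ c₂ hf) :
    IsBilinearMap ℝ (M.jumpForm hf (k := k)) := by
  refine IsBilinearMap.finsetSum fun e he => isBilinearMap_edgeIntegral e (fun x => ?_) fun v w => ?_
  · exact (isBilinearMap_mul (isLinearMap_jump (fun i x => M.isLinearMap_val i x) e x)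
      (isLinearMap_jump (fun i x => M.isLinearMap_val i x) e x)).fun_const_mul _
  · obtain ⟨h1, h2, -⟩ := hm.weight_bounds hc₁ he 3
    exact M.integrableOn_weight_mul h1 h2 ((M.continuousOn_jump (M.continuousOn_val v) he).mul
      (M.continuousOn_jump (M.continuousOn_val w) he))

theorem IsMeshFunction.isBilinearMap_innerH2 (hc₁ : 0 < c₁) (hm : M.IsMeshFunction c₁ c₂ hf) :
    IsBilinearMap ℝ (M.innerH2 hf (k := k)) := by
  refine IsBilinearMap.finsetSum fun m _ => ?_
  have h1 : IsBilinearMap ℝ fun v w : M.V k => M.integral (fun i x => ∑ a, ∑ b,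
      M.pd a (M.pd b (M.val v)) i x * M.pd a (M.pd b (M.val w)) i x) :=
    isBilinearMap_integral (fun i x => IsBilinearMap.finsetSum fun a _ =>
      IsBilinearMap.finsetSum fun b _ => isBilinearMap_mul (M.isLinearMap_pd_pd_val a b i x)
        (M.isLinearMap_pd_pd_val a b i x)) fun v w =>
      (CellBounded.sum fun a _ => CellBounded.sum fun b _ =>
        (cellBounded_pd_pd_val v a b).mul (cellBounded_pd_pd_val w a b)).cellIntegrable
  have h2 : IsBilinearMap ℝ fun v w : M.V k => M.integral (fun i x => M.val v i x * M.val w i x) :=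
    isBilinearMap_integral (fun i x => isBilinearMap_mul (M.isLinearMap_val i x)
      (M.isLinearMap_val i x)) fun v w =>
      ((cellBounded_val v).mul (cellBounded_val w)).cellIntegrable
  exact IsBilinearMap.fun_comp (((h1.fun_add (hm.isBilinearMap_gradJumpForm hc₁)).fun_add
    (hm.isBilinearMap_jumpForm hc₁)).fun_add h2) (isLinearMap_apply m) (isLinearMap_apply m)

theorem isBilinearMap_stretchForm (hΩ : IsPolygonalDomain Ω)
    {g : Plane → Matrix (Fin 2) (Fin 2) ℝ}
    (hg : ∀ a b, MemLp (fun x => g x a b) ⊤ (volume.restrict Ω)) (z : M.V3 k) :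
    IsBilinearMap ℝ (M.stretchForm g z) := by
  refine isBilinearMap_integral (fun i x => ?_) fun y v =>
    ((matBounded_symProd v y).frob (matBounded_strain hΩ hg z)).cellIntegrable
  have hl : ∀ a m, IsLinearMap ℝ fun y : M.V3 k => M.pd a (M.val (y m)) i x := fun a m =>
    (M.isLinearMap_pd_val a i x).fun_comp (isLinearMap_apply m)
  refine IsBilinearMap.finsetSum fun a _ => IsBilinearMap.finsetSum fun b _ => ?_
  simp only [mul_comm _ ((M.gradProd z z i x - g x) a b)]
  refine IsBilinearMap.fun_const_mul ?_ _
  simp only [Matrix.add_apply, gradProd, Matrix.of_apply]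
  refine IsBilinearMap.fun_add (IsBilinearMap.finsetSum fun m _ => ?_)
    (IsBilinearMap.finsetSum fun m _ => isBilinearMap_mul (hl a m) (hl b m))
  simp only [mul_comm (M.pd a _ i x)]
  exact isBilinearMap_mul (hl b m) (hl a m)

theorem isLinearMap_conj (l₁ l₂ : ℕ) (P : Matrix (Fin 2) (Fin 2) ℝ) (i : Fin M.N) (x : Plane)
    (a b : Fin 2) : IsLinearMap ℝ fun v : M.V k =>
      (P * M.discreteHessian l₁ l₂ v i x * P) a b := by
  simp only [Matrix.mul_apply]
  exact IsLinearMap.finsetSum fun j _ => IsLinearMap.fun_mul_const (IsLinearMap.finsetSum fun m _ =>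
    (isLinearMap_discreteHessian l₁ l₂ i x m j).fun_const_mul _) _

theorem IsMeshFunction.isBilinearMap_bendForm (hc₁ : 0 < c₁) (hm : M.IsMeshFunction c₁ c₂ hf)
    {g : Plane → Matrix (Fin 2) (Fin 2) ℝ} (hP : M.MatBounded fun _ x => invSqrt (g x))
    (l₁ l₂ : ℕ) : IsBilinearMap ℝ (M.bendForm hf g l₁ l₂ (k := k)) := by
  refine IsBilinearMap.finsetSum fun m _ => ?_
  have hb : ∀ v : M.V k, M.MatBounded fun i x =>
      invSqrt (g x) * M.discreteHessian l₁ l₂ v i x * invSqrt (g x) := fun v =>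
    (hP.mul (matBounded_discreteHessian l₁ l₂ v)).mul hP
  have h1 : IsBilinearMap ℝ fun v w : M.V k => M.integral fun i x =>
      PrestrainedPlate.frob (invSqrt (g x) * M.discreteHessian l₁ l₂ v i x * invSqrt (g x))
        (invSqrt (g x) * M.discreteHessian l₁ l₂ w i x * invSqrt (g x)) :=
    isBilinearMap_integral (fun i x => IsBilinearMap.finsetSum fun a _ =>
      IsBilinearMap.finsetSum fun b _ => isBilinearMap_mul (isLinearMap_conj l₁ l₂ _ i x a b)
        (isLinearMap_conj l₁ l₂ _ i x a b)) fun v w => ((hb v).frob (hb w)).cellIntegrable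
  exact IsBilinearMap.fun_comp ((h1.fun_add (hm.isBilinearMap_gradJumpForm hc₁)).fun_add
    (hm.isBilinearMap_jumpForm hc₁)) (isLinearMap_apply m) (isLinearMap_apply m)

theorem bendForm_comm (g : Plane → Matrix (Fin 2) (Fin 2) ℝ) (l₁ l₂ : ℕ) (v w : M.V3 k) :
    M.bendForm hf g l₁ l₂ v w = M.bendForm hf g l₁ l₂ w v := by
  simp only [bendForm, PrestrainedPlate.frob, gradJumpForm, jumpForm, mul_comm]

theorem IsMeshFunction.bendForm_nonneg (hc₁ : 0 < c₁) (hm : M.IsMeshFunction c₁ c₂ hf)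
    (g : Plane → Matrix (Fin 2) (Fin 2) ℝ) (l₁ l₂ : ℕ) (v : M.V3 k) :
    0 ≤ M.bendForm hf g l₁ l₂ v v := by
  refine Finset.sum_nonneg fun m _ => add_nonneg (add_nonneg
    (integral_nonneg fun _ _ _ => frob_self_nonneg _) ?_) ?_
  · rw [hm.gradJumpForm_self hc₁]
    exact Finset.sum_nonneg fun a _ => hm.jumpSq_nonneg hc₁ _ _
  · rw [jumpForm_self]
    exact hm.jumpSq_nonneg hc₁ _ _

theorem IsMeshFunction.eq_zero_of_innerH2 (hc₁ : 0 < c₁) (hm : M.IsMeshFunction c₁ c₂ hf)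
    {v : M.V3 k} (h : M.innerH2 hf v v = 0) : v = 0 := by
  have h1 := (Finset.sum_eq_zero_iff_of_nonneg fun m _ =>
    (hm.scalarForm_bounds hc₁ (v m)).2.2.2.2).1 ((M.innerH2_eq hf v v).symm.trans h)
  funext m
  have h2 := (hm.scalarForm_bounds hc₁ (v m)).2.2.2.1
  rw [h1 m (Finset.mem_univ m)] at h2
  exact M.eq_zero_of_integral_val_sq (le_antisymm h2 (integral_nonneg fun _ _ _ => sq_nonneg _))

end Mesh

end PrestrainedPlate

/-! ### Energy decay in one step. -/

namespace PrestrainedPlate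

/-- The energy balance of one step of the linearized flow. -/
theorem energy_decay_of_bounds {K D H G Cp τ E Es n a₂ a₁ b₂ b₁ LL QQ WW E' d : ℝ} (hK : 0 < K)
    (hH : 0 < H) (hDH : 1 ≤ D * H) (hG : 0 ≤ G) (hCp : 0 < Cp) (hτ : 0 < τ)
    (hEs : 0 ≤ Es) (hE : Es ≤ E) (hn : 0 ≤ n)
    (heq : τ⁻¹ * n + a₂ + b₂ = -a₁ - b₁) (ha₂ : |a₂| ≤ Cp * √Es * n)
    (hLL : LL ≤ K * (H * (√Es + G)) * n) (hQQ : QQ ≤ K * n ^ 2) (hWW : WW ≤ 2 * LL + 2 * QQ)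
    (ha₁ : a₁ ^ 2 ≤ LL * (2 * Es)) (hb₂ : 0 ≤ b₂) (hb : 0 ≤ b₂ + b₁ + (E - Es) / 2)
    (hτ₁ : 2 * (1 + Cp * √E) ≤ τ⁻¹) (hτ₂ : 2 * d ≤ τ⁻¹)
    (hd : Cp / 2 * √E + (2 * K + K * (K + D) + 1) / 2 * (H * (E + 1) * (√E + G)) ≤ d)
    (hE' : E' = E + a₁ + 1 / 2 * a₂ + 1 / 2 * WW + b₁ + 1 / 2 * b₂) :
    E' + 1 / (2 * τ) * n ≤ E := by
  -- Intended meaning: `H = 1 / h_min`, `G = ‖g‖_{L¹}`, `D` the diameter of the domain, `n = ‖δ‖²`;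
  -- `a₁`, `a₂` are the stretching forms of `(y, δ)` and `(δ, δ)`, and `b₁`, `b₂` the corresponding
  -- bending forms times `σ`. `LL`, `QQ`, `WW` are the squared norms of `L`, `Q`, `L + Q`; `Es`,
  -- `E`, `E'` are the stretching energy and the total energies before and after the step.
  have hE0 : 0 ≤ E := hEs.trans hE
  have hr : √Es ≤ √E := Real.sqrt_le_sqrt hE
  have hr0 := Real.sqrt_nonneg Es
  obtain ⟨r, hrd⟩ : ∃ r, r = √E := ⟨_, rfl⟩
  have hr2 : r ^ 2 = E := by rw [hrd, Real.sq_sqrt hE0]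
  rw [← hrd] at hr hτ₁ hd
  have hrp : 0 ≤ r := hr0.trans hr
  obtain ⟨P, hP⟩ : ∃ P, P = r + G := ⟨_, rfl⟩
  rw [← hP] at hd
  have hP0 : 0 ≤ P := hP ▸ add_nonneg hrp hG
  obtain ⟨X, hX⟩ : ∃ X, X = H * (E + 1) * P := ⟨_, rfl⟩
  rw [← hX] at hd
  have hX0 : 0 ≤ X := hX ▸ by positivity
  have hHP0 : 0 ≤ H * P := mul_nonneg hH.le hP0
  have hHP : H * P ≤ X := by linarith [mul_nonneg hE0 hHP0]
  have hEHP : E * (H * P) ≤ X := by linarith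
  -- The bending part contributes a bare `E` to the a priori bound. It is compared with `X` by `r² ≤
  -- (r² + 1) r` and by `h_min ≤ D`.
  have hEX : E ≤ D * X := by
    have h1 : E ≤ (E + 1) * P := by
      have h2 : 0 ≤ r * ((r - 1) ^ 2 + r) := by positivity
      have h3 : 0 ≤ (r ^ 2 + 1) * G := by positivity
      rw [← hr2, hP]
      linarith
    have h2 : 0 ≤ (E + 1) * P := by positivity
    calc E ≤ 1 * ((E + 1) * P) := by rwa [one_mul]
      _ ≤ D * H * ((E + 1) * P) := mul_le_mul_of_nonneg_right hDH h2
      _ = D * X := by rw [hX]; ring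
  have ha₂' : |a₂| ≤ Cp * r * n := ha₂.trans (by gcongr)
  have hLL' : LL ≤ K * (H * P) * n := hLL.trans (by rw [hP]; gcongr)
  -- Young's inequality, with the coefficient of `n` chosen so that it is absorbed by `τ⁻¹ n ≥ 2 n`.
  have ha₁' : |a₁| ≤ n + 1 / 2 * (K * (E * (H * P))) := by
    refine abs_le_of_sq_le_sq ?_ (by positivity)
    have h1 : LL * (2 * Es) ≤ K * (H * P) * n * (2 * E) :=
      mul_le_mul hLL' (by linarith) (by linarith) (by positivity)
    refine (ha₁.trans h1).trans ?_
    have h2 := four_mul_le_sq_add n (1 / 2 * (K * (E * (H * P))))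
    linarith
  have hτn : 2 * (1 + Cp * r) * n ≤ τ⁻¹ * n := mul_le_mul_of_nonneg_right hτ₁ hn
  have hcn : 0 ≤ Cp * r * n := by positivity
  -- A priori bound of the increment from the tested equation. The bending terms enter only through
  -- `-(b₂ + b₁) ≤ (E - Es) / 2`.
  have hnX : n ≤ 1 / 2 * (K + D) * X := by
    have h1 := neg_le_of_abs_le ha₁'
    have h2 := neg_le_of_abs_le ha₂'
    have h3 : K * (E * (H * P)) ≤ K * X := mul_le_mul_of_nonneg_left hEHP hK.le
    linarith
  -- One of the two factors `n` of the quartic term is replaced by its a priori bound, which makes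
  -- the term linear in `n`.
  have hQQ' : QQ ≤ K * (1 / 2 * (K + D) * X) * n := by
    refine hQQ.trans ?_
    rw [sq, ← mul_assoc]
    gcongr
  have hLL'' : LL ≤ K * X * n := hLL'.trans (by gcongr)
  have hdn := mul_le_mul_of_nonneg_right hd hn
  have hτd := mul_le_mul_of_nonneg_right hτ₂ hn
  have hXn : 0 ≤ X * n := by positivity
  have h2 := neg_le_of_abs_le ha₂'
  have e : 1 / (2 * τ) * n = 1 / 2 * (τ⁻¹ * n) := by field_simp
  rw [e, hE']
  -- After elimination of `a₁ + b₁` there remain `-τ⁻¹ n - a₂ / 2 - b₂ / 2 + WW / 2`, and `d n ≤ τ⁻¹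
  -- n / 2` dominates the terms of unfavourable sign.
  linarith

namespace Mesh

variable {s : CellShape} {Ω : Set Plane} {M : Mesh s Ω} {k : ℕ}

/-! ### Expansion of the energy -/

theorem gradProd_add (y δ : M.V3 k) (i : Fin M.N) (x : Plane) :
    M.gradProd (y + δ) (y + δ) i x =
      M.gradProd y y i x + (M.symProd δ y i x + M.gradProd δ δ i x) := by
  have h : ∀ m a, M.pd a (M.val ((y + δ) m)) i x =
      M.pd a (M.val (y m)) i x + M.pd a (M.val (δ m)) i x := fun m a =>
    (M.isLinearMap_pd_val a i x).map_add (y m) (δ m)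
  ext a b
  simp only [symProd, gradProd, Matrix.add_apply, Matrix.of_apply, h, ← Finset.sum_add_distrib]
  exact Finset.sum_congr rfl fun m _ => by ring

/-- The square of `S + L + Q` is expanded with `S` kept apart. The product of `S` and `L` is `a^s(y;
y, δ)`; since `a^s(y; δ, δ)` pairs `S` with `2 Q`, it enters with the factor one half. -/
theorem stretchEnergy_add (hΩ : IsPolygonalDomain Ω) {g : Plane → Matrix (Fin 2) (Fin 2) ℝ}
    (hg : ∀ a b, MemLp (fun x => g x a b) ⊤ (volume.restrict Ω)) (y δ : M.V3 k) :
    M.stretchEnergy g (y + δ) = M.stretchEnergy g y + M.stretchForm g y y δ +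
      1 / 2 * M.stretchForm g y δ δ + 1 / 2 * M.integral fun i x =>
        PrestrainedPlate.frob (M.symProd δ y i x + M.gradProd δ δ i x)
          (M.symProd δ y i x + M.gradProd δ δ i x) := by
  have hS := matBounded_strain hΩ hg y
  have hL := matBounded_symProd δ y
  have hQ := matBounded_gradProd δ δ
  have i1 := (hS.frob hS).cellIntegrable
  have i2 := (hL.frob hS).cellIntegrable
  have i3 := ((hQ.add hQ).frob hS).cellIntegrable
  have i4 := ((hL.add hQ).frob (hL.add hQ)).cellIntegrable
  have e : ∀ i x, PrestrainedPlate.frob (M.gradProd (y + δ) (y + δ) i x - g x)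
      (M.gradProd (y + δ) (y + δ) i x - g x) =
      PrestrainedPlate.frob (M.strain g y i x) (M.strain g y i x) +
        2 * PrestrainedPlate.frob (M.symProd δ y i x) (M.strain g y i x) +
        1 * PrestrainedPlate.frob (M.gradProd δ δ i x + M.gradProd δ δ i x) (M.strain g y i x) +
        PrestrainedPlate.frob (M.symProd δ y i x + M.gradProd δ δ i x)
          (M.symProd δ y i x + M.gradProd δ δ i x) := fun i x => by
    rw [gradProd_add, strain]
    simp only [PrestrainedPlate.frob, Fin.sum_univ_two, Matrix.add_apply, Matrix.sub_apply]
    ring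
  rw [stretchEnergy]
  simp_rw [e]
  rw [integral_add ((i1.add (i2.const_mul 2)).add (i3.const_mul 1)) i4,
    integral_add (i1.add (i2.const_mul 2)) (i3.const_mul 1), integral_add i1 (i2.const_mul 2),
    integral_const_mul, integral_const_mul, integral_frob_strain]
  have e1 : (M.integral fun i x => PrestrainedPlate.frob (M.symProd δ y i x) (M.strain g y i x)) =
    M.stretchForm g y y δ := rfl
  have e2 : (M.integral fun i x => PrestrainedPlate.frob
    (M.gradProd δ δ i x + M.gradProd δ δ i x) (M.strain g y i x)) = M.stretchForm g y δ δ := rfl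
  rw [e1, e2]
  ring

theorem integral_frob_add_le {A B : Fin M.N → Plane → Matrix (Fin 2) (Fin 2) ℝ}
    (hA : M.MatBounded A) (hB : M.MatBounded B) :
    (M.integral fun i x => PrestrainedPlate.frob (A i x + B i x) (A i x + B i x)) ≤
      2 * (M.integral fun i x => PrestrainedPlate.frob (A i x) (A i x)) +
        2 * M.integral fun i x => PrestrainedPlate.frob (B i x) (B i x) := by
  have iA := (hA.frob hA).cellIntegrable
  have iB := (hB.frob hB).cellIntegrable
  rw [← integral_const_mul, ← integral_const_mul, ← integral_add (iA.const_mul 2) (iB.const_mul 2)]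
  exact integral_mono ((hA.add hB).frob (hA.add hB)).cellIntegrable
    ((iA.const_mul 2).add (iB.const_mul 2)) fun i x _ => frob_add_le _ _

theorem _root_.IsBilinearMap.self_add {E : Type*} [AddCommGroup E] [Module ℝ E] {B : E → E → ℝ}
    (h : IsBilinearMap ℝ B) (hs : ∀ u v, B u v = B v u) (u v : E) (r : ℝ) :
    B (u + r • v) (u + r • v) = B u u + 2 * r * B u v + r ^ 2 * B v v := by
  simp only [h.add_left, h.add_right, h.smul_left, h.smul_right, smul_eq_mul, hs v u]
  ring

theorem nonempty_index (hΩ : IsPolygonalDomain Ω) (M : Mesh s Ω) : Nonempty (Fin M.N) := by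
  obtain ⟨x, hx⟩ := hΩ.2.2.1.nonempty
  have := subset_closure hx
  rw [← M.cover] at this
  obtain ⟨i, -⟩ := Set.mem_iUnion.1 this
  exact ⟨i⟩

variable {c₁ c₂ : ℝ} {hf : Plane → ℝ} {g : Plane → Matrix (Fin 2) (Fin 2) ℝ} {l₁ l₂ : ℕ}
  {σ τ Cp Cp' : ℝ}

/-- For `σ = 0` the product vanishes identically, so no integrability of the Hessian weighted by
`g^{-1/2}` is required. -/
theorem IsMeshFunction.isBilinearMap_smul_bendForm (hc₁ : 0 < c₁) (hm : M.IsMeshFunction c₁ c₂ hf)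
    (hP : σ = 0 ∨ M.MatBounded fun _ x => invSqrt (g x)) (l₁ l₂ : ℕ) :
    IsBilinearMap ℝ fun u v : M.V3 k => σ * M.bendForm hf g l₁ l₂ u v := by
  rcases hP with rfl | hP
  · simp only [zero_mul]
    exact ⟨fun _ _ _ => by simp, fun _ _ _ => by simp, fun _ _ _ => by simp, fun _ _ _ => by simp⟩
  · exact (hm.isBilinearMap_bendForm hc₁ hP l₁ l₂).fun_const_mul σ

theorem IsMeshFunction.stretchEnergy_le_preEnergy (hc₁ : 0 < c₁) (hm : M.IsMeshFunction c₁ c₂ hf)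
    (hσ : 0 ≤ σ) (y : M.V3 k) : M.stretchEnergy g y ≤ M.preEnergy hf g l₁ l₂ σ y := by
  have := mul_nonneg hσ (mul_nonneg (show (0 : ℝ) ≤ 1 / 2 by norm_num)
    (hm.bendForm_nonneg hc₁ g l₁ l₂ y))
  rw [preEnergy, bendEnergy]
  linarith

/-- The linearized equation has exactly one solution for small step sizes. -/
theorem IsMeshFunction.existsUnique_increment (hc₁ : 0 < c₁) (hm : M.IsMeshFunction c₁ c₂ hf)
    (hΩ : IsPolygonalDomain Ω) (hg : ∀ a b, MemLp (fun x => g x a b) ⊤ (volume.restrict Ω))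
    (hP : σ = 0 ∨ M.MatBounded fun _ x => invSqrt (g x)) (hσ : 0 ≤ σ) (hCp : 0 < Cp)
    (hcont : ∀ z v w : M.V3 k,
      |M.stretchForm g z v w| ≤ Cp * √(M.stretchEnergy g z) * M.normH2 hf v * M.normH2 hf w)
    (y : M.V3 k) (hτ : 2 * (1 + Cp * √(M.preEnergy hf g l₁ l₂ σ y)) ≤ τ⁻¹) :
    ∃! δ, M.IsIncrement hf g l₁ l₂ σ τ y δ := by
  have hB1 := (hm.isBilinearMap_innerH2 (k := k) hc₁).fun_const_mul τ⁻¹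
  have hB2 := isBilinearMap_stretchForm hΩ hg y
  have hB3 := hm.isBilinearMap_smul_bendForm (k := k) hc₁ hP l₁ l₂
  have hf1 : IsLinearMap ℝ fun v => - M.stretchForm g y y v - σ * M.bendForm hf g l₁ l₂ y v := by
    have := ((hB2.isLinearMap_right y).fun_const_mul (-1)).fun_sub (hB3.isLinearMap_right y)
    simpa only [neg_one_mul] using this
  refine exists_unique_representer ((hB1.fun_add hB2).fun_add hB3) (fun δ hδ => ?_) hf1
  refine hm.eq_zero_of_innerH2 hc₁ ?_
  have h1 := hcont y δ δ
  rw [mul_assoc, ← sq, hm.normH2_sq hc₁] at h1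
  have hn := hm.innerH2_nonneg hc₁ δ
  have hb := mul_nonneg hσ (hm.bendForm_nonneg hc₁ g l₁ l₂ δ)
  have hr : √(M.stretchEnergy g y) ≤ √(M.preEnergy hf g l₁ l₂ σ y) :=
    Real.sqrt_le_sqrt (hm.stretchEnergy_le_preEnergy hc₁ hσ y)
  have hr0 := Real.sqrt_nonneg (M.stretchEnergy g y)
  -- Coercivity: `τ⁻¹ ‖δ‖²` exceeds twice the possible negative part of the stretching form by `2
  -- ‖δ‖²`, and the bending form is nonnegative.
  have h2 := mul_le_mul_of_nonneg_right hτ hn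
  have h3 := neg_le_of_abs_le h1
  have h4 : Cp * √(M.stretchEnergy g y) * M.innerH2 hf δ δ ≤
      Cp * √(M.preEnergy hf g l₁ l₂ σ y) * M.innerH2 hf δ δ := by gcongr
  have h5 : 0 ≤ Cp * √(M.stretchEnergy g y) * M.innerH2 hf δ δ := by positivity
  linarith

theorem dStep_mono (hh : 0 ≤ M.hMin) (hσ : 0 ≤ σ) (hCp : 0 ≤ Cp) (hCp' : 0 ≤ Cp') {y z : M.V3 k}
    (hz : 0 ≤ M.preEnergy hf g l₁ l₂ σ z)
    (h : M.preEnergy hf g l₁ l₂ σ z ≤ M.preEnergy hf g l₁ l₂ σ y) :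
    M.dStep hf g l₁ l₂ σ Cp Cp' z ≤ M.dStep hf g l₁ l₂ σ Cp Cp' y := by
  have hG := normL1_nonneg (Ω := Ω) g
  simp only [dStep]
  generalize M.preEnergy hf g l₁ l₂ σ y = E at h
  generalize M.preEnergy hf g l₁ l₂ σ z = F at h hz
  have hE := hz.trans h
  have hr := Real.sqrt_le_sqrt h
  have h1 : M.hMin⁻¹ * (F + 1) * (√F + normL1 Ω g) ≤ M.hMin⁻¹ * (E + 1) * (√E + normL1 Ω g) :=
    mul_le_mul (mul_le_mul_of_nonneg_left (by linarith) (inv_nonneg.2 hh)) (by linarith)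
      (add_nonneg (Real.sqrt_nonneg F) hG) (mul_nonneg (inv_nonneg.2 hh) (by linarith))
  have h2 := mul_le_mul_of_nonneg_left h hσ
  exact add_le_add (mul_le_mul_of_nonneg_left hr (by linarith))
    (mul_le_mul_of_nonneg_left (add_le_add h1 h2) (by linarith))

theorem dStep_pos (hh : 0 < M.hMin) (hσ : 0 ≤ σ) (hCp : 0 ≤ Cp) (hCp' : 0 < Cp')
    (hG : 0 < normL1 Ω g) {y : M.V3 k} (hy : 0 ≤ M.preEnergy hf g l₁ l₂ σ y) :
    0 < M.dStep hf g l₁ l₂ σ Cp Cp' y := by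
  simp only [dStep]
  positivity

theorem cStep_mono (hh : 0 < M.hMin) (hσ : 0 ≤ σ) (hCp : 0 ≤ Cp) (hCp' : 0 < Cp')
    (hG : 0 < normL1 Ω g) {y z : M.V3 k} (hz : 0 ≤ M.preEnergy hf g l₁ l₂ σ z)
    (h : M.preEnergy hf g l₁ l₂ σ z ≤ M.preEnergy hf g l₁ l₂ σ y) :
    M.cStep hf g l₁ l₂ σ Cp Cp' y ≤ M.cStep hf g l₁ l₂ σ Cp Cp' z := by
  have h1 := M.dStep_mono hh.le hσ hCp hCp'.le hz h
  have h2 := M.dStep_pos hh hσ hCp hCp' hG hz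
  refine min_le_min (inv_anti₀ (by positivity) ?_) (inv_anti₀ h2 h1)
  gcongr

theorem IsMeshFunction.preEnergy_nonneg (hc₁ : 0 < c₁) (hm : M.IsMeshFunction c₁ c₂ hf)
    (hσ : 0 ≤ σ) (y : M.V3 k) : 0 ≤ M.preEnergy hf g l₁ l₂ σ y :=
  (stretchEnergy_nonneg g y).trans (hm.stretchEnergy_le_preEnergy hc₁ hσ y)

end Mesh

/-- One step of the linearized gradient flow decreases the energy. -/
theorem exists_energy_decay_constant (s : CellShape) (k : ℕ) (ϱ c₁ c₂ : ℝ) (hc₁ : 0 < c₁)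
    {Ω : Set Plane} (hΩ : IsPolygonalDomain Ω) {g : Plane → Matrix (Fin 2) (Fin 2) ℝ}
    (hg : ∀ a b, MemLp (fun x => g x a b) ⊤ (volume.restrict Ω)) (l₁ l₂ : ℕ) (Cp : ℝ)
    (hCp : 0 < Cp) (hcont : IsContinuityConstant Ω g s k ϱ c₁ c₂ Cp) :
    ∃ Cp' : ℝ, 0 < Cp' ∧ ∀ (M : Mesh s Ω) (hf : Plane → ℝ),
      M.ShapeRegular ϱ → M.IsMeshFunction c₁ c₂ hf → ∀ σ : ℝ, 0 ≤ σ →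
      (σ = 0 ∨ M.MatBounded fun _ x => invSqrt (g x)) → ∀ (y δ : M.V3 k) (τ : ℝ), 0 < τ →
      2 * (1 + Cp * √(M.preEnergy hf g l₁ l₂ σ y)) ≤ τ⁻¹ →
      2 * M.dStep hf g l₁ l₂ σ Cp Cp' y ≤ τ⁻¹ → M.IsIncrement hf g l₁ l₂ σ τ y δ →
      M.preEnergy hf g l₁ l₂ σ (y + δ) + 1 / (2 * τ) * M.normH2 hf δ ^ 2 ≤
        M.preEnergy hf g l₁ l₂ σ y := by
  obtain ⟨K, hK, hbound⟩ := exists_increment_bounds s k ϱ c₁ c₂ hc₁ hΩ hg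
  set D := Metric.diam (closure Ω) with hD
  have hD0 : 0 ≤ D := Metric.diam_nonneg
  -- `2 K` pays for `‖L‖²`, and `K (K + D)` for `‖Q‖²` after one factor `‖δ‖²` has been replaced by
  -- its a priori bound.
  refine ⟨2 * K + K * (K + D) + 1, by positivity,
    fun M hf hreg hm σ hσ hP y δ τ hτ hτ₁ hτ₂ hδ => ?_⟩
  obtain ⟨i⟩ := M.nonempty_index hΩ
  have hh := M.hMin_pos i
  obtain ⟨hLL, hQQ⟩ := hbound M hf hreg hm y δ
  have hEs := Mesh.stretchEnergy_nonneg g y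
  have hE := hm.stretchEnergy_le_preEnergy (g := g) (l₁ := l₁) (l₂ := l₂) hc₁ hσ y
  have hn := hm.innerH2_nonneg hc₁ δ
  have hG := Mesh.normL1_nonneg (Ω := Ω) g
  have hB := hm.isBilinearMap_smul_bendForm (k := k) hc₁ hP l₁ l₂
  have hsymm : ∀ u v : M.V3 k, σ * M.bendForm hf g l₁ l₂ u v = σ * M.bendForm hf g l₁ l₂ v u :=
    fun u v => by rw [Mesh.bendForm_comm]
  have hpos : ∀ u : M.V3 k, 0 ≤ σ * M.bendForm hf g l₁ l₂ u u := fun u =>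
    mul_nonneg hσ (hm.bendForm_nonneg hc₁ g l₁ l₂ u)
  have ha₂ := hcont M hf hreg hm y δ δ
  rw [mul_assoc, ← sq, hm.normH2_sq hc₁] at ha₂
  rw [hm.normH2_sq hc₁]
  -- Nonnegativity of the bending form at `δ + y / 2`; a quarter of its value at `y` is half of the
  -- bending part of the energy.
  have hb : 0 ≤ σ * M.bendForm hf g l₁ l₂ δ δ + σ * M.bendForm hf g l₁ l₂ y δ +
      (M.preEnergy hf g l₁ l₂ σ y - M.stretchEnergy g y) / 2 := by
    have h1 := hpos (δ + (1 / 2 : ℝ) • y)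
    have h2 := hB.self_add hsymm δ y (1 / 2)
    simp only [hsymm δ y] at h2
    rw [h2] at h1
    rw [Mesh.preEnergy, Mesh.bendEnergy]
    linarith
  have hDH : 1 ≤ D * M.hMin⁻¹ := by
    rw [← div_eq_mul_inv, one_le_div hh]
    exact (M.hMin_le i).trans (M.diam_cell_le hΩ i)
  have hE0 := hm.preEnergy_nonneg (g := g) (l₁ := l₁) (l₂ := l₂) hc₁ hσ y
  refine energy_decay_of_bounds hK (inv_pos.2 hh) hDH hG hCp hτ hEs hE hn (hδ δ) ha₂ hLL hQQ
    (Mesh.integral_frob_add_le (Mesh.matBounded_symProd δ y) (Mesh.matBounded_gradProd δ δ))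
    (Mesh.sq_stretchForm_le hΩ hg y y δ) (hpos δ) hb hτ₁ hτ₂ ?_ ?_
  -- The summand `σ E` of `dStep` is nonnegative and can be dropped.
  · simp only [Mesh.dStep]
    have h1 : 0 ≤ σ * M.preEnergy hf g l₁ l₂ σ y := mul_nonneg hσ hE0
    gcongr
    linarith
  · have h1 := hB.self_add hsymm y δ 1
    simp only [one_smul] at h1
    rw [Mesh.preEnergy, Mesh.preEnergy, Mesh.stretchEnergy_add hΩ hg, Mesh.bendEnergy,
      Mesh.bendEnergy]
    linarith

end PrestrainedPlate

/-! ### The iteration: induction over the steps. -/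

theorem mainTheorem9
    (Ω : Set PrestrainedPlate.Plane) (hΩ : PrestrainedPlate.IsPolygonalDomain Ω)
    (g : PrestrainedPlate.Plane → Matrix (Fin 2) (Fin 2) ℝ)
    (hgpos : ∀ᵐ x ∂(volume.restrict Ω), (g x).PosDef)
    (hgbdd : ∀ a b, MemLp (fun x => g x a b) ⊤ (volume.restrict Ω))
    (s : PrestrainedPlate.CellShape) (k l₁ l₂ : ℕ) (hk : 2 ≤ k)
    (ϱ c₁ c₂ : ℝ) (hc₁ : 0 < c₁) :
    (∃ Cp : ℝ, 0 < Cp ∧ PrestrainedPlate.IsContinuityConstant Ω g s k ϱ c₁ c₂ Cp) ∧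
    ∀ Cp : ℝ, 0 < Cp → PrestrainedPlate.IsContinuityConstant Ω g s k ϱ c₁ c₂ Cp →
      ∃ Cp' : ℝ, 0 < Cp' ∧
        ∀ (M : PrestrainedPlate.Mesh s Ω) (hf : PrestrainedPlate.Plane → ℝ),
          M.ShapeRegular ϱ → M.IsMeshFunction c₁ c₂ hf →
        ∀ σ : ℝ, 0 ≤ σ → (σ = 0 ∨ PrestrainedPlate.UniformlyPosDef Ω g) →
        ∀ (y₀ : M.V3 k) (τ : ℝ), 0 < τ → τ ≤ (1 / 2) * M.cStep hf g l₁ l₂ σ Cp Cp' y₀ →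
          ∃ y : ℕ → M.V3 k, y 0 = y₀ ∧
            (∀ n, M.IsIncrement hf g l₁ l₂ σ τ (y n) (y (n + 1) - y n) ∧
              ∀ δ : M.V3 k, M.IsIncrement hf g l₁ l₂ σ τ (y n) δ → δ = y (n + 1) - y n) ∧
            Monotone (fun n => M.cStep hf g l₁ l₂ σ Cp Cp' (y n)) ∧
            ∀ N : ℕ,
              M.preEnergy hf g l₁ l₂ σ (y (N + 1)) +
                  1 / (2 * τ) * ∑ n ∈ Finset.range (N + 1), M.normH2 hf (y (n + 1) - y n) ^ 2 ≤
                M.preEnergy hf g l₁ l₂ σ y₀ := by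
  refine ⟨PrestrainedPlate.exists_continuity_constant s k ϱ c₁ c₂ hc₁ hΩ hgbdd,
    fun Cp hCp hcont => ?_⟩
  obtain ⟨Cp', hCp', hdecay⟩ := PrestrainedPlate.exists_energy_decay_constant s k ϱ c₁ c₂ hc₁ hΩ
    hgbdd l₁ l₂ Cp hCp hcont
  refine ⟨Cp', hCp', fun M hf hreg hm σ hσ hu y₀ τ hτ hτc => ?_⟩
  have hP : σ = 0 ∨ M.MatBounded fun _ x => PrestrainedPlate.invSqrt (g x) :=
    hu.imp_right fun h => PrestrainedPlate.Mesh.matBounded_of_memLp (g := fun x =>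
      PrestrainedPlate.invSqrt (g x)) hΩ (PrestrainedPlate.memLp_invSqrt hgpos hgbdd h)
  obtain ⟨i⟩ := M.nonempty_index hΩ
  have hh := M.hMin_pos i
  have hG := PrestrainedPlate.normL1_pos hΩ hgpos hgbdd
  have hE := fun y : M.V3 k => hm.preEnergy_nonneg (g := g) (l₁ := l₁) (l₂ := l₂) hc₁ hσ y
  -- The minimum in `cStep` encodes both restrictions: one serves solvability and the a priori
  -- bound, the other the absorption of the remainders.
  have hstep : ∀ y : M.V3 k, τ ≤ 1 / 2 * M.cStep hf g l₁ l₂ σ Cp Cp' y →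
      2 * (1 + Cp * √(M.preEnergy hf g l₁ l₂ σ y)) ≤ τ⁻¹ ∧
        2 * M.dStep hf g l₁ l₂ σ Cp Cp' y ≤ τ⁻¹ := by
    intro y hy
    have aux : ∀ x : ℝ, 0 < x → M.cStep hf g l₁ l₂ σ Cp Cp' y ≤ x⁻¹ → 2 * x ≤ τ⁻¹ := by
      intro x hx hcx
      rw [le_inv_comm₀ (by positivity) hτ, mul_inv]
      linarith
    refine ⟨aux _ ?_ (min_le_left _ _), aux _ (M.dStep_pos hh hσ hCp.le hCp' hG (hE y))
      (min_le_right _ _)⟩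
    have := mul_nonneg hCp.le (Real.sqrt_nonneg (M.preEnergy hf g l₁ l₂ σ y))
    linarith
  have hex : ∀ y : M.V3 k, τ ≤ 1 / 2 * M.cStep hf g l₁ l₂ σ Cp Cp' y →
      ∃! δ, M.IsIncrement hf g l₁ l₂ σ τ y δ := fun y hy =>
    hm.existsUnique_increment hc₁ hΩ hgbdd hP hσ hCp (hcont M hf hreg hm) y (hstep y hy).1
  -- The iteration map is defined on the whole space by choice. That the chosen increment solves the
  -- equation is known only where the step condition holds, hence the hypotheses on `τ` in the
  -- following facts.
  let next : M.V3 k → M.V3 k := fun y =>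
    y + Classical.epsilon fun δ => M.IsIncrement hf g l₁ l₂ σ τ y δ
  let y : ℕ → M.V3 k := fun n => next^[n] y₀
  have hsucc : ∀ n, y (n + 1) - y n =
      Classical.epsilon fun δ => M.IsIncrement hf g l₁ l₂ σ τ (y n) δ := fun n => by
    simp only [y, Function.iterate_succ_apply', next, add_sub_cancel_left]
  have hinc : ∀ n, τ ≤ 1 / 2 * M.cStep hf g l₁ l₂ σ Cp Cp' (y n) →
      M.IsIncrement hf g l₁ l₂ σ τ (y n) (y (n + 1) - y n) := fun n hn => by
    rw [hsucc n]
    exact Classical.epsilon_spec (hex (y n) hn).exists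
  have hdec : ∀ n, τ ≤ 1 / 2 * M.cStep hf g l₁ l₂ σ Cp Cp' (y n) →
      M.preEnergy hf g l₁ l₂ σ (y (n + 1)) + 1 / (2 * τ) * M.normH2 hf (y (n + 1) - y n) ^ 2 ≤
        M.preEnergy hf g l₁ l₂ σ (y n) := fun n hn => by
    have h := hdecay M hf hreg hm σ hσ hP (y n) _ τ hτ (hstep _ hn).1 (hstep _ hn).2 (hinc n hn)
    rwa [add_sub_cancel] at h
  have hmono : ∀ n, τ ≤ 1 / 2 * M.cStep hf g l₁ l₂ σ Cp Cp' (y n) →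
      M.cStep hf g l₁ l₂ σ Cp Cp' (y n) ≤ M.cStep hf g l₁ l₂ σ Cp Cp' (y (n + 1)) := fun n hn => by
    refine M.cStep_mono hh hσ hCp.le hCp' hG (hE _) (le_trans ?_ (hdec n hn))
    have : 0 ≤ 1 / (2 * τ) * M.normH2 hf (y (n + 1) - y n) ^ 2 := by positivity
    linarith
  -- The step condition propagates: under it the energy decreases, so the threshold does not
  -- decrease and the condition holds again at the next iterate.
  have hτn : ∀ n, τ ≤ 1 / 2 * M.cStep hf g l₁ l₂ σ Cp Cp' (y n) := by
    intro n
    induction n with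
    | zero => exact hτc
    | succ n ih => linarith [hmono n ih]
  refine ⟨y, rfl, fun n => ⟨hinc n (hτn n), fun δ hδ => (hex _ (hτn n)).unique hδ
    (hinc n (hτn n))⟩, monotone_nat_of_le_succ fun n => hmono n (hτn n), fun N => ?_⟩
  have hsum : ∀ m : ℕ, M.preEnergy hf g l₁ l₂ σ (y m) +
      1 / (2 * τ) * ∑ n ∈ Finset.range m, M.normH2 hf (y (n + 1) - y n) ^ 2 ≤
        M.preEnergy hf g l₁ l₂ σ y₀ := by
    intro m
    induction m with
    | zero => simp [y]
    | succ m ih =>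
      rw [Finset.sum_range_succ, mul_add]
      linarith [hdec m (hτn m)]
  exact hsum (N + 1)
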